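/- Let $\mathbb F$ be the field with two elements, let $p,q$ be coprime positive integers and $r=p/q$. *Diagram.* In $\mathbb T^2=\mathbb R^2/\mathbb Z^2$ let $\beta_0$ and $\beta_\infty$ be the images of the $x$-axis and the $y$-axis, and let $\beta_r$ be the image of the line of slope $r$ through $(\frac1{2p},0)$. Let $\zeta=(0,0)\in\beta_\infty\cap\beta_0$, let $\theta_i=(\frac{i+1/2}{p},0)$ ($i=0,\dots,p-1$) be the points of $\beta_0\cap\beta_r$, and let $\xi_j=(0,-\frac{j+1/2}{q})$ ($j=0,\dots,q-1$) be the points of $\beta_r\cap\beta_\infty$. The basepoint is $z=(\varepsilon,\varepsilon)$ with $\varepsilon>0$ small ($4(p+q)\varepsilon<1$ suffices). Let $A_0=\{\varepsilon\}\times[-\varepsilon,\varepsilon]$, oriented downwards, so that paths in $\beta_0$ that go to the right cross it positively, and $A_\infty=[-\varepsilon,\varepsilon]\times\{\varepsilon\}$, oriented to the left, so that paths in $\beta_\infty$ that go down cross it positively. The indices of $\theta,y,s,c$ below are read modulo $p$, those of $\xi,v$ modulo $q$, and an index $\ell$ of $x_{i,\ell}$ modulo $c_i$; $q^{-1}$ is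 an inverse of $q$ modulo $p$, and $a\bmod q\in\{0,\dots,q-1\}$. *Local systems.* Let $s_0\ge\dots\ge s_{p-1}$ be the sequence with values in $\{\lceil q/p\rceil,\lfloor q/p\rfloor\}$ and sum $q$. For $k\in\{0,\dots,p-1\}$ let $c_i=s_{i-k}$, and let $U_a=U$ if $a\equiv -iq^{-1}-1 \pmod p$ for some $i\in\{0,\dots,k-1\}$ and $U_a=1$ otherwise. Equip $\beta_0$ with $E_0^k=\bigoplus_{i=0}^{p-1}\bigoplus_{\ell=0}^{c_i-1}x_{i,\ell}\mathbb F[[U]]$ with monodromy $x_{i,\ell}\mapsto x_{i,\ell+1}$ along $A_0$, equip $\beta_\infty$ with $E_\infty^k=\bigoplus_{i=0}^{p-1}y_i\mathbb F[[U]]$ with monodromy $y_i\mapsto U_i\,y_{i+1}$ along $A_\infty$, and equip $\beta_r$ with the trivial local system. Let $x_{i,\ell}^*$, $y_i^*$ be the dual bases. *Polygon counts.* For curves $\alpha,\beta$ with local systems $(E_\alpha,\phi_\alpha,A_\alpha),(E_\beta,\phi_\beta,A_\beta)$ let $CF(\alpha,\beta)=\bigoplus_{x\in\alpha\cap\beta}\mathrm{Hom}(E_\alpha,E_\beta)\,x$.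 The map $\mu_d:CF(\alpha_0,\alpha_1)\otimes\dots\otimes CF(\alpha_{d-1},\alpha_d)\to CF(\alpha_0,\alpha_d)$ counts modulo $2$ the orientation preserving immersed $(d+1)$-gons $D$ in $\mathbb T^2$ with convex corners, up to reparametrization, whose sides lie clockwise on $\alpha_0,\dots,\alpha_d$; if $x_j$ is the corner where the side changes from $\alpha_{j-1}$ to $\alpha_j$ and $y$ is the corner where it changes from $\alpha_d$ to $\alpha_0$, then $D$ contributes $$U^{n_z(D)}\,\phi_{\alpha_d}^{\#(A_{\alpha_d}\cap\partial_{\alpha_d}D)}\circ e_d\circ\phi_{\alpha_{d-1}}^{\#(A_{\alpha_{d-1}}\cap\partial_{\alpha_{d-1}}D)}\circ\dots\circ e_1\circ\phi_{\alpha_0}^{\#(A_{\alpha_0}\cap\partial_{\alpha_0}D)}\; y$$ to $\mu_d(e_1x_1\otimes\dots\otimes e_dx_d)$, where $n_z(D)$ is the multiplicity of $D$ at $z$ and $\partial_{\alpha_j}D$ is the side on $\alpha_j$, traversed clockwise. The compositions are formed over $\mathbb F((U))$, and the sums are required to converge $U$-adically. *Standard translates.* A standard translate $\alpha'$ of $\alpha\in\{\beta_0,\beta_r,\beta_\infty\}$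 is obtained by pushing $\alpha$ off slightly (in particular not across $z$) and modifying the push-off in a small region that is disjoint from the other two curves so that it meets $\alpha$ in two points, which lie on either side of $A_\alpha$ if $\alpha\ne\beta_r$; it carries the same local system. Let $\Theta^+_0,\Theta^+_r,\Theta^+_\infty$ be the intersection point of the respective curve and its translate in the top grading, i.e. the one from which both bigons start. A prime on a chain denotes its image under the nearest point map $CF(\beta,\alpha)\to CF(\beta,\alpha')$. **Theorem.** There exist $u_{i,\ell},v_j,w_{i,\ell}\in\mathbb F[[U]]$ for $i=0,\dots,p-1$, $\ell=0,\dots,s_i-1$, $j=0,\dots,q-1$, such that, modulo $U$, $$u_{i,\ell}\equiv w_{i,\ell}\equiv\begin{cases}1&\ell=0\\0&\text{otherwise}\end{cases},\qquad v_j\equiv\begin{cases}1&j\equiv-1,-2,\dots,-\min(p,q)\ (\mathrm{mod}\ q)\\0&\text{otherwise}\end{cases},$$ and such that for every $k=0,\dots,p-1$ the elements $$\psi_{0r}^k=\sum_{i=0}^{p-k-1}\sum_{\ell=0}^{s_i-1}u_{i,\ell}\,x^*_{i+k,\ell}\,\theta_{i+k}+\sum_{i=p-k}^{p-1}\sum_{\ell=0}^{s_i-1}u_{i,\ell}\,x^*_{i+k,\ell+1}\,\theta_{i+k}\in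 CF(\beta_0,\beta_r),$$ $$\psi_{r\infty}^k=\sum_{j=0}^{q-1}v_j\,y_{-((j+k)\bmod q)q^{-1}}\,\xi_{j+k}\in CF(\beta_r,\beta_\infty),\qquad \psi_{\infty0}^k=\sum_{i=0}^{p-1}\sum_{\ell=0}^{s_i-1}w_{i,\ell}\,x_{i+k,\ell}\,y^*_{-(i+k)q^{-1}}\,\zeta\in CF(\beta_\infty,\beta_0)$$ have the following properties. 1. They are cycles: $\mu_1(\psi_{0r}^k)=0$, $\mu_1(\psi_{r\infty}^k)=0$, $\mu_1(\psi_{\infty0}^k)=0$. 2. $\mu_2(\psi_{\infty0}^k\otimes\psi_{0r}^k)=0$, $\mu_2(\psi_{0r}^k\otimes\psi_{r\infty}^k)=0$, $\mu_2(\psi_{r\infty}^k\otimes\psi_{\infty0}^k)=0$. 3. Modulo $U$, $\mu_3(\psi_{0r}^k\otimes\psi_{r\infty}^k\otimes{\psi_{\infty0}^k}')\equiv\mathrm{Id}_{E_0^k}\Theta_0^+$, $\mu_3(\psi_{r\infty}^k\otimes\psi_{\infty0}^k\otimes{\psi_{0r}^k}')\equiv\Theta_r^+$, and $\mu_3(\psi_{\infty0}^k\otimes\psi_{0r}^k\otimes{\psi_{r\infty}^k}')\equiv\mathrm{Id}_{E_\infty^k}\Theta_\infty^+$.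 Moreover, the coefficients can be chosen with $u_{i,0}=1$ and $u_{i,\ell}=0$ for $\ell\neq0$, for all $i$; alternatively, they can be chosen with $w_{i,0}=1$ and $w_{i,\ell}=0$ for $\ell\ne0$, for all $i$. -/

import Mathlib

open Topology

noncomputable section

namespace LocalComp

/-! ### Coefficients -/

/-- The field `F` with two elements. -/
abbrev F2 : Type := ZMod 2

/-- `F[[U]]`. -/
abbrev FU : Type := PowerSeries F2

/-- `F((U)) = U⁻¹ F[[U]]`.  The monodromies below may have inverses that involve `U⁻¹`, so all
compositions of maps are computed over `F((U))`, which contains `F[[U]]`. -/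
abbrev FUinv : Type := LaurentSeries F2

/-- The variable `U`, as an element of `F((U))`. -/
def Uvar : FUinv := ((PowerSeries.X : FU) : FUinv)

/-- The (possibly infinite) family `f` converges unconditionally in the `U`-adic topology and its
sum is `s`: for every `N`, all but finitely many members lie in `U ^ (N + 1) F[[U]]`, and the
coefficients of `s` are the (finite) sums of the coefficients of the members. -/
def UAdicHasSum {ι : Type*} (f : ι → FUinv) (s : FUinv) : Prop :=
  (∀ N : ℤ, {i | ∃ n ≤ N, (f i).coeff n ≠ 0}.Finite) ∧
    ∀ n : ℤ, s.coeff n = ∑ᶠ i, (f i).coeff n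

/-! ### Curves in the torus, local systems, chains -/

/-- The torus `ℝ² / ℤ²`. -/
abbrev T2 : Type := UnitAddCircle × UnitAddCircle

/-- The universal covering map `ℝ² → ℝ² / ℤ²`. -/
def toTorus (P : ℝ × ℝ) : T2 := ((P.1 : UnitAddCircle), (P.2 : UnitAddCircle))

/-- A simple closed curve in the torus, described by an orientation preserving coordinate system
`(along, across)` of the universal cover `ℝ²`: the preimage of the curve in `ℝ²` is the union of the
lines `across = m`, `m ∈ ℤ`, the function `along` is a coordinate on each of these lines, and
`across` increases towards the left if one moves in the direction in which `along` increases.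
Integral translations of `ℝ²` change both functions by integers. -/
structure Curve where
  along : ℝ × ℝ → ℝ
  across : ℝ × ℝ → ℝ

/-- The curve as a subset of the torus. -/
def Curve.carrier (α : Curve) : Set T2 :=
  toTorus '' {P | ∃ m : ℤ, α.across P = m}

/-- A curve with a local system: the module is free with basis indexed by `ι`, `mono` is the
monodromy, and `arc` is the value (modulo `1`) of `along` at the point where the oriented arc of the
local system crosses the curve; a path in the curve crosses the arc positively if `along` decreases
at the crossing. -/
structure LCurve (ι : Type) extends Curve where
  mono : Matrix ι ι FUinv
  arc : ℝ

/-- `CF(α, β) = ⨁ₓ Hom(E_α, E_β) x`, the sum over the intersection points `x` of `α` and `β`;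
homomorphisms are matrices, with rows indexed by the basis of the target. -/
abbrev CF {ι κ : Type} (α : LCurve ι) (β : LCurve κ) : Type :=
  ↥(α.toCurve.carrier ∩ β.toCurve.carrier) → Matrix κ ι FUinv

open Classical in
/-- The coefficient of a chain at the image in the torus of a point `P` of `ℝ²` that lies over an
intersection point. -/
def coeffAt {ι κ : Type} {α : LCurve ι} {β : LCurve κ} (ψ : CF α β) (P : ℝ × ℝ) :
    Matrix κ ι FUinv :=
  if h : toTorus P ∈ α.toCurve.carrier ∩ β.toCurve.carrier then ψ ⟨toTorus P, h⟩ else 0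

/-- The signed number of crossings with the oriented arc of a path from `P` to `Q` in (a lift of)
the curve `α`. -/
def LCurve.crossings {ι : Type} (α : LCurve ι) (P Q : ℝ × ℝ) : ℤ :=
  ⌊α.along P - α.arc⌋ - ⌊α.along Q - α.arc⌋

/-! ### Immersed polygons with convex corners -/

/-- The closed unit disk. -/
abbrev Disk : Type := ↥(Metric.closedBall (0 : ℂ) 1)

/-- The boundary of the disk is divided into `n` sides, which are numbered clockwise: the points of
the `j`-th side are `sidePoint n j t`, `0 ≤ t ≤ 1`, traversed clockwise as `t` increases. -/
def sidePoint (n : ℕ) (j : ℕ) (t : ℝ) : Disk :=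
  ⟨(Circle.exp (-(2 * Real.pi * (j + t) / n)) : ℂ), by
    rw [mem_closedBall_zero_iff]; exact (Circle.norm_coe _).le⟩

/-- The `j`-th side, including its two endpoints. -/
def sideSet (n : ℕ) (j : ℕ) : Set Disk := sidePoint n j '' Set.Icc 0 1

/-- A polygon with sides on `γ 0, …, γ (n - 1)`, in clockwise order: an orientation preserving
topological immersion of the disk with `n` convex corners.  A map from the disk to the torus lifts
to the universal cover, and `u` is such a lift.
* `u` is open on the interior of the disk and locally injective on the whole disk.
* The `j`-th side is mapped to one lift `across = level j` of the curve `γ j`.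
* Near every point of the `j`-th side, endpoints included, the interior of the disk is mapped
  strictly to the right of that lift of `γ j`, seen in the direction from the beginning to the end
  of the side.  At inner points of a side this says that `u` preserves the orientation; a corner
  belongs to two sides, and the two conditions together say that the corner is convex, i.e. that
  a neighbourhood of it covers exactly one of the four quadrants there. -/
structure Polygon {n : ℕ} (γ : Fin n → Curve) where
  u : C(Disk, ℝ × ℝ)
  level : Fin n → ℤ
  open_interior : ∀ V : Set Disk, IsOpen V → (∀ w ∈ V, ‖(w : ℂ)‖ < 1) → IsOpen (u '' V)
  locally_injective : ∀ w : Disk, ∃ N ∈ 𝓝 w, Set.InjOn u N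
  side_mem : ∀ j : Fin n, ∀ t ∈ Set.Icc (0 : ℝ) 1,
    (γ j).across (u (sidePoint n j t)) = level j
  right_side : ∀ j : Fin n, ∀ t ∈ Set.Icc (0 : ℝ) 1, ∀ᶠ w : Disk in 𝓝 (sidePoint n j t),
    ‖(w : ℂ)‖ < 1 →
      ((γ j).along (u (sidePoint n j 1)) - (γ j).along (u (sidePoint n j 0))) *
        ((γ j).across (u w) - level j) < 0

namespace Polygon

variable {n : ℕ} {γ : Fin n → Curve}

/-- The corner at which the `j`-th side begins. -/
def start (T : Polygon γ) (j : Fin n) : ℝ × ℝ := T.u (sidePoint n j 0)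

/-- The corner at which the `j`-th side ends. -/
def finish (T : Polygon γ) (j : Fin n) : ℝ × ℝ := T.u (sidePoint n j 1)

/-- The local multiplicity of the polygon at the point of the torus below `z`. -/
def mult (T : Polygon γ) (z : ℝ × ℝ) : ℕ :=
  Set.ncard {w : Disk | toTorus (T.u w) = toTorus z}

/-- Two lifted polygons are identified if they differ by a reparametrization of the disk that
respects the corners and sides, and by a deck transformation of `ℝ² → ℝ² / ℤ²`. -/
def Equivalent (T T' : Polygon γ) : Prop :=
  ∃ φ : Disk ≃ₜ Disk, (∀ j : Fin n, φ (sidePoint n j 0) = sidePoint n j 0) ∧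
    (∀ j : Fin n, φ '' sideSet n j = sideSet n j) ∧
    ∃ a b : ℤ, ∀ w, T'.u (φ w) = T.u w + ((a : ℝ), (b : ℝ))

theorem equivalent_equivalence : Equivalence (Equivalent (γ := γ)) where
  refl T := ⟨Homeomorph.refl _, fun _ => rfl, fun _ => by simp, 0, 0, fun w => by simp⟩
  symm := by
    rintro T T' ⟨φ, h1, h2, a, b, h3⟩
    refine ⟨φ.symm, fun j => ?_, fun j => ?_, -a, -b, fun w => ?_⟩
    · rw [Homeomorph.symm_apply_eq, h1]
    · conv_lhs => rw [← h2 j]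
      rw [← Set.image_comp]
      simp
    · have h := h3 (φ.symm w)
      rw [Homeomorph.apply_symm_apply] at h
      rw [h, add_assoc]
      simp
  trans := by
    rintro T T' T'' ⟨φ, h1, h2, a, b, h3⟩ ⟨φ', h1', h2', a', b', h3'⟩
    refine ⟨φ.trans φ', fun j => ?_, fun j => ?_, a + a', b + b', fun w => ?_⟩
    · simp [h1, h1']
    · have h : (⇑(φ.trans φ') : Disk → Disk) = φ' ∘ φ := rfl
      rw [h, Set.image_comp, h2, h2']
    · simp only [Homeomorph.trans_apply, h3', h3, add_assoc]
      simp

/-- The equivalence relation on polygons. -/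
def polygonSetoid (γ : Fin n → Curve) : Setoid (Polygon γ) where
  r := Equivalent
  iseqv := equivalent_equivalence

end Polygon

/-- The polygons in the torus with sides on `γ 0, …, γ (n - 1)`, up to reparametrization. -/
def PolygonClass {n : ℕ} (γ : Fin n → Curve) : Type := Quotient (Polygon.polygonSetoid γ)

/-- A representative of a class; the quantities used below do not depend on it. -/
def PolygonClass.rep {n : ℕ} {γ : Fin n → Curve} (T : PolygonClass γ) : Polygon γ := Quotient.out T

/-! ### The polygon counting maps

A polygon with sides on `α₀, …, α_d` has corners `y, x₁, …, x_d`, where the side on `α_j` begins at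
`x_j` (the side on `α₀` begins at `y`).  It contributes `U ^ n_z` times the composition of the
coefficients `e_j` at `x_j` and the monodromies along the sides to the coefficient at `y`. -/

section Mu

variable {ι₀ ι₁ ι₂ ι₃ : Type}
  [Fintype ι₀] [DecidableEq ι₀] [Fintype ι₁] [DecidableEq ι₁]
  [Fintype ι₂] [DecidableEq ι₂] [Fintype ι₃] [DecidableEq ι₃]

/-- `μ₁ ψ₁ = M`, with basepoint `z`. -/
def IsMu1 (z : ℝ × ℝ) (α₀ : LCurve ι₀) (α₁ : LCurve ι₁) (ψ₁ : CF α₀ α₁) (M : CF α₀ α₁) : Prop :=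
  open Classical in
  ∀ (y : ↥(α₀.toCurve.carrier ∩ α₁.toCurve.carrier)) i j, UAdicHasSum
    (fun T : PolygonClass ![α₀.toCurve, α₁.toCurve] =>
      if toTorus (T.rep.start 0) = (y : T2) then
        (Uvar ^ T.rep.mult z •
          (α₁.mono ^ α₁.crossings (T.rep.start 1) (T.rep.finish 1) *
            coeffAt ψ₁ (T.rep.start 1) *
            α₀.mono ^ α₀.crossings (T.rep.start 0) (T.rep.finish 0))) i j
      else 0)
    (M y i j)

/-- `μ₂ (ψ₁ ⊗ ψ₂) = M`, with basepoint `z`. -/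
def IsMu2 (z : ℝ × ℝ) (α₀ : LCurve ι₀) (α₁ : LCurve ι₁) (α₂ : LCurve ι₂)
    (ψ₁ : CF α₀ α₁) (ψ₂ : CF α₁ α₂) (M : CF α₀ α₂) : Prop :=
  open Classical in
  ∀ (y : ↥(α₀.toCurve.carrier ∩ α₂.toCurve.carrier)) i j, UAdicHasSum
    (fun T : PolygonClass ![α₀.toCurve, α₁.toCurve, α₂.toCurve] =>
      if toTorus (T.rep.start 0) = (y : T2) then
        (Uvar ^ T.rep.mult z •
          (α₂.mono ^ α₂.crossings (T.rep.start 2) (T.rep.finish 2) *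
            coeffAt ψ₂ (T.rep.start 2) *
            α₁.mono ^ α₁.crossings (T.rep.start 1) (T.rep.finish 1) *
            coeffAt ψ₁ (T.rep.start 1) *
            α₀.mono ^ α₀.crossings (T.rep.start 0) (T.rep.finish 0))) i j
      else 0)
    (M y i j)

/-- `μ₃ (ψ₁ ⊗ ψ₂ ⊗ ψ₃) = M`, with basepoint `z`. -/
def IsMu3 (z : ℝ × ℝ) (α₀ : LCurve ι₀) (α₁ : LCurve ι₁) (α₂ : LCurve ι₂) (α₃ : LCurve ι₃)
    (ψ₁ : CF α₀ α₁) (ψ₂ : CF α₁ α₂) (ψ₃ : CF α₂ α₃) (M : CF α₀ α₃) : Prop :=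
  open Classical in
  ∀ (y : ↥(α₀.toCurve.carrier ∩ α₃.toCurve.carrier)) i j, UAdicHasSum
    (fun T : PolygonClass ![α₀.toCurve, α₁.toCurve, α₂.toCurve, α₃.toCurve] =>
      if toTorus (T.rep.start 0) = (y : T2) then
        (Uvar ^ T.rep.mult z •
          (α₃.mono ^ α₃.crossings (T.rep.start 3) (T.rep.finish 3) *
            coeffAt ψ₃ (T.rep.start 3) *
            α₂.mono ^ α₂.crossings (T.rep.start 2) (T.rep.finish 2) *
            coeffAt ψ₂ (T.rep.start 2) *
            α₁.mono ^ α₁.crossings (T.rep.start 1) (T.rep.finish 1) *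
            coeffAt ψ₁ (T.rep.start 1) *
            α₀.mono ^ α₀.crossings (T.rep.start 0) (T.rep.finish 0))) i j
      else 0)
    (M y i j)

end Mu

/-- `M ≡ M'` modulo `U`: the difference of the chains has all its entries in `U F[[U]]`. -/
def ModUEq {ι κ : Type} {α : LCurve ι} {β : LCurve κ} (M M' : CF α β) : Prop :=
  ∀ x i j, ∃ g : FU, M x i j - M' x i j = ((PowerSeries.X * g : FU) : FUinv)

/-! ### Standard translates -/

/-- The curve `across = f(along)` (modulo integers), with the same local system. -/
def LCurve.translate {ι : Type} (α : LCurve ι) (f : ℝ → ℝ) : LCurve ι where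
  along := α.along
  across P := α.across P - f (α.along P)
  mono := α.mono
  arc := α.arc

/-- The curve `across = f(along)` is a standard translate of `α` in the presence of the curves `β`
and `γ`: it is a small parallel push-off of `α` (by `|s| < δ ≤ ε`), except that in a small region
around `along = c` it crosses `α` twice, at `along = tPlus` and `along = tMinus` (modulo `1`).  The
push-off may be to the right (the first alternative) or to the left (the second one).  The crossing
at `tPlus`, where `f` changes from negative to positive, is `Θ⁺`, the intersection point in the top
grading: the two bigons between the curves go from it to the other crossing.  The small region is
disjoint from `β` and `γ`. -/
structure IsStandardTranslate (α β γ : Curve) (ε c : ℝ) (f : ℝ → ℝ) (tPlus : ℝ) : Prop where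
  continuous : Continuous f
  periodic : Function.Periodic f 1
  region : ∃ δ ρ s tMinus : ℝ, δ ≤ ε ∧ ρ ≤ 1 / 2 ∧ (∀ t, |f t| < δ) ∧
    ((c - ρ < tPlus ∧ tPlus < c ∧ c < tMinus ∧ tMinus < c + ρ) ∨
      (c < tPlus ∧ tPlus < c + ρ ∧ c - ρ < tMinus - 1 ∧ tMinus - 1 < c)) ∧
    f tPlus = 0 ∧ f tMinus = 0 ∧
    (∀ t ∈ Set.Ioo tPlus tMinus, 0 < f t) ∧
    (∀ t ∈ Set.Ioo tMinus (tPlus + 1), f t < 0) ∧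
    (∀ t ∈ Set.Icc (c + ρ) (c + 1 - ρ), f t = s) ∧
    ∀ P : ℝ × ℝ, (∃ m : ℤ, |α.across P - m| < δ) → (∃ m : ℤ, |α.along P - c - m| < ρ) →
      ∀ m : ℤ, β.across P ≠ m ∧ γ.across P ≠ m

open Classical in
/-- The chain `Id Θ⁺` in `CF(α, α')`, where `α'` is a standard translate. -/
def idTheta {ι : Type} (α : LCurve ι) (f : ℝ → ℝ) (tPlus : ℝ) : CF α (α.translate f) :=
  fun x => if ∃ P : ℝ × ℝ, toTorus P = x ∧ (∃ m : ℤ, α.across P = m) ∧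
      ∃ m : ℤ, α.along P = tPlus + m then 1 else 0

/-- `x' ∈ γ ∩ α'` is the nearest point to `x ∈ γ ∩ α`: they have lifts to `ℝ²` on the same lift of
`γ`, and on a lift of `α` and the corresponding translated lift, respectively. -/
def IsNearest {ι κ : Type} (γ : LCurve κ) (α : LCurve ι) (f : ℝ → ℝ) (x x' : T2) : Prop :=
  ∃ P P' : ℝ × ℝ, toTorus P = x ∧ toTorus P' = x' ∧
    (∃ m : ℤ, γ.across P = m ∧ γ.across P' = m) ∧
    ∃ m : ℤ, α.across P = m ∧ (α.translate f).across P' = m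

/-- The nearest point map `CF(γ, α) → CF(γ, α')`. -/
def nearestPointMap {ι κ : Type} {γ : LCurve κ} {α : LCurve ι} (f : ℝ → ℝ) (ψ : CF γ α) :
    CF γ (α.translate f) :=
  fun x' => ∑ᶠ (x : ↥(γ.toCurve.carrier ∩ α.toCurve.carrier)) (_ : IsNearest γ α f x x'), ψ x

/-! ### The diagram and the local systems -/

section Diagram

variable (p q : ℕ)

/-- The weakly decreasing sequence `s₀, …, s_{p-1}` with values `⌈q/p⌉, ⌊q/p⌋` and sum `q`. -/
def sSeq (i : ZMod p) : ℕ := if i.val < q % p then q / p + 1 else q / p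

/-- `c_i = s_{i-k}`. -/
def cSeq (k : ℕ) (i : ZMod p) : ℕ := sSeq p q (i - k)

/-- The index set of the basis `x_{i,ℓ}` of `E₀ᵏ`. -/
abbrev XIndex (k : ℕ) : Type := Σ i : ZMod p, Fin (cSeq p q k i)

/-- The index set of the coefficients `u_{i,ℓ}` and `w_{i,ℓ}`. -/
abbrev CoeffIndex : Type := Σ i : ZMod p, Fin (sSeq p q i)

variable {p q} in
/-- The index `(i + k, ℓ)` of a basis element of `E₀ᵏ`. -/
def xShift (k : ℕ) (a : CoeffIndex p q) : XIndex p q k :=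
  ⟨a.1 + k, Fin.cast (by simp [cSeq]) a.2⟩

variable {p q} in
/-- `(i, ℓ) ↦ (i, ℓ + 1)`, where `ℓ` is interpreted modulo `c_i`. -/
def xNext {k : ℕ} (a : XIndex p q k) : XIndex p q k := ⟨a.1, finRotate _ a.2⟩

/-- The monodromy `x_{i,ℓ} ↦ x_{i,ℓ+1}`. -/
def phi0 (k : ℕ) : Matrix (XIndex p q k) (XIndex p q k) FUinv :=
  Matrix.of fun a b => if a = xNext b then 1 else 0

open Classical in
/-- The sequence `u_a ∈ {1, U}`: the value is `U` if `a = -i q⁻¹ - 1` modulo `p` for some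
`i = 0, …, k - 1`, and `1` otherwise. -/
def uSeq (k : ℕ) (a : ZMod p) : FUinv :=
  if ∃ i : ℕ, i < k ∧ a = -(i : ZMod p) * (q : ZMod p)⁻¹ - 1 then Uvar else 1

/-- The monodromy `y_i ↦ u_i y_{i+1}`. -/
def phiInf (k : ℕ) : Matrix (ZMod p) (ZMod p) FUinv :=
  Matrix.of fun a b => if a = b + 1 then uSeq p q k b else 0

/-- The image of the `x`-axis, with the local system `E₀ᵏ` whose arc goes down from `(ε, ε)` to
`(ε, -ε)`; moving to the right is positive. -/
def beta0 (k : ℕ) (ε : ℝ) : LCurve (XIndex p q k) where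
  along P := -P.1
  across P := -P.2
  mono := phi0 p q k
  arc := -ε

/-- The image of the `y`-axis, with the local system `E_∞ᵏ` whose arc goes left from `(ε, ε)` to
`(-ε, ε)`; moving down is positive. -/
def betaInf (k : ℕ) (ε : ℝ) : LCurve (ZMod p) where
  along P := P.2
  across P := -P.1
  mono := phiInf p q k
  arc := ε

/-- The image of the line of slope `p / q` through `(1 / (2 p), 0)`, with the trivial local system.
The integers `a, b` in `along (x, y) = a x + b y` satisfy `a q + b p = 1`. -/
def betaR : LCurve Unit where
  along P := (Nat.gcdA q p : ℝ) * P.1 + (Nat.gcdB q p : ℝ) * P.2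
  across P := q * P.2 - p * P.1 + 1 / 2
  mono := 1
  arc := 0

/-- The intersection points of `beta0` and `betaR`, from left to right. -/
def theta (i : ZMod p) : T2 := toTorus (((i.val : ℝ) + 1 / 2) / p, 0)

/-- The intersection points of `betaR` and `betaInf`, from top to bottom. -/
def xi (j : ZMod q) : T2 := toTorus (0, -(((j.val : ℝ) + 1 / 2) / q))

/-- The intersection point of `betaInf` and `beta0`. -/
def zeta : T2 := toTorus (0, 0)

variable {p q} in
open Classical in
/-- `∑ u_{i,ℓ} x*_{i+k,ℓ} θ_{i+k}` (over `i < p - k`) `+ ∑ u_{i,ℓ} x*_{i+k,ℓ+1} θ_{i+k}`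
(over `i ≥ p - k`). -/
def psi0r [NeZero p] (k : ℕ) (ε : ℝ) (u : CoeffIndex p q → FU) :
    CF (beta0 p q k ε) (betaR p q) :=
  fun x => ∑ a : CoeffIndex p q,
    if (x : T2) = theta p (a.1 + k) then
      Matrix.single () (if a.1.val < p - k then xShift k a else xNext (xShift k a))
        (u a : FUinv)
    else 0

variable {p q} in
open Classical in
/-- `∑ v_j y_{-((j+k) mod q) q⁻¹} ξ_{(j+k) mod q}`. -/
def psirInf [NeZero q] (k : ℕ) (ε : ℝ) (v : ZMod q → FU) :
    CF (betaR p q) (betaInf p q k ε) :=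
  fun x => ∑ j : ZMod q,
    if (x : T2) = xi q (j + k) then
      Matrix.single (-((j + k).val : ZMod p) * (q : ZMod p)⁻¹) () (v j : FUinv)
    else 0

variable {p q} in
open Classical in
/-- `∑ w_{i,ℓ} x_{i+k,ℓ} y*_{-(i+k) q⁻¹} ζ`. -/
def psiInf0 [NeZero p] (k : ℕ) (ε : ℝ) (w : CoeffIndex p q → FU) :
    CF (betaInf p q k ε) (beta0 p q k ε) :=
  fun x => ∑ a : CoeffIndex p q,
    if (x : T2) = zeta then
      Matrix.single (xShift k a) (-(a.1 + k) * (q : ZMod p)⁻¹) (w a : FUinv)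
    else 0

/-! ### The properties of the coefficients -/

/-- The coefficients `1` for `ℓ = 0` and `0` otherwise. -/
def trivialCoeff (a : CoeffIndex p q) : FU := if (a.2 : ℕ) = 0 then 1 else 0

variable {p q}

/-- The prescribed reductions modulo `U`. -/
def ReducesCorrectly (u : CoeffIndex p q → FU) (v : ZMod q → FU) (w : CoeffIndex p q → FU) : Prop :=
  open Classical in
  (∀ a, PowerSeries.constantCoeff (u a) = if (a.2 : ℕ) = 0 then 1 else 0) ∧
  (∀ a, PowerSeries.constantCoeff (w a) = if (a.2 : ℕ) = 0 then 1 else 0) ∧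
  ∀ j, PowerSeries.constantCoeff (v j) =
    if ∃ t : ℕ, 1 ≤ t ∧ t ≤ min p q ∧ j = -(t : ZMod q) then 1 else 0

/-- The three chains are cycles. -/
def AreCycles [NeZero p] [NeZero q] (u : CoeffIndex p q → FU) (v : ZMod q → FU)
    (w : CoeffIndex p q → FU) (k : ℕ) (ε : ℝ) : Prop :=
  IsMu1 (ε, ε) (beta0 p q k ε) (betaR p q) (psi0r k ε u) 0 ∧
  IsMu1 (ε, ε) (betaR p q) (betaInf p q k ε) (psirInf k ε v) 0 ∧
  IsMu1 (ε, ε) (betaInf p q k ε) (beta0 p q k ε) (psiInf0 k ε w) 0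

/-- The three triangle counting maps vanish. -/
def TrianglesVanish [NeZero p] [NeZero q] (u : CoeffIndex p q → FU) (v : ZMod q → FU)
    (w : CoeffIndex p q → FU) (k : ℕ) (ε : ℝ) : Prop :=
  IsMu2 (ε, ε) (betaInf p q k ε) (beta0 p q k ε) (betaR p q) (psiInf0 k ε w) (psi0r k ε u) 0 ∧
  IsMu2 (ε, ε) (beta0 p q k ε) (betaR p q) (betaInf p q k ε) (psi0r k ε u) (psirInf k ε v) 0 ∧
  IsMu2 (ε, ε) (betaR p q) (betaInf p q k ε) (beta0 p q k ε) (psirInf k ε v) (psiInf0 k ε w) 0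

/-- The three quadrilateral counting maps are the identity modulo `U`, for all standard translates of
the three curves. -/
def QuadrilateralsIdentity [NeZero p] [NeZero q] (u : CoeffIndex p q → FU) (v : ZMod q → FU)
    (w : CoeffIndex p q → FU) (k : ℕ) (ε : ℝ) : Prop :=
  (∀ (f : ℝ → ℝ) (t : ℝ),
    IsStandardTranslate (beta0 p q k ε).toCurve (betaR p q).toCurve (betaInf p q k ε).toCurve
      ε (-ε) f t →
    ∃ M, IsMu3 (ε, ε) (beta0 p q k ε) (betaR p q) (betaInf p q k ε) ((beta0 p q k ε).translate f)
        (psi0r k ε u) (psirInf k ε v) (nearestPointMap f (psiInf0 k ε w)) M ∧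
      ModUEq M (idTheta (beta0 p q k ε) f t)) ∧
  (∀ (c : ℝ) (f : ℝ → ℝ) (t : ℝ),
    IsStandardTranslate (betaR p q).toCurve (betaInf p q k ε).toCurve (beta0 p q k ε).toCurve
      ε c f t →
    ∃ M, IsMu3 (ε, ε) (betaR p q) (betaInf p q k ε) (beta0 p q k ε) ((betaR p q).translate f)
        (psirInf k ε v) (psiInf0 k ε w) (nearestPointMap f (psi0r k ε u)) M ∧
      ModUEq M (idTheta (betaR p q) f t)) ∧
  (∀ (f : ℝ → ℝ) (t : ℝ),
    IsStandardTranslate (betaInf p q k ε).toCurve (beta0 p q k ε).toCurve (betaR p q).toCurve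
      ε ε f t →
    ∃ M, IsMu3 (ε, ε) (betaInf p q k ε) (beta0 p q k ε) (betaR p q) ((betaInf p q k ε).translate f)
        (psiInf0 k ε w) (psi0r k ε u) (nearestPointMap f (psirInf k ε v)) M ∧
      ModUEq M (idTheta (betaInf p q k ε) f t))

/-- The coefficients have the prescribed reductions modulo `U`, and for all `k = 0, …, p - 1` and all
sufficiently small `ε > 0` (so that the arcs of the local systems avoid the other curves) the chains
they define are cycles, have vanishing triangle counting maps, and have quadrilateral counting maps
that are the identity modulo `U`. -/
def IsSolution [NeZero p] [NeZero q] (u : CoeffIndex p q → FU) (v : ZMod q → FU)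
    (w : CoeffIndex p q → FU) : Prop :=
  ReducesCorrectly u v w ∧
    ∀ k < p, ∀ ε : ℝ, 0 < ε → 4 * (p + q) * ε < 1 →
      AreCycles u v w k ε ∧ TrianglesVanish u v w k ε ∧ QuadrilateralsIdentity u v w k ε

end Diagram

end LocalComp

end

/-! ### Rigidity: an immersed polygon is determined by its lifts and corners -/

open Topology
noncomputable section
namespace LocalComp

/-! ### Locally injective maps of intervals and disks -/

/-! Everything is computed in the universal cover, where the three curves lift to straight lines. Up
to deck transformations the triples of lifts are indexed by an integer `i`: the two axes and the
line `q y - p x + i + 1/2 = 0`. They bound one triangle, in the fourth quadrant for `i ≥ 0` and in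
the second for `i < 0`. Two lines meet at most once, so there are no bigons. Every immersed triangle
on the three lines is the embedded one: compared with an embedded model, its parametrization is an
open, locally injective map of the disk that is injective on the boundary circle, hence a
homeomorphism (`disk_bijective`, `Polygon.equivalent_of_corners`). Thus `μ₂` is a sum over `ℤ`. A
quadrilateral for a standard translate is such a triangle with one side bent at a lift of `Θ⁺` on
it, so `μ₃` is a sum over pairs of an `i` and such a lift.

The multiplicity `nz i` at the basepoint is a lattice point count. It vanishes exactly for `-p ≤ i <
q`, is invariant under `i ↦ q - p - 1 - i`, and satisfies `nz (i + q) = nz i + ⌊i/p⌋ + 1`. By the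
last relation the powers of `U` in the monodromy of `β_∞` turn `U ^ nz i` into `U ^ nz (i - k)`
(`uSeq_eq`, `Uvar_pow_mul_gexp`). The relabelling in the chains shifts the other indices in the same
way, so all `k` lead to the equations for `k = 0`, collected in `IsAlgSol`.

If `u` is trivial, these equations say that `v` and `w` lie in the right and left kernels of the
matrix `countMatrix`, which is square because the `s_m` add up to `q`. Its determinant vanishes: the
symmetry of `nz` gives involutions of the rows and columns that preserve the matrix, so in
characteristic two the terms of the determinant cancel in pairs except those of equivariant
permutations, and each of these contains an entry at a fixed row and column that is itself zero by
pairwise cancellation (`Matrix.det_eq_zero_of_involutions`, `exists_countMatrix_eq_zero`). A kernel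
vector can be divided by a power of `U` until its reduction is nonzero. Modulo `U` only `-p ≤ i < q`
matter, and both kernels are lines spanned by the prescribed vectors; this uses that `p` and `q` are
coprime (`right_kernel_mod`, `left_kernel_mod`). The substitution `ℓ ↦ -ℓ` interchanges the roles of
`u` and `w` and gives the solution with trivial `w`.

The quadrilateral counts need only the reductions modulo `U`. The terms that survive are those with
`i - k < 0` or `i - k ≥ q - p` within the range where `nz (i - k) = 0`. They can be paired, and the
lifts of `Θ⁺` counted by the two members of a pair differ by a few consecutive ones. What remains is
that one of `s` consecutive integers is divisible by `s` for `β_0`, that `p` consecutive integers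
represent each residue once for `β_∞`, and the Bézout identity `a q + b p = 1` for `β_r`. -/

theorem injOn_Icc_of_locally_injective {f : ℝ → ℝ} {a b : ℝ} (hf : ContinuousOn f (Set.Icc a b))
    (hl : ∀ t ∈ Set.Icc a b, ∃ N ∈ 𝓝[Set.Icc a b] t, Set.InjOn f N) :
    Set.InjOn f (Set.Icc a b) := by
  have key : ∀ x ∈ Set.Icc a b, ∀ y ∈ Set.Icc a b, x < y → f x ≠ f y := by
    intro x hx y hy hxy h
    have hsub : Set.Icc x y ⊆ Set.Icc a b := Set.Icc_subset_Icc hx.1 hy.2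
    -- Rolle: equal values force an interior local extremum `c`, whereas a continuous function that
    -- is injective near `c` is strictly monotone there.
    obtain ⟨c, hc, hext⟩ := exists_isLocalExtr_Ioo hxy (hf.mono hsub) h
    obtain ⟨N, hN, hinj⟩ := hl c (hsub ⟨hc.1.le, hc.2.le⟩)
    rw [mem_nhdsWithin_iff_exists_mem_nhds_inter] at hN
    obtain ⟨W, hW, hWN⟩ := hN
    have hI : W ∩ Set.Ioo x y ∈ 𝓝 c := Filter.inter_mem hW (Ioo_mem_nhds hc.1 hc.2)
    obtain ⟨r, hr, hball⟩ := Metric.nhds_basis_closedBall.mem_iff.1 hI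
    rw [Real.closedBall_eq_Icc] at hball
    have hsub' : Set.Icc (c - r) (c + r) ⊆ Set.Icc a b := fun t ht =>
      hsub (Set.Ioo_subset_Icc_self (hball ht).2)
    have hinj' : Set.InjOn f (Set.Icc (c - r) (c + r)) :=
      hinj.mono fun t ht => hWN ⟨(hball ht).1, hsub' ht⟩
    have hmem : c ∈ Set.Icc (c - r) (c + r) := ⟨by linarith, by linarith⟩
    have hR : ∃ᶠ t in 𝓝 c, c < t ∧ t ∈ Set.Icc (c - r) (c + r) := by
      refine Filter.Eventually.frequently (f := 𝓝[>] c) ?_ |>.filter_mono nhdsWithin_le_nhds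
      filter_upwards [Ioo_mem_nhdsGT (show c < c + r by linarith)] with t ht
      exact ⟨ht.1, by linarith [ht.1], ht.2.le⟩
    have hL : ∃ᶠ t in 𝓝 c, t < c ∧ t ∈ Set.Icc (c - r) (c + r) := by
      refine Filter.Eventually.frequently (f := 𝓝[<] c) ?_ |>.filter_mono nhdsWithin_le_nhds
      filter_upwards [Ioo_mem_nhdsLT (show c - r < c by linarith)] with t ht
      exact ⟨ht.2, ht.1.le, by linarith [ht.2]⟩
    rcases (hf.mono hsub').strictMonoOn_of_injOn_Icc' (by linarith) hinj' with hm | hm <;>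
      rcases hext with he | he
    · obtain ⟨t, ht, h2⟩ := (hL.and_eventually he).exists
      exact absurd (hm ht.2 hmem ht.1) (not_lt.2 h2)
    · obtain ⟨t, ht, h2⟩ := (hR.and_eventually he).exists
      exact absurd (hm hmem ht.2 ht.1) (not_lt.2 h2)
    · obtain ⟨t, ht, h2⟩ := (hR.and_eventually he).exists
      exact absurd (hm hmem ht.2 ht.1) (not_lt.2 h2)
    · obtain ⟨t, ht, h2⟩ := (hL.and_eventually he).exists
      exact absurd (hm ht.2 hmem ht.1) (not_lt.2 h2)
  intro x hx y hy h
  rcases lt_trichotomy x y with hlt | heq | hgt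
  · exact absurd h (key x hx y hy hlt)
  · exact heq
  · exact absurd h.symm (key y hy x hx hgt)

theorem image_Icc_eq_uIcc_of_injOn {f : ℝ → ℝ} (hf : ContinuousOn f (Set.Icc 0 1))
    (hi : Set.InjOn f (Set.Icc 0 1)) : f '' Set.Icc 0 1 = Set.uIcc (f 0) (f 1) := by
  apply Set.Subset.antisymm
  · rintro _ ⟨t, ht, rfl⟩
    rcases hf.strictMonoOn_of_injOn_Icc' zero_le_one hi with hm | hm
    · exact Set.mem_uIcc_of_le (hm.monotoneOn ⟨le_rfl, zero_le_one⟩ ht ht.1)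
        (hm.monotoneOn ht ⟨zero_le_one, le_rfl⟩ ht.2)
    · exact Set.mem_uIcc_of_ge (hm.antitoneOn ht ⟨zero_le_one, le_rfl⟩ ht.2)
        (hm.antitoneOn ⟨le_rfl, zero_le_one⟩ ht ht.1)
  · have h := intermediate_value_uIcc (f := f) (a := 0) (b := 1)
      (by rwa [Set.uIcc_of_le zero_le_one])
    rwa [Set.uIcc_of_le (zero_le_one' ℝ)] at h

theorem isOpen_openDisk : IsOpen {w : Disk | ‖(w : ℂ)‖ < 1} :=
  isOpen_lt (by fun_prop) continuous_const

theorem Disk.norm_le (w : Disk) : ‖(w : ℂ)‖ ≤ 1 := mem_closedBall_zero_iff.1 w.2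

/-- A map of the disk that is open in the interior, locally injective, and maps the boundary circle
injectively to itself is a bijection onto the disk. -/
theorem disk_bijective {v : Disk → ℂ} (hc : Continuous v)
    (ho : ∀ V : Set Disk, IsOpen V → (∀ w ∈ V, ‖(w : ℂ)‖ < 1) → IsOpen (v '' V))
    (hl : ∀ w : Disk, ∃ N ∈ 𝓝 w, Set.InjOn v N)
    (hb : ∀ w : Disk, ‖(w : ℂ)‖ = 1 → ‖v w‖ = 1)
    (hi : ∀ w w' : Disk, ‖(w : ℂ)‖ = 1 → ‖(w' : ℂ)‖ = 1 → v w = v w' → w = w') :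
    Function.Injective v ∧ Set.range v = Metric.closedBall 0 1 := by
  have hV := isOpen_openDisk
  have hvV : IsOpen (v '' {w : Disk | ‖(w : ℂ)‖ < 1}) := ho _ hV fun w hw => hw
  -- Maximum principle: if `‖v‖` had a maximum above `1`, it would be at an interior point, and the
  -- open image would contain a slightly stretched multiple of the value.
  have hle : ∀ w, ‖v w‖ ≤ 1 := by
    obtain ⟨w₀, -, hw₀⟩ := isCompact_univ.exists_isMaxOn (f := fun w => ‖v w‖)
      ⟨(⟨0, by simp⟩ : Disk), trivial⟩ (by fun_prop)
    intro w
    refine (hw₀ (Set.mem_univ w) : ‖v w‖ ≤ ‖v w₀‖).trans ?_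
    rcases (Disk.norm_le w₀).lt_or_eq with h | h
    · by_contra hgt
      push Not at hgt
      have h1 : v '' {w : Disk | ‖(w : ℂ)‖ < 1} ∈ 𝓝 ((1 : ℝ) • v w₀) := by
        rw [one_smul]; exact hvV.mem_nhds ⟨w₀, h, rfl⟩
      have h2 : Filter.Tendsto (fun r : ℝ => r • v w₀) (𝓝[>] 1) (𝓝 ((1 : ℝ) • v w₀)) :=
        (Continuous.tendsto (by fun_prop) _).mono_left nhdsWithin_le_nhds
      obtain ⟨r, ⟨w', -, hw'⟩, hr⟩ := ((h2.eventually h1).and self_mem_nhdsWithin).exists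
      have h3 : ‖v w'‖ ≤ ‖v w₀‖ := hw₀ (Set.mem_univ w')
      have hr' : (1 : ℝ) < r := hr
      rw [hw', norm_smul, Real.norm_of_nonneg (by linarith)] at h3
      nlinarith
    · exact (hb _ h).le
  have hlt : ∀ w : Disk, ‖(w : ℂ)‖ < 1 → ‖v w‖ < 1 := by
    intro w hw
    have h1 : v '' {w : Disk | ‖(w : ℂ)‖ < 1} ⊆ interior (Metric.closedBall 0 1) :=
      interior_maximal (by rintro _ ⟨w, -, rfl⟩; simpa using hle w) hvV
    rw [interior_closedBall _ one_ne_zero] at h1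
    simpa using h1 ⟨w, hw, rfl⟩
  have hinside : ∀ w : Disk, ‖v w‖ < 1 → ‖(w : ℂ)‖ < 1 := by
    intro w hw
    rcases (Disk.norm_le w).lt_or_eq with h | h
    · exact h
    · exact absurd (hb _ h) hw.ne
  have hball : IsPreconnected (Metric.ball (0 : ℂ) 1) := (convex_ball _ _).isPreconnected
  have hone : ‖v (⟨1, by simp⟩ : Disk)‖ = 1 := hb _ (by simp)
  -- the set of points with at least two preimages
  set S : Set ℂ := {Q | ∃ w w', w ≠ w' ∧ v w = Q ∧ v w' = Q} with hS
  -- Local injectivity keeps coincidences of distinct points away from the diagonal, so they form a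
  -- compact set, of which `S` is a continuous image.
  have hSclosed : IsClosed S := by
    have hE : IsClosed {x : Disk × Disk | v x.1 = v x.2 ∧ x.1 ≠ x.2} := by
      rw [← isOpen_compl_iff, isOpen_iff_mem_nhds]
      rintro ⟨w, w'⟩ h
      by_cases hww : v w = v w'
      · have : w = w' := by
          by_contra hne
          exact h ⟨hww, hne⟩
        subst this
        obtain ⟨N, hN, hinj⟩ := hl w
        filter_upwards [prod_mem_nhds hN hN]
        rintro ⟨x, y⟩ ⟨hx, hy⟩ ⟨h1, h2⟩
        exact h2 (hinj hx hy h1)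
      · have : {x : Disk × Disk | v x.1 ≠ v x.2} ∈ 𝓝 (w, w') :=
          (isOpen_ne_fun (by fun_prop) (by fun_prop)).mem_nhds hww
        filter_upwards [this] with x hx h
        exact hx h.1
    have h2 : S = (fun x : Disk × Disk => v x.1) '' {x | v x.1 = v x.2 ∧ x.1 ≠ x.2} := by
      ext Q
      constructor
      · rintro ⟨w, w', h, h1, h2⟩
        exact ⟨(w, w'), ⟨h1.trans h2.symm, h⟩, h1⟩
      · rintro ⟨⟨w, w'⟩, ⟨h1, h2⟩, h3⟩
        exact ⟨w, w', h2, h3, h1.symm.trans h3⟩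
    rw [h2]
    exact (hE.isCompact.image (by fun_prop)).isClosed
  -- The preimages of a value inside the disk are interior points; disjoint neighbourhoods of two of
  -- them have open images.
  have hSopen : IsOpen (S ∩ Metric.ball 0 1) := by
    rw [isOpen_iff_mem_nhds]
    rintro Q ⟨⟨w, w', hne, rfl, h2⟩, hQ⟩
    have hQ' : ‖v w‖ < 1 := by simpa using hQ
    obtain ⟨N, N', hN, hN', hw, hw', hd⟩ := t2_separation hne
    have h1 := (ho (N ∩ {w | ‖(w : ℂ)‖ < 1}) (hN.inter hV) fun w hw => hw.2).mem_nhds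
      ⟨w, ⟨hw, hinside w hQ'⟩, rfl⟩
    have h3 := (ho (N' ∩ {w | ‖(w : ℂ)‖ < 1}) (hN'.inter hV) fun w hw => hw.2).mem_nhds
      ⟨w', ⟨hw', hinside w' (h2 ▸ hQ')⟩, h2⟩
    filter_upwards [h1, h3, Metric.isOpen_ball.mem_nhds hQ]
    rintro R ⟨x, hx, rfl⟩ ⟨y, hy, hxy⟩ hR
    exact ⟨⟨x, y, fun h => Set.disjoint_left.1 hd hx.1 (h ▸ hy.1), rfl, hxy⟩, hR⟩
  -- The ball is connected, and values close to `v 1` are not in the closed set `S` because `v 1` is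
  -- attained only once.
  have hSempty : ¬ (S ∩ Metric.ball 0 1).Nonempty := by
    intro hne
    have hout : v ⟨1, by simp⟩ ∈ Sᶜ := by
      rintro ⟨w, w', hne, h1, h2⟩
      have hw : ∀ w, v w = v ⟨1, by simp⟩ → ‖(w : ℂ)‖ = 1 := by
        intro w h
        rcases (Disk.norm_le w).lt_or_eq with h' | h'
        · exact absurd (hlt w h') (by rw [h, hone]; exact lt_irrefl _)
        · exact h'
      exact hne (hi w w' (hw w h1) (hw w' h2) (h1.trans h2.symm))
    have hcl : v ⟨1, by simp⟩ ∈ closure (Metric.ball (0 : ℂ) 1) := by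
      rw [closure_ball _ one_ne_zero]
      simp [hone]
    obtain ⟨R, hR, hR'⟩ := mem_closure_iff.1 hcl _ hSclosed.isOpen_compl hout
    obtain ⟨x, -, hx1, hx2⟩ := hball _ _ hSopen hSclosed.isOpen_compl
      (fun x hx => by by_cases h : x ∈ S; exacts [Or.inl ⟨h, hx⟩, Or.inr h])
      (hne.imp fun x hx => ⟨hx.2, hx⟩) ⟨R, hR', hR⟩
    exact hx2 hx1.1
  refine ⟨fun w w' h => ?_, Set.Subset.antisymm ?_ ?_⟩
  · by_contra hne
    rcases (hle w).lt_or_eq with h' | h'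
    · exact hSempty ⟨v w, ⟨w, w', hne, rfl, h.symm⟩, by simpa using h'⟩
    · have hw : ∀ w, ‖v w‖ = 1 → ‖(w : ℂ)‖ = 1 := fun w hw =>
        (Disk.norm_le w).lt_or_eq.resolve_left fun h => (hlt w h).ne hw
      exact hne (hi w w' (hw w h') (hw w' (h ▸ h')) h)
  · rintro _ ⟨w, rfl⟩
    simpa using hle w
  -- Surjectivity is another connectedness argument: within the ball the range is closed and is also
  -- the image of the open disk, hence open.
  · have hclosed : IsClosed (Set.range v) := (isCompact_range hc).isClosed
    rw [← closure_ball (0 : ℂ) one_ne_zero]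
    refine closure_minimal (fun Q hQ => ?_) hclosed
    by_contra hQr
    obtain ⟨x, -, ⟨w, -, hx1⟩, hx2⟩ := hball _ _ hvV hclosed.isOpen_compl
      (fun x hx => by
        by_cases h : x ∈ Set.range v
        · obtain ⟨w, rfl⟩ := h
          exact Or.inl ⟨w, hinside w (by simpa using hx), rfl⟩
        · exact Or.inr h)
      ⟨v ⟨0, by simp⟩, by simpa using hlt ⟨0, by simp⟩ (by simp), ⟨0, by simp⟩, by simp, rfl⟩
      ⟨Q, hQ, hQr⟩
    exact hx2 ⟨w, hx1⟩

/-! ### The sides of the disk -/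

theorem norm_sidePoint (n j : ℕ) (t : ℝ) : ‖(sidePoint n j t : ℂ)‖ = 1 := Circle.norm_coe _

theorem continuous_sidePoint (n j : ℕ) : Continuous (sidePoint n j) := by
  unfold sidePoint
  fun_prop

theorem sidePoint_eq_iff {n : ℕ} (hn : n ≠ 0) (j j' : ℕ) (t t' : ℝ) :
    sidePoint n j t = sidePoint n j' t' ↔ ∃ m : ℤ, (j + t : ℝ) = j' + t' + m * n := by
  have hn' : (n : ℝ) ≠ 0 := by exact_mod_cast hn
  have hpi := Real.pi_ne_zero
  simp only [sidePoint, Subtype.mk.injEq, Circle.coe_inj, Circle.exp_eq_exp]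
  constructor
  · rintro ⟨m, hm⟩
    refine ⟨-m, ?_⟩
    field_simp at hm
    push_cast
    linear_combination -hm
  · rintro ⟨m, hm⟩
    refine ⟨-m, ?_⟩
    rw [hm]
    field_simp
    push_cast
    ring

theorem sidePoint_one {n : ℕ} (j : ℕ) : sidePoint n j 1 = sidePoint n (j + 1) 0 := by
  simp [sidePoint]

theorem sidePoint_injOn {n : ℕ} (hn : 2 ≤ n) (j : ℕ) : Set.InjOn (sidePoint n j) (Set.Icc 0 1) := by
  intro t ht t' ht' h
  obtain ⟨m, hm⟩ := (sidePoint_eq_iff (by omega) _ _ _ _).1 h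
  have hn' : (2 : ℝ) ≤ n := by exact_mod_cast hn
  have h1 : |(m : ℝ)| < 1 := by
    have h2 : |(m : ℝ) * n| ≤ 1 := by
      rw [show (m : ℝ) * n = t - t' by linarith, abs_le]
      constructor <;> linarith [ht.1, ht.2, ht'.1, ht'.2]
    rw [abs_mul, abs_of_pos (by linarith : (0 : ℝ) < n)] at h2
    nlinarith [abs_nonneg (m : ℝ)]
  have hm0 : m = 0 := by
    rw [← Int.abs_lt_one_iff]
    exact_mod_cast h1
  subst hm0
  simp at hm
  linarith

theorem exists_sidePoint {n : ℕ} (hn : n ≠ 0) (w : Disk) (hw : ‖(w : ℂ)‖ = 1) :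
    ∃ j : Fin n, ∃ t ∈ Set.Icc (0 : ℝ) 1, w = sidePoint n j t := by
  have hn' : (0 : ℝ) < n := by exact_mod_cast Nat.pos_of_ne_zero hn
  have hpi := Real.pi_pos
  obtain ⟨θ, hθ⟩ := Circle.exp_surjective ⟨(w : ℂ), by simpa [Submonoid.unitSphere] using hw⟩
  set x : ℝ := -(θ * n / (2 * Real.pi)) with hx
  set y : ℝ := x - n * ⌊x / n⌋ with hy
  have hy0 : 0 ≤ y := by
    have := Int.floor_le (x / n)
    rw [le_div_iff₀ hn'] at this
    linarith
  have hyn : y < n := by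
    have := Int.lt_floor_add_one (x / n)
    rw [div_lt_iff₀ hn'] at this
    linarith
  have hw' : w = sidePoint n 0 x := by
    apply Subtype.ext
    have h1 := congrArg (fun c : Circle => (c : ℂ)) hθ
    have h3 : -(2 * Real.pi * (((0 : ℕ) : ℝ) + x) / n) = θ := by
      rw [hx]; field_simp; simp
    simp only [sidePoint, h3]
    exact h1.symm
  refine ⟨⟨⌊y⌋₊, (Nat.floor_lt hy0).2 hyn⟩, y - ⌊y⌋₊,
    ⟨by linarith [Nat.floor_le hy0], by linarith [Nat.lt_floor_add_one y]⟩, ?_⟩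
  rw [hw', sidePoint_eq_iff hn]
  refine ⟨⌊x / n⌋, ?_⟩
  simp [hy]
  ring

/-! ### Uniqueness of polygons with given corners -/

namespace Polygon

variable {n : ℕ} {γ : Fin n → Curve}

theorem side_coord_continuous (T : Polygon γ) (j : Fin n) {g : ℝ × ℝ → ℝ} (hg : Continuous g) :
    Continuous fun t => g (T.u (sidePoint n j t)) :=
  hg.comp (T.u.continuous.comp (continuous_sidePoint n j))

/-- On a single lift of the curve `g` is a faithful coordinate, so local injectivity of the polygon
passes to a function on an interval: a side never turns back. -/
theorem side_coord_injOn (hn : 2 ≤ n) (T : Polygon γ) (j : Fin n) {g : ℝ × ℝ → ℝ}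
    (hg : Continuous g) (hgi : Set.InjOn g {P | (γ j).across P = T.level j}) :
    Set.InjOn (fun t => g (T.u (sidePoint n j t))) (Set.Icc 0 1) := by
  refine injOn_Icc_of_locally_injective (T.side_coord_continuous j hg).continuousOn
    fun t ht => ?_
  obtain ⟨N, hN, hinj⟩ := T.locally_injective (sidePoint n j t)
  refine ⟨sidePoint n j ⁻¹' N ∩ Set.Icc 0 1, Filter.inter_mem
    (mem_nhdsWithin_of_mem_nhds ((continuous_sidePoint n j).continuousAt hN))
    self_mem_nhdsWithin, ?_⟩
  intro x hx y hy h
  exact sidePoint_injOn hn j hx.2 hy.2 (hinj hx.1 hy.1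
    (hgi (T.side_mem j x hx.2) (T.side_mem j y hy.2) h))

theorem finish_eq_start (T : Polygon γ) (j j' : Fin n) (h : ((j : ℕ) + 1) % n = j') :
    T.finish j = T.start j' := by
  have hn : n ≠ 0 := by have := j.2; omega
  unfold finish start
  congr 1
  rw [sidePoint_eq_iff hn]
  refine ⟨((((j : ℕ) + 1) / n : ℕ) : ℤ), ?_⟩
  have := Nat.mod_add_div ((j : ℕ) + 1) n
  rw [h] at this
  have h2 : ((j : ℕ) : ℝ) + 1 = (j' : ℕ) + n * (((j : ℕ) + 1) / n : ℕ) := by exact_mod_cast this.symm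
  rw [Int.cast_natCast, h2]
  ring

/-- Both sides run monotonically through the interval between the same two end values of `g`. -/
theorem exists_side_match (hn : 2 ≤ n) (T T' : Polygon γ) (j : Fin n) {g : ℝ × ℝ → ℝ}
    (hg : Continuous g) (hgi : Set.InjOn g {P | (γ j).across P = T.level j})
    (hl : T'.level j = T.level j) (hs : T'.start j = T.start j) (hf : T'.finish j = T.finish j)
    {t : ℝ} (ht : t ∈ Set.Icc (0 : ℝ) 1) :
    ∃ τ ∈ Set.Icc (0 : ℝ) 1, T'.u (sidePoint n j t) = T.u (sidePoint n j τ) := by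
  have h1 := image_Icc_eq_uIcc_of_injOn (T.side_coord_continuous j hg).continuousOn
    (T.side_coord_injOn hn j hg hgi)
  have h2 := image_Icc_eq_uIcc_of_injOn (T'.side_coord_continuous j hg).continuousOn
    (T'.side_coord_injOn hn j hg (by rwa [hl]))
  have hs' : T'.u (sidePoint n j 0) = T.u (sidePoint n j 0) := hs
  have hf' : T'.u (sidePoint n j 1) = T.u (sidePoint n j 1) := hf
  simp only [hs', hf'] at h2
  rw [← h1] at h2
  obtain ⟨τ, hτ, h⟩ := h2.subset ⟨t, ht, rfl⟩
  refine ⟨τ, hτ, (hgi (T.side_mem j τ hτ) ?_ h).symm⟩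
  have := T'.side_mem j t ht
  rwa [hl] at this

/-- Two polygons with the same corners and the same lifts of the curves are equivalent, if one of
them is the restriction of a homeomorphism of the plane. -/
theorem equivalent_of_corners (hn : 2 ≤ n) (T₀ T : Polygon γ) (Ψ : ℂ ≃ₜ ℝ × ℝ)
    (hΨ : ∀ w : Disk, T₀.u w = Ψ w) (g : Fin n → ℝ × ℝ → ℝ) (hg : ∀ j, Continuous (g j))
    (hgi : ∀ j, Set.InjOn (g j) {P | (γ j).across P = T₀.level j})
    (hl : T.level = T₀.level) (hs : ∀ j, T.start j = T₀.start j) : Equivalent T T₀ := by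
  have hn0 : n ≠ 0 := by omega
  have hnR : (2 : ℝ) ≤ n := by exact_mod_cast hn
  have hf : ∀ j, T.finish j = T₀.finish j := by
    intro j
    have hj : ((j : ℕ) + 1) % n < n := Nat.mod_lt _ (by omega)
    rw [T.finish_eq_start j ⟨_, hj⟩ rfl, T₀.finish_eq_start j ⟨_, hj⟩ rfl, hs]
  have hgi' : ∀ j, Set.InjOn (g j) {P | (γ j).across P = T.level j} := by rw [hl]; exact hgi
  have hmatch := fun j t ht => exists_side_match hn T₀ T j (hg j) (hgi j) (by rw [hl]) (hs j)
    (hf j) (t := t) ht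
  have hmatch' := fun j t ht => exists_side_match hn T T₀ j (hg j) (hgi' j) (by rw [hl])
    (hs j).symm (hf j).symm (t := t) ht
  -- This is the sought reparametrization; on the boundary circle it matches the sides of `T` with
  -- those of the model.
  set v : Disk → ℂ := fun w => Ψ.symm (T.u w) with hv
  have hvc : Continuous v := Ψ.symm.continuous.comp T.u.continuous
  have hvT₀ : ∀ w w', T.u w = T₀.u w' → v w = w' := by
    intro w w' h
    rw [hv]
    simp only
    rw [h, hΨ, Homeomorph.symm_apply_apply]
  have hinj := fun j => T.side_coord_injOn hn j (hg j) (hgi' j)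
  obtain ⟨hvi, hvr⟩ := disk_bijective (v := v) hvc
    (fun V hV hV1 => by
      have h : v '' V = Ψ.symm '' (T.u '' V) := by rw [Set.image_image]
      rw [h]
      exact Ψ.symm.isOpenMap _ (T.open_interior V hV hV1))
    (fun w => by
      obtain ⟨N, hN, h⟩ := T.locally_injective w
      exact ⟨N, hN, fun x hx y hy hxy => h hx hy (Ψ.symm.injective hxy)⟩)
    (fun w hw => by
      obtain ⟨j, t, ht, rfl⟩ := exists_sidePoint hn0 w hw
      obtain ⟨τ, hτ, h⟩ := hmatch j t ht
      rw [hvT₀ _ _ h, norm_sidePoint])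
    (fun w w' hw hw' h => by
      obtain ⟨j, t, ht, rfl⟩ := exists_sidePoint hn0 w hw
      obtain ⟨j', t', ht', rfl⟩ := exists_sidePoint hn0 w' hw'
      obtain ⟨τ, hτ, h1⟩ := hmatch j t ht
      obtain ⟨τ', hτ', h2⟩ := hmatch j' t' ht'
      rw [hvT₀ _ _ h1, hvT₀ _ _ h2] at h
      obtain ⟨m, hm⟩ := (sidePoint_eq_iff hn0 _ _ _ _).1 (Subtype.ext h)
      have h00 : (0 : ℝ) ∈ Set.Icc (0 : ℝ) 1 := ⟨le_rfl, zero_le_one⟩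
      have h11 : (1 : ℝ) ∈ Set.Icc (0 : ℝ) 1 := ⟨zero_le_one, le_rfl⟩
      have e0 : ∀ (j : Fin n) (t τ : ℝ), t ∈ Set.Icc (0 : ℝ) 1 →
          T.u (sidePoint n j t) = T₀.u (sidePoint n j τ) → τ = 0 → t = 0 := by
        intro j t τ ht h hτ
        subst hτ
        refine hinj j ht h00 ?_
        change g j _ = g j (T.start j)
        rw [hs j, h]; rfl
      have e1 : ∀ (j : Fin n) (t τ : ℝ), t ∈ Set.Icc (0 : ℝ) 1 →
          T.u (sidePoint n j t) = T₀.u (sidePoint n j τ) → τ = 1 → t = 1 := by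
        intro j t τ ht h hτ
        subst hτ
        refine hinj j ht h11 ?_
        change g j _ = g j (T.finish j)
        rw [hf j, h]; rfl
      -- The integer `d` is a difference of two parameters in `[0, 1]`. For `d = 0` both points lie
      -- on the same side at the same parameter; for `d = ±1` they are the common corner of
      -- consecutive sides, and corners match corners.
      set d : ℤ := (j : ℕ) - (j' : ℕ) - m * n with hd
      have hdR : (d : ℝ) = τ' - τ := by rw [hd]; push_cast; linarith
      have hd1 : d ≤ 1 := by
        have : (d : ℝ) ≤ 1 := by linarith [hτ.1, hτ'.2]
        exact_mod_cast this
      have hd2 : -1 ≤ d := by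
        have : (-1 : ℝ) ≤ d := by linarith [hτ.2, hτ'.1]
        exact_mod_cast this
      have hd3 : d = -1 ∨ d = 0 ∨ d = 1 := by omega
      rcases hd3 with h' | h' | h'
      · have hdR' := hdR
        rw [h'] at hdR'
        push_cast at hdR'
        have a1 : τ = 1 := by linarith [hτ.2, hτ'.1]
        have a2 : τ' = 0 := by linarith [hτ.2, hτ'.1]
        rw [e1 j t τ ht h1 a1, e0 j' t' τ' ht' h2 a2]
        rw [sidePoint_eq_iff hn0]
        exact ⟨m, by rw [a1, a2] at hm; exact hm⟩
      · have hm0 : m = 0 := by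
          have hj := j.2
          have hj' := j'.2
          have : (j : ℤ) - j' = m * n := by omega
          rcases lt_trichotomy m 0 with hm' | hm' | hm'
          · nlinarith
          · exact hm'
          · nlinarith
        subst hm0
        have hjj : j = j' := by
          apply Fin.ext
          simp at hd
          omega
        subst hjj
        have : τ = τ' := by rw [h'] at hdR; push_cast at hdR; linarith
        subst this
        congr 1
        exact hinj j ht ht' (by simp only [h1, h2])
      · have hdR' := hdR
        rw [h'] at hdR'
        push_cast at hdR'
        have a1 : τ = 0 := by linarith [hτ.1, hτ'.2]
        have a2 : τ' = 1 := by linarith [hτ.1, hτ'.2]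
        rw [e0 j t τ ht h1 a1, e1 j' t' τ' ht' h2 a2]
        rw [sidePoint_eq_iff hn0]
        exact ⟨m, by rw [a1, a2] at hm; exact hm⟩)
  have hmem : ∀ w, v w ∈ Metric.closedBall (0 : ℂ) 1 := fun w => hvr.subset ⟨w, rfl⟩
  let e : Disk ≃ Disk := Equiv.ofBijective (fun w => ⟨v w, hmem w⟩)
    ⟨fun w w' h => hvi (congrArg Subtype.val h), fun w => by
      obtain ⟨w', hw'⟩ := hvr.superset w.2
      exact ⟨w', Subtype.ext hw'⟩⟩
  have hec : Continuous e := Continuous.subtype_mk hvc hmem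
  let φ : Disk ≃ₜ Disk := hec.homeoOfEquivCompactToT2
  have hφ : ∀ w, (φ w : ℂ) = v w := fun w => rfl
  have hφ' : ∀ w w', T.u w = T₀.u w' → φ w = w' := fun w w' h => Subtype.ext (hvT₀ w w' h)
  refine ⟨φ, fun j => hφ' _ _ (hs j), fun j => Set.Subset.antisymm ?_ ?_, 0, 0, fun w => ?_⟩
  · rintro _ ⟨_, ⟨t, ht, rfl⟩, rfl⟩
    obtain ⟨τ, hτ, h⟩ := hmatch j t ht
    exact ⟨τ, hτ, (hφ' _ _ h).symm⟩
  · rintro _ ⟨t, ht, rfl⟩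
    obtain ⟨τ, hτ, h⟩ := hmatch' j t ht
    exact ⟨_, ⟨τ, hτ, rfl⟩, hφ' _ _ h.symm⟩
  · rw [hΨ, hφ, hv]
    simp

end Polygon
end LocalComp
end

/-! ### Model triangles and quadrilaterals -/

open Topology
noncomputable section
namespace LocalComp

/-! ### Homeomorphisms of the plane -/

/-- A radial homeomorphism that maps the circle of radius `r` to the level set `g = r`. -/
def radialHomeo (g : ℂ → ℝ) (hg : Continuous g) (hh : ∀ r : ℝ, 0 ≤ r → ∀ z, g (r • z) = r * g z)
    (hp : ∀ z, ‖z‖ ≤ 2 * g z) : ℂ ≃ₜ ℂ where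
  toFun z := (‖z‖ / g z) • z
  invFun z := (g z / ‖z‖) • z
  left_inv z := by
    rcases eq_or_ne z 0 with rfl | hz
    · simp
    have hz' : 0 < ‖z‖ := norm_pos_iff.2 hz
    have hgz : 0 < g z := by linarith [hp z]
    simp only [hh _ (div_nonneg hz'.le hgz.le), norm_smul, Real.norm_of_nonneg
      (div_nonneg hz'.le hgz.le), smul_smul]
    rw [show ‖z‖ / g z * g z / (‖z‖ / g z * ‖z‖) * (‖z‖ / g z) = 1 by field_simp, one_smul]
  right_inv z := by
    rcases eq_or_ne z 0 with rfl | hz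
    · simp
    have hz' : 0 < ‖z‖ := norm_pos_iff.2 hz
    have hgz : 0 < g z := by linarith [hp z]
    simp only [hh _ (div_nonneg hgz.le hz'.le), norm_smul, Real.norm_of_nonneg
      (div_nonneg hgz.le hz'.le), smul_smul]
    rw [show g z / ‖z‖ * ‖z‖ / (g z / ‖z‖ * g z) * (g z / ‖z‖) = 1 by field_simp, one_smul]
  continuous_toFun := by
    rw [continuous_iff_continuousAt]
    intro z
    rcases eq_or_ne z 0 with rfl | hz
    · rw [ContinuousAt, smul_zero]
      -- Only the origin is delicate; there `hp` bounds the scaling factor by `2`.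
      refine squeeze_zero_norm (a := fun z : ℂ => 2 * ‖z‖) (fun z => ?_) ?_
      · rcases eq_or_ne z 0 with rfl | hz
        · simp
        have hz' : 0 < ‖z‖ := norm_pos_iff.2 hz
        have hgz : 0 < g z := by linarith [hp z]
        rw [norm_smul, Real.norm_of_nonneg (div_nonneg hz'.le hgz.le)]
        refine mul_le_mul_of_nonneg_right ?_ hz'.le
        rw [div_le_iff₀ hgz]
        exact hp z
      · have : Continuous fun z : ℂ => 2 * ‖z‖ := by fun_prop
        simpa using this.tendsto 0
    · have hgz : g z ≠ 0 := by
        have := hp z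
        have := norm_pos_iff.2 hz
        intro h
        linarith
      exact (continuousAt_id.norm.div hg.continuousAt hgz).smul continuousAt_id
  continuous_invFun := by
    rw [continuous_iff_continuousAt]
    intro z
    rcases eq_or_ne z 0 with rfl | hz
    · have hg0 : g 0 = 0 := by simpa using hh 0 le_rfl 0
      rw [ContinuousAt, smul_zero]
      refine squeeze_zero_norm (a := g) (fun z => ?_) (by simpa [hg0] using hg.tendsto 0)
      rcases eq_or_ne z 0 with rfl | hz
      · simp [hg0]
      have hz' : 0 < ‖z‖ := norm_pos_iff.2 hz
      have hgz : 0 < g z := by linarith [hp z]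
      rw [norm_smul, Real.norm_of_nonneg (div_nonneg hgz.le hz'.le)]
      exact (by field_simp : g z / ‖z‖ * ‖z‖ = g z).le
    · exact (hg.continuousAt.div continuousAt_id.norm (norm_ne_zero_iff.2 hz)).smul continuousAt_id

theorem radialHomeo_apply {g : ℂ → ℝ} {hg : Continuous g}
    {hh : ∀ r : ℝ, 0 ≤ r → ∀ z, g (r • z) = r * g z} {hp : ∀ z, ‖z‖ ≤ 2 * g z} (z : ℂ) :
    radialHomeo g hg hh hp z = (‖z‖ / g z) • z := rfl

theorem gauge_radialHomeo {g : ℂ → ℝ} {hg : Continuous g}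
    {hh : ∀ r : ℝ, 0 ≤ r → ∀ z, g (r • z) = r * g z} {hp : ∀ z, ‖z‖ ≤ 2 * g z} (z : ℂ) :
    g (radialHomeo g hg hh hp z) = ‖z‖ := by
  have h0 : 0 ≤ g z := by linarith [hp z, norm_nonneg z]
  rw [radialHomeo_apply, hh _ (div_nonneg (norm_nonneg _) h0)]
  rcases eq_or_ne z 0 with rfl | hz
  · simp
  have hgz : 0 < g z := by linarith [hp z, norm_pos_iff.2 hz]
  field_simp

/-- A point of the circle between two of the `n` corners is a nonnegative combination of them. -/
theorem exists_sidePoint_combination {n : ℕ} (hn : 3 ≤ n) (j : ℕ) {t : ℝ}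
    (ht : t ∈ Set.Icc (0 : ℝ) 1) : ∃ α β : ℝ, 0 ≤ α ∧ 0 ≤ β ∧
      (sidePoint n j t : ℂ) = α * (sidePoint n j 0 : ℂ) + β * (sidePoint n j 1 : ℂ) := by
  have hn' : (3 : ℝ) ≤ n := by exact_mod_cast hn
  have hpi := Real.pi_pos
  set d : ℝ := 2 * Real.pi / n with hd
  have hd0 : 0 < d := by positivity
  have hdpi : d < Real.pi := by rw [hd, div_lt_iff₀ (by linarith)]; nlinarith
  have hs : 0 < Real.sin d := Real.sin_pos_of_pos_of_lt_pi hd0 hdpi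
  -- The law of sines gives the coefficients. With at least three corners the angle `d` is less than
  -- `π`, so `sin d` is positive.
  refine ⟨Real.sin ((1 - t) * d) / Real.sin d, Real.sin (t * d) / Real.sin d,
    div_nonneg (Real.sin_nonneg_of_nonneg_of_le_pi (mul_nonneg (by linarith [ht.2]) hd0.le)
      (by nlinarith [ht.1])) hs.le,
    div_nonneg (Real.sin_nonneg_of_nonneg_of_le_pi (mul_nonneg ht.1 hd0.le)
      (by nlinarith [ht.2])) hs.le, ?_⟩
  have hsp : ∀ s : ℝ, (sidePoint n j s : ℂ) = ⟨Real.cos (j * d + s * d), -Real.sin (j * d + s * d)⟩ := by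
    intro s
    have h1 : -(2 * Real.pi * (j + s) / n) = -(j * d + s * d) := by rw [hd]; ring
    simp only [sidePoint, h1, Circle.coe_exp]
    apply Complex.ext
    · rw [Complex.exp_ofReal_mul_I_re, Real.cos_neg]
    · rw [Complex.exp_ofReal_mul_I_im, Real.sin_neg]
  have e1 : (1 - t) * d = d - t * d := by ring
  rw [hsp, hsp, hsp, e1, Real.sin_sub]
  have hs' := hs.ne'
  have hq := Real.sin_sq_add_cos_sq d
  apply Complex.ext
  · simp only [Complex.add_re, Complex.mul_re, Complex.ofReal_re, Complex.ofReal_im, zero_mul,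
      sub_zero, one_mul, add_zero, Real.cos_add]
    field_simp
    ring
  · simp only [Complex.add_im, Complex.mul_im, Complex.ofReal_re, Complex.ofReal_im, zero_mul,
      add_zero, one_mul, Real.sin_add]
    field_simp
    ring

/-- Bounded displacement makes the map proper, hence closed. -/
theorem isHomeomorph_of_bounded_displacement {F : ℝ × ℝ → ℝ × ℝ} (hc : Continuous F)
    (hb : Function.Bijective F) {C : ℝ} (hC : ∀ P, ‖F P - P‖ ≤ C) : IsHomeomorph F := by
  rw [isHomeomorph_iff_continuous_isClosedMap_bijective]
  refine ⟨hc, IsProperMap.isClosedMap ?_, hb⟩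
  rw [isProperMap_iff_tendsto_cocompact]
  refine ⟨hc, ?_⟩
  rw [← Metric.cobounded_eq_cocompact, ← comap_norm_atTop, Filter.tendsto_comap_iff]
  have h1 : Filter.Tendsto (fun P : ℝ × ℝ => ‖P‖ - C) (Filter.comap norm Filter.atTop)
      Filter.atTop := Filter.tendsto_atTop_add_const_right _ _ Filter.tendsto_comap
  refine Filter.tendsto_atTop_mono (fun P => ?_) h1
  have h2 := norm_sub_norm_le P (F P)
  rw [norm_sub_rev] at h2
  simp only [Function.comp]
  linarith [hC P]

/-- A homeomorphism of the plane that preserves the vertical lines. -/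
def fiberHomeo (v : ℝ → ℝ → ℝ) (hc : Continuous fun P : ℝ × ℝ => v P.1 P.2)
    (hm : ∀ t, StrictMono (v t)) (C : ℝ) (hC : ∀ t c, |v t c - c| ≤ C) : ℝ × ℝ ≃ₜ ℝ × ℝ :=
  (isHomeomorph_of_bounded_displacement (F := fun P => (P.1, v P.1 P.2)) (by fun_prop)
    ⟨fun P Q h => by
      obtain ⟨h1, h2⟩ := Prod.mk.inj h
      exact Prod.ext h1 ((hm P.1).injective (by rw [h2, h1])),
    fun P => by
      have hs : Function.Surjective (v P.1) := by
        refine Continuous.surjective (by fun_prop) ?_ ?_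
        · refine Filter.tendsto_atTop_mono (f := fun c => c - C) (fun c => ?_)
            (Filter.tendsto_atTop_add_const_right _ _ Filter.tendsto_id)
          linarith [(abs_le.1 (hC P.1 c)).1]
        · refine Filter.tendsto_atBot_mono (g := v P.1) (f := fun c => c + C) (fun c => ?_)
            (Filter.tendsto_atBot_add_const_right _ _ Filter.tendsto_id)
          linarith [(abs_le.1 (hC P.1 c)).2]
      obtain ⟨c, hc⟩ := hs P.2
      exact ⟨(P.1, c), Prod.ext rfl hc⟩⟩ (C := C)
    (fun P => by
      have h0 : 0 ≤ C := (abs_nonneg _).trans (hC 0 0)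
      simp only [Prod.norm_def, Prod.fst_sub, Prod.snd_sub, sub_self, norm_zero, Real.norm_eq_abs]
      exact max_le h0 (hC _ _))).homeomorph

/-! ### The standard triangle and the standard square -/

/-- The gauge of the triangle inscribed in the unit circle. -/
def triGauge (z : ℂ) : ℝ := max (-2 * z.re) (max (z.re + √3 * z.im) (z.re - √3 * z.im))

theorem one_lt_sqrt_three : (1 : ℝ) < √3 := by
  rw [Real.lt_sqrt] <;> norm_num

/-- A radial homeomorphism that maps the disk to an equilateral triangle. -/
def triRadial : ℂ ≃ₜ ℂ := radialHomeo triGauge (by unfold triGauge; fun_prop)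
  (fun r hr z => by
    simp only [triGauge, Complex.smul_re, Complex.smul_im, smul_eq_mul]
    rw [mul_max_of_nonneg _ _ hr, mul_max_of_nonneg _ _ hr]
    congr 1
    · ring
    · congr 1 <;> ring)
  (fun z => by
    have h3 := one_lt_sqrt_three
    have h1 : -2 * z.re ≤ triGauge z := le_max_left _ _
    have h2 : z.re + √3 * z.im ≤ triGauge z := (le_max_left _ _).trans (le_max_right _ _)
    have h4 : z.re - √3 * z.im ≤ triGauge z := (le_max_right _ _).trans (le_max_right _ _)
    have hx : |z.re| ≤ triGauge z := by
      rw [abs_le]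
      constructor <;> linarith
    have hy : |z.im| ≤ triGauge z := by
      have hy' : √3 * |z.im| ≤ 3 / 2 * triGauge z := by
        rcases abs_cases z.im with ⟨h, -⟩ | ⟨h, -⟩ <;> rw [h] <;> linarith
      have h5 : (3 / 2 : ℝ) < √3 := by rw [Real.lt_sqrt] <;> norm_num
      nlinarith [abs_nonneg z.im]
    linarith [Complex.norm_le_abs_re_add_abs_im z])

/-- The gauge of the square inscribed in the unit circle. -/
def sqGauge (z : ℂ) : ℝ := |z.re| + |z.im|

/-- A radial homeomorphism that maps the disk to a square. -/
def sqRadial : ℂ ≃ₜ ℂ := radialHomeo sqGauge (by unfold sqGauge; fun_prop)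
  (fun r hr z => by
    simp only [sqGauge, Complex.smul_re, Complex.smul_im, smul_eq_mul, abs_mul, abs_of_nonneg hr]
    ring)
  (fun z => by
    have := Complex.norm_le_abs_re_add_abs_im z
    have := norm_nonneg z
    unfold sqGauge
    linarith)

theorem triGauge_triRadial (z : ℂ) : triGauge (triRadial z) = ‖z‖ := gauge_radialHomeo z

theorem sqGauge_sqRadial (z : ℂ) : sqGauge (sqRadial z) = ‖z‖ := gauge_radialHomeo z

theorem sidePoint_re_im (n j : ℕ) (t : ℝ) : (sidePoint n j t : ℂ).re = Real.cos (2 * Real.pi * (j + t) / n)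
    ∧ (sidePoint n j t : ℂ).im = -Real.sin (2 * Real.pi * (j + t) / n) := by
  simp only [sidePoint, Circle.coe_exp, Complex.exp_ofReal_mul_I_re, Complex.exp_ofReal_mul_I_im,
    Real.cos_neg, Real.sin_neg, and_self]

theorem cos_two_pi_div_three : Real.cos (2 * Real.pi / 3) = -1 / 2 := by
  rw [show 2 * Real.pi / 3 = Real.pi - Real.pi / 3 by ring, Real.cos_pi_sub, Real.cos_pi_div_three]
  ring

theorem sin_two_pi_div_three : Real.sin (2 * Real.pi / 3) = √3 / 2 := by
  rw [show 2 * Real.pi / 3 = Real.pi - Real.pi / 3 by ring, Real.sin_pi_sub, Real.sin_pi_div_three]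

theorem sidePoint_three_zero : (sidePoint 3 0 0 : ℂ).re = 1 ∧ (sidePoint 3 0 0 : ℂ).im = 0 := by
  have := sidePoint_re_im 3 0 0
  simpa using this

theorem sidePoint_three_one : (sidePoint 3 1 0 : ℂ).re = -1 / 2 ∧
    (sidePoint 3 1 0 : ℂ).im = -(√3 / 2) := by
  have := sidePoint_re_im 3 1 0
  push_cast at this
  rw [show 2 * Real.pi * (1 + 0) / 3 = 2 * Real.pi / 3 by ring, cos_two_pi_div_three,
    sin_two_pi_div_three] at this
  exact this

theorem sidePoint_three_two : (sidePoint 3 2 0 : ℂ).re = -1 / 2 ∧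
    (sidePoint 3 2 0 : ℂ).im = √3 / 2 := by
  have := sidePoint_re_im 3 2 0
  push_cast at this
  rw [show 2 * Real.pi * (2 + 0) / 3 = 2 * Real.pi - 2 * Real.pi / 3 by ring, Real.cos_two_pi_sub,
    Real.sin_two_pi_sub, cos_two_pi_div_three, sin_two_pi_div_three, neg_neg] at this
  exact this

theorem sidePoint_wrap (n : ℕ) (hn : n ≠ 0) : sidePoint n n 0 = sidePoint n 0 0 := by
  rw [sidePoint_eq_iff hn]
  exact ⟨1, by simp⟩

/-- On the cone spanned by two corners, the maximum that defines `triGauge` is attained by the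
linear form of the edge between them. The radial map normalizes the gauge of boundary points to `1`,
so the form equals `1` on the side. The other two sides are analogous. -/
theorem triRadial_side_zero {t : ℝ} (ht : t ∈ Set.Icc (0 : ℝ) 1) :
    (triRadial (sidePoint 3 0 t)).re - √3 * (triRadial (sidePoint 3 0 t)).im = 1 := by
  obtain ⟨α, β, hα, hβ, h⟩ := exists_sidePoint_combination le_rfl 0 ht
  have hg := triGauge_triRadial (sidePoint 3 0 t)
  rw [norm_sidePoint] at hg
  rw [sidePoint_one] at h
  have h3 : √3 * √3 = 3 := Real.mul_self_sqrt (by norm_num)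
  have hre : (sidePoint 3 0 t : ℂ).re = α - β / 2 := by
    rw [h]; simp [sidePoint_three_zero, sidePoint_three_one]; ring
  have him : (sidePoint 3 0 t : ℂ).im = -(β * (√3 / 2)) := by
    rw [h]; simp [sidePoint_three_zero, sidePoint_three_one]
  have him' : √3 * (sidePoint 3 0 t : ℂ).im = -(3 / 2) * β := by
    rw [him]; linear_combination -(β / 2) * h3
  have key : triGauge (sidePoint 3 0 t) = (sidePoint 3 0 t : ℂ).re - √3 * (sidePoint 3 0 t : ℂ).im := by
    rw [triGauge, max_eq_right, max_eq_right]
    · linarith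
    · refine le_max_of_le_right ?_
      linarith
  have hr : triRadial (sidePoint 3 0 t) = (‖(sidePoint 3 0 t : ℂ)‖ / triGauge (sidePoint 3 0 t)) •
    (sidePoint 3 0 t : ℂ) := rfl
  have hgp : triGauge (sidePoint 3 0 t) ≠ 0 := by
    intro h0
    rw [hr, h0] at hg
    simp [triGauge] at hg
  rw [hr, norm_sidePoint]
  simp only [Complex.smul_re, Complex.smul_im, smul_eq_mul]
  rw [show ∀ a x y : ℝ, a * x - √3 * (a * y) = a * (x - √3 * y) by intros; ring, ← key]
  field_simp

theorem triRadial_side_one {t : ℝ} (ht : t ∈ Set.Icc (0 : ℝ) 1) :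
    -2 * (triRadial (sidePoint 3 1 t)).re = 1 := by
  obtain ⟨α, β, hα, hβ, h⟩ := exists_sidePoint_combination le_rfl 1 ht
  have hg := triGauge_triRadial (sidePoint 3 1 t)
  rw [norm_sidePoint] at hg
  rw [sidePoint_one] at h
  have h3 : √3 * √3 = 3 := Real.mul_self_sqrt (by norm_num)
  have hre : (sidePoint 3 1 t : ℂ).re = -α / 2 - β / 2 := by
    rw [h]; simp [sidePoint_three_two, sidePoint_three_one]; ring
  have him : (sidePoint 3 1 t : ℂ).im = -(α * (√3 / 2)) + β * (√3 / 2) := by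
    rw [h]; simp [sidePoint_three_two, sidePoint_three_one]
  have him' : √3 * (sidePoint 3 1 t : ℂ).im = 3 / 2 * (β - α) := by
    rw [him]; linear_combination ((β - α) / 2) * h3
  have key : triGauge (sidePoint 3 1 t) = -2 * (sidePoint 3 1 t : ℂ).re := by
    rw [triGauge, max_eq_left]
    refine max_le ?_ ?_ <;> linarith
  have hr : triRadial (sidePoint 3 1 t) = (‖(sidePoint 3 1 t : ℂ)‖ / triGauge (sidePoint 3 1 t)) •
    (sidePoint 3 1 t : ℂ) := rfl
  have hgp : triGauge (sidePoint 3 1 t) ≠ 0 := by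
    intro h0
    rw [hr, h0] at hg
    simp [triGauge] at hg
  rw [hr, norm_sidePoint]
  simp only [Complex.smul_re, smul_eq_mul]
  rw [show ∀ a x : ℝ, -2 * (a * x) = a * (-2 * x) by intros; ring, ← key]
  field_simp

theorem triRadial_side_two {t : ℝ} (ht : t ∈ Set.Icc (0 : ℝ) 1) :
    (triRadial (sidePoint 3 2 t)).re + √3 * (triRadial (sidePoint 3 2 t)).im = 1 := by
  obtain ⟨α, β, hα, hβ, h⟩ := exists_sidePoint_combination le_rfl 2 ht
  have hg := triGauge_triRadial (sidePoint 3 2 t)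
  rw [norm_sidePoint] at hg
  rw [sidePoint_one, sidePoint_wrap 3 (by norm_num)] at h
  have h3 : √3 * √3 = 3 := Real.mul_self_sqrt (by norm_num)
  have hre : (sidePoint 3 2 t : ℂ).re = -α / 2 + β := by
    rw [h]; simp [sidePoint_three_two, sidePoint_three_zero]; ring
  have him : (sidePoint 3 2 t : ℂ).im = α * (√3 / 2) := by
    rw [h]; simp [sidePoint_three_two, sidePoint_three_zero]
  have him' : √3 * (sidePoint 3 2 t : ℂ).im = 3 / 2 * α := by
    rw [him]; linear_combination (α / 2) * h3
  have key : triGauge (sidePoint 3 2 t) = (sidePoint 3 2 t : ℂ).re + √3 * (sidePoint 3 2 t : ℂ).im := by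
    rw [triGauge, max_eq_right, max_eq_left]
    · linarith
    · refine le_max_of_le_left ?_
      linarith
  have hr : triRadial (sidePoint 3 2 t) = (‖(sidePoint 3 2 t : ℂ)‖ / triGauge (sidePoint 3 2 t)) •
    (sidePoint 3 2 t : ℂ) := rfl
  have hgp : triGauge (sidePoint 3 2 t) ≠ 0 := by
    intro h0
    rw [hr, h0] at hg
    simp [triGauge] at hg
  rw [hr, norm_sidePoint]
  simp only [Complex.smul_re, Complex.smul_im, smul_eq_mul]
  rw [show ∀ a x y : ℝ, a * x + √3 * (a * y) = a * (x + √3 * y) by intros; ring, ← key]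
  field_simp

/-- The side of the standard square on which the `j`-th side is mapped. -/
theorem sqRadial_side (j : ℕ) (hj : j < 4) {t : ℝ} (ht : t ∈ Set.Icc (0 : ℝ) 1) :
    |(sqRadial (sidePoint 4 j t)).re| + |(sqRadial (sidePoint 4 j t)).im| = 1 ∧
    (j = 0 → 0 ≤ (sqRadial (sidePoint 4 j t)).re ∧ (sqRadial (sidePoint 4 j t)).im ≤ 0) ∧
    (j = 1 → (sqRadial (sidePoint 4 j t)).re ≤ 0 ∧ (sqRadial (sidePoint 4 j t)).im ≤ 0) ∧
    (j = 2 → (sqRadial (sidePoint 4 j t)).re ≤ 0 ∧ 0 ≤ (sqRadial (sidePoint 4 j t)).im) ∧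
    (j = 3 → 0 ≤ (sqRadial (sidePoint 4 j t)).re ∧ 0 ≤ (sqRadial (sidePoint 4 j t)).im) := by
  have hg := sqGauge_sqRadial (sidePoint 4 j t)
  rw [norm_sidePoint] at hg
  have hr : sqRadial (sidePoint 4 j t) = (‖(sidePoint 4 j t : ℂ)‖ / sqGauge (sidePoint 4 j t)) •
    (sidePoint 4 j t : ℂ) := rfl
  have hpos : 0 ≤ ‖(sidePoint 4 j t : ℂ)‖ / sqGauge (sidePoint 4 j t) :=
    div_nonneg (norm_nonneg _) (by unfold sqGauge; positivity)
  obtain ⟨h1, h2⟩ := sidePoint_re_im 4 j t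
  have hpi := Real.pi_pos
  refine ⟨hg, ?_, ?_, ?_, ?_⟩ <;> rintro rfl <;> rw [hr] <;>
    simp only [Complex.smul_re, Complex.smul_im, smul_eq_mul, h1, h2] <;> constructor
  · exact mul_nonneg hpos (Real.cos_nonneg_of_neg_pi_div_two_le_of_le
      (by push_cast; nlinarith [ht.1]) (by push_cast; nlinarith [ht.2]))
  · exact mul_nonpos_of_nonneg_of_nonpos hpos (neg_nonpos.2
      (Real.sin_nonneg_of_nonneg_of_le_pi (by push_cast; nlinarith [ht.1])
      (by push_cast; nlinarith [ht.2])))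
  · exact mul_nonpos_of_nonneg_of_nonpos hpos (Real.cos_nonpos_of_pi_div_two_le_of_le
      (by push_cast; nlinarith [ht.1]) (by push_cast; nlinarith [ht.2]))
  · exact mul_nonpos_of_nonneg_of_nonpos hpos (neg_nonpos.2
      (Real.sin_nonneg_of_nonneg_of_le_pi (by push_cast; nlinarith [ht.1])
      (by push_cast; nlinarith [ht.2])))
  · exact mul_nonpos_of_nonneg_of_nonpos hpos (Real.cos_nonpos_of_pi_div_two_le_of_le
      (by push_cast; nlinarith [ht.1]) (by push_cast; nlinarith [ht.2]))
  · refine mul_nonneg hpos (neg_nonneg.2 ?_)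
    rw [← Real.sin_sub_two_pi]
    exact Real.sin_nonpos_of_nonpos_of_neg_pi_le (by push_cast; nlinarith [ht.2])
      (by push_cast; nlinarith [ht.1])
  · refine mul_nonneg hpos ?_
    rw [← Real.cos_sub_two_pi]
    exact Real.cos_nonneg_of_neg_pi_div_two_le_of_le
      (by push_cast; nlinarith [ht.1]) (by push_cast; nlinarith [ht.2])
  · refine mul_nonneg hpos (neg_nonneg.2 ?_)
    rw [← Real.sin_sub_two_pi]
    exact Real.sin_nonpos_of_nonpos_of_neg_pi_le (by push_cast; nlinarith [ht.2])
      (by push_cast; nlinarith [ht.1])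

end LocalComp
end

open Topology
noncomputable section
namespace LocalComp

/-! ### Polygons that are restrictions of homeomorphisms of the plane -/

theorem toTorus_eq_iff {P Q : ℝ × ℝ} :
    toTorus P = toTorus Q ↔ ∃ m : ℤ × ℤ, P = Q + ((m.1 : ℝ), (m.2 : ℝ)) := by
  simp only [toTorus, Prod.mk.injEq, QuotientAddGroup.eq_iff_sub_mem,
    AddSubgroup.mem_zmultiples_iff]
  constructor
  · rintro ⟨⟨a, ha⟩, ⟨b, hb⟩⟩
    refine ⟨(a, b), Prod.ext ?_ ?_⟩
    · simp at ha ⊢; linarith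
    · simp at hb ⊢; linarith
  · rintro ⟨m, rfl⟩
    exact ⟨⟨m.1, by simp⟩, ⟨m.2, by simp⟩⟩

namespace Polygon

variable {n : ℕ} {γ : Fin n → Curve}

/-- The polygon that is the restriction of a homeomorphism of the plane. -/
def ofHomeo (γ : Fin n → Curve) (Ψ : ℂ ≃ₜ ℝ × ℝ) (level : Fin n → ℤ)
    (side : ∀ j : Fin n, ∀ t ∈ Set.Icc (0 : ℝ) 1, (γ j).across (Ψ (sidePoint n j t)) = level j)
    (right : ∀ j : Fin n, ∀ t ∈ Set.Icc (0 : ℝ) 1, ∀ᶠ w : Disk in 𝓝 (sidePoint n j t),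
      ‖(w : ℂ)‖ < 1 → ((γ j).along (Ψ (sidePoint n j 1)) - (γ j).along (Ψ (sidePoint n j 0))) *
        ((γ j).across (Ψ w) - level j) < 0) : Polygon γ where
  u := ⟨fun w => Ψ w, by fun_prop⟩
  level := level
  open_interior V hV hV1 := by
    obtain ⟨W, hW, rfl⟩ := isOpen_induced_iff.1 hV
    have h : (fun w : Disk => Ψ w) '' (Subtype.val ⁻¹' W) = Ψ '' (W ∩ Metric.ball 0 1) := by
      ext P
      constructor
      · rintro ⟨w, hw, rfl⟩
        exact ⟨w, ⟨hw, by simpa using hV1 w hw⟩, rfl⟩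
      · rintro ⟨w, ⟨hw, hw1⟩, rfl⟩
        exact ⟨⟨w, Metric.ball_subset_closedBall hw1⟩, hw, rfl⟩
    exact h ▸ Ψ.isOpenMap _ (hW.inter Metric.isOpen_ball)
  locally_injective w := ⟨Set.univ, Filter.univ_mem, fun x _ y _ h =>
    Subtype.ext (Ψ.injective h)⟩
  side_mem := side
  right_side := right

/-- Since `Ψ` is injective, preimages of the basepoint in the disk correspond to lattice translates
of `z` in the image of the disk. -/
theorem mult_ofHomeo (T : Polygon γ) (Ψ : ℂ ≃ₜ ℝ × ℝ) (hΨ : ∀ w : Disk, T.u w = Ψ w)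
    (z : ℝ × ℝ) : T.mult z =
      Set.ncard {m : ℤ × ℤ | ‖Ψ.symm (z + ((m.1 : ℝ), (m.2 : ℝ)))‖ ≤ 1} := by
  symm
  refine Set.ncard_congr (fun m hm => ⟨Ψ.symm (z + ((m.1 : ℝ), (m.2 : ℝ))), by simpa using hm⟩)
    ?_ ?_ ?_
  · intro m hm
    simp only [Set.mem_ofPred_eq, hΨ, Homeomorph.apply_symm_apply]
    exact toTorus_eq_iff.2 ⟨m, rfl⟩
  · intro m m' hm hm' h
    have h1 := Ψ.symm.injective (congrArg Subtype.val h)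
    have h2 := add_left_cancel h1
    obtain ⟨h3, h4⟩ := Prod.mk.inj h2
    exact Prod.ext (by exact_mod_cast h3) (by exact_mod_cast h4)
  · intro w hw
    simp only [Set.mem_ofPred_eq, hΨ] at hw
    obtain ⟨m, hm⟩ := toTorus_eq_iff.1 hw
    have hm' : Ψ.symm (z + ((m.1 : ℝ), (m.2 : ℝ))) = w := by rw [← hm, Homeomorph.symm_apply_apply]
    refine ⟨m, ?_, Subtype.ext hm'⟩
    simp only [Set.mem_ofPred_eq, hm']
    exact Disk.norm_le w

end Polygon

/-! ### Coordinates adapted to three lines -/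

/-- Coordinates `(t, c)` of the plane in which chosen lifts of three curves are the lines `c = 0`,
`t = tA + κ₁ c` and `t = tO + κ₂ c`, where `tO < tA` and `κ₂ < κ₁`. -/
structure Frame (γ₀ γ₁ γ₂ : Curve) (l₀ l₁ l₂ : ℤ) where
  Ξ : ℝ × ℝ ≃ₜ ℝ × ℝ
  (σ tO tA κ₁ κ₂ ν₁ ν₂ m₁ m₂ : ℝ)
  σ_mul_self : σ * σ = 1
  along₀ : ∀ P, γ₀.along P = σ * (Ξ P).1
  across₀ : ∀ P, γ₀.across P = l₀ + σ * (Ξ P).2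
  across₁ : ∀ P, γ₁.across P = l₁ + ν₁ * ((Ξ P).1 - tA - κ₁ * (Ξ P).2)
  along₁ : ∀ P Q, γ₁.across P = l₁ → γ₁.across Q = l₁ →
    γ₁.along P - γ₁.along Q = m₁ * ((Ξ P).2 - (Ξ Q).2)
  -- The sign says that the curve's coordinates `(along, across)` have the same orientation as the
  -- frame; `neg₂` does the same for the third curve.
  neg₁ : m₁ * ν₁ < 0
  across₂ : ∀ P, γ₂.across P = l₂ + ν₂ * ((Ξ P).1 - tO - κ₂ * (Ξ P).2)
  along₂ : ∀ P Q, γ₂.across P = l₂ → γ₂.across Q = l₂ →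
    γ₂.along P - γ₂.along Q = m₂ * ((Ξ P).2 - (Ξ Q).2)
  neg₂ : m₂ * ν₂ < 0
  tO_lt : tO < tA
  κ_lt : κ₂ < κ₁

namespace Frame

variable {γ₀ γ₁ γ₂ : Curve} {l₀ l₁ l₂ : ℤ} (Fr : Frame γ₀ γ₁ γ₂ l₀ l₁ l₂)

/-- The second coordinate of the corner opposite to the first curve. -/
def cB : ℝ := -((Fr.tA - Fr.tO) / (Fr.κ₁ - Fr.κ₂))

theorem cB_neg : Fr.cB < 0 := by
  have := Fr.tO_lt
  have := Fr.κ_lt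
  exact neg_neg_of_pos (div_pos (by linarith) (by linarith))

theorem cB_mul : Fr.cB * (Fr.κ₁ - Fr.κ₂) = -(Fr.tA - Fr.tO) := by
  have := Fr.κ_lt
  rw [cB, neg_mul, div_mul_cancel₀ _ (by linarith)]

theorem ν₁_ne : Fr.ν₁ ≠ 0 := fun h => by have := Fr.neg₁; simp [h] at this

theorem ν₂_ne : Fr.ν₂ ≠ 0 := fun h => by have := Fr.neg₂; simp [h] at this

theorem σ_ne : Fr.σ ≠ 0 := fun h => by have := Fr.σ_mul_self; simp [h] at this

theorem across₀_eq_iff (P : ℝ × ℝ) : γ₀.across P = l₀ ↔ (Fr.Ξ P).2 = 0 := by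
  rw [Fr.across₀]
  simp [Fr.σ_ne]

theorem across₁_eq_iff (P : ℝ × ℝ) :
    γ₁.across P = l₁ ↔ (Fr.Ξ P).1 = Fr.tA + Fr.κ₁ * (Fr.Ξ P).2 := by
  rw [Fr.across₁]
  simp only [add_eq_left, mul_eq_zero, Fr.ν₁_ne, false_or]
  constructor <;> intro h <;> linarith

theorem across₂_eq_iff (P : ℝ × ℝ) :
    γ₂.across P = l₂ ↔ (Fr.Ξ P).1 = Fr.tO + Fr.κ₂ * (Fr.Ξ P).2 := by
  rw [Fr.across₂]
  simp only [add_eq_left, mul_eq_zero, Fr.ν₂_ne, false_or]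
  constructor <;> intro h <;> linarith

/-- Such products are what `Polygon.right_side` constrains. In frame coordinates the direction `σ`
of the curve drops out because it enters twice; in `right₁` and `right₂` it leaves only a negative
factor. -/
theorem right₀ (P Q R : ℝ × ℝ) : (γ₀.along P - γ₀.along Q) * (γ₀.across R - l₀) =
    ((Fr.Ξ P).1 - (Fr.Ξ Q).1) * (Fr.Ξ R).2 := by
  rw [Fr.along₀, Fr.along₀, Fr.across₀]
  linear_combination (((Fr.Ξ P).1 - (Fr.Ξ Q).1) * (Fr.Ξ R).2) * Fr.σ_mul_self

theorem right₁ {P Q : ℝ × ℝ} (hP : γ₁.across P = l₁) (hQ : γ₁.across Q = l₁) (R : ℝ × ℝ) :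
    (γ₁.along P - γ₁.along Q) * (γ₁.across R - l₁) = (Fr.m₁ * Fr.ν₁) *
    (((Fr.Ξ P).2 - (Fr.Ξ Q).2) * ((Fr.Ξ R).1 - Fr.tA - Fr.κ₁ * (Fr.Ξ R).2)) := by
  rw [Fr.along₁ P Q hP hQ, Fr.across₁ R]
  ring

theorem right₂ {P Q : ℝ × ℝ} (hP : γ₂.across P = l₂) (hQ : γ₂.across Q = l₂) (R : ℝ × ℝ) :
    (γ₂.along P - γ₂.along Q) * (γ₂.across R - l₂) = (Fr.m₂ * Fr.ν₂) *
    (((Fr.Ξ P).2 - (Fr.Ξ Q).2) * ((Fr.Ξ R).1 - Fr.tO - Fr.κ₂ * (Fr.Ξ R).2)) := by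
  rw [Fr.along₂ P Q hP hQ, Fr.across₂ R]
  ring

/-- The corner on the first and the last curve. -/
def ptO : ℝ × ℝ := Fr.Ξ.symm (Fr.tO, 0)

/-- The corner on the first two curves. -/
def ptA : ℝ × ℝ := Fr.Ξ.symm (Fr.tA, 0)

/-- The corner on the last two curves. -/
def ptB : ℝ × ℝ := Fr.Ξ.symm (Fr.tO + Fr.κ₂ * Fr.cB, Fr.cB)

theorem eq_ptO {P : ℝ × ℝ} (h₀ : γ₀.across P = l₀) (h₂ : γ₂.across P = l₂) : P = Fr.ptO := by
  rw [Fr.across₀_eq_iff] at h₀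
  rw [Fr.across₂_eq_iff, h₀, mul_zero, add_zero] at h₂
  rw [ptO, Homeomorph.eq_symm_apply]
  exact Prod.ext h₂ h₀

theorem eq_ptA {P : ℝ × ℝ} (h₀ : γ₀.across P = l₀) (h₁ : γ₁.across P = l₁) : P = Fr.ptA := by
  rw [Fr.across₀_eq_iff] at h₀
  rw [Fr.across₁_eq_iff, h₀, mul_zero, add_zero] at h₁
  rw [ptA, Homeomorph.eq_symm_apply]
  exact Prod.ext h₁ h₀

theorem eq_ptB {P : ℝ × ℝ} (h₁ : γ₁.across P = l₁) (h₂ : γ₂.across P = l₂) : P = Fr.ptB := by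
  rw [Fr.across₁_eq_iff] at h₁
  rw [Fr.across₂_eq_iff] at h₂
  have h : (Fr.Ξ P).2 = Fr.cB := by
    have := Fr.cB_mul
    have h3 := Fr.κ_lt
    have h4 : ((Fr.Ξ P).2 - Fr.cB) * (Fr.κ₁ - Fr.κ₂) = 0 := by linear_combination h₂ - h₁ - this
    rcases mul_eq_zero.1 h4 with h5 | h5 <;> linarith
  rw [ptB, Homeomorph.eq_symm_apply]
  exact Prod.ext (by rw [h₂, h]) h

/-- The closed triangle bounded by the three lines. -/
def InTriangle (Q : ℝ × ℝ) : Prop :=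
  Q.2 ≤ 0 ∧ Q.1 ≤ Fr.tA + Fr.κ₁ * Q.2 ∧ Fr.tO + Fr.κ₂ * Q.2 ≤ Q.1

/-- The affine map from the standard triangle to the triangle bounded by the three lines. -/
def triAffine : ℂ ≃ₜ ℝ × ℝ where
  -- Barycentric coordinates: `(1 - re - √3 im) / 3` is the weight of the corner `A`, `(1 - re + √3
  -- im) / 3` that of `B`, and `(1 + 2 re) / 3` that of `O`. Each defining function of a line is a
  -- multiple of one weight.
  toFun z := (Fr.tO + Fr.κ₂ * ((1 - z.re + √3 * z.im) / 3 * Fr.cB) +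
    (1 - z.re - √3 * z.im) / 3 * (Fr.tA - Fr.tO), (1 - z.re + √3 * z.im) / 3 * Fr.cB)
  invFun Q := ⟨(3 * (1 - (Q.1 - Fr.tO - Fr.κ₂ * Q.2) / (Fr.tA - Fr.tO) - Q.2 / Fr.cB) - 1) / 2,
    √3 * (Q.2 / Fr.cB - (Q.1 - Fr.tO - Fr.κ₂ * Q.2) / (Fr.tA - Fr.tO)) / 2⟩
  left_inv z := by
    have h1 := Fr.cB_neg.ne
    have h2 : Fr.tA - Fr.tO ≠ 0 := by linarith [Fr.tO_lt]
    have h3 : √3 * √3 = 3 := Real.mul_self_sqrt (by norm_num)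
    have e1 : (1 - z.re + √3 * z.im) / 3 * Fr.cB / Fr.cB = (1 - z.re + √3 * z.im) / 3 := by
      field_simp
    have e2 : (Fr.tO + Fr.κ₂ * ((1 - z.re + √3 * z.im) / 3 * Fr.cB) +
        (1 - z.re - √3 * z.im) / 3 * (Fr.tA - Fr.tO) - Fr.tO -
        Fr.κ₂ * ((1 - z.re + √3 * z.im) / 3 * Fr.cB)) / (Fr.tA - Fr.tO) =
        (1 - z.re - √3 * z.im) / 3 := by
      field_simp
      ring
    apply Complex.ext
    · simp only [e1, e2]; ring
    · simp only [e1, e2]; linear_combination (z.im / 3) * h3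
  right_inv Q := by
    have h1 := Fr.cB_neg.ne
    have h2 : Fr.tA - Fr.tO ≠ 0 := by linarith [Fr.tO_lt]
    have h3 : √3 * √3 = 3 := Real.mul_self_sqrt (by norm_num)
    set a := (Q.1 - Fr.tO - Fr.κ₂ * Q.2) / (Fr.tA - Fr.tO) with ha
    set b := Q.2 / Fr.cB with hb
    have e1 : (1 - (3 * (1 - a - b) - 1) / 2 + √3 * (√3 * (b - a) / 2)) / 3 = b := by
      linear_combination ((b - a) / 6) * h3
    have e2 : (1 - (3 * (1 - a - b) - 1) / 2 - √3 * (√3 * (b - a) / 2)) / 3 = a := by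
      linear_combination (-(b - a) / 6) * h3
    have e3 : b * Fr.cB = Q.2 := by rw [hb]; field_simp
    have e4 : a * (Fr.tA - Fr.tO) = Q.1 - Fr.tO - Fr.κ₂ * Q.2 := by rw [ha]; field_simp
    apply Prod.ext
    · simp only [← ha, ← hb, e1, e2, e3, e4]; ring
    · simp only [← ha, ← hb, e1, e3]
  continuous_toFun := by fun_prop
  continuous_invFun := by
    have h1 := Fr.cB_neg.ne
    have h2 : Fr.tA - Fr.tO ≠ 0 := by linarith [Fr.tO_lt]
    have h : (fun Q : ℝ × ℝ => (⟨(3 * (1 - (Q.1 - Fr.tO - Fr.κ₂ * Q.2) / (Fr.tA - Fr.tO) -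
        Q.2 / Fr.cB) - 1) / 2, √3 * (Q.2 / Fr.cB - (Q.1 - Fr.tO - Fr.κ₂ * Q.2) /
        (Fr.tA - Fr.tO)) / 2⟩ : ℂ)) = fun Q => Complex.equivRealProdCLM.symm
        ((3 * (1 - (Q.1 - Fr.tO - Fr.κ₂ * Q.2) / (Fr.tA - Fr.tO) -
        Q.2 / Fr.cB) - 1) / 2, √3 * (Q.2 / Fr.cB - (Q.1 - Fr.tO - Fr.κ₂ * Q.2) /
        (Fr.tA - Fr.tO)) / 2) := by
      funext Q
      apply Complex.ext <;> simp
    rw [h]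
    fun_prop

theorem triAffine_snd (z : ℂ) : (Fr.triAffine z).2 = (1 - z.re + √3 * z.im) / 3 * Fr.cB := rfl

theorem triAffine_sub₂ (z : ℂ) : (Fr.triAffine z).1 - Fr.tO - Fr.κ₂ * (Fr.triAffine z).2 =
    (1 - z.re - √3 * z.im) / 3 * (Fr.tA - Fr.tO) := by
  simp only [triAffine, Homeomorph.homeomorph_mk_coe, Equiv.coe_fn_mk]
  ring

theorem triAffine_sub₁ (z : ℂ) : (Fr.triAffine z).1 - Fr.tA - Fr.κ₁ * (Fr.triAffine z).2 =
    -((1 + 2 * z.re) / 3 * (Fr.tA - Fr.tO)) := by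
  have h := Fr.triAffine_sub₂ z
  have h2 := Fr.cB_mul
  have h3 := Fr.triAffine_snd z
  linear_combination h - (Fr.κ₁ - Fr.κ₂) * h3 - (1 - z.re + √3 * z.im) / 3 * h2

/-- The homeomorphism of the plane that maps the disk to the triangle bounded by the three lines. -/
def triHomeo : ℂ ≃ₜ ℝ × ℝ := triRadial.trans (Fr.triAffine.trans Fr.Ξ.symm)

theorem Ξ_triHomeo (z : ℂ) : Fr.Ξ (Fr.triHomeo z) = Fr.triAffine (triRadial z) := by
  simp [triHomeo]

theorem triGauge_le_iff {z : ℂ} {r : ℝ} : triGauge z ≤ r ↔ -2 * z.re ≤ r ∧ z.re + √3 * z.im ≤ r ∧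
    z.re - √3 * z.im ≤ r := by simp [triGauge]

theorem triGauge_lt_iff {z : ℂ} {r : ℝ} : triGauge z < r ↔ -2 * z.re < r ∧ z.re + √3 * z.im < r ∧
    z.re - √3 * z.im < r := by simp [triGauge]

theorem norm_triHomeo_symm_le_iff (P : ℝ × ℝ) :
    ‖Fr.triHomeo.symm P‖ ≤ 1 ↔ Fr.InTriangle (Fr.Ξ P) := by
  obtain ⟨z, rfl⟩ := Fr.triHomeo.surjective P
  rw [Homeomorph.symm_apply_apply, Fr.Ξ_triHomeo, ← triGauge_triRadial, triGauge_le_iff]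
  set y := triRadial z
  have h1 := Fr.triAffine_sub₁ y
  have h2 := Fr.triAffine_sub₂ y
  have h3 := Fr.triAffine_snd y
  have hc := Fr.cB_neg
  have ht := Fr.tO_lt
  unfold InTriangle
  constructor
  · rintro ⟨a, b, c⟩
    refine ⟨?_, ?_, ?_⟩
    · rw [h3]; nlinarith
    · nlinarith
    · nlinarith
  · rintro ⟨a, b, c⟩
    refine ⟨?_, ?_, ?_⟩
    · by_contra h
      push Not at h
      nlinarith
    · by_contra h
      push Not at h
      nlinarith
    · by_contra h
      push Not at h
      rw [h3] at a
      nlinarith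

theorem across_triHomeo_side (j : Fin 3) {t : ℝ} (ht : t ∈ Set.Icc (0 : ℝ) 1) :
    (![γ₀, γ₁, γ₂] j).across (Fr.triHomeo (sidePoint 3 j t)) = (![l₀, l₁, l₂] j : ℤ) := by
  fin_cases j
  · change γ₀.across (Fr.triHomeo (sidePoint 3 0 t)) = l₀
    have := triRadial_side_zero ht
    rw [Fr.across₀_eq_iff, Fr.Ξ_triHomeo, Fr.triAffine_snd]
    rw [show ∀ x y : ℝ, (1 - x + y) = 1 - (x - y) by intros; ring, this]
    simp
  · change γ₁.across (Fr.triHomeo (sidePoint 3 1 t)) = l₁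
    have := triRadial_side_one ht
    have h := Fr.triAffine_sub₁ (triRadial (sidePoint 3 1 t))
    rw [Fr.across₁_eq_iff, Fr.Ξ_triHomeo]
    rw [show 2 * (triRadial (sidePoint 3 1 t)).re = -1 by linarith] at h
    linarith
  · change γ₂.across (Fr.triHomeo (sidePoint 3 2 t)) = l₂
    have := triRadial_side_two ht
    have h := Fr.triAffine_sub₂ (triRadial (sidePoint 3 2 t))
    rw [Fr.across₂_eq_iff, Fr.Ξ_triHomeo]
    rw [sub_sub (1 : ℝ), this] at h
    linarith

theorem triHomeo_corners : Fr.triHomeo (sidePoint 3 0 0) = Fr.ptO ∧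
    Fr.triHomeo (sidePoint 3 1 0) = Fr.ptA ∧ Fr.triHomeo (sidePoint 3 2 0) = Fr.ptB := by
  have h0 : (0 : ℝ) ∈ Set.Icc (0 : ℝ) 1 := ⟨le_rfl, zero_le_one⟩
  have h1 : (1 : ℝ) ∈ Set.Icc (0 : ℝ) 1 := ⟨zero_le_one, le_rfl⟩
  have hw : sidePoint 3 2 1 = sidePoint 3 0 0 := by rw [sidePoint_one, sidePoint_wrap 3 (by norm_num)]
  refine ⟨Fr.eq_ptO (Fr.across_triHomeo_side 0 h0) ?_, Fr.eq_ptA ?_ (Fr.across_triHomeo_side 1 h0),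
    Fr.eq_ptB ?_ (Fr.across_triHomeo_side 2 h0)⟩
  · rw [← hw]; exact Fr.across_triHomeo_side 2 h1
  · rw [← sidePoint_one 0]; exact Fr.across_triHomeo_side 0 h1
  · rw [← sidePoint_one 1]; exact Fr.across_triHomeo_side 1 h1

/-- The triangle with sides on the three lines. -/
def triangle : Polygon ![γ₀, γ₁, γ₂] :=
  Polygon.ofHomeo _ Fr.triHomeo ![l₀, l₁, l₂] (fun j _ ht => Fr.across_triHomeo_side j ht)
    (by
      intro j t ht
      refine Filter.Eventually.of_forall fun w hw => ?_
      have h0 : (0 : ℝ) ∈ Set.Icc (0 : ℝ) 1 := ⟨le_rfl, zero_le_one⟩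
      have h1 : (1 : ℝ) ∈ Set.Icc (0 : ℝ) 1 := ⟨zero_le_one, le_rfl⟩
      have hs0 := Fr.across_triHomeo_side j h0
      have hs1 := Fr.across_triHomeo_side j h1
      obtain ⟨cO, cA, cB⟩ := Fr.triHomeo_corners
      have hw3 : sidePoint 3 2 1 = sidePoint 3 0 0 := by
        rw [sidePoint_one, sidePoint_wrap 3 (by norm_num)]
      rw [← triGauge_triRadial, triGauge_lt_iff] at hw
      obtain ⟨a, b, c⟩ := hw
      have hc := Fr.cB_neg
      have htt := Fr.tO_lt
      fin_cases j
      · change (γ₀.along (Fr.triHomeo (sidePoint 3 0 1)) - γ₀.along (Fr.triHomeo (sidePoint 3 0 0))) *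
          (γ₀.across (Fr.triHomeo w) - l₀) < 0
        rw [Fr.right₀, sidePoint_one, cO, cA, Fr.Ξ_triHomeo, Fr.triAffine_snd, ptO, ptA]
        simp only [Homeomorph.apply_symm_apply]
        refine mul_neg_of_pos_of_neg (by linarith) (mul_neg_of_pos_of_neg (by linarith) hc)
      · change (γ₁.along (Fr.triHomeo (sidePoint 3 1 1)) - γ₁.along (Fr.triHomeo (sidePoint 3 1 0))) *
          (γ₁.across (Fr.triHomeo w) - l₁) < 0
        rw [Fr.right₁ hs1 hs0, sidePoint_one, cA, cB, Fr.Ξ_triHomeo, Fr.triAffine_sub₁, ptB, ptA]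
        simp only [Homeomorph.apply_symm_apply]
        refine mul_neg_of_neg_of_pos Fr.neg₁ (mul_pos_of_neg_of_neg (by linarith) ?_)
        nlinarith
      · change (γ₂.along (Fr.triHomeo (sidePoint 3 2 1)) - γ₂.along (Fr.triHomeo (sidePoint 3 2 0))) *
          (γ₂.across (Fr.triHomeo w) - l₂) < 0
        rw [Fr.right₂ hs1 hs0, hw3, cO, cB, Fr.Ξ_triHomeo, Fr.triAffine_sub₂, ptB, ptO]
        simp only [Homeomorph.apply_symm_apply]
        refine mul_neg_of_neg_of_pos Fr.neg₂ (mul_pos (by linarith) ?_)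
        nlinarith)

theorem triangle_u (w : Disk) : Fr.triangle.u w = Fr.triHomeo w := rfl

theorem triangle_level : Fr.triangle.level = ![l₀, l₁, l₂] := rfl

theorem triangle_start : Fr.triangle.start 0 = Fr.ptO ∧ Fr.triangle.start 1 = Fr.ptA ∧
    Fr.triangle.start 2 = Fr.ptB := Fr.triHomeo_corners

theorem mult_triangle (z : ℝ × ℝ) : Fr.triangle.mult z =
    Set.ncard {m : ℤ × ℤ | Fr.InTriangle (Fr.Ξ (z + ((m.1 : ℝ), (m.2 : ℝ))))} := by
  rw [Polygon.mult_ofHomeo _ Fr.triHomeo Fr.triangle_u]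
  simp only [Fr.norm_triHomeo_symm_le_iff]

theorem coord_injOn₀ : Set.InjOn (fun P => (Fr.Ξ P).1) {P | γ₀.across P = l₀} := by
  intro P hP Q hQ h
  exact Fr.Ξ.injective (Prod.ext h (((Fr.across₀_eq_iff P).1 hP).trans
    ((Fr.across₀_eq_iff Q).1 hQ).symm))

theorem coord_injOn₁ : Set.InjOn (fun P => (Fr.Ξ P).2) {P | γ₁.across P = l₁} := by
  intro P hP Q hQ h
  refine Fr.Ξ.injective (Prod.ext ?_ h)
  rw [(Fr.across₁_eq_iff P).1 hP, (Fr.across₁_eq_iff Q).1 hQ]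
  simp only at h
  rw [h]

theorem coord_injOn₂ : Set.InjOn (fun P => (Fr.Ξ P).2) {P | γ₂.across P = l₂} := by
  intro P hP Q hQ h
  refine Fr.Ξ.injective (Prod.ext ?_ h)
  rw [(Fr.across₂_eq_iff P).1 hP, (Fr.across₂_eq_iff Q).1 hQ]
  simp only at h
  rw [h]

/-- Every triangle with sides on the three lines is equivalent to the standard one. -/
theorem equivalent_triangle (T : Polygon ![γ₀, γ₁, γ₂]) (hl : T.level = ![l₀, l₁, l₂]) :
    Polygon.Equivalent T Fr.triangle := by
  have h0 : (0 : ℝ) ∈ Set.Icc (0 : ℝ) 1 := ⟨le_rfl, zero_le_one⟩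
  have h1 : (1 : ℝ) ∈ Set.Icc (0 : ℝ) 1 := ⟨zero_le_one, le_rfl⟩
  have hs0 : ∀ j, (![γ₀, γ₁, γ₂] j).across (T.start j) = (![l₀, l₁, l₂] j : ℤ) :=
    fun j => by rw [← hl]; exact T.side_mem j 0 h0
  have hs1 : ∀ j, (![γ₀, γ₁, γ₂] j).across (T.finish j) = (![l₀, l₁, l₂] j : ℤ) :=
    fun j => by rw [← hl]; exact T.side_mem j 1 h1
  obtain ⟨cO, cA, cB⟩ := Fr.triangle_start
  -- The lines meet pairwise in single points, so the levels already determine the corners.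
  refine Polygon.equivalent_of_corners (by norm_num) Fr.triangle T Fr.triHomeo Fr.triangle_u
    ![fun P => (Fr.Ξ P).1, fun P => (Fr.Ξ P).2, fun P => (Fr.Ξ P).2] ?_ ?_ hl ?_
  · intro j
    fin_cases j <;> (simp; fun_prop)
  · intro j
    fin_cases j
    exacts [Fr.coord_injOn₀, Fr.coord_injOn₁, Fr.coord_injOn₂]
  · intro j
    fin_cases j
    · change T.start 0 = Fr.triangle.start 0
      rw [cO]
      exact Fr.eq_ptO (hs0 0) (by rw [← T.finish_eq_start 2 0 rfl]; exact hs1 2)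
    · change T.start 1 = Fr.triangle.start 1
      rw [cA]
      exact Fr.eq_ptA (by rw [← T.finish_eq_start 0 1 rfl]; exact hs1 0) (hs0 1)
    · change T.start 2 = Fr.triangle.start 2
      rw [cB]
      exact Fr.eq_ptB (by rw [← T.finish_eq_start 1 2 rfl]; exact hs1 1) (hs0 2)

end Frame

end LocalComp
end

open Topology
noncomputable section
namespace LocalComp

/-! ### Quadrilaterals with one curved side -/

/-- A curve `c = f t` close to the line `c = 0` that is flat outside `Rg`. -/
structure Wiggle {γ₀ γ₁ γ₂ : Curve} {l₀ l₁ l₂ : ℤ} (Fr : Frame γ₀ γ₁ γ₂ l₀ l₁ l₂)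
    (f : ℝ → ℝ) where
  (δ δ' s : ℝ)
  Rg : Set ℝ
  cont : Continuous f
  bdd : ∀ t, |f t| < δ'
  -- The gap between the two bounds is what makes the leaves constructed below disjoint.
  lt_δ : δ' < δ
  flat : ∀ t, t ∉ Rg → f t = s
  -- Inside the strip `|c| < δ` the two transverse lines stay off the region where the curve may
  -- fail to be flat.
  avoid₁ : ∀ c, |c| < δ → Fr.tA + Fr.κ₁ * c ∉ Rg
  avoid₂ : ∀ c, |c| < δ → Fr.tO + Fr.κ₂ * c ∉ Rg

/-- In addition, a point `ty` at which the curve crosses the line upwards, between the other two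
lines. -/
structure QuadData {γ₀ γ₁ γ₂ : Curve} {l₀ l₁ l₂ : ℤ} (Fr : Frame γ₀ γ₁ γ₂ l₀ l₁ l₂)
    (f : ℝ → ℝ) extends Wiggle Fr f where
  ty : ℝ
  ty_mem : ty ∈ Rg
  ty_gt : Fr.tO < ty
  ty_lt : ty < Fr.tA
  zero : f ty = 0
  left : ∀ᶠ t in 𝓝[<] ty, f t < 0
  right : ∀ᶠ t in 𝓝[>] ty, 0 < f t

namespace QuadData

variable {γ₀ γ₁ γ₂ : Curve} {l₀ l₁ l₂ : ℤ} {Fr : Frame γ₀ γ₁ γ₂ l₀ l₁ l₂} {f : ℝ → ℝ}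
  (D : QuadData Fr f)

theorem δ'_pos : 0 < D.δ' := (abs_nonneg _).trans_lt (D.bdd 0)

theorem δ_pos : 0 < D.δ := D.δ'_pos.trans D.lt_δ

/-- At `c = 0` the line is to the right of `ty`. To get past `ty` within the strip it would have to
meet `ty` itself, which lies in the forbidden region. -/
theorem ty_lt_line {c : ℝ} (hc : |c| < D.δ) : D.ty < Fr.tA + Fr.κ₁ * c := by
  by_contra h
  push Not at h
  have h1 := D.ty_lt
  have hκ : Fr.κ₁ ≠ 0 := by rintro h0; rw [h0] at h; linarith
  refine D.avoid₁ ((D.ty - Fr.tA) / Fr.κ₁) ?_ (by rw [mul_div_cancel₀ _ hκ]; simpa using D.ty_mem)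
  refine lt_of_le_of_lt ?_ hc
  rw [abs_div, div_le_iff₀ (abs_pos.2 hκ), abs_of_neg (by linarith), ← abs_mul, mul_comm]
  exact le_trans (by linarith) (neg_le_abs _)

theorem line_lt_ty {c : ℝ} (hc : |c| < D.δ) : Fr.tO + Fr.κ₂ * c < D.ty := by
  by_contra h
  push Not at h
  have h1 := D.ty_gt
  have hκ : Fr.κ₂ ≠ 0 := by rintro h0; rw [h0] at h; linarith
  refine D.avoid₂ ((D.ty - Fr.tO) / Fr.κ₂) ?_ (by rw [mul_div_cancel₀ _ hκ]; simpa using D.ty_mem)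
  refine lt_of_le_of_lt ?_ hc
  rw [abs_div, div_le_iff₀ (abs_pos.2 hκ), abs_of_pos (by linarith), ← abs_mul, mul_comm]
  exact le_trans (by linarith) (le_abs_self _)

/-- Such an `x` is the abscissa of a point of the third line inside the strip. -/
theorem near {x : ℝ} (hx : |x - Fr.tO| < |Fr.κ₂| * D.δ) : x ∉ D.Rg ∧ x < D.ty := by
  have hκ : Fr.κ₂ ≠ 0 := by
    rintro h0
    rw [h0, abs_zero, zero_mul] at hx
    exact absurd hx (not_lt.2 (abs_nonneg _))
  have hc : |(x - Fr.tO) / Fr.κ₂| < D.δ := by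
    rw [abs_div, div_lt_iff₀ (abs_pos.2 hκ), mul_comm]
    exact hx
  have e : Fr.tO + Fr.κ₂ * ((x - Fr.tO) / Fr.κ₂) = x := by field_simp; ring
  exact ⟨e ▸ D.avoid₂ _ hc, e ▸ D.line_lt_ty hc⟩

/-- The slopes of the leaves near the corner `O`. -/
def kap (τ : ℝ) : ℝ :=
  max 0 (Fr.κ₂ - |τ - Fr.tO| / D.δ) - max 0 (-Fr.κ₂ - |τ - Fr.tO| / D.δ)

theorem kap_tO : D.kap Fr.tO = Fr.κ₂ := by
  simp only [kap, sub_self, abs_zero, zero_div, sub_zero]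
  rcases le_total 0 Fr.κ₂ with h | h
  · rw [max_eq_right h, max_eq_left (by linarith)]; ring
  · rw [max_eq_left h, max_eq_right (by linarith)]; ring

/-- The plane is foliated so that the third line is, inside the strip, the leaf through `tO`, and
the leaves far from it are vertical. The slope is a tent function of height `κ₂`, of either sign,
that decays at rate `1 / δ`. -/
theorem kap_eq (τ : ℝ) : (0 ≤ Fr.κ₂ ∧ D.kap τ = max 0 (|Fr.κ₂| - |τ - Fr.tO| / D.δ)) ∨
    (Fr.κ₂ ≤ 0 ∧ D.kap τ = -max 0 (|Fr.κ₂| - |τ - Fr.tO| / D.δ)) := by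
  have h0 : 0 ≤ |τ - Fr.tO| / D.δ := div_nonneg (abs_nonneg _) D.δ_pos.le
  rcases le_total 0 Fr.κ₂ with h | h
  · left
    refine ⟨h, ?_⟩
    rw [kap, abs_of_nonneg h, max_eq_left (b := -Fr.κ₂ - |τ - Fr.tO| / D.δ) (by linarith), sub_zero]
  · right
    refine ⟨h, ?_⟩
    rw [kap, abs_of_nonpos h, max_eq_left (b := Fr.κ₂ - |τ - Fr.tO| / D.δ) (by linarith), zero_sub]

theorem kap_lipschitz (τ τ' : ℝ) : |D.kap τ - D.kap τ'| ≤ |τ - τ'| / D.δ := by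
  have key : |max 0 (|Fr.κ₂| - |τ - Fr.tO| / D.δ) - max 0 (|Fr.κ₂| - |τ' - Fr.tO| / D.δ)| ≤
      |τ - τ'| / D.δ := by
    refine (abs_max_sub_max_le_max _ _ _ _).trans ?_
    rw [sub_self, abs_zero]
    refine max_le (div_nonneg (abs_nonneg _) D.δ_pos.le) ?_
    rw [show |Fr.κ₂| - |τ - Fr.tO| / D.δ - (|Fr.κ₂| - |τ' - Fr.tO| / D.δ) =
      (|τ' - Fr.tO| - |τ - Fr.tO|) / D.δ by ring, abs_div, abs_of_pos D.δ_pos]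
    refine div_le_div_of_nonneg_right ((abs_abs_sub_abs_le_abs_sub _ _).trans ?_) D.δ_pos.le
    rw [show τ' - Fr.tO - (τ - Fr.tO) = -(τ - τ') by ring, abs_neg]
  rcases D.kap_eq τ with ⟨h, h1⟩ | ⟨h, h1⟩ <;> rcases D.kap_eq τ' with ⟨h', h2⟩ | ⟨h', h2⟩ <;>
    rw [h1, h2]
  · exact key
  · have : |Fr.κ₂| = 0 := by rw [abs_eq_zero]; linarith
    rw [this, max_eq_left, max_eq_left]
    · simp; exact div_nonneg (abs_nonneg _) D.δ_pos.le
    · simp; exact div_nonneg (abs_nonneg _) D.δ_pos.le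
    · simp; exact div_nonneg (abs_nonneg _) D.δ_pos.le
  · have : |Fr.κ₂| = 0 := by rw [abs_eq_zero]; linarith
    rw [this, max_eq_left, max_eq_left]
    · simp; exact div_nonneg (abs_nonneg _) D.δ_pos.le
    · simp; exact div_nonneg (abs_nonneg _) D.δ_pos.le
    · simp; exact div_nonneg (abs_nonneg _) D.δ_pos.le
  · rw [show ∀ a b : ℝ, -a - -b = -(a - b) by intros; ring, abs_neg]
    exact key

theorem abs_kap (τ : ℝ) : |D.kap τ| = max 0 (|Fr.κ₂| - |τ - Fr.tO| / D.δ) := by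
  rcases D.kap_eq τ with ⟨-, h⟩ | ⟨-, h⟩ <;> rw [h]
  · exact abs_of_nonneg (le_max_left _ _)
  · rw [abs_neg]; exact abs_of_nonneg (le_max_left _ _)

theorem abs_kap_le (τ : ℝ) : |D.kap τ| ≤ |Fr.κ₂| := by
  rw [abs_kap]
  refine max_le (abs_nonneg _) ?_
  linarith [div_nonneg (abs_nonneg (τ - Fr.tO)) D.δ_pos.le]

/-- The tent is narrow enough that a slanted leaf stays, inside the strip, among the points covered
by `near`. The curve is flat along it. -/
theorem leaf_near {τ c : ℝ} (h : D.kap τ ≠ 0) (hc : |c| < D.δ) :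
    |τ + D.kap τ * c - Fr.tO| < |Fr.κ₂| * D.δ := by
  have h1 := abs_pos.2 h
  have h2 := D.abs_kap τ
  have h3 : |D.kap τ| = |Fr.κ₂| - |τ - Fr.tO| / D.δ := by
    rw [h2]
    refine max_eq_right ?_
    by_contra hn
    rw [max_eq_left (by linarith)] at h2
    linarith
  have h4 : |τ - Fr.tO| = (|Fr.κ₂| - |D.kap τ|) * D.δ := by
    rw [h3]
    have := D.δ_pos.ne'
    field_simp
    ring
  calc |τ + D.kap τ * c - Fr.tO| = |(τ - Fr.tO) + D.kap τ * c| := by ring_nf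
    _ ≤ |τ - Fr.tO| + |D.kap τ| * |c| := by rw [← abs_mul]; exact abs_add_le _ _
    _ < |τ - Fr.tO| + |D.kap τ| * D.δ := by nlinarith
    _ = |Fr.κ₂| * D.δ := by rw [h4]; ring

theorem kap_eq_zero {τ : ℝ} (h : D.ty ≤ τ) : D.kap τ = 0 := by
  by_contra hk
  have := D.leaf_near (c := 0) hk (by simpa using D.δ_pos)
  rw [mul_zero, add_zero] at this
  exact absurd (D.near this).2 (not_lt.2 h)

/-- Truncation to the strip `|c| ≤ δ'`. -/
def clamp (c : ℝ) : ℝ := max (-D.δ') (min c D.δ')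

theorem clamp_of_abs_le {c : ℝ} (h : |c| ≤ D.δ') : D.clamp c = c := by
  obtain ⟨h1, h2⟩ := abs_le.1 h
  rw [clamp, min_eq_left h2, max_eq_right h1]

theorem abs_clamp_le (c : ℝ) : |D.clamp c| ≤ D.δ' := by
  rw [abs_le]
  exact ⟨le_max_left _ _, max_le (by linarith [D.δ'_pos]) (min_le_right _ _)⟩

/-- The slope is Lipschitz with constant `1 / δ` and the height is clamped to `δ' < δ`, so
neighbouring leaves cannot meet. -/
theorem leaf_strictMono (c : ℝ) : StrictMono fun τ => τ + D.kap τ * D.clamp c := by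
  intro τ τ' h
  have h1 := D.kap_lipschitz τ τ'
  have h2 := D.abs_clamp_le c
  have h3 : |(D.kap τ - D.kap τ') * D.clamp c| < τ' - τ := by
    rw [abs_mul]
    calc |D.kap τ - D.kap τ'| * |D.clamp c| ≤ |τ - τ'| / D.δ * D.δ' :=
          mul_le_mul h1 h2 (abs_nonneg _) (div_nonneg (abs_nonneg _) D.δ_pos.le)
      _ < |τ - τ'| / D.δ * D.δ := by
          refine mul_lt_mul_of_pos_left D.lt_δ (div_pos (abs_pos.2 (by linarith)) D.δ_pos)
      _ = τ' - τ := by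
          rw [div_mul_cancel₀ _ D.δ_pos.ne', abs_of_neg (by linarith)]; ring
  have h4 := le_abs_self ((D.kap τ - D.kap τ') * D.clamp c)
  simp only
  nlinarith

theorem continuous_kap : Continuous D.kap := by
  have := D.δ_pos.ne'
  unfold kap
  fun_prop

/-- The homeomorphism that maps the vertical lines to the leaves. -/
def leafHomeo : ℝ × ℝ ≃ₜ ℝ × ℝ :=
  (Homeomorph.prodComm ℝ ℝ).trans ((fiberHomeo (fun c τ => τ + D.kap τ * D.clamp c)
    (by have := D.continuous_kap; unfold clamp; fun_prop) D.leaf_strictMono (|Fr.κ₂| * D.δ')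
    (fun c τ => by
      rw [add_sub_cancel_left, abs_mul]
      exact mul_le_mul (D.abs_kap_le _) (D.abs_clamp_le _) (abs_nonneg _) (abs_nonneg _))).trans
    (Homeomorph.prodComm ℝ ℝ))

theorem leafHomeo_apply (Q : ℝ × ℝ) :
    D.leafHomeo Q = (Q.1 + D.kap Q.1 * D.clamp Q.2, Q.2) := rfl

/-- The upper boundary of the quadrilateral. -/
def top (t : ℝ) : ℝ := if t ≤ D.ty then f t else 0

theorem continuous_top : Continuous D.top :=
  Continuous.if_le D.cont continuous_const continuous_id continuous_const
    (by rintro t (rfl : t = D.ty); exact D.zero)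

theorem abs_top_lt (t : ℝ) : |D.top t| < D.δ' := by
  unfold top
  split_ifs
  · exact D.bdd t
  · simpa using D.δ'_pos

/-- A bump function supported in the strip `|c| ≤ δ'`. -/
def bump (c : ℝ) : ℝ := max 0 (1 - |c| / D.δ')

theorem bump_lipschitz (c c' : ℝ) : |D.bump c - D.bump c'| ≤ |c - c'| / D.δ' := by
  refine (abs_max_sub_max_le_max _ _ _ _).trans ?_
  rw [sub_self, abs_zero]
  refine max_le (div_nonneg (abs_nonneg _) D.δ'_pos.le) ?_
  rw [show 1 - |c| / D.δ' - (1 - |c'| / D.δ') = (|c'| - |c|) / D.δ' by ring, abs_div,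
    abs_of_pos D.δ'_pos]
  refine div_le_div_of_nonneg_right ((abs_abs_sub_abs_le_abs_sub _ _).trans ?_) D.δ'_pos.le
  rw [abs_sub_comm]

theorem bump_zero : D.bump 0 = 1 := by simp [bump]

theorem bump_of_le {c : ℝ} (h : D.δ' ≤ |c|) : D.bump c = 0 := by
  rw [bump, max_eq_left]
  rw [sub_nonpos, le_div_iff₀ D.δ'_pos]
  linarith

theorem abs_bump_le (c : ℝ) : |D.bump c| ≤ 1 := by
  rw [abs_of_nonneg (le_max_left _ _)]
  exact max_le zero_le_one (by linarith [div_nonneg (abs_nonneg c) D.δ'_pos.le])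

/-- The bump is Lipschitz with constant `1 / δ'`, and it is multiplied by a number smaller than
`δ'`. -/
theorem lift_strictMono (t : ℝ) : StrictMono fun c => c + D.top t * D.bump c := by
  intro c c' h
  have h1 := D.bump_lipschitz c c'
  have h2 := D.abs_top_lt t
  have h3 : |D.top t * (D.bump c - D.bump c')| < c' - c := by
    rw [abs_mul]
    have hpos : 0 < |c - c'| / D.δ' := div_pos (abs_pos.2 (by linarith)) D.δ'_pos
    calc |D.top t| * |D.bump c - D.bump c'| ≤ |D.top t| * (|c - c'| / D.δ') :=
          mul_le_mul_of_nonneg_left h1 (abs_nonneg _)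
      _ < D.δ' * (|c - c'| / D.δ') := mul_lt_mul_of_pos_right h2 hpos
      _ = c' - c := by
          rw [mul_div_cancel₀ _ D.δ'_pos.ne', abs_of_neg (by linarith)]; ring
  have h4 := le_abs_self (D.top t * (D.bump c - D.bump c'))
  simp only
  nlinarith

/-- The homeomorphism that moves the line `c = 0` to the upper boundary, along vertical lines. -/
def liftHomeo : ℝ × ℝ ≃ₜ ℝ × ℝ :=
  fiberHomeo (fun t c => c + D.top t * D.bump c)
    (by
      have := D.continuous_top
      have h := D.δ'_pos.ne'
      unfold bump
      fun_prop) D.lift_strictMono D.δ'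
    (fun t c => by
      rw [add_sub_cancel_left, abs_mul]
      nlinarith [D.abs_top_lt t, D.abs_bump_le c, abs_nonneg (D.top t), abs_nonneg (D.bump c)])

theorem liftHomeo_apply (Q : ℝ × ℝ) :
    D.liftHomeo Q = (Q.1, Q.2 + D.top Q.1 * D.bump Q.2) := rfl

theorem abs_lift_lt {t c : ℝ} (hc : |c| < D.δ') : |c + D.top t * D.bump c| < D.δ' := by
  obtain ⟨h1, h2⟩ := abs_lt.1 hc
  have a := D.lift_strictMono t h2
  have b := D.lift_strictMono t h1
  simp only [D.bump_of_le (le_abs_self D.δ'), D.bump_of_le (c := -D.δ') (by rw [abs_neg]; exact le_abs_self _),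
    mul_zero, add_zero] at a b
  exact abs_lt.2 ⟨b, a⟩

/-- The homeomorphism that maps the triangle to the quadrilateral. -/
def bend : ℝ × ℝ ≃ₜ ℝ × ℝ := D.leafHomeo.symm.trans (D.liftHomeo.trans D.leafHomeo)

/-- Bending moves points along the leaves. Hence it preserves the third line, fixes everything to
the right of `ty` or outside the strip, and carries the base to the left of `ty` onto the graph. -/
theorem bend_leaf (Q : ℝ × ℝ) : D.bend (D.leafHomeo Q) = D.leafHomeo (D.liftHomeo Q) := by
  simp [bend]

theorem bend_far {Q : ℝ × ℝ} (h : D.δ' ≤ |Q.2|) : D.bend Q = Q := by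
  obtain ⟨R, rfl⟩ := D.leafHomeo.surjective Q
  rw [bend_leaf]
  congr 1
  rw [D.leafHomeo_apply] at h
  rw [D.liftHomeo_apply, D.bump_of_le h]
  simp

theorem leaf_ge_iff (R : ℝ × ℝ) : D.ty ≤ (D.leafHomeo R).1 ↔ D.ty ≤ R.1 := by
  have := (D.leaf_strictMono R.2).le_iff_le (a := D.ty) (b := R.1)
  simp only [D.kap_eq_zero le_rfl, zero_mul, add_zero] at this
  rw [← this]
  rfl

theorem bend_right {Q : ℝ × ℝ} (h : D.ty ≤ Q.1) : D.bend Q = Q := by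
  obtain ⟨R, rfl⟩ := D.leafHomeo.surjective Q
  rw [D.leaf_ge_iff] at h
  rw [bend_leaf]
  congr 1
  rw [D.liftHomeo_apply]
  have h0 : D.top R.1 = 0 := by
    unfold top
    split_ifs with h'
    · rw [le_antisymm h' h, D.zero]
    · rfl
  rw [h0]
  simp

theorem bend_fst_lt {Q : ℝ × ℝ} (h : Q.1 < D.ty) : (D.bend Q).1 < D.ty := by
  obtain ⟨R, rfl⟩ := D.leafHomeo.surjective Q
  have h' := lt_of_not_ge fun h1 => not_le.2 h ((D.leaf_ge_iff R).2 h1)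
  rw [bend_leaf]
  exact lt_of_not_ge fun h1 => not_le.2 h' ((D.leaf_ge_iff (D.liftHomeo R)).1 h1)

theorem abs_bend_snd_lt {Q : ℝ × ℝ} (h : |Q.2| < D.δ') : |(D.bend Q).2| < D.δ' := by
  obtain ⟨R, rfl⟩ := D.leafHomeo.surjective Q
  rw [bend_leaf]
  exact D.abs_lift_lt h

/-- Inside the strip the third line is the leaf of `tO`, so the comparison is the monotonicity of
the leaves. -/
theorem leaf_compare {τ c : ℝ} (hc : |c| < D.δ') :
    (Fr.tO < τ ↔ Fr.tO + Fr.κ₂ * c < τ + D.kap τ * D.clamp c) ∧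
    (Fr.tO = τ ↔ Fr.tO + Fr.κ₂ * c = τ + D.kap τ * D.clamp c) := by
  have h1 := (D.leaf_strictMono c).lt_iff_lt (a := Fr.tO) (b := τ)
  have h2 := (D.leaf_strictMono c).injective.eq_iff (a := Fr.tO) (b := τ)
  simp only [D.kap_tO, D.clamp_of_abs_le hc.le] at h1 h2
  simp only [D.clamp_of_abs_le hc.le]
  exact ⟨h1.symm, h2.symm⟩

theorem bend_line₂ {Q : ℝ × ℝ} (h : Fr.tO + Fr.κ₂ * Q.2 = Q.1) :
    Fr.tO + Fr.κ₂ * (D.bend Q).2 = (D.bend Q).1 := by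
  rcases lt_or_ge |Q.2| D.δ' with hc | hc
  · obtain ⟨R, rfl⟩ := D.leafHomeo.surjective Q
    rw [bend_leaf]
    have h1 := (D.leaf_compare hc).2.2 h
    exact (D.leaf_compare (D.abs_lift_lt hc)).2.1 h1
  · rw [D.bend_far hc, h]

theorem bend_lt₂ {Q : ℝ × ℝ} (h : Fr.tO + Fr.κ₂ * Q.2 < Q.1) :
    Fr.tO + Fr.κ₂ * (D.bend Q).2 < (D.bend Q).1 := by
  rcases lt_or_ge |Q.2| D.δ' with hc | hc
  · obtain ⟨R, rfl⟩ := D.leafHomeo.surjective Q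
    rw [bend_leaf]
    have h1 := (D.leaf_compare hc).1.2 h
    exact (D.leaf_compare (D.abs_lift_lt hc)).1.1 h1
  · rw [D.bend_far hc]; exact h

theorem bend_line₁ {Q : ℝ × ℝ} (h : Q.1 = Fr.tA + Fr.κ₁ * Q.2) : D.bend Q = Q := by
  rcases lt_or_ge |Q.2| D.δ' with hc | hc
  · refine D.bend_right ?_
    rw [h]
    exact (D.ty_lt_line (hc.trans D.lt_δ)).le
  · exact D.bend_far hc

theorem bend_lt₁ {Q : ℝ × ℝ} (h : Q.1 < Fr.tA + Fr.κ₁ * Q.2) :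
    (D.bend Q).1 < Fr.tA + Fr.κ₁ * (D.bend Q).2 := by
  rcases lt_or_ge |Q.2| D.δ' with hc | hc
  · rcases lt_or_ge Q.1 D.ty with ht | ht
    · exact (D.bend_fst_lt ht).trans (D.ty_lt_line ((D.abs_bend_snd_lt hc).trans D.lt_δ))
    · rw [D.bend_right ht]; exact h
  · rw [D.bend_far hc]; exact h

/-- A vertical leaf has constant abscissa, and a slanted one stays where the curve is flat. -/
theorem f_leaf {τ c : ℝ} (hc : |c| < D.δ') : f (τ + D.kap τ * D.clamp c) = f τ := by
  rw [D.clamp_of_abs_le hc.le]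
  by_cases hk : D.kap τ = 0
  · rw [hk]; simp
  · have h1 := D.leaf_near hk (hc.trans D.lt_δ)
    have h2 := D.leaf_near (c := 0) hk (by simpa using D.δ_pos)
    rw [mul_zero, add_zero] at h2
    rw [D.flat _ (D.near h1).1, D.flat _ (D.near h2).1]

theorem bend_base_left {t : ℝ} (ht : t ≤ D.ty) : (D.bend (t, 0)).2 = f (D.bend (t, 0)).1 := by
  have h : D.leafHomeo (t, 0) = (t, 0) := by
    rw [D.leafHomeo_apply]
    simp [D.clamp_of_abs_le (c := 0) (by simpa using D.δ'_pos.le)]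
  rw [← h, D.bend_leaf, D.liftHomeo_apply, D.leafHomeo_apply]
  simp only [D.bump_zero, zero_add, mul_one]
  rw [D.f_leaf (D.abs_top_lt t), top, if_pos ht]

theorem bend_below {Q : ℝ × ℝ} (ht : Q.1 ≤ D.ty) (h0 : Q.2 < 0) (hc : |Q.2| < D.δ') :
    (D.bend Q).2 < f (D.bend Q).1 := by
  obtain ⟨R, rfl⟩ := D.leafHomeo.surjective Q
  have hR : R.1 ≤ D.ty := by
    by_contra h
    push Not at h
    have h2 : D.kap R.1 = 0 := D.kap_eq_zero h.le
    rw [D.leafHomeo_apply] at ht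
    simp only [h2, zero_mul, add_zero] at ht
    linarith
  rw [bend_leaf]
  have h1 : D.leafHomeo (D.liftHomeo R) = (R.1 + D.kap R.1 * D.clamp (R.2 + D.top R.1 * D.bump R.2),
    R.2 + D.top R.1 * D.bump R.2) := rfl
  have hc' : |R.2| < D.δ' := hc
  have h0' : R.2 < 0 := h0
  rw [h1]
  simp only
  rw [D.f_leaf (D.abs_lift_lt hc')]
  have h2 := D.lift_strictMono R.1 h0'
  simp only [D.bump_zero, zero_add, mul_one] at h2
  have h3 : D.top R.1 = f R.1 := by rw [top, if_pos hR]
  linarith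

end QuadData

end LocalComp
end

/-! ### The quadrilateral as a bent triangle with an additional corner -/

open Topology
noncomputable section
namespace LocalComp

namespace QuadData

variable {γ₀ γ₁ γ₂ : Curve} {l₀ l₁ l₂ : ℤ} {Fr : Frame γ₀ γ₁ γ₂ l₀ l₁ l₂} {f : ℝ → ℝ}
  (D : QuadData Fr f)

/-- The piecewise linear map from the standard square to the triangle, with an additional corner at
`ty`. -/
def sqAffine : ℂ ≃ₜ ℝ × ℝ where
  -- The diagonal `im = 0` cuts the square into two triangles, with barycentric weights `(1 + re -
  -- |im|) / 2` at the corner `ty`, `(1 - re - |im|) / 2` at `B`, `max (-im) 0` at `A` and `max im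
  -- 0` at `O`.
  toFun z := (Fr.tO + Fr.κ₂ * ((1 - z.re - |z.im|) / 2 * Fr.cB) +
    (1 - (1 - z.re - |z.im|) / 2) * (D.ty - Fr.tO) +
    (max (-z.im) 0 * (Fr.tA - D.ty) - max z.im 0 * (D.ty - Fr.tO)),
    (1 - z.re - |z.im|) / 2 * Fr.cB)
  invFun Q :=
    ⟨1 - 2 * (Q.2 / Fr.cB) -
      |max (-(Q.1 - Fr.tO - Fr.κ₂ * Q.2 - (1 - Q.2 / Fr.cB) * (D.ty - Fr.tO))) 0 / (D.ty - Fr.tO) -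
      max (Q.1 - Fr.tO - Fr.κ₂ * Q.2 - (1 - Q.2 / Fr.cB) * (D.ty - Fr.tO)) 0 / (Fr.tA - D.ty)|,
    max (-(Q.1 - Fr.tO - Fr.κ₂ * Q.2 - (1 - Q.2 / Fr.cB) * (D.ty - Fr.tO))) 0 / (D.ty - Fr.tO) -
      max (Q.1 - Fr.tO - Fr.κ₂ * Q.2 - (1 - Q.2 / Fr.cB) * (D.ty - Fr.tO)) 0 / (Fr.tA - D.ty)⟩
  left_inv z := by
    have h1 := Fr.cB_neg.ne
    have h2 : 0 < D.ty - Fr.tO := by linarith [D.ty_gt]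
    have h3 : 0 < Fr.tA - D.ty := by linarith [D.ty_lt]
    set b := (1 - z.re - |z.im|) / 2 with hb
    have e1 : b * Fr.cB / Fr.cB = b := by field_simp
    set s := max (-z.im) 0 * (Fr.tA - D.ty) - max z.im 0 * (D.ty - Fr.tO) with hs
    have e2 : Fr.tO + Fr.κ₂ * (b * Fr.cB) + (1 - b) * (D.ty - Fr.tO) + s - Fr.tO -
        Fr.κ₂ * (b * Fr.cB) - (1 - b) * (D.ty - Fr.tO) = s := by ring
    have e3 : max (-s) 0 / (D.ty - Fr.tO) - max s 0 / (Fr.tA - D.ty) = z.im := by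
      rcases le_total 0 z.im with h | h
      · rw [max_eq_right (by linarith : -z.im ≤ 0), max_eq_left h, zero_mul, zero_sub] at hs
        rw [hs, neg_neg, max_eq_left (by positivity), max_eq_right (by nlinarith)]
        field_simp
        ring
      · rw [max_eq_left (by linarith : 0 ≤ -z.im), max_eq_right h, zero_mul, sub_zero] at hs
        rw [hs, max_eq_right (by nlinarith), max_eq_left (by nlinarith)]
        field_simp
        ring
    apply Complex.ext
    · simp only [← hb, ← hs, e1, e2, e3]; rw [hb]; ring
    · simp only [← hb, ← hs, e1, e2, e3]
  right_inv Q := by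
    have h1 := Fr.cB_neg.ne
    have h2 : 0 < D.ty - Fr.tO := by linarith [D.ty_gt]
    have h3 : 0 < Fr.tA - D.ty := by linarith [D.ty_lt]
    set b := Q.2 / Fr.cB with hb
    set s := Q.1 - Fr.tO - Fr.κ₂ * Q.2 - (1 - b) * (D.ty - Fr.tO) with hs
    set y := max (-s) 0 / (D.ty - Fr.tO) - max s 0 / (Fr.tA - D.ty) with hy
    have e1 : (1 - (1 - 2 * b - |y|) - |y|) / 2 = b := by ring
    have e2 : max (-y) 0 * (Fr.tA - D.ty) - max y 0 * (D.ty - Fr.tO) = s := by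
      rcases le_total 0 s with h | h
      · rw [max_eq_right (by linarith : -s ≤ 0), max_eq_left h, zero_div, zero_sub] at hy
        have : 0 ≤ s / (Fr.tA - D.ty) := by positivity
        rw [hy, neg_neg, max_eq_left this, max_eq_right (by linarith)]
        field_simp
        ring
      · rw [max_eq_left (by linarith : 0 ≤ -s), max_eq_right h, zero_div, sub_zero] at hy
        have : 0 ≤ -s / (D.ty - Fr.tO) := div_nonneg (by linarith) h2.le
        rw [hy, max_eq_right (by linarith), max_eq_left this]
        field_simp
        ring
    have e3 : b * Fr.cB = Q.2 := by rw [hb]; field_simp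
    apply Prod.ext
    · simp only [← hb, ← hs, ← hy, e1, e2, e3]
      rw [hs]; ring
    · simp only [← hb, ← hs, ← hy, e1, e3]
  continuous_toFun := by fun_prop
  continuous_invFun := by
    have h1 := Fr.cB_neg.ne
    have h2 : D.ty - Fr.tO ≠ 0 := by linarith [D.ty_gt]
    have h3 : Fr.tA - D.ty ≠ 0 := by linarith [D.ty_lt]
    refine Complex.equivRealProdCLM.symm.continuous.comp (f := fun Q : ℝ × ℝ => (_, _)) ?_ |>.congr
      (fun Q => Complex.ext (by simp; rfl) (by simp; rfl))
    fun_prop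

theorem sqAffine_snd (z : ℂ) : (D.sqAffine z).2 = (1 - z.re - |z.im|) / 2 * Fr.cB := rfl

theorem sqAffine_sub₂ (z : ℂ) : (D.sqAffine z).1 - (Fr.tO + Fr.κ₂ * (D.sqAffine z).2) =
    (1 + z.re - |z.im|) / 2 * (D.ty - Fr.tO) + max (-z.im) 0 * (Fr.tA - Fr.tO) := by
  simp only [sqAffine, Homeomorph.homeomorph_mk_coe, Equiv.coe_fn_mk]
  have : |z.im| = max (-z.im) 0 + max z.im 0 := by
    rcases le_total 0 z.im with h | h
    · rw [abs_of_nonneg h, max_eq_right (by linarith : -z.im ≤ 0), max_eq_left h, zero_add]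
    · rw [abs_of_nonpos h, max_eq_left (by linarith : 0 ≤ -z.im), max_eq_right h, add_zero]
  linear_combination (D.ty - Fr.tO) * this

theorem sqAffine_sub₁ (z : ℂ) : (D.sqAffine z).1 - (Fr.tA + Fr.κ₁ * (D.sqAffine z).2) =
    -((1 + z.re - |z.im|) / 2 * (Fr.tA - D.ty) + max z.im 0 * (Fr.tA - Fr.tO)) := by
  have h := D.sqAffine_sub₂ z
  have h2 := Fr.cB_mul
  have h3 := D.sqAffine_snd z
  have : |z.im| = max (-z.im) 0 + max z.im 0 := by
    rcases le_total 0 z.im with h | h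
    · rw [abs_of_nonneg h, max_eq_right (by linarith : -z.im ≤ 0), max_eq_left h, zero_add]
    · rw [abs_of_nonpos h, max_eq_left (by linarith : 0 ≤ -z.im), max_eq_right h, add_zero]
  linear_combination h - (Fr.κ₁ - Fr.κ₂) * h3 - (1 - z.re - |z.im|) / 2 * h2 -
    (Fr.tA - Fr.tO) * this

theorem inTriangle_sqAffine_iff (z : ℂ) : Fr.InTriangle (D.sqAffine z) ↔ sqGauge z ≤ 1 := by
  have h1 := D.sqAffine_sub₁ z
  have h2 := D.sqAffine_sub₂ z
  have h3 := D.sqAffine_snd z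
  have hc := Fr.cB_neg
  have ht := Fr.tO_lt
  have hy1 := D.ty_gt
  have hy2 := D.ty_lt
  have hA : 0 < Fr.tA - D.ty := by linarith
  have hO : 0 < D.ty - Fr.tO := by linarith
  unfold Frame.InTriangle sqGauge
  constructor
  · rintro ⟨a, b, c⟩
    have hB : 0 ≤ 1 - z.re - |z.im| := by
      by_contra h
      push Not at h
      rw [h3] at a
      nlinarith
    have hY : 0 ≤ 1 + z.re - |z.im| := by
      by_contra h
      push Not at h
      rcases le_total 0 z.im with hi | hi
      · rw [max_eq_right (by linarith : -z.im ≤ 0)] at h2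
        nlinarith
      · rw [max_eq_right hi] at h1
        nlinarith
    rcases abs_cases z.re with ⟨h, -⟩ | ⟨h, -⟩ <;> rw [h] <;> linarith
  · intro h
    have hB : 0 ≤ 1 - z.re - |z.im| := by linarith [le_abs_self z.re]
    have hY : 0 ≤ 1 + z.re - |z.im| := by linarith [neg_le_abs z.re]
    have m1 := le_max_right (-z.im) 0
    have m2 := le_max_right z.im 0
    refine ⟨by rw [h3]; nlinarith, ?_, ?_⟩
    · nlinarith [mul_nonneg hY hA.le, mul_nonneg m2 (by linarith : 0 ≤ Fr.tA - Fr.tO)]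
    · nlinarith [mul_nonneg hY hO.le, mul_nonneg m1 (by linarith : 0 ≤ Fr.tA - Fr.tO)]

theorem sqAffine_interior {z : ℂ} (h : sqGauge z < 1) : (D.sqAffine z).2 < 0 ∧
    (D.sqAffine z).1 < Fr.tA + Fr.κ₁ * (D.sqAffine z).2 ∧
    Fr.tO + Fr.κ₂ * (D.sqAffine z).2 < (D.sqAffine z).1 := by
  have h1 := D.sqAffine_sub₁ z
  have h2 := D.sqAffine_sub₂ z
  have h3 := D.sqAffine_snd z
  have hc := Fr.cB_neg
  have ht := Fr.tO_lt
  have hA : 0 < Fr.tA - D.ty := by linarith [D.ty_lt]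
  have hO : 0 < D.ty - Fr.tO := by linarith [D.ty_gt]
  unfold sqGauge at h
  have hB : 0 < 1 - z.re - |z.im| := by linarith [le_abs_self z.re]
  have hY : 0 < 1 + z.re - |z.im| := by linarith [neg_le_abs z.re]
  have m1 := le_max_right (-z.im) 0
  have m2 := le_max_right z.im 0
  refine ⟨by rw [h3]; nlinarith, ?_, ?_⟩
  · nlinarith [mul_pos hY hA, mul_nonneg m2 (by linarith : 0 ≤ Fr.tA - Fr.tO)]
  · nlinarith [mul_pos hY hO, mul_nonneg m1 (by linarith : 0 ≤ Fr.tA - Fr.tO)]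

theorem sqAffine_side_zero {t : ℝ} (ht : t ∈ Set.Icc (0 : ℝ) 1) :
    (D.sqAffine (sqRadial (sidePoint 4 0 t))).2 = 0 ∧
    D.ty ≤ (D.sqAffine (sqRadial (sidePoint 4 0 t))).1 := by
  obtain ⟨h1, h2, -⟩ := sqRadial_side 0 (by norm_num) ht
  obtain ⟨hx, hy⟩ := h2 rfl
  set z := sqRadial (sidePoint 4 0 t)
  have e := D.sqAffine_sub₂ z
  have e3 := D.sqAffine_snd z
  rw [abs_of_nonneg hx] at h1
  have e3' : (D.sqAffine z).2 = 0 := by rw [e3, show 1 - z.re - |z.im| = 0 by linarith]; simp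
  refine ⟨e3', ?_⟩
  rw [max_eq_left (by linarith : 0 ≤ -z.im), e3', abs_of_nonpos hy] at e
  rw [abs_of_nonpos hy] at h1
  rw [show z.re = 1 + z.im by linarith] at e
  have := mul_nonneg (neg_nonneg.2 hy) (sub_nonneg.2 D.ty_lt.le)
  linarith

theorem sqAffine_side_one {t : ℝ} (ht : t ∈ Set.Icc (0 : ℝ) 1) :
    (D.sqAffine (sqRadial (sidePoint 4 1 t))).1 =
      Fr.tA + Fr.κ₁ * (D.sqAffine (sqRadial (sidePoint 4 1 t))).2 := by
  obtain ⟨h1, -, h2, -⟩ := sqRadial_side 1 (by norm_num) ht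
  obtain ⟨hx, hy⟩ := h2 rfl
  set z := sqRadial (sidePoint 4 1 t)
  have e := D.sqAffine_sub₁ z
  rw [abs_of_nonpos hx] at h1
  rw [max_eq_right hy, show 1 + z.re - |z.im| = 0 by linarith] at e
  linarith

theorem sqAffine_side_two {t : ℝ} (ht : t ∈ Set.Icc (0 : ℝ) 1) :
    Fr.tO + Fr.κ₂ * (D.sqAffine (sqRadial (sidePoint 4 2 t))).2 =
      (D.sqAffine (sqRadial (sidePoint 4 2 t))).1 := by
  obtain ⟨h1, -, -, h2, -⟩ := sqRadial_side 2 (by norm_num) ht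
  obtain ⟨hx, hy⟩ := h2 rfl
  set z := sqRadial (sidePoint 4 2 t)
  have e := D.sqAffine_sub₂ z
  rw [abs_of_nonpos hx] at h1
  rw [max_eq_right (by linarith : -z.im ≤ 0), show 1 + z.re - |z.im| = 0 by linarith] at e
  linarith

theorem sqAffine_side_three {t : ℝ} (ht : t ∈ Set.Icc (0 : ℝ) 1) :
    (D.sqAffine (sqRadial (sidePoint 4 3 t))).2 = 0 ∧
    (D.sqAffine (sqRadial (sidePoint 4 3 t))).1 ≤ D.ty := by
  obtain ⟨h1, -, -, -, h2⟩ := sqRadial_side 3 (by norm_num) ht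
  obtain ⟨hx, hy⟩ := h2 rfl
  set z := sqRadial (sidePoint 4 3 t)
  have e := D.sqAffine_sub₂ z
  have e3 := D.sqAffine_snd z
  rw [abs_of_nonneg hx] at h1
  have e3' : (D.sqAffine z).2 = 0 := by rw [e3, show 1 - z.re - |z.im| = 0 by linarith]; simp
  refine ⟨e3', ?_⟩
  rw [max_eq_right (by linarith : -z.im ≤ 0), e3', abs_of_nonneg hy] at e
  rw [abs_of_nonneg hy] at h1
  rw [show z.re = 1 - z.im by linarith] at e
  have := mul_nonneg hy (sub_nonneg.2 D.ty_gt.le)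
  linarith

/-- The homeomorphism of the plane that maps the disk to the quadrilateral. -/
def quadHomeo : ℂ ≃ₜ ℝ × ℝ := sqRadial.trans (D.sqAffine.trans (D.bend.trans Fr.Ξ.symm))

theorem Ξ_quadHomeo (z : ℂ) : Fr.Ξ (D.quadHomeo z) = D.bend (D.sqAffine (sqRadial z)) := by
  simp [quadHomeo]

/-- Bending is the identity outside the strip, so points there belong to the quadrilateral exactly
if they belong to the triangle. This lets the basepoint count be inherited from the triangle. -/
theorem norm_quadHomeo_symm_le_iff {P : ℝ × ℝ} (hP : D.δ' ≤ |(Fr.Ξ P).2|) :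
    ‖D.quadHomeo.symm P‖ ≤ 1 ↔ Fr.InTriangle (Fr.Ξ P) := by
  obtain ⟨z, rfl⟩ := D.quadHomeo.surjective P
  rw [Homeomorph.symm_apply_apply, ← sqGauge_sqRadial, ← D.inTriangle_sqAffine_iff]
  have h : D.sqAffine (sqRadial z) = Fr.Ξ (D.quadHomeo z) := by
    have h1 := D.Ξ_quadHomeo z
    have h2 := D.bend_far hP
    rw [h1] at h2
    exact (D.bend.injective h2).symm.trans h1.symm |>.symm ▸ rfl
  rw [h]

end QuadData

/-- The description of the fourth curve in adapted coordinates. -/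
structure Frame.IsGraph {γ₀ γ₁ γ₂ : Curve} {l₀ l₁ l₂ : ℤ} (Fr : Frame γ₀ γ₁ γ₂ l₀ l₁ l₂)
    (f : ℝ → ℝ) (γ₃ : Curve) : Prop where
  along : ∀ P, γ₃.along P = Fr.σ * (Fr.Ξ P).1
  across : ∀ P, γ₃.across P = l₀ + Fr.σ * ((Fr.Ξ P).2 - f (Fr.Ξ P).1)

namespace Frame.IsGraph

variable {γ₀ γ₁ γ₂ γ₃ : Curve} {l₀ l₁ l₂ : ℤ} {Fr : Frame γ₀ γ₁ γ₂ l₀ l₁ l₂} {f : ℝ → ℝ}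

theorem across_eq_iff (h₃ : Fr.IsGraph f γ₃) (P : ℝ × ℝ) : γ₃.across P = l₀ ↔ (Fr.Ξ P).2 = f (Fr.Ξ P).1 := by
  rw [h₃.across]
  simp [Fr.σ_ne, sub_eq_zero]

theorem right (h₃ : Fr.IsGraph f γ₃) (P Q R : ℝ × ℝ) : (γ₃.along P - γ₃.along Q) * (γ₃.across R - l₀) =
    ((Fr.Ξ P).1 - (Fr.Ξ Q).1) * ((Fr.Ξ R).2 - f (Fr.Ξ R).1) := by
  rw [h₃.along, h₃.along, h₃.across]
  linear_combination (((Fr.Ξ P).1 - (Fr.Ξ Q).1) * ((Fr.Ξ R).2 - f (Fr.Ξ R).1)) * Fr.σ_mul_self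

theorem coord_injOn (h₃ : Fr.IsGraph f γ₃) : Set.InjOn (fun P => (Fr.Ξ P).1) {P | γ₃.across P = l₀} := by
  intro P hP Q hQ h
  refine Fr.Ξ.injective (Prod.ext h ?_)
  simp only at h
  rw [(h₃.across_eq_iff P).1 hP, (h₃.across_eq_iff Q).1 hQ, h]

end Frame.IsGraph

namespace Wiggle

variable {γ₀ γ₁ γ₂ γ₃ : Curve} {l₀ l₁ l₂ : ℤ} {Fr : Frame γ₀ γ₁ γ₂ l₀ l₁ l₂} {f : ℝ → ℝ}
  (W : Wiggle Fr f)

/-- The corner between the third line and the curve. -/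
def ptO' : ℝ × ℝ := Fr.Ξ.symm (Fr.tO + Fr.κ₂ * W.s, W.s)

theorem δ_pos : 0 < W.δ := ((abs_nonneg _).trans_lt (W.bdd 0)).trans W.lt_δ

theorem f_line₂ {c : ℝ} (hc : |c| < W.δ) : f (Fr.tO + Fr.κ₂ * c) = W.s := W.flat _ (W.avoid₂ c hc)

theorem abs_s_lt : |W.s| < W.δ' := by
  have := W.f_line₂ (c := 0) (by simpa using W.δ_pos)
  rw [← this]
  exact W.bdd _

/-- Along the third line inside the strip the curve has constant height `s`, so the two meet only
once. -/
theorem eq_ptO' (h₃ : Fr.IsGraph f γ₃) {P : ℝ × ℝ} (h2 : γ₂.across P = l₂)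
    (h3 : γ₃.across P = l₀) : P = W.ptO' := by
  rw [Fr.across₂_eq_iff] at h2
  rw [h₃.across_eq_iff] at h3
  have hc : |(Fr.Ξ P).2| < W.δ := by rw [h3]; exact (W.bdd _).trans W.lt_δ
  have := W.f_line₂ hc
  rw [← h2, ← h3] at this
  rw [ptO', Homeomorph.eq_symm_apply]
  exact Prod.ext (by rw [h2, this]) this

end Wiggle

namespace QuadData

variable {γ₀ γ₁ γ₂ γ₃ : Curve} {l₀ l₁ l₂ : ℤ} {Fr : Frame γ₀ γ₁ γ₂ l₀ l₁ l₂} {f : ℝ → ℝ}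
  (D : QuadData Fr f)

/-- The corner between the first line and the curve. -/
def ptY : ℝ × ℝ := Fr.Ξ.symm (D.ty, 0)

theorem four_wrap : sidePoint 4 3 1 = sidePoint 4 0 0 := by
  rw [sidePoint_one, sidePoint_wrap 4 (by norm_num)]

theorem across_quadHomeo_side (h₃ : Fr.IsGraph f γ₃) (j : Fin 4) {t : ℝ} (ht : t ∈ Set.Icc (0 : ℝ) 1) :
    (![γ₀, γ₁, γ₂, γ₃] j).across (D.quadHomeo (sidePoint 4 j t)) = (![l₀, l₁, l₂, l₀] j : ℤ) := by
  fin_cases j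
  · change γ₀.across (D.quadHomeo (sidePoint 4 0 t)) = l₀
    obtain ⟨h1, h2⟩ := D.sqAffine_side_zero ht
    rw [Fr.across₀_eq_iff, D.Ξ_quadHomeo, D.bend_right h2, h1]
  · change γ₁.across (D.quadHomeo (sidePoint 4 1 t)) = l₁
    have h := D.sqAffine_side_one ht
    rw [Fr.across₁_eq_iff, D.Ξ_quadHomeo, D.bend_line₁ h, h]
  · change γ₂.across (D.quadHomeo (sidePoint 4 2 t)) = l₂
    have h := D.sqAffine_side_two ht
    rw [Fr.across₂_eq_iff, D.Ξ_quadHomeo, D.bend_line₂ h]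
  · change γ₃.across (D.quadHomeo (sidePoint 4 3 t)) = l₀
    obtain ⟨h1, h2⟩ := D.sqAffine_side_three ht
    rw [h₃.across_eq_iff, D.Ξ_quadHomeo]
    rw [show D.sqAffine (sqRadial (sidePoint 4 3 t)) =
      ((D.sqAffine (sqRadial (sidePoint 4 3 t))).1, 0) from Prod.ext rfl h1]
    exact D.bend_base_left h2

theorem quadHomeo_corners (h₃ : Fr.IsGraph f γ₃) : D.quadHomeo (sidePoint 4 0 0) = D.ptY ∧
    D.quadHomeo (sidePoint 4 1 0) = Fr.ptA ∧ D.quadHomeo (sidePoint 4 2 0) = Fr.ptB ∧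
    D.quadHomeo (sidePoint 4 3 0) = D.ptO' := by
  have h0 : (0 : ℝ) ∈ Set.Icc (0 : ℝ) 1 := ⟨le_rfl, zero_le_one⟩
  have h1 : (1 : ℝ) ∈ Set.Icc (0 : ℝ) 1 := ⟨zero_le_one, le_rfl⟩
  refine ⟨?_, Fr.eq_ptA ?_ (D.across_quadHomeo_side h₃ 1 h0),
    Fr.eq_ptB ?_ (D.across_quadHomeo_side h₃ 2 h0),
    D.eq_ptO' h₃ ?_ (D.across_quadHomeo_side h₃ 3 h0)⟩
  · obtain ⟨a1, a2⟩ := D.sqAffine_side_zero h0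
    obtain ⟨b1, b2⟩ := D.sqAffine_side_three h1
    rw [four_wrap] at b2
    rw [ptY, Homeomorph.eq_symm_apply, D.Ξ_quadHomeo, D.bend_right a2]
    exact Prod.ext (le_antisymm b2 a2) a1
  · rw [← sidePoint_one 0]; exact D.across_quadHomeo_side h₃ 0 h1
  · rw [← sidePoint_one 1]; exact D.across_quadHomeo_side h₃ 1 h1
  · rw [← sidePoint_one 2]; exact D.across_quadHomeo_side h₃ 2 h1

/-- Only the corner at `ty` is delicate: points to its left are bent below the graph, and just to
the left of `ty` the graph is below the line. In `eventually_side_three` the graph lies above the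
line to the right of `ty`. Together these make the new corner convex, and they are why the crossing
must be upward. -/
theorem eventually_side_zero {R₀ : ℝ × ℝ} (h : D.ty ≤ R₀.1) (h0 : R₀.2 = 0) :
    ∀ᶠ R in 𝓝 R₀, R.2 < 0 → (D.bend R).2 < 0 := by
  have hc : ∀ᶠ R : ℝ × ℝ in 𝓝 R₀, |R.2| < D.δ' :=
    (isOpen_lt (f := fun R : ℝ × ℝ => |R.2|) (by fun_prop) continuous_const).mem_nhds
      (by simpa [h0] using D.δ'_pos)
  rcases h.lt_or_eq with h | h
  · have h1 : ∀ᶠ R : ℝ × ℝ in 𝓝 R₀, D.ty < R.1 :=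
      (isOpen_lt continuous_const continuous_fst).mem_nhds h
    filter_upwards [h1] with R hR hR2
    rw [D.bend_right hR.le]
    exact hR2
  · have hb : Filter.Tendsto (fun R => (D.bend R).1) (𝓝 R₀) (𝓝 D.ty) := by
      have : Continuous fun R => (D.bend R).1 := by fun_prop
      have h2 := this.tendsto R₀
      rwa [D.bend_right h.le, ← h] at h2
    have hl := D.left
    rw [eventually_nhdsWithin_iff] at hl
    filter_upwards [hc, hb.eventually hl] with R hR hR1 hR2
    rcases lt_or_ge R.1 D.ty with h3 | h3
    · exact (D.bend_below h3.le hR2 hR).trans (hR1 (D.bend_fst_lt h3))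
    · rw [D.bend_right h3]; exact hR2

theorem eventually_side_three {R₀ : ℝ × ℝ} (h : R₀.1 ≤ D.ty) (h0 : R₀.2 = 0) :
    ∀ᶠ R in 𝓝 R₀, R.2 < 0 → (D.bend R).2 < f (D.bend R).1 := by
  have hc : ∀ᶠ R : ℝ × ℝ in 𝓝 R₀, |R.2| < D.δ' :=
    (isOpen_lt (f := fun R : ℝ × ℝ => |R.2|) (by fun_prop) continuous_const).mem_nhds
      (by simpa [h0] using D.δ'_pos)
  rcases h.lt_or_eq with h | h
  · have h1 : ∀ᶠ R : ℝ × ℝ in 𝓝 R₀, R.1 < D.ty :=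
      (isOpen_lt continuous_fst continuous_const).mem_nhds h
    filter_upwards [hc, h1] with R hR hR1 hR2
    exact D.bend_below hR1.le hR2 hR
  · have hb : Filter.Tendsto (fun R : ℝ × ℝ => R.1) (𝓝 R₀) (𝓝 D.ty) := by
      rw [← h]; exact continuous_fst.tendsto R₀
    have hl := D.right
    rw [eventually_nhdsWithin_iff] at hl
    filter_upwards [hc, hb.eventually hl] with R hR hR1 hR2
    rcases le_or_gt R.1 D.ty with h3 | h3
    · exact D.bend_below h3 hR2 hR
    · rw [D.bend_right h3.le]; exact hR2.trans (hR1 h3)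

/-- The quadrilateral with sides on the three lines and the curve. -/
def quad (h₃ : Fr.IsGraph f γ₃) : Polygon ![γ₀, γ₁, γ₂, γ₃] :=
  Polygon.ofHomeo _ D.quadHomeo ![l₀, l₁, l₂, l₀] (fun j _ ht => D.across_quadHomeo_side h₃ j ht)
    (by
      intro j t ht
      have h0 : (0 : ℝ) ∈ Set.Icc (0 : ℝ) 1 := ⟨le_rfl, zero_le_one⟩
      have h1 : (1 : ℝ) ∈ Set.Icc (0 : ℝ) 1 := ⟨zero_le_one, le_rfl⟩
      have hs0 := D.across_quadHomeo_side h₃ j h0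
      have hs1 := D.across_quadHomeo_side h₃ j h1
      obtain ⟨cY, cA, cB, cO⟩ := D.quadHomeo_corners h₃
      have hcont : Filter.Tendsto (fun w : Disk => D.sqAffine (sqRadial w)) (𝓝 (sidePoint 4 j t))
          (𝓝 (D.sqAffine (sqRadial (sidePoint 4 j t)))) := by
        have : Continuous fun w : Disk => D.sqAffine (sqRadial w) := by fun_prop
        exact this.tendsto _
      have hinside : ∀ w : Disk, ‖(w : ℂ)‖ < 1 → sqGauge (sqRadial w) < 1 := fun w hw => by
        rwa [sqGauge_sqRadial]
      fin_cases j
      · obtain ⟨a1, a2⟩ := D.sqAffine_side_zero ht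
        filter_upwards [hcont.eventually (D.eventually_side_zero a2 a1)] with w hw hw1
        change (γ₀.along (D.quadHomeo (sidePoint 4 0 1)) -
          γ₀.along (D.quadHomeo (sidePoint 4 0 0))) * (γ₀.across (D.quadHomeo w) - l₀) < 0
        rw [Fr.right₀, sidePoint_one, cY, cA, D.Ξ_quadHomeo, ptY, Frame.ptA]
        simp only [Homeomorph.apply_symm_apply]
        exact mul_neg_of_pos_of_neg (by linarith [D.ty_lt])
          (hw (D.sqAffine_interior (hinside w hw1)).1)
      · refine Filter.Eventually.of_forall fun w hw1 => ?_
        change (γ₁.along (D.quadHomeo (sidePoint 4 1 1)) -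
          γ₁.along (D.quadHomeo (sidePoint 4 1 0))) * (γ₁.across (D.quadHomeo w) - l₁) < 0
        rw [Fr.right₁ hs1 hs0, sidePoint_one, cA, cB, D.Ξ_quadHomeo, Frame.ptB, Frame.ptA]
        simp only [Homeomorph.apply_symm_apply]
        have := D.bend_lt₁ (D.sqAffine_interior (hinside w hw1)).2.1
        exact mul_neg_of_neg_of_pos Fr.neg₁ (mul_pos_of_neg_of_neg
          (by linarith [Fr.cB_neg]) (by linarith))
      · refine Filter.Eventually.of_forall fun w hw1 => ?_
        change (γ₂.along (D.quadHomeo (sidePoint 4 2 1)) -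
          γ₂.along (D.quadHomeo (sidePoint 4 2 0))) * (γ₂.across (D.quadHomeo w) - l₂) < 0
        rw [Fr.right₂ hs1 hs0, sidePoint_one, cO, cB, D.Ξ_quadHomeo, Frame.ptB, Wiggle.ptO']
        simp only [Homeomorph.apply_symm_apply]
        have := D.bend_lt₂ (D.sqAffine_interior (hinside w hw1)).2.2
        -- Otherwise the corner `B`, where the second and third lines meet, would lie in the strip,
        -- in which `ty` separates these lines.
        have hs : Fr.cB < D.s := by
          by_contra hn
          push Not at hn
          have hcs : |Fr.cB| < D.δ := by
            rw [abs_of_neg Fr.cB_neg]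
            have h5 := neg_le_abs D.s
            have h6 := D.abs_s_lt
            have h7 := D.lt_δ
            linarith
          have h5 := D.line_lt_ty hcs
          have h6 := D.ty_lt_line hcs
          have h7 := Fr.cB_mul
          linarith
        exact mul_neg_of_neg_of_pos Fr.neg₂ (mul_pos (by linarith) (by linarith))
      · obtain ⟨a1, a2⟩ := D.sqAffine_side_three ht
        filter_upwards [hcont.eventually (D.eventually_side_three a2 a1)] with w hw hw1
        change (γ₃.along (D.quadHomeo (sidePoint 4 3 1)) -
          γ₃.along (D.quadHomeo (sidePoint 4 3 0))) * (γ₃.across (D.quadHomeo w) - l₀) < 0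
        rw [h₃.right, four_wrap, cO, cY, D.Ξ_quadHomeo, ptY, Wiggle.ptO']
        simp only [Homeomorph.apply_symm_apply]
        have := hw (D.sqAffine_interior (hinside w hw1)).1
        have := D.line_lt_ty (D.abs_s_lt.trans D.lt_δ)
        exact mul_neg_of_pos_of_neg (by linarith) (by linarith))

theorem quad_u (h₃ : Fr.IsGraph f γ₃) (w : Disk) : (D.quad h₃).u w = D.quadHomeo w := rfl

theorem quad_start (h₃ : Fr.IsGraph f γ₃) : (D.quad h₃).start 0 = D.ptY ∧ (D.quad h₃).start 1 = Fr.ptA ∧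
    (D.quad h₃).start 2 = Fr.ptB ∧ (D.quad h₃).start 3 = D.ptO' := D.quadHomeo_corners h₃

theorem mult_quad (h₃ : Fr.IsGraph f γ₃) {z : ℝ × ℝ}
    (hz : ∀ m : ℤ × ℤ, D.δ' ≤ |(Fr.Ξ (z + ((m.1 : ℝ), (m.2 : ℝ)))).2|) : (D.quad h₃).mult z =
    Set.ncard {m : ℤ × ℤ | Fr.InTriangle (Fr.Ξ (z + ((m.1 : ℝ), (m.2 : ℝ))))} := by
  rw [Polygon.mult_ofHomeo _ D.quadHomeo (D.quad_u h₃)]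
  congr 1
  ext m
  exact D.norm_quadHomeo_symm_le_iff (hz m)

/-- A quadrilateral with the same corner on the first line is equivalent to the standard one. -/
theorem equivalent_quad (h₃ : Fr.IsGraph f γ₃) (T : Polygon ![γ₀, γ₁, γ₂, γ₃]) (hl : T.level = ![l₀, l₁, l₂, l₀])
    (hY : T.start 0 = D.ptY) : Polygon.Equivalent T (D.quad h₃) := by
  have h0 : (0 : ℝ) ∈ Set.Icc (0 : ℝ) 1 := ⟨le_rfl, zero_le_one⟩
  have h1 : (1 : ℝ) ∈ Set.Icc (0 : ℝ) 1 := ⟨zero_le_one, le_rfl⟩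
  have hs0 : ∀ j, (![γ₀, γ₁, γ₂, γ₃] j).across (T.start j) = (![l₀, l₁, l₂, l₀] j : ℤ) :=
    fun j => by rw [← hl]; exact T.side_mem j 0 h0
  have hs1 : ∀ j, (![γ₀, γ₁, γ₂, γ₃] j).across (T.finish j) = (![l₀, l₁, l₂, l₀] j : ℤ) :=
    fun j => by rw [← hl]; exact T.side_mem j 1 h1
  obtain ⟨cY, cA, cB, cO⟩ := D.quad_start h₃
  refine Polygon.equivalent_of_corners (by norm_num) (D.quad h₃) T D.quadHomeo (D.quad_u h₃)
    ![fun P => (Fr.Ξ P).1, fun P => (Fr.Ξ P).2, fun P => (Fr.Ξ P).2, fun P => (Fr.Ξ P).1]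
    ?_ ?_ hl ?_
  · intro j
    fin_cases j <;> (simp; fun_prop)
  · intro j
    fin_cases j
    exacts [Fr.coord_injOn₀, Fr.coord_injOn₁, Fr.coord_injOn₂, h₃.coord_injOn]
  · intro j
    fin_cases j
    · change T.start 0 = (D.quad h₃).start 0
      rw [cY, hY]
    · change T.start 1 = (D.quad h₃).start 1
      rw [cA]
      exact Fr.eq_ptA (by rw [← T.finish_eq_start 0 1 rfl]; exact hs1 0) (hs0 1)
    · change T.start 2 = (D.quad h₃).start 2
      rw [cB]
      exact Fr.eq_ptB (by rw [← T.finish_eq_start 1 2 rfl]; exact hs1 1) (hs0 2)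
    · change T.start 3 = (D.quad h₃).start 3
      rw [cO]
      exact D.eq_ptO' h₃ (by rw [← T.finish_eq_start 2 3 rfl]; exact hs1 2) (hs0 3)

end QuadData

end LocalComp
end

/-! ### Necessary conditions on corners, and sums over classes of polygons -/

open Topology
noncomputable section
namespace LocalComp

/-! ### Corners of polygons -/

/-- Shrink the point radially towards the centre. -/
theorem exists_interior_near (w : Disk) {p : Disk → Prop} (h : ∀ᶠ x : Disk in 𝓝 w, p x) :
    ∃ᶠ x : Disk in 𝓝 w, ‖(x : ℂ)‖ < 1 ∧ p x := by
  have hr : ∀ r ∈ Set.Icc (0 : ℝ) 1, ‖(r : ℂ) * (w : ℂ)‖ ≤ r := fun r hr => by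
    rw [norm_mul, Complex.norm_real, Real.norm_of_nonneg hr.1]
    nlinarith [hr.1, Disk.norm_le w]
  let g : ℝ → Disk := fun r => if hr' : r ∈ Set.Icc (0 : ℝ) 1 then
    ⟨(r : ℂ) * w, mem_closedBall_zero_iff.2 ((hr r hr').trans hr'.2)⟩ else w
  have hmem : Set.Ioo (0 : ℝ) 1 ∈ 𝓝[<] (1 : ℝ) := Ioo_mem_nhdsLT zero_lt_one
  have hg : Filter.Tendsto g (𝓝[<] 1) (𝓝 w) := by
    rw [tendsto_subtype_rng]
    have h1 : Filter.Tendsto (fun r : ℝ => (r : ℂ) * (w : ℂ)) (𝓝[<] 1) (𝓝 (w : ℂ)) := by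
      have : Continuous fun r : ℝ => (r : ℂ) * (w : ℂ) := by fun_prop
      simpa using (this.tendsto 1).mono_left nhdsWithin_le_nhds
    refine h1.congr' ?_
    filter_upwards [hmem] with r hr'
    simp only [g, dif_pos (Set.Ioo_subset_Icc_self hr')]
  refine hg.frequently (Filter.Eventually.frequently ?_)
  filter_upwards [hmem, hg.eventually h] with r hr' hp
  refine ⟨?_, hp⟩
  simp only [g, dif_pos (Set.Ioo_subset_Icc_self hr')]
  exact (hr r (Set.Ioo_subset_Icc_self hr')).trans_lt hr'.2

namespace Polygon

variable {n : ℕ} {γ : Fin n → Curve}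

/-- Otherwise the strict inequality of `right_side` would have a vanishing factor at interior points
near the side. -/
theorem along_ne (T : Polygon γ) (j : Fin n) :
    (γ j).along (T.start j) ≠ (γ j).along (T.finish j) := by
  intro h
  obtain ⟨w, hw, hw2⟩ := (exists_interior_near _ (T.right_side j 0 ⟨le_rfl, zero_le_one⟩)).exists
  have := hw2 hw
  change ((γ j).along (T.finish j) - (γ j).along (T.start j)) * _ < 0 at this
  rw [h, sub_self, zero_mul] at this
  exact lt_irrefl _ this

/-- The interior is dense in the disk, so in the limit a weak form of the orientation condition
holds at boundary points as well. Applied to the preceding side, it expresses the convexity of a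
corner. -/
theorem right_side_le (T : Polygon γ) (j : Fin n) (hc : Continuous (γ j).across) {t : ℝ}
    (ht : t ∈ Set.Icc (0 : ℝ) 1) : ∀ᶠ w : Disk in 𝓝 (sidePoint n j t),
      ((γ j).along (T.finish j) - (γ j).along (T.start j)) *
        ((γ j).across (T.u w) - T.level j) ≤ 0 := by
  filter_upwards [(T.right_side j t ht).eventually_nhds] with w hw
  by_contra hn
  push Not at hn
  have hcont : Continuous fun w : Disk => ((γ j).along (T.finish j) - (γ j).along (T.start j)) *
      ((γ j).across (T.u w) - T.level j) := by fun_prop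
  have h1 : ∀ᶠ x in 𝓝 w, 0 < ((γ j).along (T.finish j) - (γ j).along (T.start j)) *
      ((γ j).across (T.u x) - T.level j) :=
    (isOpen_lt continuous_const hcont).mem_nhds hn
  obtain ⟨x, hx, hx1, hx2⟩ := (exists_interior_near w (h1.and hw)).exists
  exact absurd (hx2 hx) (not_lt.2 hx1.le)

/-- Near a corner, the preceding side lies on the correct side of the curve. -/
theorem prev_side_le (T : Polygon γ) (j j' : Fin n) (h : ((j' : ℕ) + 1) % n = j)
    (hc : Continuous (γ j).across) : ∀ᶠ r in 𝓝[<] (1 : ℝ),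
      ((γ j).along (T.finish j) - (γ j).along (T.start j)) *
        ((γ j).across (T.u (sidePoint n j' r)) - T.level j) ≤ 0 := by
  have h0 := T.right_side_le j hc (t := 0) ⟨le_rfl, zero_le_one⟩
  have hn : n ≠ 0 := by have := j.2; omega
  have hs : sidePoint n j 0 = sidePoint n j' 1 := by
    rw [sidePoint_eq_iff hn]
    refine ⟨-(((j' : ℕ) + 1) / n : ℕ), ?_⟩
    have := Nat.mod_add_div ((j' : ℕ) + 1) n
    rw [h] at this
    have h2 : ((j' : ℕ) : ℝ) + 1 = (j : ℕ) + n * (((j' : ℕ) + 1) / n : ℕ) := by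
      exact_mod_cast this.symm
    rw [Int.cast_neg, Int.cast_natCast, h2]
    ring
  rw [hs] at h0
  exact (((continuous_sidePoint n j').tendsto 1).mono_left nhdsWithin_le_nhds).eventually h0

theorem side_coord_between (hn : 2 ≤ n) (T : Polygon γ) (j : Fin n) {g : ℝ × ℝ → ℝ}
    (hg : Continuous g) (hgi : Set.InjOn g {P | (γ j).across P = T.level j}) {r : ℝ}
    (hr : r ∈ Set.Ioo (0 : ℝ) 1) :
    (g (T.start j) < g (T.finish j) → g (T.start j) < g (T.u (sidePoint n j r)) ∧
      g (T.u (sidePoint n j r)) < g (T.finish j)) ∧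
    (g (T.finish j) < g (T.start j) → g (T.finish j) < g (T.u (sidePoint n j r)) ∧
      g (T.u (sidePoint n j r)) < g (T.start j)) := by
  have hi := T.side_coord_injOn hn j hg hgi
  have h0 : (0 : ℝ) ∈ Set.Icc (0 : ℝ) 1 := ⟨le_rfl, zero_le_one⟩
  have h1 : (1 : ℝ) ∈ Set.Icc (0 : ℝ) 1 := ⟨zero_le_one, le_rfl⟩
  have hr' := Set.Ioo_subset_Icc_self hr
  have him := (image_Icc_eq_uIcc_of_injOn (T.side_coord_continuous j hg).continuousOn hi).subset
    ⟨r, hr', rfl⟩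
  change g (T.u (sidePoint n j r)) ∈ Set.uIcc (g (T.start j)) (g (T.finish j)) at him
  have n0 : g (T.u (sidePoint n j r)) ≠ g (T.start j) := fun h => hr.1.ne' (hi hr' h0 h)
  have n1 : g (T.u (sidePoint n j r)) ≠ g (T.finish j) := fun h => hr.2.ne (hi hr' h1 h)
  constructor
  · intro h
    rw [Set.uIcc_of_le h.le] at him
    exact ⟨lt_of_le_of_ne him.1 n0.symm, lt_of_le_of_ne him.2 n1⟩
  · intro h
    rw [Set.uIcc_of_ge h.le] at him
    exact ⟨lt_of_le_of_ne him.1 n1.symm, lt_of_le_of_ne him.2 n0⟩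

theorem side_coord_ne (hn : 2 ≤ n) (T : Polygon γ) (j : Fin n) {g : ℝ × ℝ → ℝ}
    (hg : Continuous g) (hgi : Set.InjOn g {P | (γ j).across P = T.level j}) :
    g (T.start j) ≠ g (T.finish j) := fun h => by
  have := T.side_coord_injOn hn j hg hgi (x₁ := 0) (x₂ := 1) ⟨le_rfl, zero_le_one⟩
    ⟨zero_le_one, le_rfl⟩ h
  norm_num at this

end Polygon

namespace Wiggle

variable {γ₀ γ₁ γ₂ γ₃ : Curve} {l₀ l₁ l₂ : ℤ} {Fr : Frame γ₀ γ₁ γ₂ l₀ l₁ l₂} {f : ℝ → ℝ}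

/-- The corner between the first line and the curve is an upward crossing between the other two
lines. -/
theorem corner_between (W : Wiggle Fr f) (h₃ : Fr.IsGraph f γ₃) (hz : ∀ t, f t = 0 → t ∈ W.Rg)
    (T : Polygon ![γ₀, γ₁, γ₂, γ₃]) (hl : T.level = ![l₀, l₁, l₂, l₀]) :
    ∃ ty, T.start 0 = Fr.Ξ.symm (ty, 0) ∧ f ty = 0 ∧ Fr.tO < ty ∧ ty < Fr.tA ∧
      ∃ᶠ t in 𝓝[<] ty, f t ≤ 0 := by
  have h0 : (0 : ℝ) ∈ Set.Icc (0 : ℝ) 1 := ⟨le_rfl, zero_le_one⟩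
  have h1 : (1 : ℝ) ∈ Set.Icc (0 : ℝ) 1 := ⟨zero_le_one, le_rfl⟩
  have hmem : ∀ j : Fin 4, ∀ t ∈ Set.Icc (0 : ℝ) 1,
      (![γ₀, γ₁, γ₂, γ₃] j).across (T.u (sidePoint 4 j t)) = (![l₀, l₁, l₂, l₀] j : ℤ) :=
    fun j t ht => by rw [← hl]; exact T.side_mem j t ht
  have hs0 : ∀ j, (![γ₀, γ₁, γ₂, γ₃] j).across (T.start j) = (![l₀, l₁, l₂, l₀] j : ℤ) :=
    fun j => hmem j 0 h0
  have hs1 : ∀ j, (![γ₀, γ₁, γ₂, γ₃] j).across (T.finish j) = (![l₀, l₁, l₂, l₀] j : ℤ) :=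
    fun j => hmem j 1 h1
  have f0 : T.finish 0 = T.start 1 := T.finish_eq_start 0 1 rfl
  have f1 : T.finish 1 = T.start 2 := T.finish_eq_start 1 2 rfl
  have f2 : T.finish 2 = T.start 3 := T.finish_eq_start 2 3 rfl
  have f3 : T.finish 3 = T.start 0 := T.finish_eq_start 3 0 rfl
  have cA : T.start 1 = Fr.ptA := Fr.eq_ptA (f0 ▸ hs1 0) (hs0 1)
  have cB : T.start 2 = Fr.ptB := Fr.eq_ptB (f1 ▸ hs1 1) (hs0 2)
  have cO : T.start 3 = W.ptO' := W.eq_ptO' h₃ (f2 ▸ hs1 2) (hs0 3)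
  set ty := (Fr.Ξ (T.start 0)).1 with hty
  have hY2 : (Fr.Ξ (T.start 0)).2 = 0 := (Fr.across₀_eq_iff _).1 (hs0 0)
  have hfy : f ty = 0 := by
    have : γ₃.across (T.start 0) = l₀ := f3 ▸ hs1 3
    rw [h₃.across_eq_iff, hY2] at this
    exact this.symm
  have hYpt : T.start 0 = Fr.Ξ.symm (ty, 0) := by
    rw [Homeomorph.eq_symm_apply]
    exact Prod.ext rfl hY2
  have xA : Fr.Ξ Fr.ptA = (Fr.tA, 0) := by simp [Frame.ptA]
  have xB : Fr.Ξ Fr.ptB = (Fr.tO + Fr.κ₂ * Fr.cB, Fr.cB) := by simp [Frame.ptB]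
  have xO : Fr.Ξ W.ptO' = (Fr.tO + Fr.κ₂ * W.s, W.s) := by simp [ptO']
  have xY : Fr.Ξ (T.start 0) = (ty, 0) := Prod.ext rfl hY2
  have hIoo : Set.Ioo (0 : ℝ) 1 ∈ 𝓝[<] (1 : ℝ) := Ioo_mem_nhdsLT zero_lt_one
  have i0 : Set.InjOn (fun P => (Fr.Ξ P).1) {P | (![γ₀, γ₁, γ₂, γ₃] 0).across P = T.level 0} := by
    rw [hl]; exact Fr.coord_injOn₀
  have i1 : Set.InjOn (fun P => (Fr.Ξ P).2) {P | (![γ₀, γ₁, γ₂, γ₃] 1).across P = T.level 1} := by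
    rw [hl]; exact Fr.coord_injOn₁
  have i2 : Set.InjOn (fun P => (Fr.Ξ P).2) {P | (![γ₀, γ₁, γ₂, γ₃] 2).across P = T.level 2} := by
    rw [hl]; exact Fr.coord_injOn₂
  have i3 : Set.InjOn (fun P => (Fr.Ξ P).1) {P | (![γ₀, γ₁, γ₂, γ₃] 3).across P = T.level 3} := by
    rw [hl]; exact h₃.coord_injOn
  have c1 : Continuous fun P => (Fr.Ξ P).1 := by fun_prop
  have c2 : Continuous fun P => (Fr.Ξ P).2 := by fun_prop
  have k0 : Continuous γ₀.across := by rw [funext Fr.across₀]; fun_prop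
  have k1 : Continuous γ₁.across := by rw [funext Fr.across₁]; fun_prop
  have k2 : Continuous γ₂.across := by rw [funext Fr.across₂]; fun_prop
  have k3 : Continuous γ₃.across := by
    have := W.cont
    rw [funext h₃.across]; fun_prop
  have hcB := Fr.cB_neg
  -- the first side
  have hyA : ty < Fr.tA := by
    have hne := T.side_coord_ne (by norm_num) 0 c1 i0
    rw [f0, cA, xA, xY] at hne
    refine lt_of_le_of_ne (le_of_not_gt fun hgt => ?_) hne
    -- If `ty` were beyond `tA`, the first side would reach `A` from the wrong side of the second
    -- line.
    obtain ⟨r, hr, hle⟩ := ((T.prev_side_le 1 0 rfl k1).and hIoo).exists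
    have hb := (T.side_coord_between (by norm_num) 0 c1 i0 hle).2
    rw [f0, cA, xA, xY] at hb
    have hb' := (hb hgt).1
    have hm := (Fr.across₀_eq_iff _).1 (hmem 0 r (Set.Ioo_subset_Icc_self hle))
    rw [hl] at hr
    change (γ₁.along (T.finish 1) - γ₁.along (T.start 1)) *
      (γ₁.across (T.u (sidePoint 4 0 r)) - l₁) ≤ 0 at hr
    rw [Fr.right₁ (hs1 1) (hs0 1), f1, cA, cB, xA, xB] at hr
    have hm' : (Fr.Ξ (T.u (sidePoint 4 0 r))).2 = 0 := hm
    rw [hm'] at hr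
    have hb'' : Fr.tA < (Fr.Ξ (T.u (sidePoint 4 0 r))).1 := hb'
    simp only [mul_zero, sub_zero] at hr
    have : Fr.cB * ((Fr.Ξ (T.u (sidePoint 4 0 r))).1 - Fr.tA) < 0 :=
      mul_neg_of_neg_of_pos hcB (by linarith)
    nlinarith [mul_pos_of_neg_of_neg Fr.neg₁ this]
  -- the third side
  have hBs : Fr.cB < W.s := by
    have hne := T.side_coord_ne (by norm_num) 2 c2 i2
    rw [f2, cB, cO, xB, xO] at hne
    refine lt_of_le_of_ne (le_of_not_gt fun hgt => ?_) hne
    -- If the third side descended from `B`, the second side, which comes down to `B`, would arrive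
    -- on the wrong side of the third line.
    obtain ⟨r, hr, hle⟩ := ((T.prev_side_le 2 1 rfl k2).and hIoo).exists
    have hb := (T.side_coord_between (by norm_num) 1 c2 i1 hle).2
    rw [f1, cA, cB, xA, xB] at hb
    have hb' : Fr.cB < (Fr.Ξ (T.u (sidePoint 4 1 r))).2 := (hb hcB).1
    have hm : (Fr.Ξ (T.u (sidePoint 4 1 r))).1 = Fr.tA + Fr.κ₁ * (Fr.Ξ (T.u (sidePoint 4 1 r))).2 :=
      (Fr.across₁_eq_iff _).1 (hmem 1 r (Set.Ioo_subset_Icc_self hle))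
    rw [hl] at hr
    change (γ₂.along (T.finish 2) - γ₂.along (T.start 2)) *
      (γ₂.across (T.u (sidePoint 4 1 r)) - l₂) ≤ 0 at hr
    rw [Fr.right₂ (hs1 2) (hs0 2), f2, cB, cO, xB, xO] at hr
    have e : (Fr.Ξ (T.u (sidePoint 4 1 r))).1 - Fr.tO - Fr.κ₂ * (Fr.Ξ (T.u (sidePoint 4 1 r))).2 =
        (Fr.κ₁ - Fr.κ₂) * ((Fr.Ξ (T.u (sidePoint 4 1 r))).2 - Fr.cB) := by
      rw [hm]; linear_combination Fr.cB_mul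
    rw [e] at hr
    have hpos : 0 < (Fr.κ₁ - Fr.κ₂) * ((Fr.Ξ (T.u (sidePoint 4 1 r))).2 - Fr.cB) :=
      mul_pos (by linarith [Fr.κ_lt]) (by linarith)
    have : (W.s - Fr.cB) * ((Fr.κ₁ - Fr.κ₂) * ((Fr.Ξ (T.u (sidePoint 4 1 r))).2 - Fr.cB)) < 0 :=
      mul_neg_of_neg_of_pos (by linarith) hpos
    nlinarith [mul_pos_of_neg_of_neg Fr.neg₂ this]
  -- the fourth side
  have hOy : Fr.tO + Fr.κ₂ * W.s < ty := by
    have hne := T.side_coord_ne (by norm_num) 3 c1 i3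
    rw [f3, cO, xO, xY] at hne
    refine lt_of_le_of_ne (le_of_not_gt fun hgt => ?_) hne
    have hnear : ∀ᶠ r in 𝓝[<] (1 : ℝ), |(Fr.Ξ (T.u (sidePoint 4 2 r))).2| < W.δ := by
      have hc : Continuous fun r => |(Fr.Ξ (T.u (sidePoint 4 2 r))).2| := by
        have := T.side_coord_continuous 2 c2
        exact this.abs
      refine nhdsWithin_le_nhds ((isOpen_lt hc continuous_const).mem_nhds ?_)
      change |(Fr.Ξ (T.finish 2)).2| < W.δ
      rw [f2, cO, xO]
      exact W.abs_s_lt.trans W.lt_δ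
    -- If the fourth side ran to the left, its right-hand side would be above the graph, while the
    -- third side comes from below.
    obtain ⟨r, hr, hle, hnr⟩ := ((T.prev_side_le 3 2 rfl k3).and
      ((Filter.Eventually.and hIoo hnear))).exists
    have hb := (T.side_coord_between (by norm_num) 2 c2 i2 hle).1
    rw [f2, cB, cO, xB, xO] at hb
    have hb' : (Fr.Ξ (T.u (sidePoint 4 2 r))).2 < W.s := (hb hBs).2
    have hm : (Fr.Ξ (T.u (sidePoint 4 2 r))).1 = Fr.tO + Fr.κ₂ * (Fr.Ξ (T.u (sidePoint 4 2 r))).2 :=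
      (Fr.across₂_eq_iff _).1 (hmem 2 r (Set.Ioo_subset_Icc_self hle))
    rw [hl] at hr
    change (γ₃.along (T.finish 3) - γ₃.along (T.start 3)) *
      (γ₃.across (T.u (sidePoint 4 2 r)) - l₀) ≤ 0 at hr
    rw [h₃.right, f3, cO, xO, xY, hm, W.f_line₂ hnr] at hr
    have := mul_pos_of_neg_of_neg (a := ty - (Fr.tO + Fr.κ₂ * W.s))
      (b := (Fr.Ξ (T.u (sidePoint 4 2 r))).2 - W.s) (by linarith) (by linarith)
    linarith
  refine ⟨ty, hYpt, hfy, ?_, hyA, ?_⟩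
  · by_contra hn
    push Not at hn
    have hκ : Fr.κ₂ ≠ 0 := by rintro h0; rw [h0] at hOy; linarith
    -- If `ty` were between `tO + κ₂ s` and `tO`, it would be the abscissa of a point of the third
    -- line in the strip.
    refine W.avoid₂ ((ty - Fr.tO) / Fr.κ₂) ?_ (by
      rw [mul_div_cancel₀ _ hκ]; simpa using hz ty hfy)
    refine lt_of_le_of_lt ?_ (W.abs_s_lt.trans W.lt_δ)
    rw [abs_div, div_le_iff₀ (abs_pos.2 hκ), abs_of_nonpos (by linarith), ← abs_mul, mul_comm]
    exact le_trans (by linarith) (neg_le_abs _)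
  -- The fourth side approaches its end from the left, and convexity there keeps it on or below the
  -- first line.
  · have htend : Filter.Tendsto (fun r => (Fr.Ξ (T.u (sidePoint 4 3 r))).1) (𝓝[<] 1) (𝓝[<] ty) := by
      rw [tendsto_nhdsWithin_iff]
      constructor
      · have := ((T.side_coord_continuous 3 c1).tendsto 1).mono_left
          (nhdsWithin_le_nhds (s := Set.Iio 1))
        have e : (Fr.Ξ (T.u (sidePoint 4 ((3 : Fin 4) : ℕ) 1))).1 = ty := by
          change (Fr.Ξ (T.finish 3)).1 = ty
          rw [f3]
        rw [e] at this
        exact this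
      · filter_upwards [hIoo] with r hr
        have hb := (T.side_coord_between (by norm_num) 3 c1 i3 hr).1
        rw [f3, cO, xO, xY] at hb
        exact (hb hOy).2
    refine htend.frequently (Filter.Eventually.frequently ?_)
    filter_upwards [T.prev_side_le 0 3 rfl k0, hIoo] with r hr hr2
    have hm : (Fr.Ξ (T.u (sidePoint 4 3 r))).2 = f (Fr.Ξ (T.u (sidePoint 4 3 r))).1 :=
      (h₃.across_eq_iff _).1 (hmem 3 r (Set.Ioo_subset_Icc_self hr2))
    rw [hl] at hr
    change (γ₀.along (T.finish 0) - γ₀.along (T.start 0)) *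
      (γ₀.across (T.u (sidePoint 4 3 r)) - l₀) ≤ 0 at hr
    rw [Fr.right₀, f0, cA, xA, xY, hm] at hr
    by_contra hn
    push Not at hn
    have := mul_pos (a := Fr.tA - ty) (by linarith) hn
    linarith

end Wiggle

/-! ### Classes of polygons -/

theorem UAdicHasSum.of_bijective {I J : Type*} {e : I → J} (he : Function.Bijective e)
    {f : I → FUinv} {g : J → FUinv} (h : ∀ i, g (e i) = f i) {s : FUinv}
    (hs : UAdicHasSum f s) : UAdicHasSum g s := by
  refine ⟨fun N => ?_, fun n => ?_⟩
  · refine ((hs.1 N).image e).subset ?_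
    rintro j ⟨n, hn, hj⟩
    obtain ⟨i, rfl⟩ := he.2 j
    exact ⟨i, ⟨n, hn, by rwa [h] at hj⟩, rfl⟩
  · rw [hs.2 n]
    exact finsum_eq_of_bijective e he fun i => by rw [h]

namespace Polygon

variable {n : ℕ} {γ : Fin n → Curve}

/-- The sum over the classes of polygons, in terms of a complete set of representatives. -/
theorem uAdicHasSum_classes {I : Type*} (model : I → Polygon γ)
    (hsurj : ∀ T, ∃ i, Equivalent T (model i))
    (hinj : ∀ i j, Equivalent (model i) (model j) → i = j) {term : Polygon γ → FUinv}
    (hterm : ∀ T T', Equivalent T T' → term T = term T') {s : FUinv}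
    (h : UAdicHasSum (fun i => term (model i)) s) :
    UAdicHasSum (fun T : PolygonClass γ => term T.rep) s := by
  refine h.of_bijective (e := fun i => (Quotient.mk (polygonSetoid γ) (model i) : PolygonClass γ))
    ⟨fun i j hij => hinj i j (Quotient.exact hij), fun T => ?_⟩ fun i => ?_
  · obtain ⟨T, rfl⟩ := Quotient.exists_rep T
    obtain ⟨i, hi⟩ := hsurj T
    exact ⟨i, (Quotient.sound hi).symm⟩
  · exact hterm _ _ (Quotient.exact (s := polygonSetoid γ) (Quotient.out_eq _))

theorem Equivalent.mult_eq {T T' : Polygon γ} (h : Equivalent T T') (z : ℝ × ℝ) :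
    T.mult z = T'.mult z := by
  obtain ⟨φ, -, -, a, b, h3⟩ := h
  have ht : ∀ w, toTorus (T'.u (φ w)) = toTorus (T.u w) := fun w =>
    toTorus_eq_iff.2 ⟨(a, b), h3 w⟩
  refine Set.ncard_congr (fun w _ => φ w) (fun w hw => ?_) (fun w w' _ _ h => φ.injective h)
    (fun w hw => ⟨φ.symm w, ?_, by simp⟩)
  · exact (ht w).trans hw
  · have := ht (φ.symm w)
    rw [Homeomorph.apply_symm_apply] at this
    exact this.symm.trans hw

theorem Equivalent.exists_lattice {T T' : Polygon γ} (h : Equivalent T T') : ∃ m : ℤ × ℤ,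
    (∀ j, T'.start j = T.start j + ((m.1 : ℝ), (m.2 : ℝ))) ∧
    ∀ j, T'.finish j = T.finish j + ((m.1 : ℝ), (m.2 : ℝ)) := by
  obtain ⟨φ, h1, -, a, b, h3⟩ := h
  have hs : ∀ j, T'.start j = T.start j + ((a : ℝ), (b : ℝ)) := fun j => by
    have := h3 (sidePoint n j 0)
    rw [h1] at this
    exact this
  refine ⟨(a, b), hs, fun j => ?_⟩
  have hj : ((j : ℕ) + 1) % n < n := Nat.mod_lt _ (by have := j.2; omega)
  rw [T.finish_eq_start j ⟨_, hj⟩ rfl, T'.finish_eq_start j ⟨_, hj⟩ rfl, hs]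

/-- The translate of a polygon by a lattice vector. -/
theorem exists_translate (T : Polygon γ) (m : ℤ × ℤ) (A C : Fin n → ℤ)
    (hA : ∀ j P, (γ j).along (P + ((m.1 : ℝ), (m.2 : ℝ))) = (γ j).along P + A j)
    (hC : ∀ j P, (γ j).across (P + ((m.1 : ℝ), (m.2 : ℝ))) = (γ j).across P + C j) :
    ∃ T' : Polygon γ, Equivalent T T' ∧ T'.level = fun j => T.level j + C j := by
  refine ⟨⟨⟨fun w => T.u w + ((m.1 : ℝ), (m.2 : ℝ)), by fun_prop⟩, fun j => T.level j + C j,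
    fun V hV hV1 => ?_, fun w => ?_, fun j t ht => ?_, fun j t ht => ?_⟩, ?_, rfl⟩
  · have h := (Homeomorph.addRight ((m.1 : ℝ), (m.2 : ℝ))).isOpenMap _ (T.open_interior V hV hV1)
    rw [Set.image_image] at h
    exact h
  · obtain ⟨N, hN, h⟩ := T.locally_injective w
    exact ⟨N, hN, fun x hx y hy hxy => h hx hy (add_right_cancel hxy)⟩
  · have := T.side_mem j t ht
    simp only [ContinuousMap.coe_mk, hC, this]
    push_cast
    rfl
  · filter_upwards [T.right_side j t ht] with w hw hw1
    have := hw hw1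
    simp only [ContinuousMap.coe_mk, hC, hA]
    push_cast
    rw [add_sub_add_right_eq_sub, add_sub_add_right_eq_sub]
    exact this
  · exact ⟨Homeomorph.refl _, fun _ => rfl, fun _ => by simp, m.1, m.2, fun w => rfl⟩

/-- If two curves have at most one point in common in the universal cover, there are no bigons. -/
theorem isEmpty_bigon {γ₀ γ₁ : Curve} (h : ∀ l₀ l₁ : ℤ, ∀ P Q, γ₀.across P = l₀ → γ₁.across P = l₁ →
    γ₀.across Q = l₀ → γ₁.across Q = l₁ → P = Q) : IsEmpty (PolygonClass ![γ₀, γ₁]) := by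
  refine ⟨fun T => ?_⟩
  obtain ⟨T, -⟩ := Quotient.exists_rep T
  have h0 : (0 : ℝ) ∈ Set.Icc (0 : ℝ) 1 := ⟨le_rfl, zero_le_one⟩
  have h1 : (1 : ℝ) ∈ Set.Icc (0 : ℝ) 1 := ⟨zero_le_one, le_rfl⟩
  -- Both corners of a bigon lie on the same two lifts, so they would coincide.
  refine T.along_ne 0 (congrArg _ (h (T.level 0) (T.level 1) _ _ (T.side_mem 0 0 h0) ?_
    (T.side_mem 0 1 h1) ?_))
  · rw [← T.finish_eq_start 1 0 rfl]
    exact T.side_mem 1 1 h1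
  · rw [T.finish_eq_start 0 1 rfl]
    exact T.side_mem 1 0 h0

end Polygon

theorem uAdicHasSum_of_isEmpty {I : Type*} [IsEmpty I] (f : I → FUinv) : UAdicHasSum f 0 :=
  ⟨fun N => Set.toFinite _, fun n => by simp [finsum_of_isEmpty]⟩

end LocalComp
end

/-! ### Frames adapted to each of the three curves of the diagram -/

open Topology
noncomputable section
namespace LocalComp

/-! ### The triangles of the diagram -/

/-- The sign of `i + 1 / 2`. -/
def halfSign (i : ℤ) : ℝ := if 0 ≤ i then 1 else -1

theorem halfSign_mul_self (i : ℤ) : halfSign i * halfSign i = 1 := by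
  unfold halfSign; split_ifs <;> norm_num

theorem halfSign_mul_pos (i : ℤ) : 0 < halfSign i * ((i : ℝ) + 1 / 2) := by
  unfold halfSign
  split_ifs with h
  · have : (0 : ℝ) ≤ i := by exact_mod_cast h
    linarith
  · have : (i : ℝ) ≤ -1 := by exact_mod_cast (by omega : i ≤ -1)
    linarith

/-- The triangle cut out by the two axes and the `i`-th line. -/
def InRegion (p q : ℕ) (i : ℤ) (P : ℝ × ℝ) : Prop :=
  0 ≤ halfSign i * P.1 ∧ halfSign i * P.2 ≤ 0 ∧
    0 ≤ halfSign i * (q * P.2 - p * P.1 + i + 1 / 2)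

/-- The corner of the `i`-th triangle on the first axis. -/
def cornerA (p : ℕ) (i : ℤ) : ℝ × ℝ := (((i : ℝ) + 1 / 2) / p, 0)

/-- The corner of the `i`-th triangle on the second axis. -/
def cornerB (q : ℕ) (i : ℤ) : ℝ × ℝ := (0, -(((i : ℝ) + 1 / 2) / q))

/-- The homeomorphism of the plane given by two affine functions. -/
def planeHomeo (f g : ℝ × ℝ → ℝ × ℝ) (hf : Continuous f) (hg : Continuous g)
    (h : ∀ P, g (f P) = P) (h' : ∀ P, f (g P) = P) : ℝ × ℝ ≃ₜ ℝ × ℝ where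
  toFun := f
  invFun := g
  left_inv := h
  right_inv := h'
  continuous_toFun := hf
  continuous_invFun := hg

section

variable (p q : ℕ)

theorem gcd_combination (hpq : p.Coprime q) :
    (Nat.gcdA q p : ℝ) * q + (Nat.gcdB q p : ℝ) * p = 1 := by
  have h := Nat.gcd_eq_gcd_ab q p
  rw [Nat.Coprime.gcd_eq_one hpq.symm] at h
  have h2 : (((1 : ℕ) : ℤ) : ℝ) = ((q * Nat.gcdA q p + p * Nat.gcdB q p : ℤ) : ℝ) := by rw [h]
  push_cast at h2
  linarith

variable [NeZero p] [NeZero q]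

/-- The frame of the `i`-th triangle, based at the first axis. -/
def frameZero (hpq : p.Coprime q) (k : ℕ) (ε : ℝ) (i : ℤ) :
    Frame (beta0 p q k ε).toCurve (betaR p q).toCurve (betaInf p q k ε).toCurve 0 (-i) 0 where
  -- For `i < 0` the triangle is in the second quadrant; a half-turn brings it to the standard
  -- position below its first side.
  Ξ := planeHomeo (fun P => (halfSign i * P.1, halfSign i * P.2))
    (fun P => (halfSign i * P.1, halfSign i * P.2)) (by fun_prop) (by fun_prop)
    (fun P => by simp [← mul_assoc, halfSign_mul_self])
    (fun P => by simp [← mul_assoc, halfSign_mul_self])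
  σ := -halfSign i
  tO := 0
  tA := halfSign i * ((i : ℝ) + 1 / 2) / p
  κ₁ := q / p
  κ₂ := 0
  ν₁ := -p * halfSign i
  ν₂ := -halfSign i
  m₁ := halfSign i / p
  m₂ := halfSign i
  σ_mul_self := by linarith [halfSign_mul_self i]
  along₀ P := by
    change -P.1 = -halfSign i * (halfSign i * P.1)
    linear_combination P.1 * halfSign_mul_self i
  across₀ P := by
    change -P.2 = ((0 : ℤ) : ℝ) + -halfSign i * (halfSign i * P.2)
    push_cast
    linear_combination P.2 * halfSign_mul_self i
  across₁ P := by
    have hp : (p : ℝ) ≠ 0 := NeZero.ne _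
    change q * P.2 - p * P.1 + 1 / 2 = ((-i : ℤ) : ℝ) + -p * halfSign i *
      (halfSign i * P.1 - halfSign i * ((i : ℝ) + 1 / 2) / p - q / p * (halfSign i * P.2))
    push_cast
    field_simp
    linear_combination (2 * p * P.1 - 2 * q * P.2 - 2 * i - 1) * halfSign_mul_self i
  along₁ P Q hP hQ := by
    have hp : (p : ℝ) ≠ 0 := NeZero.ne _
    change q * P.2 - p * P.1 + 1 / 2 = _ at hP
    change q * Q.2 - p * Q.1 + 1 / 2 = _ at hQ
    change ((Nat.gcdA q p : ℝ) * P.1 + (Nat.gcdB q p : ℝ) * P.2) -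
      ((Nat.gcdA q p : ℝ) * Q.1 + (Nat.gcdB q p : ℝ) * Q.2) =
      halfSign i / p * (halfSign i * P.2 - halfSign i * Q.2)
    field_simp
    linear_combination (-(Nat.gcdA q p : ℝ)) * (hP - hQ) +
      (P.2 - Q.2) * gcd_combination p q hpq - (P.2 - Q.2) * halfSign_mul_self i
  neg₁ := by
    have hp : (p : ℝ) ≠ 0 := NeZero.ne _
    have : halfSign i / p * (-p * halfSign i) = -1 := by
      field_simp
      linear_combination -halfSign_mul_self i
    linarith
  across₂ P := by
    change -P.1 = ((0 : ℤ) : ℝ) + -halfSign i * (halfSign i * P.1 - 0 - 0 * (halfSign i * P.2))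
    push_cast
    linear_combination P.1 * halfSign_mul_self i
  along₂ P Q _ _ := by
    change P.2 - Q.2 = halfSign i * (halfSign i * P.2 - halfSign i * Q.2)
    linear_combination -(P.2 - Q.2) * halfSign_mul_self i
  neg₂ := by linarith [halfSign_mul_self i]
  tO_lt := div_pos (halfSign_mul_pos i) (by exact_mod_cast NeZero.pos p)
  κ_lt := div_pos (by exact_mod_cast NeZero.pos q) (by exact_mod_cast NeZero.pos p)

/-- The frame of the `i`-th triangle, based at the second axis. -/
def frameInf (hpq : p.Coprime q) (k : ℕ) (ε : ℝ) (i : ℤ) :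
    Frame (betaInf p q k ε).toCurve (beta0 p q k ε).toCurve (betaR p q).toCurve 0 0 (-i) where
  -- A quarter turn makes the second axis horizontal, again followed by a half-turn for `i < 0`.
  Ξ := planeHomeo (fun P => (halfSign i * P.2, -halfSign i * P.1))
    (fun P => (-halfSign i * P.2, halfSign i * P.1)) (by fun_prop) (by fun_prop)
    (fun P => by simp [← mul_assoc, halfSign_mul_self])
    (fun P => by simp [← mul_assoc, halfSign_mul_self])
  σ := halfSign i
  tO := -(halfSign i * ((i : ℝ) + 1 / 2) / q)
  tA := 0
  κ₁ := 0
  κ₂ := -(p / q)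
  ν₁ := -halfSign i
  ν₂ := q * halfSign i
  m₁ := halfSign i
  m₂ := -(halfSign i / q)
  σ_mul_self := by linarith [halfSign_mul_self i]
  along₀ P := by
    change P.2 = halfSign i * (halfSign i * P.2)
    linear_combination -P.2 * halfSign_mul_self i
  across₀ P := by
    change -P.1 = ((0 : ℤ) : ℝ) + halfSign i * (-halfSign i * P.1)
    push_cast
    linear_combination P.1 * halfSign_mul_self i
  across₂ P := by
    have hq : (q : ℝ) ≠ 0 := NeZero.ne _
    change q * P.2 - p * P.1 + 1 / 2 = ((-i : ℤ) : ℝ) + q * halfSign i *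
      (halfSign i * P.2 - -(halfSign i * ((i : ℝ) + 1 / 2) / q) - -(p / q) * (-halfSign i * P.1))
    push_cast
    field_simp
    linear_combination (2 * p * P.1 - 2 * q * P.2 - 2 * i - 1) * halfSign_mul_self i
  along₂ P Q hP hQ := by
    have hq : (q : ℝ) ≠ 0 := NeZero.ne _
    change q * P.2 - p * P.1 + 1 / 2 = _ at hP
    change q * Q.2 - p * Q.1 + 1 / 2 = _ at hQ
    change ((Nat.gcdA q p : ℝ) * P.1 + (Nat.gcdB q p : ℝ) * P.2) -
      ((Nat.gcdA q p : ℝ) * Q.1 + (Nat.gcdB q p : ℝ) * Q.2) =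
      -(halfSign i / q) * (-halfSign i * P.1 - -halfSign i * Q.1)
    field_simp
    linear_combination ((Nat.gcdB q p : ℝ)) * (hP - hQ) +
      (P.1 - Q.1) * gcd_combination p q hpq - (P.1 - Q.1) * halfSign_mul_self i
  neg₂ := by
    have hq : (q : ℝ) ≠ 0 := NeZero.ne _
    have : -(halfSign i / q) * (q * halfSign i) = -1 := by
      field_simp
      linear_combination -halfSign_mul_self i
    linarith
  across₁ P := by
    change -P.2 = ((0 : ℤ) : ℝ) + -halfSign i * (halfSign i * P.2 - 0 - 0 * (-halfSign i * P.1))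
    push_cast
    linear_combination P.2 * halfSign_mul_self i
  along₁ P Q _ _ := by
    change -P.1 - -Q.1 = halfSign i * (-halfSign i * P.1 - -halfSign i * Q.1)
    linear_combination (P.1 - Q.1) * halfSign_mul_self i
  neg₁ := by linarith [halfSign_mul_self i]
  tO_lt := neg_neg_of_pos (div_pos (halfSign_mul_pos i) (by exact_mod_cast NeZero.pos q))
  κ_lt := neg_neg_of_pos (div_pos (by exact_mod_cast NeZero.pos p) (by exact_mod_cast NeZero.pos q))

/-- The frame of the `i`-th triangle, based at the line of slope `p / q`. -/
def frameR (hpq : p.Coprime q) (k : ℕ) (ε : ℝ) (i : ℤ) :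
    Frame (betaR p q).toCurve (betaInf p q k ε).toCurve (beta0 p q k ε).toCurve (-i) 0 0 where
  -- These are, up to sign, the coordinates `along` and `across + i` of the sloped line; the Bézout
  -- identity says that the linear change of coordinates has determinant one.
  Ξ := planeHomeo
    (fun P => (-halfSign i * ((Nat.gcdA q p : ℝ) * P.1 + (Nat.gcdB q p : ℝ) * P.2),
      -halfSign i * (q * P.2 - p * P.1 + 1 / 2 + i)))
    (fun P => (q * (-halfSign i * P.1) - (Nat.gcdB q p : ℝ) * (-halfSign i * P.2 - 1 / 2 - i),
      p * (-halfSign i * P.1) + (Nat.gcdA q p : ℝ) * (-halfSign i * P.2 - 1 / 2 - i)))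
    (by fun_prop) (by fun_prop)
    (fun P => by
      have h1 := gcd_combination p q hpq
      have h2 := halfSign_mul_self i
      ext
      · simp only
        linear_combination (q * (Nat.gcdA q p * P.1 + Nat.gcdB q p * P.2) -
          Nat.gcdB q p * (q * P.2 - p * P.1 + 1 / 2 + i)) * h2 + P.1 * h1
      · simp only
        linear_combination (p * (Nat.gcdA q p * P.1 + Nat.gcdB q p * P.2) +
          Nat.gcdA q p * (q * P.2 - p * P.1 + 1 / 2 + i)) * h2 + P.2 * h1)
    (fun P => by
      have h1 := gcd_combination p q hpq
      have h2 := halfSign_mul_self i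
      ext
      · simp only
        linear_combination (halfSign i * halfSign i * P.1) * h1 + P.1 * h2
      · simp only
        linear_combination (halfSign i * (halfSign i * P.2 + 1 / 2 + i)) * h1 + P.2 * h2)
  σ := -halfSign i
  tO := -(halfSign i * (Nat.gcdA q p : ℝ) * ((i : ℝ) + 1 / 2) / p)
  tA := halfSign i * (Nat.gcdB q p : ℝ) * ((i : ℝ) + 1 / 2) / q
  κ₁ := (Nat.gcdB q p : ℝ) / q
  κ₂ := -((Nat.gcdA q p : ℝ) / p)
  ν₁ := q * halfSign i
  ν₂ := p * halfSign i
  m₁ := -(halfSign i / q)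
  m₂ := -(halfSign i / p)
  σ_mul_self := by linarith [halfSign_mul_self i]
  along₀ P := by
    change (Nat.gcdA q p : ℝ) * P.1 + (Nat.gcdB q p : ℝ) * P.2 =
      -halfSign i * (-halfSign i * ((Nat.gcdA q p : ℝ) * P.1 + (Nat.gcdB q p : ℝ) * P.2))
    linear_combination -((Nat.gcdA q p : ℝ) * P.1 + (Nat.gcdB q p : ℝ) * P.2) * halfSign_mul_self i
  across₀ P := by
    change q * P.2 - p * P.1 + 1 / 2 = ((-i : ℤ) : ℝ) + -halfSign i *
      (-halfSign i * (q * P.2 - p * P.1 + 1 / 2 + i))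
    push_cast
    linear_combination -(q * P.2 - p * P.1 + 1 / 2 + i) * halfSign_mul_self i
  across₁ P := by
    have hq : (q : ℝ) ≠ 0 := NeZero.ne _
    have h1 := gcd_combination p q hpq
    have h2 := halfSign_mul_self i
    change -P.1 = ((0 : ℤ) : ℝ) + q * halfSign i *
      (-halfSign i * ((Nat.gcdA q p : ℝ) * P.1 + (Nat.gcdB q p : ℝ) * P.2) -
        halfSign i * (Nat.gcdB q p : ℝ) * ((i : ℝ) + 1 / 2) / q - (Nat.gcdB q p : ℝ) / q *
          (-halfSign i * (q * P.2 - p * P.1 + 1 / 2 + i)))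
    push_cast
    field_simp
    linear_combination (2 * P.1 * halfSign i * halfSign i) * h1 + 2 * P.1 * h2
  along₁ P Q hP hQ := by
    have hq : (q : ℝ) ≠ 0 := NeZero.ne _
    have h2 := halfSign_mul_self i
    change -P.1 = _ at hP
    change -Q.1 = _ at hQ
    change P.2 - Q.2 = -(halfSign i / q) * (-halfSign i * (q * P.2 - p * P.1 + 1 / 2 + i) -
      -halfSign i * (q * Q.2 - p * Q.1 + 1 / 2 + i))
    field_simp
    linear_combination (-(2 * q * (P.2 - Q.2)) + p * (P.1 - Q.1)) * h2 -
      (p + p * halfSign i * halfSign i) * (hP - hQ)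
  neg₁ := by
    have hq : (q : ℝ) ≠ 0 := NeZero.ne _
    have : -(halfSign i / q) * (q * halfSign i) = -1 := by
      field_simp
      linear_combination -halfSign_mul_self i
    linarith
  across₂ P := by
    have hp : (p : ℝ) ≠ 0 := NeZero.ne _
    have h1 := gcd_combination p q hpq
    have h2 := halfSign_mul_self i
    change -P.2 = ((0 : ℤ) : ℝ) + p * halfSign i *
      (-halfSign i * ((Nat.gcdA q p : ℝ) * P.1 + (Nat.gcdB q p : ℝ) * P.2) -
        -(halfSign i * (Nat.gcdA q p : ℝ) * ((i : ℝ) + 1 / 2) / p) - -((Nat.gcdA q p : ℝ) / p) *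
          (-halfSign i * (q * P.2 - p * P.1 + 1 / 2 + i)))
    push_cast
    field_simp
    linear_combination (2 * P.2 * halfSign i * halfSign i) * h1 + 2 * P.2 * h2
  along₂ P Q hP hQ := by
    have hp : (p : ℝ) ≠ 0 := NeZero.ne _
    have h2 := halfSign_mul_self i
    change -P.2 = _ at hP
    change -Q.2 = _ at hQ
    change -P.1 - -Q.1 = -(halfSign i / p) * (-halfSign i * (q * P.2 - p * P.1 + 1 / 2 + i) -
      -halfSign i * (q * Q.2 - p * Q.1 + 1 / 2 + i))
    field_simp
    linear_combination (-(q * (P.2 - Q.2)) + 2 * p * (P.1 - Q.1)) * h2 +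
      (q + q * halfSign i * halfSign i) * (hP - hQ)
  neg₂ := by
    have hp : (p : ℝ) ≠ 0 := NeZero.ne _
    have : -(halfSign i / p) * (p * halfSign i) = -1 := by
      field_simp
      linear_combination -halfSign_mul_self i
    linarith
  tO_lt := by
    have hp : (0 : ℝ) < p := by exact_mod_cast NeZero.pos p
    have hq : (0 : ℝ) < q := by exact_mod_cast NeZero.pos q
    rw [← sub_pos]
    have : halfSign i * (Nat.gcdB q p : ℝ) * ((i : ℝ) + 1 / 2) / q -
        -(halfSign i * (Nat.gcdA q p : ℝ) * ((i : ℝ) + 1 / 2) / p) =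
        halfSign i * ((i : ℝ) + 1 / 2) / (p * q) := by
      field_simp
      linear_combination (halfSign i * (2 * i + 1)) * gcd_combination p q hpq
    rw [this]
    exact div_pos (halfSign_mul_pos i) (mul_pos hp hq)
  κ_lt := by
    have hp : (0 : ℝ) < p := by exact_mod_cast NeZero.pos p
    have hq : (0 : ℝ) < q := by exact_mod_cast NeZero.pos q
    rw [← sub_pos]
    have : (Nat.gcdB q p : ℝ) / q - -((Nat.gcdA q p : ℝ) / p) = 1 / (p * q) := by
      field_simp
      linear_combination gcd_combination p q hpq
    rw [this]
    positivity

end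

end LocalComp
end

/-! ### The counting maps as sums over integer indices -/

open Topology
noncomputable section
namespace LocalComp

/-! ### Deck transformations -/

/-- The vector of `ℤ²` that corresponds to a deck transformation. -/
def latticeVec (m : ℤ × ℤ) : ℝ × ℝ := ((m.1 : ℝ), (m.2 : ℝ))

theorem toTorus_add_latticeVec (P : ℝ × ℝ) (m : ℤ × ℤ) :
    toTorus (P + latticeVec m) = toTorus P := toTorus_eq_iff.2 ⟨m, rfl⟩

theorem coeffAt_add_latticeVec {ι κ : Type} {α : LCurve ι} {β : LCurve κ} (ψ : CF α β)
    (P : ℝ × ℝ) (m : ℤ × ℤ) : coeffAt ψ (P + latticeVec m) = coeffAt ψ P := by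
  have key : ∀ {x y : T2}, x = y → (open Classical in
      (if h : x ∈ α.toCurve.carrier ∩ β.toCurve.carrier then ψ ⟨x, h⟩ else 0) =
      if h : y ∈ α.toCurve.carrier ∩ β.toCurve.carrier then ψ ⟨y, h⟩ else 0) := by
    rintro x _ rfl; rfl
  exact key (toTorus_add_latticeVec P m)

/-- Deck transformations change the coordinates of the curve by the integers `A m` and `C m`. -/
structure Curve.IsEquivariant (γ : Curve) (A C : ℤ × ℤ → ℤ) : Prop where
  along : ∀ m P, γ.along (P + latticeVec m) = γ.along P + A m
  across : ∀ m P, γ.across (P + latticeVec m) = γ.across P + C m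

theorem Curve.IsEquivariant.translate {ι : Type} {α : LCurve ι} {A C : ℤ × ℤ → ℤ}
    (h : α.toCurve.IsEquivariant A C) {f : ℝ → ℝ} (hf : Function.Periodic f 1) :
    (α.translate f).toCurve.IsEquivariant A C where
  along := h.along
  across m P := by
    have := hf.int_mul (A m) (α.along P)
    rw [mul_one] at this
    change α.across _ - f (α.along _) = α.across P - f (α.along P) + C m
    rw [h.along, h.across, this]
    ring

theorem LCurve.crossings_add_latticeVec {ι : Type} {α : LCurve ι} {A C : ℤ × ℤ → ℤ}
    (h : α.toCurve.IsEquivariant A C) (P Q : ℝ × ℝ) (m : ℤ × ℤ) :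
    α.crossings (P + latticeVec m) (Q + latticeVec m) = α.crossings P Q := by
  have key : ∀ P, ⌊α.along (P + latticeVec m) - α.arc⌋ = ⌊α.along P - α.arc⌋ + A m := fun P => by
    rw [h.along, add_sub_right_comm, Int.floor_add_intCast]
  rw [LCurve.crossings, LCurve.crossings, key, key]
  ring

/-- Any pair that witnesses nearness can be moved by a deck transformation so that its second point
is `P'`. The first point then lies on the same two lifts as `P`, and these meet only once, so the
sum has one term. -/
theorem coeffAt_nearestPointMap {ι κ : Type} {γ : LCurve κ} {α : LCurve ι} {f : ℝ → ℝ}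
    (ψ : CF γ α) {A C A' C' : ℤ × ℤ → ℤ} (hγ : γ.toCurve.IsEquivariant A C)
    (hα : α.toCurve.IsEquivariant A' C') (hf : Function.Periodic f 1) {P P' : ℝ × ℝ} {l l' : ℤ}
    (h1 : γ.across P = l) (h2 : γ.across P' = l) (h3 : α.across P = l')
    (h4 : (α.translate f).across P' = l')
    (huniq : ∀ R, γ.across R = l → α.across R = l' → R = P) :
    coeffAt (nearestPointMap f ψ) P' = coeffAt ψ P := by
  have hP : toTorus P ∈ γ.toCurve.carrier ∩ α.toCurve.carrier := ⟨⟨P, ⟨l, h1⟩, rfl⟩, ⟨P, ⟨l', h3⟩, rfl⟩⟩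
  have hP' : toTorus P' ∈ γ.toCurve.carrier ∩ (α.translate f).toCurve.carrier :=
    ⟨⟨P', ⟨l, h2⟩, rfl⟩, ⟨P', ⟨l', h4⟩, rfl⟩⟩
  rw [coeffAt, coeffAt, dif_pos hP, dif_pos hP', nearestPointMap]
  refine (finsum_eq_single (fun x : ↥(γ.toCurve.carrier ∩ α.toCurve.carrier) =>
    ∑ᶠ _ : IsNearest γ α f x (toTorus P'), ψ x) ⟨toTorus P, hP⟩ ?_).trans ?_
  rotate_left
  · have : IsNearest γ α f (toTorus P) (toTorus P') :=
      ⟨P, P', rfl, rfl, ⟨l, h1, h2⟩, ⟨l', h3, h4⟩⟩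
    simp [this]
  · rintro ⟨x, hx⟩ hne
    suffices hn : ¬ IsNearest γ α f x (toTorus P') by
      have : IsEmpty (IsNearest γ α f x (toTorus P')) := ⟨hn⟩
      exact finsum_of_isEmpty _
    refine fun hn => hne ?_
    obtain ⟨R, R', rfl, hR', ⟨a, ha, ha'⟩, ⟨b, hb, hb'⟩⟩ := hn
    obtain ⟨m, hm⟩ := toTorus_eq_iff.1 hR'
    change R' = P' + latticeVec m at hm
    have hRm : R - latticeVec m + latticeVec m = R := sub_add_cancel _ _
    have := huniq (R - latticeVec m) ?_ ?_
    · rw [Subtype.mk.injEq, ← hRm, this, toTorus_add_latticeVec]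
    · have e1 := hγ.across m (R - latticeVec m)
      have e2 := hγ.across m P'
      rw [hRm] at e1
      rw [← hm] at e2
      linarith
    · have e1 := hα.across m (R - latticeVec m)
      have e2 := (hα.translate hf).across m P'
      rw [hRm] at e1
      rw [← hm] at e2
      linarith

/-! ### Systems of triangles -/

/-- Three curves and a family of frames that represents every triple of lifts of the curves exactly
once up to deck transformations. -/
structure TriangleSystem (γ₀ γ₁ γ₂ : Curve) where
  (A₀ C₀ A₁ C₁ A₂ C₂ : ℤ × ℤ → ℤ)
  eqv₀ : γ₀.IsEquivariant A₀ C₀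
  eqv₁ : γ₁.IsEquivariant A₁ C₁
  eqv₂ : γ₂.IsEquivariant A₂ C₂
  (l₀ l₁ l₂ : ℤ → ℤ)
  frame : ∀ i, Frame γ₀ γ₁ γ₂ (l₀ i) (l₁ i) (l₂ i)
  surj : ∀ a b c, ∃ m i, a + C₀ m = l₀ i ∧ b + C₁ m = l₁ i ∧ c + C₂ m = l₂ i
  inj : ∀ i i' m, l₀ i' = l₀ i + C₀ m → l₁ i' = l₁ i + C₁ m → l₂ i' = l₂ i + C₂ m → i = i' ∧ m = 0
  -- This makes all lifts of `Θ⁺` equivalent under deck transformations.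
  basis : ∀ a c, ∃ m, A₀ m = a ∧ C₀ m = c

namespace TriangleSystem

section Triangles

variable {γ₀ γ₁ γ₂ : Curve} (S : TriangleSystem γ₀ γ₁ γ₂)

/-- A deck transformation normalizes the levels, and the levels determine the triangle. -/
theorem exists_equivalent_triangle (T : Polygon ![γ₀, γ₁, γ₂]) :
    ∃ i, Polygon.Equivalent T (S.frame i).triangle := by
  obtain ⟨m, i, h0, h1, h2⟩ := S.surj (T.level 0) (T.level 1) (T.level 2)
  obtain ⟨T', hT', hl⟩ := T.exists_translate m ![S.A₀ m, S.A₁ m, S.A₂ m] ![S.C₀ m, S.C₁ m, S.C₂ m]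
    (fun j P => by
      fin_cases j
      exacts [S.eqv₀.along m P, S.eqv₁.along m P, S.eqv₂.along m P])
    (fun j P => by
      fin_cases j
      exacts [S.eqv₀.across m P, S.eqv₁.across m P, S.eqv₂.across m P])
  refine ⟨i, Polygon.equivalent_equivalence.trans hT' ((S.frame i).equivalent_triangle T' ?_)⟩
  rw [hl]
  funext j
  fin_cases j
  exacts [h0, h1, h2]

theorem level_eq_add {n : ℕ} {γ : Fin n → Curve} {T T' : Polygon γ} {m : ℤ × ℤ}
    (h : ∀ j, T'.start j = T.start j + latticeVec m) (j : Fin n) {A C : ℤ × ℤ → ℤ}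
    (hj : (γ j).IsEquivariant A C) : T'.level j = T.level j + C m := by
  have h0 : (0 : ℝ) ∈ Set.Icc (0 : ℝ) 1 := ⟨le_rfl, zero_le_one⟩
  have e1 := T.side_mem j 0 h0
  have e2 := T'.side_mem j 0 h0
  change (γ j).across (T'.start j) = _ at e2
  rw [h, hj.across, Polygon.start, e1] at e2
  exact_mod_cast e2.symm

theorem triangle_injective (i i' : ℤ)
    (h : Polygon.Equivalent (S.frame i).triangle (S.frame i').triangle) : i = i' := by
  obtain ⟨m, hs, -⟩ := h.exists_lattice
  refine (S.inj i i' m ?_ ?_ ?_).1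
  · simpa [Frame.triangle_level] using level_eq_add hs 0 S.eqv₀
  · simpa [Frame.triangle_level] using level_eq_add hs 1 S.eqv₁
  · simpa [Frame.triangle_level] using level_eq_add hs 2 S.eqv₂

end Triangles

section Mu2

variable {ι₀ ι₁ ι₂ : Type} [Fintype ι₀] [DecidableEq ι₀] [Fintype ι₁] [DecidableEq ι₁]
  [Fintype ι₂] [DecidableEq ι₂] {α₀ : LCurve ι₀} {α₁ : LCurve ι₁} {α₂ : LCurve ι₂}

open Classical in
/-- The triangle counting map is a sum over the frames of the system. -/
theorem isMu2 (S : TriangleSystem α₀.toCurve α₁.toCurve α₂.toCurve) {z : ℝ × ℝ} {ψ₁ : CF α₀ α₁}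
    {ψ₂ : CF α₁ α₂} {M : CF α₀ α₂}
    (h : ∀ (y : ↥(α₀.toCurve.carrier ∩ α₂.toCurve.carrier)) a b, UAdicHasSum (fun i : ℤ =>
      if toTorus (S.frame i).ptO = (y : T2) then
        (Uvar ^ Set.ncard {m : ℤ × ℤ | (S.frame i).InTriangle ((S.frame i).Ξ (z + latticeVec m))} •
          (α₂.mono ^ α₂.crossings (S.frame i).ptB (S.frame i).ptO *
            coeffAt ψ₂ (S.frame i).ptB *
            α₁.mono ^ α₁.crossings (S.frame i).ptA (S.frame i).ptB *
            coeffAt ψ₁ (S.frame i).ptA *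
            α₀.mono ^ α₀.crossings (S.frame i).ptO (S.frame i).ptA)) a b
      else 0) (M y a b)) : IsMu2 z α₀ α₁ α₂ ψ₁ ψ₂ M := by
  intro y a b
  refine Polygon.uAdicHasSum_classes (fun i => (S.frame i).triangle) S.exists_equivalent_triangle
    S.triangle_injective (term := fun T => if toTorus (T.start 0) = (y : T2) then
        (Uvar ^ T.mult z •
          (α₂.mono ^ α₂.crossings (T.start 2) (T.finish 2) *
            coeffAt ψ₂ (T.start 2) *
            α₁.mono ^ α₁.crossings (T.start 1) (T.finish 1) *
            coeffAt ψ₁ (T.start 1) *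
            α₀.mono ^ α₀.crossings (T.start 0) (T.finish 0))) a b
      else 0) ?_ ?_
  · intro T T' hT
    obtain ⟨m, hs, hf⟩ := hT.exists_lattice
    change ∀ j, T'.start j = T.start j + latticeVec m at hs
    change ∀ j, T'.finish j = T.finish j + latticeVec m at hf
    simp only [hs, hf, hT.mult_eq z, toTorus_add_latticeVec, coeffAt_add_latticeVec,
      LCurve.crossings_add_latticeVec S.eqv₀, LCurve.crossings_add_latticeVec S.eqv₁,
      LCurve.crossings_add_latticeVec S.eqv₂]
  · convert h y a b using 2 with i
    obtain ⟨s0, s1, s2⟩ := (S.frame i).triangle_start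
    have f0 := (S.frame i).triangle.finish_eq_start 0 1 rfl
    have f1 := (S.frame i).triangle.finish_eq_start 1 2 rfl
    have f2 := (S.frame i).triangle.finish_eq_start 2 0 rfl
    simp only [s0, s1, s2, f0, f1, f2, Frame.mult_triangle]
    rfl

end Mu2

end TriangleSystem

end LocalComp
end

open Topology
noncomputable section
namespace LocalComp

/-! ### Standard translates -/

/-- The properties of a standard translate that are used to find the quadrilaterals. -/
structure TranslateData (γ₀ γ₁ γ₂ : Curve) (ε : ℝ) (f : ℝ → ℝ) (tp : ℝ) where
  (δ δ' s : ℝ)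
  Rg : Set ℝ
  cont : Continuous f
  periodic : Function.Periodic f 1
  bdd : ∀ t, |f t| < δ'
  lt_δ : δ' < δ
  le_ε : δ ≤ ε
  flat : ∀ t, t ∉ Rg → f t = s
  avoid : ∀ P, (∃ m : ℤ, |γ₀.across P - m| < δ) → γ₀.along P ∈ Rg →
    ∀ m : ℤ, γ₁.across P ≠ m ∧ γ₂.across P ≠ m
  zero_mem : ∀ t, f t = 0 → t ∈ Rg
  zero : ∀ h : ℤ, f (tp + h) = 0
  left : ∀ h : ℤ, ∀ᶠ t in 𝓝[<] (tp + h), f t < 0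
  right : ∀ h : ℤ, ∀ᶠ t in 𝓝[>] (tp + h), 0 < f t
  zero_cases : ∀ t, f t = 0 → (∃ h : ℤ, t = tp + h) ∨
    (∀ᶠ t' in 𝓝[<] t, 0 < f t') ∧ ∀ᶠ t' in 𝓝[>] t, f t' < 0

/-- By periodicity the zeros of `f` are the integral translates of `tPlus` and `tMinus`, and the
signs on the two intervals between them tell which crossings are upward. -/
theorem IsStandardTranslate.nonempty_translateData {γ₀ γ₁ γ₂ : Curve} {ε c : ℝ} {f : ℝ → ℝ} {tp : ℝ}
    (h : IsStandardTranslate γ₀ γ₁ γ₂ ε c f tp) : Nonempty (TranslateData γ₀ γ₁ γ₂ ε f tp) := by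
  obtain ⟨hc, hper, δ, ρ, s, tm, hδ, hρ, hb, ht, z1, z2, pos, neg, flat, av⟩ := h
  have hshift : ∀ (m : ℤ) t, f (t + m) = f t := fun m t => by simpa using hper.int_mul m t
  have hshift' : ∀ (m : ℤ) t, f (t - m) = f t := fun m t => by
    have := hshift m (t - m); rw [sub_add_cancel] at this; exact this.symm
  have h1 : tp < tm ∧ tm < tp + 1 := by rcases ht with ht | ht <;> constructor <;> linarith
  obtain ⟨x0, -, hx0⟩ := (isCompact_Icc (a := (0 : ℝ)) (b := 1)).exists_isMaxOn ⟨0, by simp⟩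
    (hc.abs.continuousOn)
  have hmax : ∀ t, |f t| ≤ |f x0| := fun t => by
    rw [← hshift' ⌊t⌋ t]
    exact hx0 ⟨by linarith [Int.floor_le t], by linarith [Int.lt_floor_add_one t]⟩
  have hposm : ∀ (m : ℤ) t, tp + m < t → t < tm + m → 0 < f t := fun m t h h' => by
    rw [← hshift' m t]; exact pos _ ⟨by linarith, by linarith⟩
  have hnegm : ∀ (m : ℤ) t, tm + m < t → t < tp + 1 + m → f t < 0 := fun m t h h' => by
    rw [← hshift' m t]; exact neg _ ⟨by linarith, by linarith⟩
  have hnegm' : ∀ (m : ℤ) t, tm - 1 + m < t → t < tp + m → f t < 0 := fun m t h h' =>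
    hnegm (m - 1) t (by push_cast; linarith) (by push_cast; linarith)
  have hcases : ∀ t, f t = 0 → ∃ m : ℤ, t = tp + m ∨ t = tm + m := fun t h0 => by
    refine ⟨⌊t - tp⌋, ?_⟩
    have e1 := Int.floor_le (t - tp)
    have e2 := Int.lt_floor_add_one (t - tp)
    rcases lt_trichotomy t (tm + ⌊t - tp⌋) with hlt | he | hgt
    · left
      by_contra hne
      have := hposm ⌊t - tp⌋ t (lt_of_le_of_ne (by linarith) (Ne.symm hne)) hlt
      linarith
    · exact Or.inr he
    · have := hnegm ⌊t - tp⌋ t hgt (by linarith)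
      linarith
  -- A continuous periodic function attains the maximum of its absolute value, so there is room for
  -- a second bound strictly below `δ`.
  refine ⟨⟨δ, (|f x0| + δ) / 2, s, {t | ∃ m : ℤ, |t - c - m| < ρ}, hc, hper, fun t => ?_, ?_, hδ,
    fun t ht' => ?_, av, fun t h0 => ?_, fun m => by rw [hshift, z1], fun m => ?_, fun m => ?_,
    fun t h0 => ?_⟩⟩
  · linarith [hmax t, hb x0]
  · linarith [hb x0]
  · simp only [Set.mem_ofPred_eq, not_exists, not_lt] at ht'
    rw [← hshift' ⌊t - c⌋ t]
    have e1 := Int.floor_le (t - c)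
    have e2 := Int.lt_floor_add_one (t - c)
    have a1 := ht' ⌊t - c⌋
    have a2 := ht' (⌊t - c⌋ + 1)
    rw [abs_of_nonneg (by linarith)] at a1
    push_cast at a2
    rw [abs_of_neg (by linarith)] at a2
    exact flat _ ⟨by linarith, by linarith⟩
  · obtain ⟨m, rfl | rfl⟩ := hcases t h0
    · exact ⟨m, by rw [abs_lt]; rcases ht with ht | ht <;> constructor <;> linarith⟩
    · rcases ht with ht | ht
      · exact ⟨m, by rw [abs_lt]; constructor <;> linarith⟩
      · exact ⟨m + 1, by rw [abs_lt]; push_cast; constructor <;> linarith⟩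
  · filter_upwards [Ioo_mem_nhdsLT (show tm - 1 + m < tp + m by linarith)] with t ht'
    exact hnegm' m t ht'.1 ht'.2
  · filter_upwards [Ioo_mem_nhdsGT (show tp + m < tm + m by linarith)] with t ht'
    exact hposm m t ht'.1 ht'.2
  · obtain ⟨m, rfl | rfl⟩ := hcases t h0
    · exact Or.inl ⟨m, rfl⟩
    · refine Or.inr ⟨?_, ?_⟩
      · filter_upwards [Ioo_mem_nhdsLT (show tp + m < tm + m by linarith)] with t ht'
        exact hposm m t ht'.1 ht'.2
      · filter_upwards [Ioo_mem_nhdsGT (show tm + m < tp + 1 + m by linarith)] with t ht'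
        exact hnegm m t ht'.1 ht'.2

theorem Frame.σ_eq {γ₀ γ₁ γ₂ : Curve} {l₀ l₁ l₂ : ℤ} (Fr : Frame γ₀ γ₁ γ₂ l₀ l₁ l₂) :
    Fr.σ = 1 ∨ Fr.σ = -1 := mul_self_eq_one_iff.1 Fr.σ_mul_self

theorem Frame.σ_σ_mul {γ₀ γ₁ γ₂ : Curve} {l₀ l₁ l₂ : ℤ} (Fr : Frame γ₀ γ₁ γ₂ l₀ l₁ l₂) (x : ℝ) :
    Fr.σ * (Fr.σ * x) = x := by rw [← mul_assoc, Fr.σ_mul_self, one_mul]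

theorem Frame.abs_σ_mul {γ₀ γ₁ γ₂ : Curve} {l₀ l₁ l₂ : ℤ} (Fr : Frame γ₀ γ₁ γ₂ l₀ l₁ l₂) (x : ℝ) :
    |Fr.σ * x| = |x| := by rcases Fr.σ_eq with h | h <;> simp [h]

namespace TranslateData

variable {γ₀ γ₁ γ₂ : Curve} {ε : ℝ} {f : ℝ → ℝ} {tp : ℝ} (D : TranslateData γ₀ γ₁ γ₂ ε f tp)
  {l₀ l₁ l₂ : ℤ} (Fr : Frame γ₀ γ₁ γ₂ l₀ l₁ l₂)

/-- The translate in the coordinates of a frame. -/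
def wiggle : Wiggle Fr (fun t => Fr.σ * f (Fr.σ * t)) where
  δ := D.δ
  δ' := D.δ'
  s := Fr.σ * D.s
  Rg := {t | Fr.σ * t ∈ D.Rg}
  cont := continuous_const.mul (D.cont.comp (continuous_const.mul continuous_id))
  bdd t := by rw [Fr.abs_σ_mul]; exact D.bdd _
  lt_δ := D.lt_δ
  flat t ht := by rw [D.flat _ ht]
  avoid₁ c hc h := by
    refine (D.avoid (Fr.Ξ.symm (Fr.tA + Fr.κ₁ * c, c)) ⟨l₀, ?_⟩ ?_ l₁).1 ?_
    · rw [Fr.across₀, Homeomorph.apply_symm_apply, add_sub_cancel_left, Fr.abs_σ_mul]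
      exact hc
    · rw [Fr.along₀, Homeomorph.apply_symm_apply]
      exact h
    · rw [Fr.across₁, Homeomorph.apply_symm_apply]
      ring
  avoid₂ c hc h := by
    refine (D.avoid (Fr.Ξ.symm (Fr.tO + Fr.κ₂ * c, c)) ⟨l₀, ?_⟩ ?_ l₂).2 ?_
    · rw [Fr.across₀, Homeomorph.apply_symm_apply, add_sub_cancel_left, Fr.abs_σ_mul]
      exact hc
    · rw [Fr.along₀, Homeomorph.apply_symm_apply]
      exact h
    · rw [Fr.across₂, Homeomorph.apply_symm_apply]
      ring

/-- The quadrilateral data for an intersection point over `Θ⁺`. -/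
def quadData (h : ℤ) (h1 : Fr.tO < Fr.σ * (tp + h)) (h2 : Fr.σ * (tp + h) < Fr.tA) :
    QuadData Fr (fun t => Fr.σ * f (Fr.σ * t)) where
  toWiggle := D.wiggle Fr
  ty := Fr.σ * (tp + h)
  ty_mem := by
    change Fr.σ * (Fr.σ * _) ∈ D.Rg
    rw [Fr.σ_σ_mul]
    exact D.zero_mem _ (D.zero h)
  ty_gt := h1
  ty_lt := h2
  zero := by rw [Fr.σ_σ_mul, D.zero, mul_zero]
  left := by
    -- For `σ = -1` the graph is turned by a half-turn, which exchanges left and right and changes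
    -- the sign: upward crossings stay upward.
    rcases Fr.σ_eq with hσ | hσ
    · simpa [hσ] using D.left h
    · have := (tendsto_neg_nhdsLT (a := -(tp + h))).eventually (by simpa using D.right h)
      simpa [hσ] using this
  right := by
    rcases Fr.σ_eq with hσ | hσ
    · simpa [hσ] using D.right h
    · have := (tendsto_neg_nhdsGT (a := -(tp + h))).eventually (by simpa using D.left h)
      simpa [hσ] using this

/-- The other kind of zero is a downward crossing, which has positive values on its left. -/
theorem exists_eq_of_zero (D : TranslateData γ₀ γ₁ γ₂ ε f tp) {t : ℝ} (h0 : Fr.σ * f (Fr.σ * t) = 0)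
    (hl : ∃ᶠ x in 𝓝[<] t, Fr.σ * f (Fr.σ * x) ≤ 0) : ∃ h : ℤ, t = Fr.σ * (tp + h) := by
  have h0' : f (Fr.σ * t) = 0 := by simpa [Fr.σ_ne] using h0
  rcases D.zero_cases _ h0' with ⟨h, hh⟩ | ⟨hL, hR⟩
  · exact ⟨h, by rw [← hh, Fr.σ_σ_mul]⟩
  · refine (hl ?_).elim
    rcases Fr.σ_eq with hσ | hσ
    · rw [hσ] at hL ⊢
      simpa using hL
    · rw [hσ] at hR ⊢
      have := (tendsto_neg_nhdsLT (a := t)).eventually (by simpa using hR)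
      simpa using this

end TranslateData

end LocalComp
end

open Topology
noncomputable section
namespace LocalComp

namespace TriangleSystem

/-! ### Quadrilaterals in a system of triangles -/

section Quads

variable {ι₀ ι₁ ι₂ : Type} {α₀ : LCurve ι₀} {α₁ : LCurve ι₁} {α₂ : LCurve ι₂}
  (S : TriangleSystem α₀.toCurve α₁.toCurve α₂.toCurve)

/-- The lifts of `Θ⁺` on the first sides of the triangles. -/
def QuadIndex (tp : ℝ) : Type :=
  {x : ℤ × ℤ // (S.frame x.1).tO < (S.frame x.1).σ * (tp + x.2) ∧
    (S.frame x.1).σ * (tp + x.2) < (S.frame x.1).tA}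

/-- The lift of `Θ⁺` that corresponds to an index. -/
def ptY (tp : ℝ) (x : ℤ × ℤ) : ℝ × ℝ :=
  (S.frame x.1).Ξ.symm ((S.frame x.1).σ * (tp + x.2), 0)

variable {ε : ℝ} {f : ℝ → ℝ} {tp : ℝ}
  (D : TranslateData α₀.toCurve α₁.toCurve α₂.toCurve ε f tp)

theorem isGraph (f : ℝ → ℝ) (i : ℤ) : (S.frame i).IsGraph
    (fun t => (S.frame i).σ * f ((S.frame i).σ * t)) (α₀.translate f).toCurve where
  along := (S.frame i).along₀
  across P := by
    change α₀.across P - f (α₀.along P) = _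
    rw [(S.frame i).across₀, (S.frame i).along₀, mul_sub, (S.frame i).σ_σ_mul]
    ring

/-- The quadrilateral that corresponds to an index. -/
def quad (x : S.QuadIndex tp) :
    Polygon ![α₀.toCurve, α₁.toCurve, α₂.toCurve, (α₀.translate f).toCurve] :=
  (D.quadData (S.frame x.1.1) x.1.2 x.2.1 x.2.2).quad (S.isGraph f x.1.1)

theorem exists_equivalent_quad (hε : ε ≤ 1)
    (T : Polygon ![α₀.toCurve, α₁.toCurve, α₂.toCurve, (α₀.translate f).toCurve]) :
    ∃ x, Polygon.Equivalent T (S.quad D x) := by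
  obtain ⟨m, i, h0, h1, h2⟩ := S.surj (T.level 0) (T.level 1) (T.level 2)
  have eqv₃ := S.eqv₀.translate D.periodic
  obtain ⟨T', hT', hl⟩ := T.exists_translate m ![S.A₀ m, S.A₁ m, S.A₂ m, S.A₀ m]
    ![S.C₀ m, S.C₁ m, S.C₂ m, S.C₀ m]
    (fun j P => by
      fin_cases j
      exacts [S.eqv₀.along m P, S.eqv₁.along m P, S.eqv₂.along m P, eqv₃.along m P])
    (fun j P => by
      fin_cases j
      exacts [S.eqv₀.across m P, S.eqv₁.across m P, S.eqv₂.across m P, eqv₃.across m P])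
  -- The first and fourth sides share a corner, where the levels differ by a value of `f`, which is
  -- smaller than `1` in absolute value.
  have h30 : T'.level 3 = T'.level 0 := by
    have e0 : α₀.across (T'.start 0) = T'.level 0 := T'.side_mem 0 0 ⟨le_rfl, zero_le_one⟩
    have e3 : (α₀.translate f).across (T'.finish 3) = T'.level 3 :=
      T'.side_mem 3 1 ⟨zero_le_one, le_rfl⟩
    rw [T'.finish_eq_start 3 0 rfl] at e3
    change α₀.across (T'.start 0) - f _ = _ at e3
    rw [e0] at e3
    have hb := (D.bdd (α₀.along (T'.start 0))).trans (D.lt_δ.trans_le (D.le_ε.trans hε))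
    have e4 : |((T'.level 0 - T'.level 3 : ℤ) : ℝ)| < 1 := by
      push_cast
      rwa [show (T'.level 0 : ℝ) - T'.level 3 = f (α₀.along (T'.start 0)) by linarith]
    have : |T'.level 0 - T'.level 3| < 1 := by exact_mod_cast e4
    have := Int.abs_lt_one_iff.1 this
    omega
  have hl' : T'.level = ![S.l₀ i, S.l₁ i, S.l₂ i, S.l₀ i] := by
    funext j
    fin_cases j
    · rw [hl]; exact h0
    · rw [hl]; exact h1
    · rw [hl]; exact h2
    · exact h30.trans (by rw [hl]; exact h0)
  obtain ⟨ty, hty, hz, hO, hA, hfr⟩ := (D.wiggle (S.frame i)).corner_between (S.isGraph f i)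
    (fun t ht => D.zero_mem _ (by simpa [(S.frame i).σ_ne] using ht)) T' hl'
  obtain ⟨h, rfl⟩ := D.exists_eq_of_zero (S.frame i) hz hfr
  exact ⟨⟨(i, h), hO, hA⟩, Polygon.equivalent_equivalence.trans hT'
    ((D.quadData (S.frame i) h hO hA).equivalent_quad (S.isGraph f i) T' hl' hty)⟩

theorem quad_start (x : S.QuadIndex tp) : (S.quad D x).start 0 = S.ptY tp x.1 ∧
    (S.quad D x).start 1 = (S.frame x.1.1).ptA ∧ (S.quad D x).start 2 = (S.frame x.1.1).ptB ∧
    (S.quad D x).start 3 = (D.wiggle (S.frame x.1.1)).ptO' :=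
  (D.quadData (S.frame x.1.1) x.1.2 x.2.1 x.2.2).quad_start (S.isGraph f x.1.1)

theorem quad_level (x : S.QuadIndex tp) : (S.quad D x).level =
    ![S.l₀ x.1.1, S.l₁ x.1.1, S.l₂ x.1.1, S.l₀ x.1.1] := rfl

theorem quad_injective (x x' : S.QuadIndex tp)
    (h : Polygon.Equivalent (S.quad D x) (S.quad D x')) : x = x' := by
  obtain ⟨m, hs, -⟩ := h.exists_lattice
  obtain ⟨hi, rfl⟩ := S.inj x.1.1 x'.1.1 m
    (by simpa [quad_level] using level_eq_add hs 0 S.eqv₀)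
    (by simpa [quad_level] using level_eq_add hs 1 S.eqv₁)
    (by simpa [quad_level] using level_eq_add hs 2 S.eqv₂)
  have h0 := hs 0
  rw [(S.quad_start D x).1, (S.quad_start D x').1] at h0
  obtain ⟨⟨i, n⟩, hx⟩ := x
  obtain ⟨⟨i', n'⟩, hx'⟩ := x'
  simp only at hi
  subst hi
  have : S.ptY tp (i, n') = S.ptY tp (i, n) := by
    rw [h0]
    simp only [Prod.fst_zero, Prod.snd_zero, Int.cast_zero]
    exact add_zero _
  simp only [ptY, EmbeddingLike.apply_eq_iff_eq, Prod.mk.injEq, and_true,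
    mul_right_inj' (S.frame i).σ_ne, add_right_inj, Int.cast_inj] at this
  subst this
  rfl

/-- The point `y` is `Θ⁺`. -/
def IsTheta (α : Curve) (tp : ℝ) (y : T2) : Prop :=
  ∃ P : ℝ × ℝ, toTorus P = y ∧ (∃ m : ℤ, α.across P = m) ∧ ∃ m : ℤ, α.along P = tp + m

theorem toTorus_ptY_eq_iff (x : ℤ × ℤ) (y : T2) :
    toTorus (S.ptY tp x) = y ↔ IsTheta α₀.toCurve tp y := by
  have e1 : α₀.across (S.ptY tp x) = S.l₀ x.1 := by
    rw [(S.frame x.1).across₀, ptY, Homeomorph.apply_symm_apply]; simp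
  have e2 : α₀.along (S.ptY tp x) = tp + x.2 := by
    rw [(S.frame x.1).along₀, ptY, Homeomorph.apply_symm_apply, (S.frame x.1).σ_σ_mul]
  constructor
  · rintro rfl
    exact ⟨_, rfl, ⟨_, e1⟩, ⟨_, e2⟩⟩
  · rintro ⟨P, rfl, ⟨a, ha⟩, ⟨b, hb⟩⟩
    obtain ⟨m, hm1, hm2⟩ := S.basis (x.2 - b) (S.l₀ x.1 - a)
    rw [← toTorus_add_latticeVec P m]
    congr 1
    refine (S.frame x.1).Ξ.injective (Prod.ext ?_ ?_)
    · refine mul_left_cancel₀ (S.frame x.1).σ_ne ?_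
      rw [← (S.frame x.1).along₀, ← (S.frame x.1).along₀, e2, S.eqv₀.along, hm1, hb]
      push_cast
      ring
    · refine mul_left_cancel₀ (S.frame x.1).σ_ne (add_left_cancel (a := (S.l₀ x.1 : ℝ)) ?_)
      rw [← (S.frame x.1).across₀, ← (S.frame x.1).across₀, e1, S.eqv₀.across, hm2, ha]
      push_cast
      ring

/-- Used to replace the pushed-off corner by the original one: the monodromy is trivial, or no arc
is passed in between. -/
theorem zpow_crossings_congr {ι : Type} [Fintype ι] [DecidableEq ι] {α : LCurve ι} {P P' Q Q' : ℝ × ℝ}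
    (h : α.mono = 1 ∨ ⌊α.along P - α.arc⌋ = ⌊α.along P' - α.arc⌋)
    (h' : α.mono = 1 ∨ ⌊α.along Q - α.arc⌋ = ⌊α.along Q' - α.arc⌋) :
    α.mono ^ α.crossings P Q = α.mono ^ α.crossings P' Q' := by
  rcases h with h | h
  · simp [h]
  · rcases h' with h' | h'
    · simp [h']
    · rw [LCurve.crossings, LCurve.crossings, h, h']

open Classical in
/-- The quadrilateral counting map is a sum over the quadrilateral indices. -/
theorem isMu3 [Fintype ι₀] [DecidableEq ι₀] [Fintype ι₁] [DecidableEq ι₁]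
    [Fintype ι₂] [DecidableEq ι₂]
    (D : TranslateData α₀.toCurve α₁.toCurve α₂.toCurve ε f tp) {z : ℝ × ℝ} {ψ₁ : CF α₀ α₁} {ψ₂ : CF α₁ α₂} {ψ₃ : CF α₂ α₀} (hε : ε ≤ 1)
    (hz : ∀ l : ℤ, ε ≤ |α₀.across z - l|)
    (hO₀ : ∀ i s, |s| < ε → α₀.mono = 1 ∨
      ⌊α₀.along ((S.frame i).Ξ.symm ((S.frame i).tO + (S.frame i).κ₂ * s, s)) - α₀.arc⌋ =
        ⌊α₀.along (S.frame i).ptO - α₀.arc⌋)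
    (hO₂ : ∀ i s, |s| < ε → α₂.mono = 1 ∨
      ⌊α₂.along ((S.frame i).Ξ.symm ((S.frame i).tO + (S.frame i).κ₂ * s, s)) - α₂.arc⌋ =
        ⌊α₂.along (S.frame i).ptO - α₂.arc⌋)
    (R : Matrix ι₀ ι₀ FUinv)
    (h : ∀ a b, UAdicHasSum (fun x : S.QuadIndex tp =>
        (Uvar ^ Set.ncard {m : ℤ × ℤ |
            (S.frame x.1.1).InTriangle ((S.frame x.1.1).Ξ (z + latticeVec m))} •
          (α₀.mono ^ α₀.crossings (S.frame x.1.1).ptO (S.ptY tp x.1) *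
            coeffAt ψ₃ (S.frame x.1.1).ptO *
            α₂.mono ^ α₂.crossings (S.frame x.1.1).ptB (S.frame x.1.1).ptO *
            coeffAt ψ₂ (S.frame x.1.1).ptB *
            α₁.mono ^ α₁.crossings (S.frame x.1.1).ptA (S.frame x.1.1).ptB *
            coeffAt ψ₁ (S.frame x.1.1).ptA *
            α₀.mono ^ α₀.crossings (S.ptY tp x.1) (S.frame x.1.1).ptA)) a b)
      (R a b)) :
    IsMu3 z α₀ α₁ α₂ (α₀.translate f) ψ₁ ψ₂ (nearestPointMap f ψ₃)
      (fun y => if IsTheta α₀.toCurve tp y then R else 0) := by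
  intro y a b
  have eqv₃ := S.eqv₀.translate D.periodic
  refine Polygon.uAdicHasSum_classes (S.quad D) (S.exists_equivalent_quad D hε)
    (S.quad_injective D) (term := fun T => if toTorus (T.start 0) = (y : T2) then
        (Uvar ^ T.mult z •
          ((α₀.translate f).mono ^ (α₀.translate f).crossings (T.start 3) (T.finish 3) *
            coeffAt (nearestPointMap f ψ₃) (T.start 3) *
            α₂.mono ^ α₂.crossings (T.start 2) (T.finish 2) *
            coeffAt ψ₂ (T.start 2) *
            α₁.mono ^ α₁.crossings (T.start 1) (T.finish 1) *
            coeffAt ψ₁ (T.start 1) *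
            α₀.mono ^ α₀.crossings (T.start 0) (T.finish 0))) a b
      else 0) ?_ ?_
  · intro T T' hT
    obtain ⟨m, hs, hf⟩ := hT.exists_lattice
    change ∀ j, T'.start j = T.start j + latticeVec m at hs
    change ∀ j, T'.finish j = T.finish j + latticeVec m at hf
    simp only [hs, hf, hT.mult_eq z, toTorus_add_latticeVec, coeffAt_add_latticeVec,
      LCurve.crossings_add_latticeVec S.eqv₀, LCurve.crossings_add_latticeVec S.eqv₁,
      LCurve.crossings_add_latticeVec S.eqv₂, LCurve.crossings_add_latticeVec eqv₃]
  · change UAdicHasSum _ ((if IsTheta α₀.toCurve tp y then R else (0 : Matrix ι₀ ι₀ FUinv)) a b)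
    by_cases hy : IsTheta α₀.toCurve tp y
    · rw [if_pos hy]
      convert h a b using 2 with x
      obtain ⟨s0, s1, s2, s3⟩ := S.quad_start D x
      have f0 := (S.quad D x).finish_eq_start 0 1 rfl
      have f1 := (S.quad D x).finish_eq_start 1 2 rfl
      have f2 := (S.quad D x).finish_eq_start 2 3 rfl
      have f3 := (S.quad D x).finish_eq_start 3 0 rfl
      simp only [f0, f1, f2, f3, s0, s1, s2, s3]
      rw [if_pos ((S.toTorus_ptY_eq_iff x.1 y).2 hy)]
      have hs : |(D.wiggle (S.frame x.1.1)).s| < ε :=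
        ((D.wiggle (S.frame x.1.1)).abs_s_lt).trans (D.lt_δ.trans_le D.le_ε)
      -- The basepoint is at distance at least `ε` from every lift of the first curve, hence outside
      -- the strip where the quadrilateral differs from the triangle.
      have hm := (D.quadData (S.frame x.1.1) x.1.2 x.2.1 x.2.2).mult_quad (S.isGraph f x.1.1)
        (z := z) (fun m => by
          refine (D.lt_δ.le.trans D.le_ε).trans ((hz (S.l₀ x.1.1 - S.C₀ m)).trans ?_)
          have e1 := S.eqv₀.across m z
          rw [(S.frame x.1.1).across₀] at e1
          have e2 : α₀.across z - ((S.l₀ x.1.1 - S.C₀ m : ℤ) : ℝ) =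
              (S.frame x.1.1).σ * ((S.frame x.1.1).Ξ (z + latticeVec m)).2 := by
            push_cast
            linarith
          rw [e2, (S.frame x.1.1).abs_σ_mul]
          exact le_rfl)
      have hmult : (S.quad D x).mult z = Set.ncard {m : ℤ × ℤ |
          (S.frame x.1.1).InTriangle ((S.frame x.1.1).Ξ (z + latticeVec m))} := hm
      have hc : coeffAt (nearestPointMap f ψ₃) (D.wiggle (S.frame x.1.1)).ptO' =
          coeffAt ψ₃ (S.frame x.1.1).ptO := by
        have hO2 : α₂.across (S.frame x.1.1).ptO = S.l₂ x.1.1 := by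
          rw [(S.frame x.1.1).across₂_eq_iff, Frame.ptO, Homeomorph.apply_symm_apply]; simp
        have hO0 : α₀.across (S.frame x.1.1).ptO = S.l₀ x.1.1 := by
          rw [(S.frame x.1.1).across₀_eq_iff, Frame.ptO, Homeomorph.apply_symm_apply]
        refine coeffAt_nearestPointMap ψ₃ S.eqv₂ S.eqv₀ D.periodic hO2 ?_ hO0 ?_
          (fun R h2 h0 => (S.frame x.1.1).eq_ptO h0 h2)
        · have := (S.quad D x).side_mem 2 1 ⟨zero_le_one, le_rfl⟩
          change α₂.across ((S.quad D x).finish 2) = _ at this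
          rwa [f2, s3] at this
        · have := (S.quad D x).side_mem 3 0 ⟨le_rfl, zero_le_one⟩
          change (α₀.translate f).across ((S.quad D x).start 3) = _ at this
          rwa [s3] at this
      have hcr3 : (α₀.translate f).mono ^ (α₀.translate f).crossings
          (D.wiggle (S.frame x.1.1)).ptO' (S.ptY tp x.1) =
          α₀.mono ^ α₀.crossings (S.frame x.1.1).ptO (S.ptY tp x.1) :=
        zpow_crossings_congr (α := α₀) (hO₀ x.1.1 _ hs) (Or.inr rfl)
      have hcr2 : α₂.mono ^ α₂.crossings (S.frame x.1.1).ptB (D.wiggle (S.frame x.1.1)).ptO' =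
          α₂.mono ^ α₂.crossings (S.frame x.1.1).ptB (S.frame x.1.1).ptO :=
        zpow_crossings_congr (Or.inr rfl) (hO₂ x.1.1 _ hs)
      rw [hmult, hc, hcr2, hcr3]
    · rw [if_neg hy]
      have h0 : ∀ x, toTorus ((S.quad D x).start 0) ≠ (y : T2) := fun x => by
        rw [(S.quad_start D x).1]
        exact fun h => hy ((S.toTorus_ptY_eq_iff x.1 y).1 h)
      simp only [h0, if_false]
      exact ⟨fun N => by simp, fun n => by simp⟩

end Quads

end TriangleSystem

end LocalComp
end

open Topology
noncomputable section
namespace LocalComp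

set_option linter.unusedSectionVars false

/-! ### The three systems of triangles of the diagram -/

section

variable (p q : ℕ)

theorem beta0_equivariant (k : ℕ) (ε : ℝ) : (beta0 p q k ε).toCurve.IsEquivariant
    (fun m => -m.1) (fun m => -m.2) where
  along m P := by
    change -(P.1 + (m.1 : ℝ)) = -P.1 + ((-m.1 : ℤ) : ℝ)
    push_cast; ring
  across m P := by
    change -(P.2 + (m.2 : ℝ)) = -P.2 + ((-m.2 : ℤ) : ℝ)
    push_cast; ring

theorem betaInf_equivariant (k : ℕ) (ε : ℝ) : (betaInf p q k ε).toCurve.IsEquivariant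
    (fun m => m.2) (fun m => -m.1) where
  along m P := rfl
  across m P := by
    change -(P.1 + (m.1 : ℝ)) = -P.1 + ((-m.1 : ℤ) : ℝ)
    push_cast; ring

theorem betaR_equivariant : (betaR p q).toCurve.IsEquivariant
    (fun m => Nat.gcdA q p * m.1 + Nat.gcdB q p * m.2) (fun m => q * m.2 - p * m.1) where
  along m P := by
    change (Nat.gcdA q p : ℝ) * (P.1 + (m.1 : ℝ)) + (Nat.gcdB q p : ℝ) * (P.2 + (m.2 : ℝ)) =
      (Nat.gcdA q p : ℝ) * P.1 + (Nat.gcdB q p : ℝ) * P.2 +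
        ((Nat.gcdA q p * m.1 + Nat.gcdB q p * m.2 : ℤ) : ℝ)
    push_cast; ring
  across m P := by
    change q * (P.2 + (m.2 : ℝ)) - p * (P.1 + (m.1 : ℝ)) + 1 / 2 =
      q * P.2 - p * P.1 + 1 / 2 + ((q * m.2 - p * m.1 : ℤ) : ℝ)
    push_cast; ring

variable [NeZero p] [NeZero q]

/-- The system of triangles based at the first axis. -/
def systemZero (hpq : p.Coprime q) (k : ℕ) (ε : ℝ) :
    TriangleSystem (beta0 p q k ε).toCurve (betaR p q).toCurve (betaInf p q k ε).toCurve where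
  A₀ := _
  C₀ := _
  A₁ := _
  C₁ := _
  A₂ := _
  C₂ := _
  eqv₀ := beta0_equivariant p q k ε
  eqv₁ := betaR_equivariant p q
  eqv₂ := betaInf_equivariant p q k ε
  l₀ _ := 0
  l₁ i := -i
  l₂ _ := 0
  frame := frameZero p q hpq k ε
  -- The deck transformation is forced by moving the lifts of the two axes to level `0`; the
  -- remaining level is called `-i`. The other two systems use the same normalization.
  surj a b c := ⟨(c, a), -(b + q * a - p * c), by simp, by ring, by simp⟩
  inj i i' m h0 h1 h2 := by
    have e1 : m.1 = 0 := by linarith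
    have e2 : m.2 = 0 := by linarith
    rw [e1, e2] at h1
    exact ⟨by linarith, Prod.ext e1 e2⟩
  basis a c := ⟨(-a, -c), by simp, by simp⟩

/-- The system of triangles based at the second axis. -/
def systemInf (hpq : p.Coprime q) (k : ℕ) (ε : ℝ) :
    TriangleSystem (betaInf p q k ε).toCurve (beta0 p q k ε).toCurve (betaR p q).toCurve where
  A₀ := _
  C₀ := _
  A₁ := _
  C₁ := _
  A₂ := _
  C₂ := _
  eqv₀ := betaInf_equivariant p q k ε
  eqv₁ := beta0_equivariant p q k ε
  eqv₂ := betaR_equivariant p q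
  l₀ _ := 0
  l₁ _ := 0
  l₂ i := -i
  frame := frameInf p q hpq k ε
  surj a b c := ⟨(a, b), -(c + q * b - p * a), by simp, by simp, by ring⟩
  inj i i' m h0 h1 h2 := by
    have e1 : m.1 = 0 := by linarith
    have e2 : m.2 = 0 := by linarith
    rw [e1, e2] at h2
    exact ⟨by linarith, Prod.ext e1 e2⟩
  basis a c := ⟨(-c, a), rfl, by simp⟩

/-- The system of triangles based at the line of slope `p / q`. -/
def systemR (hpq : p.Coprime q) (k : ℕ) (ε : ℝ) :
    TriangleSystem (betaR p q).toCurve (betaInf p q k ε).toCurve (beta0 p q k ε).toCurve where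
  A₀ := _
  C₀ := _
  A₁ := _
  C₁ := _
  A₂ := _
  C₂ := _
  eqv₀ := betaR_equivariant p q
  eqv₁ := betaInf_equivariant p q k ε
  eqv₂ := beta0_equivariant p q k ε
  l₀ i := -i
  l₁ _ := 0
  l₂ _ := 0
  frame := frameR p q hpq k ε
  surj a b c := ⟨(b, c), -(a + q * c - p * b), by ring, by simp, by simp⟩
  inj i i' m h0 h1 h2 := by
    have e1 : m.1 = 0 := by linarith
    have e2 : m.2 = 0 := by linarith
    rw [e1, e2] at h0
    exact ⟨by linarith, Prod.ext e1 e2⟩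
  basis a c := by
    have h : (Nat.gcdA q p : ℤ) * q + (Nat.gcdB q p : ℤ) * p = 1 := by
      exact_mod_cast gcd_combination p q hpq
    -- The solution of a linear system whose determinant is one by the Bézout identity.
    refine ⟨(q * a - Nat.gcdB q p * c, p * a + Nat.gcdA q p * c), ?_, ?_⟩
    · linear_combination a * h
    · linear_combination c * h

end

section Corners

variable {p q : ℕ} [NeZero p] [NeZero q] (hpq : p.Coprime q) (k : ℕ) (ε : ℝ) (i : ℤ)

theorem across_cornerA_R : (betaR p q).across (cornerA p i) = ((-i : ℤ) : ℝ) := by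
  have : (p : ℝ) ≠ 0 := NeZero.ne _
  change (q : ℝ) * 0 - p * (((i : ℝ) + 1 / 2) / p) + 1 / 2 = _
  field_simp
  push_cast
  ring

theorem across_cornerB_R : (betaR p q).across (cornerB q i) = ((-i : ℤ) : ℝ) := by
  have : (q : ℝ) ≠ 0 := NeZero.ne _
  change (q : ℝ) * -(((i : ℝ) + 1 / 2) / q) - p * 0 + 1 / 2 = _
  field_simp
  push_cast
  ring

theorem across_cornerA_zero : (beta0 p q k ε).across (cornerA p i) = ((0 : ℤ) : ℝ) := by
  simp [beta0, cornerA]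

theorem across_cornerB_inf : (betaInf p q k ε).across (cornerB q i) = ((0 : ℤ) : ℝ) := by
  simp [betaInf, cornerB]

theorem across_origin_zero : (beta0 p q k ε).across (0, 0) = ((0 : ℤ) : ℝ) := by simp [beta0]

theorem across_origin_inf : (betaInf p q k ε).across (0, 0) = ((0 : ℤ) : ℝ) := by simp [betaInf]

theorem systemZero_corners : ((systemZero p q hpq k ε).frame i).ptO = (0, 0) ∧
    ((systemZero p q hpq k ε).frame i).ptA = cornerA p i ∧
    ((systemZero p q hpq k ε).frame i).ptB = cornerB q i :=
  ⟨(Frame.eq_ptO _ (across_origin_zero k ε) (across_origin_inf k ε)).symm,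
    (Frame.eq_ptA _ (across_cornerA_zero k ε i) (across_cornerA_R i)).symm,
    (Frame.eq_ptB _ (across_cornerB_R i) (across_cornerB_inf k ε i)).symm⟩

theorem systemInf_corners : ((systemInf p q hpq k ε).frame i).ptO = cornerB q i ∧
    ((systemInf p q hpq k ε).frame i).ptA = (0, 0) ∧
    ((systemInf p q hpq k ε).frame i).ptB = cornerA p i :=
  ⟨(Frame.eq_ptO _ (across_cornerB_inf k ε i) (across_cornerB_R i)).symm,
    (Frame.eq_ptA _ (across_origin_inf k ε) (across_origin_zero k ε)).symm,
    (Frame.eq_ptB _ (across_cornerA_zero k ε i) (across_cornerA_R i)).symm⟩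

theorem systemR_corners : ((systemR p q hpq k ε).frame i).ptO = cornerA p i ∧
    ((systemR p q hpq k ε).frame i).ptA = cornerB q i ∧
    ((systemR p q hpq k ε).frame i).ptB = (0, 0) :=
  ⟨(Frame.eq_ptO _ (across_cornerA_R i) (across_cornerA_zero k ε i)).symm,
    (Frame.eq_ptA _ (across_cornerB_R i) (across_cornerB_inf k ε i)).symm,
    (Frame.eq_ptB _ (across_origin_inf k ε) (across_origin_zero k ε)).symm⟩

theorem systemZero_inTriangle (P : ℝ × ℝ) : ((systemZero p q hpq k ε).frame i).InTriangle
    (((systemZero p q hpq k ε).frame i).Ξ P) ↔ InRegion p q i P := by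
  have hp : (0 : ℝ) < p := by exact_mod_cast NeZero.pos p
  change halfSign i * P.2 ≤ 0 ∧ halfSign i * P.1 ≤ halfSign i * ((i : ℝ) + 1 / 2) / p +
    q / p * (halfSign i * P.2) ∧ 0 + 0 * (halfSign i * P.2) ≤ halfSign i * P.1 ↔ _
  have e : halfSign i * ((i : ℝ) + 1 / 2) / p + q / p * (halfSign i * P.2) - halfSign i * P.1 =
      halfSign i * (q * P.2 - p * P.1 + i + 1 / 2) / p := by field_simp; ring
  have e2 : halfSign i * P.1 ≤ halfSign i * ((i : ℝ) + 1 / 2) / p + q / p * (halfSign i * P.2) ↔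
      0 ≤ halfSign i * (q * P.2 - p * P.1 + i + 1 / 2) := by
    rw [← sub_nonneg, e, le_div_iff₀ hp, zero_mul]
  rw [e2, InRegion, zero_mul, add_zero]
  tauto

theorem systemInf_inTriangle (P : ℝ × ℝ) : ((systemInf p q hpq k ε).frame i).InTriangle
    (((systemInf p q hpq k ε).frame i).Ξ P) ↔ InRegion p q i P := by
  have hq : (0 : ℝ) < q := by exact_mod_cast NeZero.pos q
  change -halfSign i * P.1 ≤ 0 ∧ halfSign i * P.2 ≤ 0 + 0 * (-halfSign i * P.1) ∧
    -(halfSign i * ((i : ℝ) + 1 / 2) / q) + -(p / q) * (-halfSign i * P.1) ≤ halfSign i * P.2 ↔ _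
  have e : halfSign i * P.2 -
      (-(halfSign i * ((i : ℝ) + 1 / 2) / q) + -(p / q) * (-halfSign i * P.1)) =
      halfSign i * (q * P.2 - p * P.1 + i + 1 / 2) / q := by field_simp; ring
  have e2 : -(halfSign i * ((i : ℝ) + 1 / 2) / q) + -(p / q) * (-halfSign i * P.1) ≤
      halfSign i * P.2 ↔ 0 ≤ halfSign i * (q * P.2 - p * P.1 + i + 1 / 2) := by
    rw [← sub_nonneg, e, le_div_iff₀ hq, zero_mul]
  rw [e2, InRegion, zero_mul, add_zero, neg_mul, neg_nonpos]

theorem systemR_inTriangle (P : ℝ × ℝ) : ((systemR p q hpq k ε).frame i).InTriangle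
    (((systemR p q hpq k ε).frame i).Ξ P) ↔ InRegion p q i P := by
  have hp : (0 : ℝ) < p := by exact_mod_cast NeZero.pos p
  have hq : (0 : ℝ) < q := by exact_mod_cast NeZero.pos q
  have h1 := gcd_combination p q hpq
  have e1 := ((systemR p q hpq k ε).frame i).across₁ P
  have e2 := ((systemR p q hpq k ε).frame i).across₂ P
  change -P.1 = ((0 : ℤ) : ℝ) + q * halfSign i * _ at e1
  change -P.2 = ((0 : ℤ) : ℝ) + p * halfSign i * _ at e2
  set X := ((systemR p q hpq k ε).frame i).Ξ P with hX
  have hX2 : X.2 = -halfSign i * (q * P.2 - p * P.1 + 1 / 2 + i) := rfl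
  have s2 := halfSign_mul_self i
  push_cast at e1 e2
  have c1 : X.1 ≤ ((systemR p q hpq k ε).frame i).tA + ((systemR p q hpq k ε).frame i).κ₁ * X.2 ↔
      0 ≤ halfSign i * P.1 := by
    have : halfSign i * P.1 = q * (((systemR p q hpq k ε).frame i).tA +
        ((systemR p q hpq k ε).frame i).κ₁ * X.2 - X.1) := by
      linear_combination -halfSign i * e1 + (q * (((systemR p q hpq k ε).frame i).tA +
        ((systemR p q hpq k ε).frame i).κ₁ * X.2 - X.1)) * s2
    rw [this, ← sub_nonneg, mul_nonneg_iff_of_pos_left hq]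
  have c2 : ((systemR p q hpq k ε).frame i).tO + ((systemR p q hpq k ε).frame i).κ₂ * X.2 ≤ X.1 ↔
      halfSign i * P.2 ≤ 0 := by
    have : -(halfSign i * P.2) = p * (X.1 - (((systemR p q hpq k ε).frame i).tO +
        ((systemR p q hpq k ε).frame i).κ₂ * X.2)) := by
      linear_combination halfSign i * e2 + (p * (X.1 - (((systemR p q hpq k ε).frame i).tO +
        ((systemR p q hpq k ε).frame i).κ₂ * X.2))) * s2
    rw [← neg_nonneg, this, ← sub_nonneg, mul_nonneg_iff_of_pos_left hp]
  unfold Frame.InTriangle InRegion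
  rw [c1, c2, hX2, neg_mul, neg_nonpos,
    show (q : ℝ) * P.2 - p * P.1 + 1 / 2 + i = q * P.2 - p * P.1 + i + 1 / 2 by ring]
  tauto

end Corners

section Crossings

variable {p q : ℕ} [NeZero p] [NeZero q] (k : ℕ) {ε : ℝ} (i : ℤ)

/-- The number `(i + 1/2) / n` has distance at least `1 / (2 n)` from every integer, so a smaller
perturbation does not affect the floor. -/
theorem floor_neg_half_div {n : ℕ} [NeZero n] (i : ℤ) {e : ℝ} (he : 2 * n * |e| < 1) :
    ⌊-(((i : ℝ) + 1 / 2) / n) + e⌋ = -(i / n) - 1 := by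
  have hn : (0 : ℝ) < n := by exact_mod_cast NeZero.pos n
  have hn' : (0 : ℤ) < n := by exact_mod_cast NeZero.pos n
  have h1 : (n : ℝ) * (i / (n : ℤ) : ℤ) + (i % (n : ℤ) : ℤ) = i := by
    exact_mod_cast Int.mul_ediv_add_emod i n
  have h2 : (0 : ℝ) ≤ (i % (n : ℤ) : ℤ) := by exact_mod_cast Int.emod_nonneg i hn'.ne'
  have h3 : ((i % (n : ℤ) : ℤ) : ℝ) ≤ n - 1 := by
    have := Int.emod_lt_of_pos i hn'
    exact_mod_cast (by omega : i % (n : ℤ) ≤ n - 1)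
  have h4 : |n * e| < 1 / 2 := by rw [abs_mul, abs_of_pos hn]; linarith
  rw [abs_lt] at h4
  have h5 : -(((i : ℝ) + 1 / 2) / n) + e =
      (-((i : ℝ) + 1 / 2) + n * e) / n := by field_simp
  rw [h5, Int.floor_eq_iff, le_div_iff₀ hn, div_lt_iff₀ hn]
  push_cast
  constructor <;> nlinarith

/-- The arc sits just to the right of the origin. The side to the corner `A` therefore meets one arc
more than it meets integral points strictly to the right of the origin; floor division makes the
formula valid for negative `i` too. -/
theorem crossings_zero (hε : 0 < ε) (hε' : 4 * ((p : ℝ) + q) * ε < 1) (i : ℤ) :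
    (beta0 p q k ε).crossings (0, 0) (cornerA p i) = i / p + 1 := by
  have hp : (1 : ℝ) ≤ p := by exact_mod_cast NeZero.pos p
  have hq : (1 : ℝ) ≤ q := by exact_mod_cast NeZero.pos q
  have e1 : ⌊(beta0 p q k ε).along (0, 0) - (beta0 p q k ε).arc⌋ = 0 := by
    change ⌊-(0 : ℝ) - -ε⌋ = 0
    rw [Int.floor_eq_zero_iff]
    constructor <;> nlinarith
  have e2 : ⌊(beta0 p q k ε).along (cornerA p i) - (beta0 p q k ε).arc⌋ = -(i / p) - 1 := by
    rw [← floor_neg_half_div i (e := ε) (by rw [abs_of_pos hε]; nlinarith)]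
    change ⌊-(((i : ℝ) + 1 / 2) / p) - -ε⌋ = _
    rw [sub_neg_eq_add]
  rw [LCurve.crossings, e1, e2]
  ring

theorem floor_along_cornerB (hε : 0 < ε) (hε' : 4 * ((p : ℝ) + q) * ε < 1) (i : ℤ) :
    ⌊(betaInf p q k ε).along (cornerB q i) - (betaInf p q k ε).arc⌋ = -(i / q) - 1 := by
  have hp : (1 : ℝ) ≤ p := by exact_mod_cast NeZero.pos p
  have hq : (1 : ℝ) ≤ q := by exact_mod_cast NeZero.pos q
  rw [← floor_neg_half_div i (e := -ε) (by rw [abs_neg, abs_of_pos hε]; nlinarith)]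
  change ⌊-(((i : ℝ) + 1 / 2) / q) - ε⌋ = _
  rw [sub_eq_add_neg]

theorem floor_along_origin (hε : 0 < ε) (hε' : 4 * ((p : ℝ) + q) * ε < 1) {e : ℝ} (he : |e| < ε) :
    ⌊e - ε⌋ = -1 := by
  have hp : (1 : ℝ) ≤ p := by exact_mod_cast NeZero.pos p
  have hq : (1 : ℝ) ≤ q := by exact_mod_cast NeZero.pos q
  rw [abs_lt] at he
  rw [Int.floor_eq_iff]
  push_cast
  constructor <;> nlinarith

/-- Here the arc is just above the origin, so there is no extra crossing when `0 ≤ i`. Upward paths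
count negatively. -/
theorem crossings_inf (hε : 0 < ε) (hε' : 4 * ((p : ℝ) + q) * ε < 1) (i : ℤ) :
    (betaInf p q k ε).crossings (cornerB q i) (0, 0) = -(i / q) := by
  have e1 : ⌊(betaInf p q k ε).along (0, 0) - (betaInf p q k ε).arc⌋ = -1 :=
    floor_along_origin hε hε' (e := 0) (by simpa using hε)
  rw [LCurve.crossings, e1, floor_along_cornerB k hε hε']
  ring

/-! ### The small push-off does not affect the crossings -/

theorem systemZero_pushOff (hpq : p.Coprime q) (s : ℝ) :
    (beta0 p q k ε).along (((systemZero p q hpq k ε).frame i).Ξ.symm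
      (((systemZero p q hpq k ε).frame i).tO + ((systemZero p q hpq k ε).frame i).κ₂ * s, s)) =
    (beta0 p q k ε).along ((systemZero p q hpq k ε).frame i).ptO := by
  rw [Frame.along₀, Frame.along₀, Frame.ptO, Homeomorph.apply_symm_apply,
    Homeomorph.apply_symm_apply]
  change _ * (_ + 0 * s) = _
  rw [zero_mul, add_zero]

theorem along₂_pushOff {γ₀ γ₁ γ₂ : Curve} {l₀ l₁ l₂ : ℤ} (Fr : Frame γ₀ γ₁ γ₂ l₀ l₁ l₂) (s : ℝ) :
    γ₂.along (Fr.Ξ.symm (Fr.tO + Fr.κ₂ * s, s)) = γ₂.along Fr.ptO + Fr.m₂ * s := by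
  have := Fr.along₂ (Fr.Ξ.symm (Fr.tO + Fr.κ₂ * s, s)) Fr.ptO
    (by rw [Fr.across₂_eq_iff, Homeomorph.apply_symm_apply])
    (by rw [Fr.across₂_eq_iff, Frame.ptO, Homeomorph.apply_symm_apply]; simp)
  rw [Frame.ptO, Homeomorph.apply_symm_apply, Homeomorph.apply_symm_apply] at this
  rw [Frame.ptO]
  linarith

theorem abs_halfSign (i : ℤ) : |halfSign i| = 1 := by
  unfold halfSign; split_ifs <;> simp

theorem systemZero_pushOff₂ (hε : 0 < ε) (hε' : 4 * ((p : ℝ) + q) * ε < 1) (hpq : p.Coprime q)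
    {s : ℝ} (hs : |s| < ε) : ⌊(betaInf p q k ε).along (((systemZero p q hpq k ε).frame i).Ξ.symm
      (((systemZero p q hpq k ε).frame i).tO + ((systemZero p q hpq k ε).frame i).κ₂ * s, s)) -
        (betaInf p q k ε).arc⌋ =
    ⌊(betaInf p q k ε).along ((systemZero p q hpq k ε).frame i).ptO - (betaInf p q k ε).arc⌋ := by
  rw [along₂_pushOff, (systemZero_corners hpq k ε i).1]
  change ⌊(0 : ℝ) + halfSign i * s - ε⌋ = ⌊(0 : ℝ) - ε⌋
  rw [floor_along_origin hε hε' (e := 0) (by simpa using hε), floor_along_origin hε hε']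
  rwa [zero_add, abs_mul, abs_halfSign, one_mul]

/-- Pushing the sloped line off by `s` moves the corner on the first axis by `|s| / p`. Together
with the offset `ε` of the arc this stays below `1 / (2 p)`. -/
theorem systemR_pushOff₂ (hε : 0 < ε) (hε' : 4 * ((p : ℝ) + q) * ε < 1) (hpq : p.Coprime q)
    {s : ℝ} (hs : |s| < ε) : ⌊(beta0 p q k ε).along (((systemR p q hpq k ε).frame i).Ξ.symm
      (((systemR p q hpq k ε).frame i).tO + ((systemR p q hpq k ε).frame i).κ₂ * s, s)) -
        (beta0 p q k ε).arc⌋ =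
    ⌊(beta0 p q k ε).along ((systemR p q hpq k ε).frame i).ptO - (beta0 p q k ε).arc⌋ := by
  have hp : (1 : ℝ) ≤ p := by exact_mod_cast NeZero.pos p
  have hq : (1 : ℝ) ≤ q := by exact_mod_cast NeZero.pos q
  rw [along₂_pushOff, (systemR_corners hpq k ε i).1]
  have key : ∀ e : ℝ, |e| ≤ ε / p →
      ⌊-(((i : ℝ) + 1 / 2) / p) + e - -ε⌋ = -(i / p) - 1 := fun e he => by
    rw [← floor_neg_half_div i (e := e + ε), sub_neg_eq_add, add_assoc]
    have h1 : |e + ε| ≤ ε / p + ε := by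
      refine (abs_add_le _ _).trans ?_
      rw [abs_of_pos hε]
      linarith
    have h2 : 2 * (p : ℝ) * (ε / p + ε) = 2 * (1 + p) * ε := by field_simp
    have : 2 * (p : ℝ) * |e + ε| ≤ 2 * p * (ε / p + ε) := by gcongr
    nlinarith
  have h0 := key 0 (by rw [abs_zero]; positivity)
  rw [add_zero] at h0
  refine (key (-(halfSign i / p) * s) ?_).trans h0.symm
  rw [abs_mul, abs_neg, abs_div, abs_halfSign, Nat.abs_cast, one_div, inv_mul_eq_div]
  gcongr

theorem systemInf_pushOff (hε : 0 < ε) (hε' : 4 * ((p : ℝ) + q) * ε < 1) (hpq : p.Coprime q)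
    {s : ℝ} (hs : |s| < ε) : ⌊(betaInf p q k ε).along (((systemInf p q hpq k ε).frame i).Ξ.symm
      (((systemInf p q hpq k ε).frame i).tO + ((systemInf p q hpq k ε).frame i).κ₂ * s, s)) -
        (betaInf p q k ε).arc⌋ =
    ⌊(betaInf p q k ε).along ((systemInf p q hpq k ε).frame i).ptO - (betaInf p q k ε).arc⌋ := by
  have hp : (1 : ℝ) ≤ p := by exact_mod_cast NeZero.pos p
  have hq : (1 : ℝ) ≤ q := by exact_mod_cast NeZero.pos q
  have e1 : (betaInf p q k ε).along (((systemInf p q hpq k ε).frame i).Ξ.symm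
      (((systemInf p q hpq k ε).frame i).tO + ((systemInf p q hpq k ε).frame i).κ₂ * s, s)) =
      (betaInf p q k ε).along ((systemInf p q hpq k ε).frame i).ptO +
        halfSign i * (-(p / q) * s) := by
    rw [Frame.along₀, Frame.along₀, Frame.ptO, Homeomorph.apply_symm_apply,
      Homeomorph.apply_symm_apply]
    exact mul_add _ _ _
  rw [e1, (systemInf_corners hpq k ε i).1, floor_along_cornerB k hε hε',
    ← floor_neg_half_div i (e := halfSign i * (-(p / q) * s) - ε)]
  · change ⌊-(((i : ℝ) + 1 / 2) / q) + _ - ε⌋ = _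
    rw [add_sub_assoc]
  · have h1 : |halfSign i * (-(p / q) * s) - ε| ≤ p / q * ε + ε := by
      refine (abs_sub _ _).trans ?_
      rw [abs_mul, abs_halfSign, abs_mul, abs_neg, abs_div, Nat.abs_cast, Nat.abs_cast,
        abs_of_pos hε, one_mul]
      gcongr
    have h2 : 2 * (q : ℝ) * (p / q * ε + ε) = 2 * (p + q) * ε := by field_simp
    have : 2 * (q : ℝ) * |halfSign i * (-(p / q) * s) - ε| ≤ 2 * q * (p / q * ε + ε) := by gcongr
    nlinarith

theorem le_abs_sub_int {x ε : ℝ} (hx : ε ≤ x) (hx' : x ≤ 1 - ε) (l : ℤ) : ε ≤ |x - l| := by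
  rcases le_or_gt l 0 with h | h
  · have : (l : ℝ) ≤ 0 := by exact_mod_cast h
    exact le_trans (by linarith) (le_abs_self _)
  · have : (1 : ℝ) ≤ l := by exact_mod_cast h
    exact le_trans (by linarith) (neg_le_abs _)

theorem basepoint_axis (hε : 0 < ε) (hε' : 4 * ((p : ℝ) + q) * ε < 1) (l : ℤ) : ε ≤ |-ε - l| := by
  have hp : (1 : ℝ) ≤ p := by exact_mod_cast NeZero.pos p
  have hq : (1 : ℝ) ≤ q := by exact_mod_cast NeZero.pos q
  have := le_abs_sub_int (x := ε) le_rfl (by nlinarith) (-l)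
  rw [← abs_neg]
  convert this using 2
  push_cast
  ring

theorem basepoint_line (hε : 0 < ε) (hε' : 4 * ((p : ℝ) + q) * ε < 1) (l : ℤ) :
    ε ≤ |(betaR p q).across (ε, ε) - l| := by
  have hp : (1 : ℝ) ≤ p := by exact_mod_cast NeZero.pos p
  have hq : (1 : ℝ) ≤ q := by exact_mod_cast NeZero.pos q
  refine le_abs_sub_int (x := q * ε - p * ε + 1 / 2) ?_ ?_ l <;> nlinarith

end Crossings

end LocalComp
end

open Topology
noncomputable section
namespace LocalComp

set_option linter.unusedSectionVars false

/-! ### The multiplicities of the triangles at the basepoint -/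

section

variable (p q : ℕ)

/-- The lattice points of the `i`-th triangle. -/
def latticeSet (i : ℤ) : Set (ℤ × ℤ) :=
  {m | (0 ≤ m.1 ∧ 1 ≤ m.2 ∧ p * m.1 + q * m.2 ≤ i) ∨ (m.1 < 0 ∧ m.2 ≤ 0 ∧ i < p * m.1 + q * m.2)}

/-- The multiplicity of the `i`-th triangle at the basepoint. -/
def nz (i : ℤ) : ℕ := (latticeSet p q i).ncard

end

variable {p q : ℕ} [NeZero p] [NeZero q]

/-- The smallness of `ε` turns each real inequality for `(ε, ε) + m` into an inequality between
integers. The second coordinate changes sign under the bijection. -/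
theorem ncard_inRegion {ε : ℝ} (hε : 0 < ε) (hε' : 4 * ((p : ℝ) + q) * ε < 1) (i : ℤ) :
    Set.ncard {m : ℤ × ℤ | InRegion p q i ((ε, ε) + latticeVec m)} = nz p q i := by
  have hp : (1 : ℝ) ≤ p := by exact_mod_cast NeZero.pos p
  have hq : (1 : ℝ) ≤ q := by exact_mod_cast NeZero.pos q
  have hp' : (1 : ℤ) ≤ p := by exact_mod_cast NeZero.pos p
  have hq' : (1 : ℤ) ≤ q := by exact_mod_cast NeZero.pos q
  have hsmall : ε < 1 / 4 := by nlinarith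
  have hb1 : q * ε - p * ε < 1 / 4 := by nlinarith
  have hb2 : -(1 / 4) < q * ε - p * ε := by nlinarith
  have x1 : ∀ a : ℤ, 0 ≤ ε + a ↔ 0 ≤ a := fun a => by
    constructor
    · intro h; by_contra hn
      have : (a : ℝ) ≤ -1 := by exact_mod_cast (by omega : a ≤ -1)
      linarith
    · intro h; have : (0 : ℝ) ≤ a := by exact_mod_cast h
      linarith
  have x2 : ∀ a : ℤ, ε + a ≤ 0 ↔ a < 0 := fun a => by
    constructor
    · intro h; by_contra hn
      have : (0 : ℝ) ≤ a := by exact_mod_cast (by omega : 0 ≤ a)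
      linarith
    · intro h; have : (a : ℝ) ≤ -1 := by exact_mod_cast (by omega : a ≤ -1)
      linarith
  have e : ∀ a b : ℤ, (q : ℝ) * (ε + b) - p * (ε + a) + i + 1 / 2 =
      ((q * b - p * a + i : ℤ) : ℝ) + (q * ε - p * ε + 1 / 2) := fun a b => by push_cast; ring
  have x3 : ∀ a b : ℤ, 0 ≤ (q : ℝ) * (ε + b) - p * (ε + a) + i + 1 / 2 ↔ 0 ≤ q * b - p * a + i :=
    fun a b => by
      rw [e]
      constructor
      · intro h; by_contra hn
        have : ((q * b - p * a + i : ℤ) : ℝ) ≤ -1 := by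
          exact_mod_cast (by omega : q * b - p * a + i ≤ -1)
        linarith
      · intro h; have : (0 : ℝ) ≤ ((q * b - p * a + i : ℤ) : ℝ) := by exact_mod_cast h
        linarith
  have x4 : ∀ a b : ℤ, (q : ℝ) * (ε + b) - p * (ε + a) + i + 1 / 2 ≤ 0 ↔ q * b - p * a + i < 0 :=
    fun a b => by
      rw [e]
      constructor
      · intro h; by_contra hn
        have : (0 : ℝ) ≤ ((q * b - p * a + i : ℤ) : ℝ) := by exact_mod_cast not_lt.1 hn
        linarith
      · intro h
        have : ((q * b - p * a + i : ℤ) : ℝ) ≤ -1 := by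
          exact_mod_cast (by omega : q * b - p * a + i ≤ -1)
        linarith
  have hmem : ∀ a b : ℤ, InRegion p q i ((ε, ε) + latticeVec (a, b)) ↔
      (a, -b) ∈ latticeSet p q i := fun a b => by
    have hpr : ((ε, ε) : ℝ × ℝ) + latticeVec (a, b) = (ε + a, ε + b) := rfl
    rw [hpr]
    unfold InRegion latticeSet halfSign
    simp only [Set.mem_ofPred_eq, mul_neg]
    split_ifs with hi
    · simp only [one_mul, x1, x2, x3]
      constructor
      · rintro ⟨h1, h2, h3⟩
        exact Or.inl ⟨h1, by omega, by linarith⟩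
      · rintro (⟨h1, h2, h3⟩ | ⟨h1, h2, h3⟩)
        · exact ⟨h1, by omega, by linarith⟩
        · nlinarith
    · simp only [neg_mul, one_mul, Left.nonneg_neg_iff, Left.neg_nonpos_iff, x1, x2, x4]
      constructor
      · rintro ⟨h1, h2, h3⟩
        exact Or.inr ⟨h1, by omega, by linarith⟩
      · rintro (⟨h1, h2, h3⟩ | ⟨h1, h2, h3⟩)
        · nlinarith
        · exact ⟨h1, by omega, by linarith⟩
  refine Set.ncard_congr (fun m _ => (m.1, -m.2)) (fun m hm => (hmem m.1 m.2).1 hm)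
    (fun m m' _ _ h => ?_) (fun m hm => ⟨(m.1, -m.2), ?_, by simp⟩)
  · simp only [Prod.mk.injEq, neg_inj] at h
    exact Prod.ext h.1 h.2
  · exact (hmem m.1 (-m.2)).2 (by simpa using hm)

theorem latticeSet_finite (i : ℤ) : (latticeSet p q i).Finite := by
  have hp : (1 : ℤ) ≤ p := by exact_mod_cast NeZero.pos p
  have hq : (1 : ℤ) ≤ q := by exact_mod_cast NeZero.pos q
  refine ((Set.finite_Icc (-|i|) |i|).prod (Set.finite_Icc (-|i|) |i|)).subset ?_
  rintro ⟨a, b⟩ (⟨h1, h2, h3⟩ | ⟨h1, h2, h3⟩)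
  · simp only at h1 h2 h3
    have := le_abs_self i
    refine ⟨⟨by linarith [abs_nonneg i], ?_⟩, ⟨by linarith [abs_nonneg i], ?_⟩⟩ <;>
    · simp only
      nlinarith
  · simp only at h1 h2 h3
    have := neg_abs_le i
    refine ⟨⟨?_, by simp only; linarith [abs_nonneg i]⟩,
      ⟨?_, by simp only; linarith [abs_nonneg i]⟩⟩ <;>
    · simp only
      nlinarith

theorem nz_eq_zero_iff (i : ℤ) : nz p q i = 0 ↔ -p ≤ i ∧ i < q := by
  have hp : (1 : ℤ) ≤ p := by exact_mod_cast NeZero.pos p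
  have hq : (1 : ℤ) ≤ q := by exact_mod_cast NeZero.pos q
  rw [nz, Set.ncard_eq_zero (latticeSet_finite i), Set.eq_empty_iff_forall_notMem]
  constructor
  · intro h
    -- As `i` leaves the interval `[-p, q)`, these are the first lattice points to appear: `(0, 1)`
    -- for `i ≥ q` and `(-1, 0)` for `i < -p`.
    have h1 := h (0, 1)
    have h2 := h (-1, 0)
    simp only [latticeSet, Set.mem_ofPred_eq] at h1 h2
    constructor <;> by_contra hn
    · exact h2 (Or.inr ⟨by norm_num, le_rfl, by linarith⟩)
    · exact h1 (Or.inl ⟨le_rfl, le_rfl, by linarith⟩)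
  · rintro ⟨h1, h2⟩ ⟨a, b⟩ (⟨h3, h4, h5⟩ | ⟨h3, h4, h5⟩)
    · simp only at h3 h4 h5; nlinarith
    · simp only at h3 h4 h5; nlinarith

/-- The point reflection `(a, b) ↦ (-1 - a, 1 - b)` exchanges the two kinds of lattice points. This
symmetry is the source of the vanishing determinant. -/
theorem nz_symm (i : ℤ) : nz p q (q - p - 1 - i) = nz p q i := by
  have key : ∀ i a b, (a, b) ∈ latticeSet p q i → (-1 - a, 1 - b) ∈ latticeSet p q (q - p - 1 - i) := by
    rintro i a b (⟨h1, h2, h3⟩ | ⟨h1, h2, h3⟩)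
    · simp only at h1 h2 h3
      exact Or.inr ⟨by simp only; omega, by simp only; omega, by simp only; linarith⟩
    · simp only at h1 h2 h3
      exact Or.inl ⟨by simp only; omega, by simp only; omega, by simp only; linarith⟩
  symm
  refine Set.ncard_congr (fun m _ => (-1 - m.1, 1 - m.2)) (fun m hm => key _ _ _ hm)
    (fun m m' _ _ h => ?_) (fun m hm => ⟨(-1 - m.1, 1 - m.2), ?_, by simp⟩)
  · simp only [Prod.mk.injEq] at h
    exact Prod.ext (by linarith [h.1]) (by linarith [h.2])
  · have := key _ _ _ hm
    rwa [sub_sub_cancel] at this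

/-- The set for `i + q` and the set for `i` moved up by one row differ only in the row `b = 1`:
there `⌊i/p⌋ + 1` points are gained, or lost if this number is negative. -/
theorem nz_add (i : ℤ) : (nz p q (i + q) : ℤ) = nz p q i + (i / p + 1) := by
  have hp : (0 : ℤ) < p := by exact_mod_cast NeZero.pos p
  set S := latticeSet p q (i + q) with hS
  set T := (fun m : ℤ × ℤ => (m.1, m.2 + 1)) '' latticeSet p q i with hT
  have hinj : Function.Injective fun m : ℤ × ℤ => (m.1, m.2 + 1) := fun m m' h => by
    simp only [Prod.mk.injEq, add_left_inj] at h
    exact Prod.ext h.1 h.2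
  have hTc : T.ncard = nz p q i := Set.ncard_image_of_injective _ hinj
  have hSf : S.Finite := latticeSet_finite _
  have hTf : T.Finite := (latticeSet_finite _).image _
  have hmemT : ∀ a b : ℤ, (a, b) ∈ T ↔ (0 ≤ a ∧ 2 ≤ b ∧ p * a + q * b ≤ i + q) ∨
      (a < 0 ∧ b ≤ 1 ∧ i + q < p * a + q * b) := fun a b => by
    constructor
    · rintro ⟨⟨a', b'⟩, h, he⟩
      simp only [Prod.mk.injEq] at he
      obtain ⟨rfl, rfl⟩ := he
      rcases h with ⟨h1, h2, h3⟩ | ⟨h1, h2, h3⟩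
      · exact Or.inl ⟨h1, by simp only at h2; omega, by simp only at h3; linarith⟩
      · exact Or.inr ⟨h1, by simp only at h2; omega, by simp only at h3; linarith⟩
    · rintro (⟨h1, h2, h3⟩ | ⟨h1, h2, h3⟩)
      · exact ⟨(a, b - 1), Or.inl ⟨h1, by simp only; omega, by simp only; linarith⟩, by simp⟩
      · exact ⟨(a, b - 1), Or.inr ⟨h1, by simp only; omega, by simp only; linarith⟩, by simp⟩
  have hdiv : ∀ a : ℤ, p * a ≤ i ↔ a ≤ i / p := fun a => by
    rw [Int.le_ediv_iff_mul_le hp, mul_comm]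
  have d1 : S \ T = (fun a : ℤ => (a, (1 : ℤ))) '' (Set.Ico 0 (i / p + 1)) := by
    ext ⟨a, b⟩
    rw [Set.mem_sdiff, hmemT, hS, latticeSet]
    simp only [Set.mem_ofPred_eq, Set.mem_image, Set.mem_Ico, Prod.mk.injEq]
    constructor
    · rintro ⟨⟨h1, h2, h3⟩ | ⟨h1, h2, h3⟩, hn⟩
      · have hb : b = 1 := by
          by_contra hb
          exact hn (Or.inl ⟨h1, by omega, h3⟩)
        subst hb
        exact ⟨a, ⟨h1, by have := (hdiv a).1 (by linarith); omega⟩, rfl, rfl⟩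
      · exact (hn (Or.inr ⟨h1, by omega, h3⟩)).elim
    · rintro ⟨a, ⟨h1, h2⟩, rfl, rfl⟩
      have := (hdiv a).2 (by omega)
      refine ⟨Or.inl ⟨h1, le_rfl, by linarith⟩, ?_⟩
      rintro (⟨h3, h4, h5⟩ | ⟨h3, h4, h5⟩) <;> omega
  have d2 : T \ S = (fun a : ℤ => (a, (1 : ℤ))) '' (Set.Ico (i / p + 1) 0) := by
    ext ⟨a, b⟩
    rw [Set.mem_sdiff, hmemT, hS, latticeSet]
    simp only [Set.mem_ofPred_eq, Set.mem_image, Set.mem_Ico, Prod.mk.injEq]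
    constructor
    · rintro ⟨⟨h1, h2, h3⟩ | ⟨h1, h2, h3⟩, hn⟩
      · exact (hn (Or.inl ⟨h1, by omega, h3⟩)).elim
      · have hb : b = 1 := by
          by_contra hb
          exact hn (Or.inr ⟨h1, by omega, h3⟩)
        subst hb
        refine ⟨a, ⟨?_, h1⟩, rfl, rfl⟩
        have : ¬ a ≤ i / p := fun h => by have := (hdiv a).2 h; linarith
        omega
    · rintro ⟨a, ⟨h1, h2⟩, rfl, rfl⟩
      have : ¬ p * a ≤ i := fun h => by have := (hdiv a).1 h; omega
      refine ⟨Or.inr ⟨h2, le_rfl, by linarith⟩, ?_⟩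
      rintro (⟨h3, h4, h5⟩ | ⟨h3, h4, h5⟩) <;> omega
  have hinj1 : Function.Injective fun a : ℤ => (a, (1 : ℤ)) := fun a b h => by simpa using h
  have c1 : (S \ T).ncard = (i / p + 1).toNat := by
    rw [d1, Set.ncard_image_of_injective _ hinj1, ← Finset.coe_Ico, Set.ncard_coe_finset,
      Int.card_Ico, sub_zero]
  have c2 : (T \ S).ncard = (-(i / p + 1)).toNat := by
    rw [d2, Set.ncard_image_of_injective _ hinj1, ← Finset.coe_Ico, Set.ncard_coe_finset,
      Int.card_Ico, zero_sub]
  have e1 := Set.ncard_inter_add_ncard_sdiff_eq_ncard S T hSf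
  have e2 := Set.ncard_inter_add_ncard_sdiff_eq_ncard T S hTf
  rw [Set.inter_comm] at e2
  rw [c1] at e1
  rw [c2, hTc] at e2
  have e3 : S.ncard = nz p q (i + q) := rfl
  omega

/-- Outside a bounded interval the triangle contains `N + 1` lattice points on one line. This
finiteness gives the `U`-adic convergence of all sums. -/
theorem nz_le_finite (N : ℕ) : {i : ℤ | nz p q i ≤ N}.Finite := by
  have hp : (1 : ℤ) ≤ p := by exact_mod_cast NeZero.pos p
  have hq : (1 : ℤ) ≤ q := by exact_mod_cast NeZero.pos q
  refine (Set.finite_Icc (-(p * (N + 1) : ℤ)) (q * (N + 1))).subset fun i hi => ?_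
  by_contra hn
  have key : ∀ (g : ℕ → ℤ × ℤ), Function.Injective g →
      (∀ j < N + 1, g j ∈ latticeSet p q i) → False := fun g hg hm => by
    have h1 : (g '' (Finset.range (N + 1) : Set ℕ)).ncard = N + 1 := by
      rw [Set.ncard_image_of_injective _ hg, Set.ncard_coe_finset, Finset.card_range]
    have h2 : (g '' (Finset.range (N + 1) : Set ℕ)).ncard ≤ nz p q i := by
      refine Set.ncard_le_ncard ?_ (latticeSet_finite i)
      rintro _ ⟨j, hj, rfl⟩
      exact hm j (by simpa using hj)
    have : nz p q i ≤ N := hi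
    omega
  rw [Set.mem_Icc, not_and_or, not_le, not_le] at hn
  rcases hn with hn | hn
  · refine key (fun j => (-1 - (j : ℤ), 0)) (fun a b h => by simpa using h) fun j hj => ?_
    have hj' : (j : ℤ) ≤ N := by exact_mod_cast Nat.lt_succ_iff.1 hj
    refine Or.inr ⟨by simp only; omega, le_rfl, ?_⟩
    simp only
    nlinarith
  · refine key (fun j => (0, (j : ℤ) + 1)) (fun a b h => by simpa using h) fun j hj => ?_
    have hj' : (j : ℤ) ≤ N := by exact_mod_cast Nat.lt_succ_iff.1 hj
    refine Or.inl ⟨le_rfl, by simp only; omega, ?_⟩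
    simp only
    nlinarith

end LocalComp
end

/-! ### Linear algebra over `F[[U]]` -/

open Topology
noncomputable section
namespace LocalComp

/-! ### Weighted sums of power series -/

section WeightedSum

variable {I : Type*}

/-- The sum of the power series `X ^ n i * g i`. -/
def wsum (n : I → ℕ) (g : I → FU) : FU :=
  PowerSeries.mk fun N => ∑ᶠ i, PowerSeries.coeff N (PowerSeries.X ^ n i * g i)

variable {n : I → ℕ}

theorem support_coeff_finite (hn : ∀ N, {i | n i ≤ N}.Finite) (g : I → FU) (N : ℕ) :
    (Function.support fun i => PowerSeries.coeff N (PowerSeries.X ^ n i * g i)).Finite := by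
  refine (hn N).subset fun i hi => ?_
  by_contra h
  refine hi ?_
  simp only [Set.mem_ofPred_eq] at h ⊢
  rw [PowerSeries.coeff_X_pow_mul', if_neg h]

theorem uAdicHasSum_wsum (hn : ∀ N, {i | n i ≤ N}.Finite) (g : I → FU) :
    UAdicHasSum (fun i => ((PowerSeries.X ^ n i * g i : FU) : FUinv)) (wsum n g : FU) := by
  refine ⟨fun N => (hn N.toNat).subset ?_, fun N => ?_⟩
  · rintro i ⟨m, hm, hi⟩
    rw [PowerSeries.coeff_coe] at hi
    split_ifs at hi with h0
    · exact (hi rfl).elim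
    · rw [PowerSeries.coeff_X_pow_mul'] at hi
      split_ifs at hi with h1
      · simp only [Set.mem_ofPred_eq]; omega
      · exact (hi rfl).elim
  · simp only [PowerSeries.coeff_coe]
    split_ifs with h0
    · simp
    · simp [wsum]

theorem wsum_finset_sum (hn : ∀ N, {i | n i ≤ N}.Finite) {J : Type*} (s : Finset J)
    (g : J → I → FU) : wsum n (fun i => ∑ j ∈ s, g j i) = ∑ j ∈ s, wsum n (g j) := by
  ext N
  simp only [wsum, PowerSeries.coeff_mk, map_sum, Finset.mul_sum]
  exact finsum_sum_comm s _ fun j _ => support_coeff_finite hn (g j) N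

theorem wsum_mul (hn : ∀ N, {i | n i ≤ N}.Finite) (c : FU) (g : I → FU) :
    wsum n (fun i => c * g i) = c * wsum n g := by
  ext N
  simp only [wsum, PowerSeries.coeff_mk, mul_left_comm _ c]
  simp only [PowerSeries.coeff_mul N c, PowerSeries.coeff_mk]
  rw [finsum_sum_comm]
  · refine Finset.sum_congr rfl fun x _ => ?_
    exact (mul_finsum _ _).symm
  · intro x _
    refine (support_coeff_finite hn g x.2).subset fun i hi => ?_
    simp only [Function.mem_support] at hi ⊢
    exact right_ne_zero_of_mul hi

theorem wsum_comp_equiv (e : I ≃ I) (he : ∀ i, n (e i) = n i) (g : I → FU) :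
    wsum n (fun i => g (e i)) = wsum n g := by
  ext N
  simp only [wsum, PowerSeries.coeff_mk]
  rw [← finsum_comp_equiv e (f := fun i => PowerSeries.coeff N (PowerSeries.X ^ n i * g i))]
  simp only [he]

theorem constantCoeff_wsum (s : Finset I) (hs : ∀ i, n i = 0 ↔ i ∈ s) (g : I → FU) :
    PowerSeries.constantCoeff (wsum n g) = ∑ i ∈ s, PowerSeries.constantCoeff (g i) := by
  rw [← PowerSeries.coeff_zero_eq_constantCoeff_apply, wsum, PowerSeries.coeff_mk,
    finsum_eq_sum_of_support_subset (s := s)]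
  · refine Finset.sum_congr rfl fun i hi => ?_
    rw [(hs i).2 hi, pow_zero, one_mul, PowerSeries.coeff_zero_eq_constantCoeff_apply]
  · intro i hi
    by_contra h
    refine hi ?_
    simp only
    rw [PowerSeries.coeff_X_pow_mul', if_neg]
    have := mt (hs i).1 h
    omega

/-- In characteristic two, terms that are exchanged by an involution without fixed points cancel. -/
theorem wsum_eq_zero_of_involution (hn : ∀ N, {i | n i ≤ N}.Finite) (e : I → I)
    (hee : ∀ i, e (e i) = i) (he : ∀ i, n (e i) = n i) (g : I → FU) (hg : ∀ i, g (e i) = g i)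
    (hfix : ∀ i, e i = i → g i = 0) : wsum n g = 0 := by
  ext N
  simp only [wsum, PowerSeries.coeff_mk, map_zero]
  rw [finsum_eq_sum_of_support_subset _ (s := (hn N).toFinset)]
  · refine Finset.sum_involution (fun i _ => e i) (fun i _ => ?_) (fun i _ hi hei => hi ?_)
      (fun i hi => ?_) (fun i _ => hee i)
    · rw [he, hg, CharTwo.add_self_eq_zero]
    · rw [hfix i hei, mul_zero, map_zero]
    · simp only [Set.Finite.mem_toFinset, Set.mem_ofPred_eq] at hi ⊢
      rwa [he]
  · intro i hi
    simp only [Set.Finite.coe_toFinset, Set.mem_ofPred_eq]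
    by_contra h
    refine hi ?_
    simp only
    rw [PowerSeries.coeff_X_pow_mul', if_neg h]

end WeightedSum

/-- A nonzero vector in the kernel of a matrix can be divided by a power of the variable so that its
reduction is nonzero. -/
theorem exists_primitive {J : Type*} [Finite J] {v : J → FU} (hv : v ≠ 0) :
    ∃ (N : ℕ) (v' : J → FU), (∀ j, v j = PowerSeries.X ^ N * v' j) ∧
      ∃ j, PowerSeries.constantCoeff (v' j) ≠ 0 := by
  classical
  have hex : ∃ N, ∃ j, PowerSeries.coeff N (v j) ≠ 0 := by
    by_contra h
    push Not at h
    exact hv (funext fun j => PowerSeries.ext fun N => by simpa using h N j)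
  have hmin : ∀ j, PowerSeries.X ^ Nat.find hex ∣ v j := fun j => by
    rw [PowerSeries.X_pow_dvd_iff]
    intro m hm
    have := Nat.find_min hex hm
    push Not at this
    exact this j
  choose v' hv' using hmin
  refine ⟨Nat.find hex, v', hv', ?_⟩
  obtain ⟨j, hj⟩ := Nat.find_spec hex
  refine ⟨j, fun h => hj ?_⟩
  rw [hv' j, PowerSeries.coeff_X_pow_mul', if_pos le_rfl, Nat.sub_self,
    PowerSeries.coeff_zero_eq_constantCoeff_apply, h]

end LocalComp
end

open Topology
noncomputable section
namespace LocalComp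

/-! ### The matrix of triangle counts -/

/-- Signs are irrelevant in characteristic two. The involution `π ↦ ρ π κ` of the permutations
preserves the products in the determinant, so terms cancel in pairs except those of fixed `π`, which
contain a zero factor. -/
theorem Matrix.det_eq_zero_of_involutions {R ι : Type*} [CommRing R] [CharP R 2] [Fintype ι]
    [DecidableEq ι] (M : Matrix ι ι R) (ρ κ : Equiv.Perm ι) (hρ : ∀ a, ρ (ρ a) = a)
    (hκ : ∀ b, κ (κ b) = b) (hM : ∀ a b, M (ρ a) (κ b) = M a b)
    (hfix : ∀ π : Equiv.Perm ι, (∀ b, ρ (π (κ b)) = π b) → ∃ b, M (π b) b = 0) : M.det = 0 := by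
  have hsign : ∀ (π : Equiv.Perm ι) (x : R), Equiv.Perm.sign π • x = x := fun π x => by
    rcases Int.units_eq_one_or (Equiv.Perm.sign π) with h | h <;> simp [h, CharTwo.neg_eq]
  rw [Matrix.det_apply]
  simp only [hsign]
  refine Finset.sum_involution (fun π _ => κ.trans (π.trans ρ)) (fun π _ => ?_)
    (fun π _ h0 he => h0 ?_) (fun _ _ => Finset.mem_univ _) (fun π _ => ?_)
  · have : ∏ b, M (κ.trans (π.trans ρ) b) b = ∏ b, M (π b) b := by
      rw [← Equiv.prod_comp κ (fun b => M (π b) b)]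
      refine Finset.prod_congr rfl fun b _ => ?_
      rw [← hM (π (κ b)) (κ b), hκ]
      rfl
    rw [this, CharTwo.add_self_eq_zero]
  · obtain ⟨b, hb⟩ := hfix π fun b => DFunLike.congr_fun he b
    exact Finset.prod_eq_zero (Finset.mem_univ b) hb
  · ext b
    simp [hρ, hκ]

theorem charP_powerSeries : CharP FU 2 :=
  charP_of_injective_ringHom (f := PowerSeries.C) PowerSeries.C_injective 2

variable {p q : ℕ}

theorem CoeffIndex.ext {a b : CoeffIndex p q} (h : a.1 = b.1) (hval : (a.2 : ℕ) = b.2) : a = b := by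
  obtain ⟨m, t⟩ := a
  obtain ⟨m', t'⟩ := b
  simp only at h
  subst h
  exact congrArg _ (Fin.ext hval)

/-- The basis index `(m, ℓ)`, where `ℓ` is read modulo `s_m`. -/
def indexMod (m : ZMod p) (h : 0 < sSeq p q m) (ℓ : ℤ) : CoeffIndex p q :=
  ⟨m, ⟨(ℓ % (sSeq p q m : ℤ)).toNat, by
    have h1 := Int.emod_nonneg ℓ (b := (sSeq p q m : ℤ)) (by omega)
    have h2 := Int.emod_lt_of_pos ℓ (b := (sSeq p q m : ℤ)) (by omega)
    omega⟩⟩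

theorem indexMod_val (m : ZMod p) (h : 0 < sSeq p q m) (ℓ : ℤ) :
    ((indexMod m h ℓ).2 : ℤ) = ℓ % (sSeq p q m : ℤ) :=
  Int.toNat_of_nonneg (Int.emod_nonneg ℓ (by omega))

theorem indexMod_self (a : CoeffIndex p q) (h : 0 < sSeq p q a.1) :
    indexMod a.1 h (a.2 : ℕ) = a := by
  refine CoeffIndex.ext rfl ?_
  zify
  rw [indexMod_val]
  exact Int.emod_eq_of_lt (by positivity) (by exact_mod_cast a.2.2)

theorem CoeffIndex.sSeq_pos (a : CoeffIndex p q) : 0 < sSeq p q a.1 :=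
  lt_of_le_of_lt (Nat.zero_le _) a.2.2

variable [NeZero p]

/-- The right-hand side counts the integers in `[0, q)` that are congruent to `i` modulo `p`; this
is the most useful description of `s_i`. -/
theorem sSeq_intCast (i : ℤ) : (sSeq p q (i : ZMod p) : ℤ) = (q - 1 - i % p) / p + 1 := by
  have hp : (0 : ℤ) < p := by exact_mod_cast NeZero.pos p
  have hv : ((i : ZMod p).val : ℤ) = i % p := ZMod.val_intCast i
  have h0 := Int.emod_nonneg i hp.ne'
  have h1 := Int.emod_lt_of_pos i hp
  have hq : (q : ℤ) = p * (q / p : ℕ) + (q % p : ℕ) := by exact_mod_cast (Nat.div_add_mod q p).symm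
  have hr : ((q % p : ℕ) : ℤ) < p := by exact_mod_cast Nat.mod_lt q (NeZero.pos p)
  unfold sSeq
  split_ifs with h
  · have h2 : i % p < (q % p : ℕ) := by rw [← hv]; exact_mod_cast h
    have : ((q : ℤ) - 1 - i % p) / p = (q / p : ℕ) := by
      rw [Int.ediv_eq_iff_of_pos hp]
      constructor <;> nlinarith
    rw [this]
    push_cast
    ring
  · have h2 : ((q % p : ℕ) : ℤ) ≤ i % p := by rw [← hv]; exact_mod_cast not_lt.1 h
    have : ((q : ℤ) - 1 - i % p) / p = (q / p : ℕ) - 1 := by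
      rw [Int.ediv_eq_iff_of_pos hp]
      have : (0 : ℤ) ≤ (q % p : ℕ) := by positivity
      constructor <;> nlinarith
    rw [this]
    ring

/-- The `s_m` add up to `q`, so the matrix of triangle counts is square. -/
theorem card_coeffIndex : Fintype.card (CoeffIndex p q) = q := by
  have h1 : Fintype.card (CoeffIndex p q) = ∑ m : ZMod p, sSeq p q m := by
    rw [Fintype.card_sigma]; simp
  have h2 : ∀ m : ZMod p, sSeq p q m = q / p + if m.val < q % p then 1 else 0 := fun m => by
    unfold sSeq; split_ifs <;> simp
  have h3 : (Finset.univ.filter fun m : ZMod p => m.val < q % p).card = q % p := by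
    have := Nat.mod_lt q (NeZero.pos p)
    rw [← Finset.card_range (q % p)]
    refine Finset.card_bij (fun m _ => m.val) (fun m hm => ?_) (fun m _ m' _ h => ?_) fun r hr => ?_
    · simpa using hm
    · exact ZMod.val_injective p h
    · refine ⟨(r : ZMod p), ?_, ?_⟩ <;>
      · simp only [Finset.mem_range] at hr
        simp [ZMod.val_natCast, Nat.mod_eq_of_lt (hr.trans this), hr]
  rw [h1, Finset.sum_congr rfl fun m _ => h2 m, Finset.sum_add_distrib, Finset.sum_boole, h3]
  simp only [Finset.sum_const, Finset.card_univ, ZMod.card, smul_eq_mul, Nat.cast_id]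
  exact Nat.div_add_mod q p

/-- The reflection `n ↦ q - 1 - n` preserves `[0, q)`, hence the sizes of its residue classes.
Modulo `s_m` the exponent `⌊i/p⌋ + 1` of the first monodromy changes sign. -/
theorem sSeq_reflect (i : ℤ) :
    sSeq p q ((q - p - 1 - i : ℤ) : ZMod p) = sSeq p q (i : ZMod p) ∧
      (q - p - 1 - i) / p + 1 = (sSeq p q (i : ZMod p) : ℤ) - (i / p + 1) := by
  have hp : (0 : ℤ) < p := by exact_mod_cast NeZero.pos p
  have h0 := Int.emod_nonneg i hp.ne'
  have h1 := Int.emod_lt_of_pos i hp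
  have h2 := Int.mul_ediv_add_emod i p
  set r := i % p
  set x := i / p
  have h3 := Int.mul_ediv_add_emod (q - 1 - r) p
  have h4 := Int.emod_nonneg (q - 1 - r) hp.ne'
  have h5 := Int.emod_lt_of_pos (q - 1 - r) hp
  have hs := sSeq_intCast (p := p) (q := q) i
  change _ = (q - 1 - r) / p + 1 at hs
  set Y := (q - 1 - r) / p
  set e := (q - 1 - r) % p
  have hdiv : (q - p - 1 - i : ℤ) / p = Y - x - 1 := by
    rw [Int.ediv_eq_iff_of_pos hp]
    constructor <;> nlinarith
  have hmod : (q - p - 1 - i : ℤ) % p = e := by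
    have := Int.mul_ediv_add_emod (q - p - 1 - i) p
    rw [hdiv] at this
    linarith
  have hs' := sSeq_intCast (p := p) (q := q) (q - p - 1 - i)
  rw [hmod] at hs'
  have : (q - 1 - e : ℤ) / p = Y := by
    rw [Int.ediv_eq_iff_of_pos hp]
    constructor <;> nlinarith
  rw [this] at hs'
  constructor
  · exact Nat.cast_injective (R := ℤ) (hs'.trans hs.symm)
  · rw [hdiv, hs]
    ring

theorem sSeq_reflect' (m : ZMod p) : sSeq p q (q - 1 - m) = sSeq p q m := by
  have := (sSeq_reflect (p := p) (q := q) (m.val : ℤ)).1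
  push_cast at this
  simpa using this

/-- The reflection of the basis indices. -/
def reflect (a : CoeffIndex p q) : CoeffIndex p q :=
  indexMod (q - 1 - a.1) (by rw [sSeq_reflect']; exact a.sSeq_pos) (-(a.2 : ℕ) : ℤ)

theorem reflect_reflect (a : CoeffIndex p q) : reflect (reflect a) = a := by
  have h1 : (reflect a).1 = q - 1 - a.1 := rfl
  refine CoeffIndex.ext (by change (q : ZMod p) - 1 - (reflect a).1 = _; rw [h1]; ring) ?_
  have h2 : ((reflect a).2 : ℤ) = (-(a.2 : ℕ) : ℤ) % (sSeq p q a.1 : ℤ) := by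
    rw [reflect, indexMod_val, sSeq_reflect']
  have h3 : ((reflect (reflect a)).2 : ℤ) =
      (-((reflect a).2 : ℕ) : ℤ) % (sSeq p q (reflect a).1 : ℤ) := by
    rw [reflect, indexMod_val, sSeq_reflect']
  have h4 : sSeq p q (reflect a).1 = sSeq p q a.1 := sSeq_reflect' a.1
  zify
  rw [h3, h2, h4]
  rw [show -(-((a.2 : ℕ) : ℤ) % (sSeq p q a.1 : ℤ)) = 0 - -((a.2 : ℕ) : ℤ) % (sSeq p q a.1 : ℤ) by ring,
    Int.sub_emod_emod, zero_sub, neg_neg]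
  exact Int.emod_eq_of_lt (by positivity) (by exact_mod_cast a.2.2)

open Classical in
/-- The condition for the `i`-th triangle to contribute to an entry of the matrix. -/
def Contributes (a : CoeffIndex p q) (j : ZMod q) (i : ℤ) : Prop :=
  (i : ZMod p) = a.1 ∧ (i : ZMod q) = j ∧ (sSeq p q a.1 : ℤ) ∣ (a.2 : ℕ) + i / p + 1

open Classical in
/-- The matrix of the triangle counts. -/
def countMatrix (a : CoeffIndex p q) (j : ZMod q) : FU :=
  wsum (nz p q) fun i => if Contributes a j i then 1 else 0

/-- Modulo `s_m` both `ℓ` and `⌊i/p⌋ + 1` change sign, so divisibility of their sum is preserved. -/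
theorem contributes_reflect (a : CoeffIndex p q) (j : ZMod q) (i : ℤ) :
    Contributes (reflect a) (-p - 1 - j) (q - p - 1 - i) ↔ Contributes a j i := by
  have key : ∀ (a : CoeffIndex p q) (j : ZMod q) (i : ℤ), Contributes a j i →
      Contributes (reflect a) (-p - 1 - j) (q - p - 1 - i) := by
    rintro a j i ⟨h1, h2, h3⟩
    refine ⟨?_, ?_, ?_⟩
    · change _ = (q : ZMod p) - 1 - a.1
      rw [← h1]
      push_cast
      simp
    · rw [← h2]
      push_cast
      simp
    · rw [reflect, indexMod_val]
      change ((sSeq p q (q - 1 - a.1) : ℕ) : ℤ) ∣ _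
      rw [sSeq_reflect', add_assoc, (sSeq_reflect i).2, h1]
      have h4 := Int.emod_add_mul_ediv (-((a.2 : ℕ) : ℤ)) (sSeq p q a.1 : ℤ)
      have : -((a.2 : ℕ) : ℤ) % (sSeq p q a.1 : ℤ) + ((sSeq p q a.1 : ℤ) - (i / p + 1)) =
          (sSeq p q a.1 : ℤ) * (1 - -((a.2 : ℕ) : ℤ) / (sSeq p q a.1 : ℤ)) -
            ((a.2 : ℕ) + i / p + 1) := by linarith
      rw [this]
      exact dvd_sub (dvd_mul_right _ _) h3
  refine ⟨fun h => ?_, key a j i⟩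
  have := key _ _ _ h
  rwa [reflect_reflect, sub_sub_cancel, sub_sub_cancel] at this

variable [NeZero q]

theorem countMatrix_reflect (a : CoeffIndex p q) (j : ZMod q) :
    countMatrix (reflect a) (-p - 1 - j) = countMatrix a j := by
  classical
  unfold countMatrix
  rw [← wsum_comp_equiv (Equiv.subLeft ((q : ℤ) - p - 1)) (fun i => nz_symm i)
    (fun i => if Contributes (reflect a) (-p - 1 - j) i then 1 else 0)]
  simp only [Equiv.subLeft_apply, contributes_reflect]

/-- The contributions of `i` and `q - p - 1 - i` to such an entry are equal and cancel. The
hypothesis `h` excludes a contribution of the centre of the reflection. -/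
theorem countMatrix_eq_zero {a : CoeffIndex p q} {j : ZMod q} (ha : reflect a = a)
    (hj : -p - 1 - j = j)
    (h : ∀ i : ℤ, 2 * i = q - p - 1 → (i : ZMod p) = a.1 → (i : ZMod q) ≠ j) :
    countMatrix a j = 0 := by
  classical
  refine wsum_eq_zero_of_involution nz_le_finite (fun i => q - p - 1 - i) (fun i => by ring)
    (fun i => nz_symm i) _ (fun i => ?_) fun i hi => ?_
  · have := contributes_reflect a j i
    rw [ha, hj] at this
    simp only [this]
  · refine if_neg fun hc => h i (by linarith) hc.1 hc.2.1

/-- An equivariant bijection matches a fixed column with a fixed row. The entry there vanishes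
unless the centre `i₀ = (q - p - 1) / 2` is an integer and contributes, and the parities of `p` and
`q` always leave a column where it does not. -/
theorem exists_countMatrix_eq_zero (hpq : p.Coprime q) (τ : CoeffIndex p q ≃ ZMod q)
    (hτ : ∀ a, τ (reflect a) = -p - 1 - τ a) : ∃ a, countMatrix a (τ a) = 0 := by
  have hfixrow : ∀ j : ZMod q, -p - 1 - j = j → reflect (τ.symm j) = τ.symm j := fun j hj => by
    rw [Equiv.eq_symm_apply, hτ, Equiv.apply_symm_apply, hj]
  have hp : (0 : ℤ) < p := by exact_mod_cast NeZero.pos p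
  have hq : (0 : ℤ) < q := by exact_mod_cast NeZero.pos q
  have hcases : (p % 2 = 1 ∧ q % 2 = 1) ∨ (p % 2 = 0 ∧ q % 2 = 1) ∨ (p % 2 = 1 ∧ q % 2 = 0) := by
    by_contra hn
    have h2 : 2 ∣ Nat.gcd p q := Nat.dvd_gcd (by omega) (by omega)
    rw [hpq.gcd_eq_one] at h2
    omega
  rcases hcases with ⟨h1, h2⟩ | ⟨h1, h2⟩ | ⟨h1, h2⟩
  -- Both are odd: the reflection of `ℤ` has no fixed point, so any fixed column will do.
  · obtain ⟨c, hc⟩ : ∃ c : ℤ, (p : ℤ) + 1 = 2 * c := ⟨(p + 1) / 2, by omega⟩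
    have hj : -(p : ZMod q) - 1 - ((-c : ℤ) : ZMod q) = ((-c : ℤ) : ZMod q) := by
      have : (-(p : ℤ) - 1) - -c = -c := by omega
      have := congrArg (Int.cast : ℤ → ZMod q) this
      push_cast at this ⊢
      exact this
    refine ⟨τ.symm ((-c : ℤ) : ZMod q), ?_⟩
    rw [Equiv.apply_symm_apply]
    exact countMatrix_eq_zero (hfixrow _ hj) hj fun i hi => by omega
  -- Now `q` is odd and there is only one fixed column, that of `i₀`. The fixed row over `(q - 1) /
  -- 2` with `ℓ = 0` must be matched with it, but `i₀` differs from `(q - 1) / 2` by `p / 2` and so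
  -- is in another class modulo `p`.
  · obtain ⟨i0, hi0⟩ : ∃ i0 : ℤ, 2 * i0 = q - p - 1 := ⟨(q - p - 1) / 2, by omega⟩
    have hj : -(p : ZMod q) - 1 - ((i0 : ℤ) : ZMod q) = ((i0 : ℤ) : ZMod q) := by
      have : ((q : ℤ) - p - 1) - i0 = i0 := by omega
      have := congrArg (Int.cast : ℤ → ZMod q) this
      push_cast at this
      simpa using this
    refine ⟨τ.symm (i0 : ZMod q), ?_⟩
    rw [Equiv.apply_symm_apply]
    refine countMatrix_eq_zero (hfixrow _ hj) hj fun i hi him => ?_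
    obtain rfl : i = i0 := by omega
    exfalso
    obtain ⟨c, hc⟩ : ∃ c : ℤ, q = 2 * c + 1 := ⟨(q - 1) / 2, by omega⟩
    have hspos : 0 < sSeq p q ((c : ℤ) : ZMod p) := by
      have h3 := sSeq_intCast (p := p) (q := q) c
      have h4 : c % p ≤ c := by
        have h5 := Int.mul_ediv_add_emod c p
        have h6 : 0 ≤ c / p := Int.ediv_nonneg (by omega) hp.le
        nlinarith
      have : 0 ≤ (q - 1 - c % p) / p := Int.ediv_nonneg (by omega) hp.le
      omega
    set a' : CoeffIndex p q := indexMod ((c : ℤ) : ZMod p) hspos 0 with ha'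
    have hra : reflect a' = a' := by
      refine CoeffIndex.ext ?_ ?_
      · change (q : ZMod p) - 1 - ((c : ℤ) : ZMod p) = ((c : ℤ) : ZMod p)
        have : (q : ℤ) - 1 - c = c := by omega
        exact_mod_cast congrArg (Int.cast : ℤ → ZMod p) this
      · have : ((a'.2 : ℕ) : ℤ) = 0 := by rw [ha', indexMod_val, Int.zero_emod]
        zify
        rw [reflect, indexMod_val, this, neg_zero, Int.zero_emod]
    have hta : τ a' = (i : ZMod q) := by
      have h3 : -(p : ZMod q) - 1 - τ a' = τ a' := by rw [← hτ, hra]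
      have h4 : (2 : ZMod q) * τ a' = 2 * (i : ZMod q) := by linear_combination hj - h3
      have h5 : IsUnit ((2 : ℕ) : ZMod q) := by
        rw [ZMod.isUnit_iff_coprime]
        exact (Nat.coprime_two_left).2 (Nat.odd_iff.2 h2)
      exact h5.mul_left_cancel (by exact_mod_cast h4)
    have hm : (c : ZMod p) = (i : ZMod p) := by
      rw [him, ← hta, Equiv.symm_apply_apply]
      rfl
    rw [ZMod.intCast_eq_intCast_iff_dvd_sub] at hm
    obtain ⟨d, hd⟩ := hm
    have : (p : ℤ) * (2 * d + 1) = 0 := by linarith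
    rcases mul_eq_zero.1 this with h | h <;> omega
  -- Now `q` is even and there is a second fixed column, that of `i₀ + q / 2`, to which `i₀` does
  -- not contribute.
  · obtain ⟨i0, hi0⟩ : ∃ i0 : ℤ, 2 * i0 = q - p - 1 := ⟨(q - p - 1) / 2, by omega⟩
    obtain ⟨c, hc⟩ : ∃ c : ℤ, q = 2 * c := ⟨q / 2, by omega⟩
    have hj : -(p : ZMod q) - 1 - ((i0 + c : ℤ) : ZMod q) = ((i0 + c : ℤ) : ZMod q) := by
      have : ((q : ℤ) + q - p - 1) - (i0 + c) = i0 + c := by omega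
      have := congrArg (Int.cast : ℤ → ZMod q) this
      push_cast at this
      push_cast
      simpa using this
    refine ⟨τ.symm ((i0 + c : ℤ) : ZMod q), ?_⟩
    rw [Equiv.apply_symm_apply]
    refine countMatrix_eq_zero (hfixrow _ hj) hj fun i hi _ he => ?_
    obtain rfl : i = i0 := by omega
    rw [ZMod.intCast_eq_intCast_iff_dvd_sub] at he
    obtain ⟨d, hd⟩ := he
    have : c * (1 - 2 * d) = 0 := by rw [hc] at hd; linarith
    rcases mul_eq_zero.1 this with h | h <;> omega

/-- The matrix of the triangle counts is singular. -/
theorem det_countMatrix (hpq : p.Coprime q) (e : CoeffIndex p q ≃ ZMod q) :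
    (Matrix.of fun a b : CoeffIndex p q => countMatrix a (e b)).det = 0 := by
  have := charP_powerSeries
  refine Matrix.det_eq_zero_of_involutions _ ⟨reflect, reflect, reflect_reflect, reflect_reflect⟩
    (e.trans ((Equiv.subLeft (-(p : ZMod q) - 1)).trans e.symm)) reflect_reflect
    (fun b => by simp) (fun a b => ?_) fun π hπ => ?_
  · simpa using countMatrix_reflect a (e b)
  -- A permutation fixed by the involution is the same as an equivariant matching of rows and
  -- columns.
  · have hτ : ∀ a, (π.symm.trans e) (reflect a) = -p - 1 - (π.symm.trans e) a := fun a => by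
      have h := hπ (e.symm (-p - 1 - e (π.symm a)))
      simp only [Equiv.coe_fn_mk, Equiv.trans_apply, Equiv.subLeft_apply, Equiv.apply_symm_apply,
        sub_sub_cancel, Equiv.symm_apply_apply] at h
      simp only [Equiv.trans_apply]
      rw [h]
      simp
    obtain ⟨a, ha⟩ := exists_countMatrix_eq_zero hpq (π.symm.trans e) hτ
    exact ⟨π.symm a, by simpa using ha⟩

end LocalComp
end

open Topology
noncomputable section
namespace LocalComp

set_option linter.unusedSectionVars false

/-! ### Solutions of the algebraic equations -/

variable {p q : ℕ}

/-- The coefficients, with the second index read modulo `s_m`. -/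
def ext {R : Type*} [Zero R] (u : CoeffIndex p q → R) (m : ZMod p) (ℓ : ℤ) : R :=
  if h : 0 < sSeq p q m then u (indexMod m h ℓ) else 0

theorem ext_congr {R : Type*} [Zero R] (u : CoeffIndex p q → R) (m : ZMod p) {ℓ ℓ' : ℤ}
    (h : (sSeq p q m : ℤ) ∣ ℓ - ℓ') : ext u m ℓ = ext u m ℓ' := by
  unfold ext
  split_ifs with h0
  · congr 1
    refine CoeffIndex.ext rfl ?_
    zify
    rw [indexMod_val, indexMod_val]
    exact Int.emod_eq_emod_iff_emod_sub_eq_zero.2 (Int.emod_eq_zero_of_dvd h)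
  · rfl

theorem ext_self {R : Type*} [Zero R] (u : CoeffIndex p q → R) (a : CoeffIndex p q) :
    ext u a.1 (a.2 : ℕ) = u a := by
  rw [ext, dif_pos a.sSeq_pos, indexMod_self]

theorem ext_eq_zero {R : Type*} [Zero R] (u : CoeffIndex p q → R) {m : ZMod p}
    (h : sSeq p q m = 0) (ℓ : ℤ) : ext u m ℓ = 0 := by
  rw [ext, dif_neg (by omega)]

theorem map_ext {R R' : Type*} [Semiring R] [Semiring R'] (f : R →+* R') (u : CoeffIndex p q → R)
    (m : ZMod p) (ℓ : ℤ) : f (ext u m ℓ) = ext (fun a => f (u a)) m ℓ := by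
  unfold ext
  split_ifs
  · rfl
  · exact map_zero f

theorem ext_indicator {R : Type*} [Zero R] [One R] (m : ZMod p) (ℓ : ℤ) :
    ext (fun a : CoeffIndex p q => if (a.2 : ℕ) = 0 then (1 : R) else 0) m ℓ =
      if 0 < sSeq p q m ∧ (sSeq p q m : ℤ) ∣ ℓ then 1 else 0 := by
  by_cases h0 : 0 < sSeq p q m
  · have hiff : ((indexMod m h0 ℓ).2 : ℕ) = 0 ↔ (sSeq p q m : ℤ) ∣ ℓ := by
      rw [Int.dvd_iff_emod_eq_zero, ← indexMod_val m h0 ℓ, Nat.cast_eq_zero]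
    rw [ext, dif_pos h0]
    simp only [hiff, h0, true_and]
  · rw [ext, dif_neg h0, if_neg fun h => h0 h.1]

theorem eq_indexMod_iff (a : CoeffIndex p q) {m : ZMod p} (h : 0 < sSeq p q m) (x : ℤ) :
    a = indexMod m h (-x) ↔ m = a.1 ∧ (sSeq p q a.1 : ℤ) ∣ (a.2 : ℕ) + x := by
  constructor
  · rintro rfl
    refine ⟨rfl, ?_⟩
    rw [indexMod_val]
    change (sSeq p q m : ℤ) ∣ _
    have h4 := Int.emod_add_mul_ediv (-x) (sSeq p q m : ℤ)
    exact ⟨-(-x / (sSeq p q m : ℤ)), by linarith⟩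
  · rintro ⟨rfl, h1⟩
    refine CoeffIndex.ext rfl ?_
    zify
    rw [indexMod_val, ← Int.emod_eq_of_lt (a := ((a.2 : ℕ) : ℤ)) (b := (sSeq p q a.1 : ℤ))
      (by positivity) (by exact_mod_cast a.2.2)]
    refine Int.emod_eq_emod_iff_emod_sub_eq_zero.2 (Int.emod_eq_zero_of_dvd ?_)
    rwa [sub_neg_eq_add]

variable [NeZero p]

theorem sum_rows {R : Type*} [AddCommMonoid R] (w : CoeffIndex p q → R) (m : ZMod p) (x : ℤ) :
    (open Classical in ∑ a : CoeffIndex p q,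
      if m = a.1 ∧ (sSeq p q a.1 : ℤ) ∣ (a.2 : ℕ) + x then w a else 0) = ext w m (-x) := by
  classical
  unfold ext
  split_ifs with h
  · simp only [← eq_indexMod_iff _ h]
    simp
  · refine Finset.sum_eq_zero fun a _ => if_neg ?_
    rintro ⟨rfl, -⟩
    exact h a.sSeq_pos

/-- The residue class of `i` has `s` representatives in `[0, q)`, with quotients `0, …, s - 1`. -/
theorem lt_iff_div_lt (i : ℤ) : i < q ↔ i / p < sSeq p q (i : ZMod p) := by
  have hp : (0 : ℤ) < p := by exact_mod_cast NeZero.pos p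
  rw [sSeq_intCast, Int.lt_add_one_iff, Int.le_ediv_iff_mul_le hp, mul_comm]
  have := Int.mul_ediv_add_emod i p
  constructor <;> intro h <;> linarith

theorem neg_le_iff_div (i : ℤ) : -p ≤ i ↔ -1 ≤ i / p := by
  have hp : (0 : ℤ) < p := by exact_mod_cast NeZero.pos p
  rw [Int.le_ediv_iff_mul_le hp]
  simp

theorem nonneg_iff_div (i : ℤ) : 0 ≤ i ↔ 0 ≤ i / p := by
  have hp : (0 : ℤ) < p := by exact_mod_cast NeZero.pos p
  rw [Int.le_ediv_iff_mul_le hp]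
  simp

theorem add_mul_div (i x : ℤ) : (i + p * x) / p = i / p + x := by
  have hp : (0 : ℤ) < p := by exact_mod_cast NeZero.pos p
  exact Int.add_mul_ediv_left _ _ hp.ne'

theorem cast_add_mul (i x : ℤ) : ((i + p * x : ℤ) : ZMod p) = i := by push_cast; simp

theorem eq_of_cast_eq_of_div_eq {i i' : ℤ} (h : (i : ZMod p) = i') (h' : i / p = i' / p) :
    i = i' := by
  have h1 : i % p = i' % p := (ZMod.intCast_eq_intCast_iff' _ _ _).1 h
  rw [← Int.mul_ediv_add_emod i p, ← Int.mul_ediv_add_emod i' p, h1, h']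

theorem eq_of_cast_eq_of_lt {n : ℕ} {i i' : ℤ} (h : (i : ZMod n) = i') (h1 : i - i' < n)
    (h2 : i' - i < n) : i = i' := by
  rw [ZMod.intCast_eq_intCast_iff_dvd_sub] at h
  have := Int.eq_zero_of_abs_lt_dvd h (by rw [abs_lt]; constructor <;> linarith)
  linarith

/-- A unit generates the additive group. This is where coprimality enters the computation of the
kernels. -/
theorem const_of_shift {α : Type*} {n : ℕ} [NeZero n] {d : ZMod n} (hd : IsUnit d)
    {f : ZMod n → α} (h : ∀ m, f m = f (m - d)) (m m' : ZMod n) : f m = f m' := by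
  have key : ∀ (k : ℕ) m, f m = f (m - k * d) := fun k => by
    induction k with
    | zero => simp
    | succ k ih => intro m; rw [ih, h]; push_cast; congr 1; ring
  have h0 : ∀ m, f m = f 0 := fun m => by
    obtain ⟨e, he⟩ := hd.exists_left_inv
    rw [key (m * e).val m, ZMod.natCast_zmod_val, mul_assoc, he, mul_one, sub_self]
  rw [h0, h0 m']

theorem exists_int_of_zmod (m : ZMod p) (x : ℤ) : ∃ i : ℤ, (i : ZMod p) = m ∧ i / p = x := by
  have hp : (0 : ℤ) < p := by exact_mod_cast NeZero.pos p
  refine ⟨m.val + p * x, by rw [cast_add_mul]; simp, ?_⟩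
  rw [add_mul_div, Int.ediv_eq_zero_of_lt (by positivity) (by exact_mod_cast ZMod.val_lt m), zero_add]

/-- In the range in which the multiplicities vanish there are few solutions of the congruence. -/
theorem dvd_iff_of_mem {t i : ℤ} (h0 : 0 ≤ t) (ht : t < sSeq p q (i : ZMod p)) (h1 : -p ≤ i)
    (h2 : i < q) : (sSeq p q (i : ZMod p) : ℤ) ∣ t + i / p + 1 ↔
      (t = 0 ∧ i / p = -1) ∨ i / p = sSeq p q (i : ZMod p) - 1 - t := by
  rw [neg_le_iff_div] at h1
  rw [lt_iff_div_lt (p := p)] at h2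
  constructor
  · rintro ⟨d, hd⟩
    -- From `0 ≤ t < s` and `-1 ≤ ⌊i/p⌋ < s` the number `t + ⌊i/p⌋ + 1` is in `[0, 2 s)`, so the
    -- quotient is `0` or `1`.
    have hd0 : 0 ≤ d := by by_contra hn; nlinarith
    have hd1 : d ≤ 1 := by by_contra hn; nlinarith
    obtain rfl | rfl : d = 0 ∨ d = 1 := by omega
    · left; omega
    · right; linarith
  · rintro (⟨rfl, h⟩ | h)
    · rw [h]; simp
    · exact ⟨1, by rw [h]; ring⟩

theorem f2_eq_one {c : F2} (h : c ≠ 0) : c = 1 := by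
  revert c; decide

theorem f2_eq_of_add {c d : F2} (h : c + d = 0) : c = d := by
  revert c d; decide

variable [NeZero q]

/-- Modulo `U` each equation has one or two terms. Those with one term kill `c i` for `0 ≤ i < q -
p`. Those with two identify the values at `i ∈ [-p, 0)` and at `i + p s ∈ [q - p, q)`; subtracting
`q` leads back to `[-p, 0)`, so the values there are invariant under a shift by `q` modulo `p` and
hence all equal. -/
theorem right_kernel_mod (hpq : p.Coprime q) {c : ZMod q → F2} (hc : c ≠ 0)
    (h : open Classical in ∀ a : CoeffIndex p q, ∑ i ∈ Finset.Ico (-(p : ℤ)) q,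
      (if (i : ZMod p) = a.1 ∧ (sSeq p q a.1 : ℤ) ∣ (a.2 : ℕ) + i / p + 1 then c i else 0) = 0)
    (j : ZMod q) :
    c j = open Classical in if ∃ t : ℕ, 1 ≤ t ∧ t ≤ min p q ∧ j = -(t : ZMod q) then 1 else 0 := by
  classical
  have hp : (0 : ℤ) < p := by exact_mod_cast NeZero.pos p
  have hq : (0 : ℤ) < q := by exact_mod_cast NeZero.pos q
  -- The row with `ℓ = s - 1 - ⌊i/p⌋`. Here `ℓ ≥ 1`, so the exceptional solution with `ℓ = 0` does
  -- not occur and `i` is the only index.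
  have hzero : ∀ i : ℤ, 0 ≤ i → i < q - p → c i = 0 := fun i h0 h1 => by
    have hs1 : i / p + 1 < sSeq p q (i : ZMod p) := by
      have := (lt_iff_div_lt (p := p) (q := q) (i + p * 1)).1 (by linarith)
      rwa [add_mul_div, cast_add_mul] at this
    have hdiv := (nonneg_iff_div (p := p) i).1 h0
    have hspos : 0 < sSeq p q (i : ZMod p) := by omega
    have h2 := h ⟨i, ⟨sSeq p q (i : ZMod p) - 1 - (i / p).toNat, by omega⟩⟩
    have hcast : ((sSeq p q (i : ZMod p) - 1 - (i / p).toNat : ℕ) : ℤ) =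
        sSeq p q (i : ZMod p) - 1 - i / p := by omega
    simp only [hcast] at h2
    rw [Finset.sum_eq_single i] at h2
    · rwa [if_pos ⟨rfl, ⟨1, by ring⟩⟩] at h2
    · intro i' hi' hne
      rw [Finset.mem_Ico] at hi'
      refine if_neg ?_
      rintro ⟨h3, h4⟩
      rw [← h3, dvd_iff_of_mem (by rw [h3]; omega) (by rw [h3]; omega) hi'.1 hi'.2, h3] at h4
      rcases h4 with h4 | h4
      · omega
      · exact hne (eq_of_cast_eq_of_div_eq h3 (by omega))
    · intro hn
      exact (hn (Finset.mem_Ico.2 ⟨by linarith, by linarith⟩)).elim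
  have hshift : ∀ i : ℤ, -p ≤ i → i < 0 → c i = c ((i + p * sSeq p q (i : ZMod p) : ℤ) : ZMod q) :=
    fun i h0 h1 => by
      have hdiv : i / p = -1 := by
        have := (neg_le_iff_div (p := p) i).1 h0
        have := mt (nonneg_iff_div (p := p) i).2 (by omega)
        omega
      rcases Nat.eq_zero_or_pos (sSeq p q (i : ZMod p)) with hs | hs
      · simp [hs]
      have h2 := h ⟨i, ⟨0, hs⟩⟩
      set i₁ := i + p * sSeq p q (i : ZMod p) with hi₁
      have hc1 : (i₁ : ZMod p) = i := cast_add_mul _ _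
      have hd1 : i₁ / p = sSeq p q (i : ZMod p) - 1 := by rw [hi₁, add_mul_div, hdiv]; ring
      rw [Finset.sum_eq_add i i₁] at h2
      · rw [if_pos ⟨rfl, by simp [hdiv]⟩, if_pos ⟨hc1, by simp [hd1]⟩] at h2
        exact f2_eq_of_add h2
      · intro he
        rw [← he] at hd1
        omega
      · intro i' hi' hne
        rw [Finset.mem_Ico] at hi'
        refine if_neg ?_
        rintro ⟨h3, h4⟩
        simp only at h3 h4
        rw [← h3, dvd_iff_of_mem (by simp) (by rw [h3]; exact_mod_cast hs) hi'.1 hi'.2, h3] at h4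
        rcases h4 with h4 | h4
        · exact hne.1 (eq_of_cast_eq_of_div_eq h3 (by omega))
        · refine hne.2 (eq_of_cast_eq_of_div_eq (h3.trans hc1.symm) ?_)
          rw [h4, hd1]
          simp
      · intro hn
        exact (hn (Finset.mem_Ico.2 ⟨h0, by linarith⟩)).elim
      · intro hn
        refine (hn (Finset.mem_Ico.2 ⟨?_, ?_⟩)).elim
        · have : (0 : ℤ) ≤ p * sSeq p q (i : ZMod p) := by positivity
          linarith
        · rw [lt_iff_div_lt (p := p), hc1, hd1]
          linarith
  -- The values on `[-p, 0)`, regarded as a function on `ZMod p`.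
  let f : ZMod p → F2 := fun m => c ((m.val - p : ℤ) : ZMod q)
  have hf : ∀ i : ℤ, -p ≤ i → i < 0 → f i = c i := fun i h0 h1 => by
    have hv : ((i : ZMod p).val : ℤ) = i + p := by
      rw [ZMod.val_intCast, ← Int.add_emod_right, Int.emod_eq_of_lt (by linarith) (by linarith)]
    simp only [f]
    rw [hv, add_sub_cancel_right]
  have hconst : ∀ m m', f m = f m' := by
    refine const_of_shift ((ZMod.isUnit_iff_coprime q p).2 hpq.symm) fun m => ?_
    obtain ⟨i, rfl, hi⟩ := exists_int_of_zmod m (-1)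
    have h0 : -p ≤ i := by rw [neg_le_iff_div, hi]
    have h1 : i < 0 := by
      by_contra hn
      have := (nonneg_iff_div (p := p) i).1 (by omega)
      omega
    set i₁ := i + p * sSeq p q (i : ZMod p) with hi₁
    have hc1 : (i₁ : ZMod p) = i := cast_add_mul _ _
    have hd1 : i₁ / p = sSeq p q (i : ZMod p) - 1 := by rw [hi₁, add_mul_div, hi]; ring
    have h3 : i₁ < q := by
      rw [lt_iff_div_lt (p := p), hc1, hd1]
      linarith
    have h4 : q - p ≤ i₁ := by
      by_contra hn
      have := (lt_iff_div_lt (p := p) (q := q) (i₁ + p * 1)).1 (by linarith)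
      rw [add_mul_div, cast_add_mul, hc1, hd1] at this
      linarith
    have h5 : (i : ZMod p) - (q : ZMod p) = ((i₁ - q : ℤ) : ZMod p) := by
      push_cast
      rw [hc1]
    rw [h5, hf i h0 h1, hf (i₁ - q) (by linarith) (by linarith), hshift i h0 h1]
    push_cast
    simp [hi₁]
  have hall : ∀ j : ZMod q, c j = if ∃ t : ℕ, 1 ≤ t ∧ t ≤ min p q ∧ j = -(t : ZMod q) then f 0 else 0 :=
    fun j => by
      split_ifs with hj
      · obtain ⟨t, h1, h2, rfl⟩ := hj
        have ht : (t : ℤ) ≤ p := by exact_mod_cast h2.trans (min_le_left _ _)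
        rw [hconst 0 ((-(t : ℤ) : ℤ) : ZMod p), hf _ (by linarith) (by omega)]
        push_cast
        rfl
      · have hv : ((j.val : ℤ) : ZMod q) = j := by simp
        rw [← hv]
        refine hzero _ (by positivity) ?_
        by_contra hn
        refine hj ⟨q - j.val, ?_, ?_, ?_⟩
        · have := ZMod.val_lt j; omega
        · rw [le_min_iff]
          omega
        · rw [Nat.cast_sub (ZMod.val_lt j).le]
          simp
  rw [hall j]
  have hf0 : f 0 ≠ 0 := fun h0 => hc (funext fun j => by rw [hall j, h0]; simp)
  rw [f2_eq_one hf0]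

end LocalComp
end

/-! ### The left kernel modulo `U`, and the solutions over `F[[U]]` -/

open Topology
noncomputable section
namespace LocalComp

set_option linter.unusedSectionVars false

variable {p q : ℕ} [NeZero p] [NeZero q]

/-- Again every equation has one or two relevant terms. If `p ≤ q`, those with one term kill the
entries with `ℓ ≠ 0`, and those with two give invariance of the entries with `ℓ = 0` under a shift
by `q` modulo `p`. If `q < p`, there are no entries with `ℓ ≠ 0`, and the equations give invariance
under a shift by `p` modulo `q`. -/
theorem left_kernel_mod (hpq : p.Coprime q) {c : CoeffIndex p q → F2} (hc : c ≠ 0)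
    (h : open Classical in ∀ j : ZMod q, ∑ i ∈ Finset.Ico (-(p : ℤ)) q,
      (if (i : ZMod q) = j then ext c (i : ZMod p) (-(i / p + 1)) else 0) = 0)
    (a : CoeffIndex p q) : c a = if (a.2 : ℕ) = 0 then 1 else 0 := by
  classical
  have hp : (0 : ℤ) < p := by exact_mod_cast NeZero.pos p
  have hq : (0 : ℤ) < q := by exact_mod_cast NeZero.pos q
  suffices hall : ∃ κ : F2, ∀ a : CoeffIndex p q, c a = if (a.2 : ℕ) = 0 then κ else 0 by
    obtain ⟨κ, hκ⟩ := hall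
    have h0 : κ ≠ 0 := fun h0 => hc (funext fun a => by rw [hκ, h0]; simp)
    rw [hκ, f2_eq_one h0]
  have hadd : ∀ i i' : ℤ, -p ≤ i → i < q → -p ≤ i' → i' < q → i ≠ i' → (i' : ZMod q) = i →
      (∀ i'' : ℤ, -p ≤ i'' → i'' < q → i'' ≠ i → i'' ≠ i' → (i'' : ZMod q) = i →
        ext c (i'' : ZMod p) (-(i'' / p + 1)) = 0) →
      ext c (i : ZMod p) (-(i / p + 1)) = ext c (i' : ZMod p) (-(i' / p + 1)) :=
    fun i i' h1 h2 h3 h4 hne he hz => by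
      have := h i
      rw [Finset.sum_eq_add i i' hne] at this
      · rw [if_pos rfl, if_pos he] at this
        exact f2_eq_of_add this
      · intro i'' hi'' hn
        rw [Finset.mem_Ico] at hi''
        split_ifs with h5
        · exact hz i'' hi''.1 hi''.2 hn.1 hn.2 h5
        · rfl
      · exact fun hn => (hn (Finset.mem_Ico.2 ⟨h1, h2⟩)).elim
      · exact fun hn => (hn (Finset.mem_Ico.2 ⟨h3, h4⟩)).elim
  rcases le_or_gt p q with hle | hlt
  · have hle' : (p : ℤ) ≤ q := by exact_mod_cast hle
    have hconst : ∀ m m' : ZMod p, ext c m 0 = ext c m' 0 := by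
      refine const_of_shift ((ZMod.isUnit_iff_coprime q p).2 hpq.symm) fun m => ?_
      obtain ⟨i, rfl, hi⟩ := exists_int_of_zmod m ((sSeq p q m : ℤ) - 1)
      have h3 : i < q := by rw [lt_iff_div_lt (p := p), hi]; linarith
      have h4 : q - p ≤ i := by
        by_contra hn
        have := (lt_iff_div_lt (p := p) (q := q) (i + p * 1)).1 (by linarith)
        rw [add_mul_div, cast_add_mul, hi] at this
        linarith
      have h5 : (i : ZMod p) - (q : ZMod p) = ((i - q : ℤ) : ZMod p) := by push_cast; rfl
      have h6 : (i - q) / p = -1 := by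
        have := (neg_le_iff_div (p := p) (i - q)).1 (by linarith)
        have := mt (nonneg_iff_div (p := p) (i - q)).2 (by linarith)
        omega
      have := hadd i (i - q) (by linarith) h3 (by linarith) (by linarith) (by linarith)
        (by push_cast; simp) fun i'' h7 h8 h9 h10 h11 => by
          exfalso
          rcases lt_or_ge i'' 0 with h12 | h12
          · refine h10 (eq_of_cast_eq_of_lt (n := q) ?_ (by linarith) (by linarith))
            rw [h11]; push_cast; simp
          · exact h9 (eq_of_cast_eq_of_lt h11 (by linarith) (by linarith))
      rw [h6, hi] at this
      rw [h5, ← ext_congr c (i : ZMod p) (ℓ := -((sSeq p q (i : ZMod p) : ℤ) - 1 + 1)) (ℓ' := 0)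
        (by simp), this]
      simp
    refine ⟨ext c 0 0, fun a => ?_⟩
    split_ifs with ha
    · rw [← ext_self c a, ha, hconst 0 a.1]; rfl
    -- The quotient is chosen so that `-(⌊i/p⌋ + 1) ≡ ℓ` modulo `s`. As `ℓ ≥ 1`, this `i` is in `[0,
    -- q - p)`, where it is alone in its class modulo `q`.
    · obtain ⟨i, hi, hi'⟩ := exists_int_of_zmod a.1 ((sSeq p q a.1 : ℤ) - 1 - (a.2 : ℕ))
      have hlt := a.2.2
      have h0 : 0 ≤ i := by rw [nonneg_iff_div (p := p), hi']; omega
      have h3 : i < q - p := by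
        have := (lt_iff_div_lt (p := p) (q := q) (i + p * 1)).2 (by
          rw [add_mul_div, cast_add_mul, hi, hi']; omega)
        linarith
      have := h i
      rw [Finset.sum_eq_single i, if_pos rfl, hi, hi'] at this
      · rw [← ext_self c a, ← this]
        refine ext_congr c _ ⟨1, by ring⟩
      · intro i' hm hne
        rw [Finset.mem_Ico] at hm
        exact if_neg fun he => hne (eq_of_cast_eq_of_lt he (by linarith) (by linarith))
      · exact fun hn => (hn (Finset.mem_Ico.2 ⟨by linarith, by linarith⟩)).elim
  · have hlt' : (q : ℤ) < p := by exact_mod_cast hlt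
    have hs : ∀ m : ZMod p, sSeq p q m = if m.val < q then 1 else 0 := fun m => by
      rw [sSeq, Nat.mod_eq_of_lt hlt, Nat.div_eq_of_lt hlt]
    have hext : ∀ m ℓ, ext c m ℓ = ext c m 0 := fun m ℓ => by
      rcases Nat.eq_zero_or_pos (sSeq p q m) with h0 | h0
      · rw [ext_eq_zero c h0, ext_eq_zero c h0]
      · refine ext_congr c m ?_
        have h1 := hs m
        rw [show sSeq p q m = 1 by split_ifs at h1 <;> omega]
        simp
    let g : ZMod q → F2 := fun j => ext c (j.val : ZMod p) 0
    have hg : ∀ i : ℤ, 0 ≤ i → i < q → g i = ext c (i : ZMod p) 0 := fun i h0 h1 => by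
      simp only [g]
      have hv : ((i : ZMod q).val : ℤ) = i := by
        rw [ZMod.val_intCast, Int.emod_eq_of_lt h0 h1]
      have := congrArg (Int.cast : ℤ → ZMod p) hv
      rw [← this]
      push_cast
      rfl
    have hconst : ∀ j j', g j = g j' := by
      refine const_of_shift ((ZMod.isUnit_iff_coprime p q).2 hpq) fun j => ?_
      have hj0 : (0 : ℤ) ≤ j.val := by positivity
      have hj1 : (j.val : ℤ) < q := by exact_mod_cast ZMod.val_lt j
      have hjc : ((j.val : ℤ) : ZMod q) = j := by simp
      set i := (j - p).val with hi
      have hi0 : (0 : ℤ) ≤ i := by positivity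
      have hi1 : (i : ℤ) < q := by exact_mod_cast ZMod.val_lt (j - (p : ZMod q))
      have hic : ((i : ℤ) : ZMod q) = j - p := by simp [hi]
      -- A negative index in `[-p, 0)` counts only if its residue modulo `p` is below `q`. This
      -- leaves one negative index besides the nonnegative one.
      have := hadd i ((j.val : ℤ) - p) (by linarith) hi1 (by linarith) (by linarith) (by linarith)
        (by rw [hic]; push_cast; simp) fun i'' h7 h8 h9 h10 h11 => by
          rw [hext]
          refine ext_eq_zero c ?_ 0
          rw [hs, if_neg]
          intro h12
          have h13 : i'' % p < q := by rw [← ZMod.val_intCast]; exact_mod_cast h12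
          rcases lt_or_ge i'' 0 with h14 | h14
          · rw [← Int.add_emod_right, Int.emod_eq_of_lt (by linarith) (by linarith)] at h13
            refine h10 (eq_of_cast_eq_of_lt (n := q) ?_ (by linarith) (by linarith))
            rw [h11, hic]; push_cast; simp
          · exact h9 (eq_of_cast_eq_of_lt h11 (by linarith) (by linarith))
      rw [hext, hext (((j.val : ℤ) - p : ℤ) : ZMod p), ← hg i hi0 hi1, hic] at this
      rw [this, ← hjc, hg _ hj0 hj1]
      push_cast
      simp
    refine ⟨g 0, fun a => ?_⟩
    have hpos := a.sSeq_pos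
    have h1 := hs a.1
    have hval : a.1.val < q := by by_contra hn; rw [if_neg hn] at h1; omega
    have h2 := a.2.2
    rw [if_pos hval] at h1
    have ha0 : (a.2 : ℕ) = 0 := by omega
    rw [if_pos ha0, ← ext_self c a, ha0, hconst 0 (a.1.val : ℤ),
      hg _ (by positivity) (by exact_mod_cast hval)]
    simp

/-- The equations that express the vanishing of the triangle counting maps. -/
structure IsAlgSol (u : CoeffIndex p q → FU) (v : ZMod q → FU) (w : CoeffIndex p q → FU) :
    Prop where
  -- The fields `right`, `right'` and `left` belong to the products of `ψ_{0r}` and `ψ_{r∞}`, of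
  -- `ψ_{r∞}` and `ψ_{∞0}`, and of `ψ_{∞0}` and `ψ_{0r}`.
  right : open Classical in ∀ (m : ZMod p) (t : ℤ), wsum (nz p q) (fun i =>
    if (i : ZMod p) = m then v i * ext u m (t + i / p + 1) else 0) = 0
  right' : open Classical in ∀ (m : ZMod p) (t : ℤ), wsum (nz p q) (fun i =>
    if (i : ZMod p) = m then v i * ext w m (t - i / p - 1) else 0) = 0
  left : open Classical in ∀ j : ZMod q, wsum (nz p q) (fun i => if (i : ZMod q) = j then
    ∑ ℓ : Fin (sSeq p q (i : ZMod p)), ext u (i : ZMod p) ((ℓ : ℕ) + i / p + 1) * w ⟨i, ℓ⟩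
      else 0) = 0

theorem nz_eq_zero_iff_mem (i : ℤ) : nz p q i = 0 ↔ i ∈ Finset.Ico (-(p : ℤ)) q := by
  rw [nz_eq_zero_iff, Finset.mem_Ico]

open Classical in
theorem sum_countMatrix_mul (v : ZMod q → FU) (a : CoeffIndex p q) :
    ∑ j, countMatrix a j * v j = wsum (nz p q) fun i =>
      if (i : ZMod p) = a.1 ∧ (sSeq p q a.1 : ℤ) ∣ (a.2 : ℕ) + i / p + 1 then v i else 0 := by
  simp only [countMatrix, mul_comm _ (v _), ← wsum_mul nz_le_finite]
  rw [← wsum_finset_sum nz_le_finite]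
  congr 1
  funext i
  rw [Finset.sum_eq_single (i : ZMod q)]
  · simp [Contributes]
  · intro j _ hj
    rw [if_neg fun h => hj h.2.1.symm, mul_zero]
  · simp

open Classical in
theorem sum_mul_countMatrix (w : CoeffIndex p q → FU) (j : ZMod q) :
    ∑ a, w a * countMatrix a j = wsum (nz p q) fun i =>
      if (i : ZMod q) = j then ext w (i : ZMod p) (-(i / p + 1)) else 0 := by
  simp only [countMatrix, ← wsum_mul nz_le_finite]
  rw [← wsum_finset_sum nz_le_finite]
  congr 1
  funext i
  split_ifs with h
  · rw [← sum_rows]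
    refine Finset.sum_congr rfl fun a _ => ?_
    simp only [Contributes, h, true_and, ← add_assoc, mul_ite, mul_one, mul_zero]
  · refine Finset.sum_eq_zero fun a _ => ?_
    rw [if_neg fun h' => h h'.2.1, mul_zero]

/-- The vanishing determinant gives a nonzero kernel vector over the domain `F[[U]]`. After division
by the largest possible power of `U` its reduction is nonzero, and `right_kernel_mod` identifies it.
-/
theorem exists_right_kernel (hpq : p.Coprime q) : ∃ v : ZMod q → FU,
    (∀ a : CoeffIndex p q, ∑ j, countMatrix a j * v j = 0) ∧
    ∀ j, PowerSeries.constantCoeff (v j) =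
      open Classical in if ∃ t : ℕ, 1 ≤ t ∧ t ≤ min p q ∧ j = -(t : ZMod q) then 1 else 0 := by
  classical
  have e : CoeffIndex p q ≃ ZMod q := Fintype.equivOfCardEq (by rw [card_coeffIndex, ZMod.card])
  obtain ⟨x, hx, hMx⟩ := Matrix.exists_mulVec_eq_zero_iff.2 (det_countMatrix hpq e)
  obtain ⟨N, v, hv, j0, hj0⟩ := exists_primitive (v := fun j => x (e.symm j))
    (fun h => hx (funext fun a => by simpa using congrFun h (e a)))
  have hker : ∀ a : CoeffIndex p q, ∑ j, countMatrix a j * v j = 0 := fun a => by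
    have h1 := congrFun hMx a
    have h2 : PowerSeries.X ^ N * ∑ j, countMatrix a j * v j = 0 := by
      rw [Finset.mul_sum, ← Equiv.sum_comp e]
      refine Eq.trans (Finset.sum_congr rfl fun b _ => ?_) h1
      have := hv (e b)
      simp only [Equiv.symm_apply_apply] at this
      change _ = countMatrix a (e b) * x b
      rw [this]
      ring
    exact (mul_eq_zero.1 h2).resolve_left (pow_ne_zero _ PowerSeries.X_ne_zero)
  refine ⟨v, hker, fun j => right_kernel_mod (p := p) hpq
    (c := fun j => PowerSeries.constantCoeff (v j)) (fun h => hj0 (congrFun h j0)) (fun a => ?_) j⟩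
  have := congrArg PowerSeries.constantCoeff (hker a)
  rw [sum_countMatrix_mul, constantCoeff_wsum _ nz_eq_zero_iff_mem, map_zero] at this
  refine Eq.trans (Finset.sum_congr rfl fun i _ => ?_) this
  split_ifs <;> simp

theorem exists_left_kernel (hpq : p.Coprime q) : ∃ w : CoeffIndex p q → FU,
    (∀ j : ZMod q, ∑ a, w a * countMatrix a j = 0) ∧
    ∀ a, PowerSeries.constantCoeff (w a) = if (a.2 : ℕ) = 0 then 1 else 0 := by
  classical
  have e : CoeffIndex p q ≃ ZMod q := Fintype.equivOfCardEq (by rw [card_coeffIndex, ZMod.card])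
  obtain ⟨x, hx, hMx⟩ := Matrix.exists_vecMul_eq_zero_iff.2 (det_countMatrix hpq e)
  obtain ⟨N, w, hw, a0, ha0⟩ := exists_primitive hx
  have hker : ∀ j : ZMod q, ∑ a, w a * countMatrix a j = 0 := fun j => by
    have h1 := congrFun hMx (e.symm j)
    have h2 : PowerSeries.X ^ N * ∑ a, w a * countMatrix a j = 0 := by
      rw [Finset.mul_sum]
      refine Eq.trans (Finset.sum_congr rfl fun b _ => ?_) h1
      change _ = x b * countMatrix b (e (e.symm j))
      rw [hw b, Equiv.apply_symm_apply]
      ring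
    exact (mul_eq_zero.1 h2).resolve_left (pow_ne_zero _ PowerSeries.X_ne_zero)
  refine ⟨w, hker, left_kernel_mod (p := p) hpq
    (c := fun a => PowerSeries.constantCoeff (w a)) (fun h => ha0 (congrFun h a0)) (fun j => ?_)⟩
  have := congrArg PowerSeries.constantCoeff (hker j)
  rw [sum_mul_countMatrix, constantCoeff_wsum _ nz_eq_zero_iff_mem, map_zero] at this
  refine Eq.trans (Finset.sum_congr rfl fun i _ => ?_) this
  split_ifs
  · rw [map_ext]
  · simp

open Classical in
/-- The right kernel equation with the second index read modulo `s_m`. -/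
theorem right_equation {v : ZMod q → FU}
    (hv : ∀ a : CoeffIndex p q, ∑ j, countMatrix a j * v j = 0) (m : ZMod p) (t : ℤ) :
    wsum (nz p q) (fun i => if (i : ZMod p) = m ∧ 0 < sSeq p q m ∧
      (sSeq p q m : ℤ) ∣ t + i / p + 1 then v i else 0) = 0 := by
  by_cases h : 0 < sSeq p q m
  · have := hv (indexMod m h t)
    rw [sum_countMatrix_mul] at this
    refine Eq.trans ?_ this
    congr 1
    funext i
    have hiff : (sSeq p q m : ℤ) ∣ t + i / p + 1 ↔
        (sSeq p q m : ℤ) ∣ ((indexMod m h t).2 : ℕ) + i / p + 1 := by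
      rw [indexMod_val]
      have h4 := Int.emod_add_mul_ediv t (sSeq p q m : ℤ)
      rw [← Int.dvd_add_mul_self (b := t % (sSeq p q m : ℤ) + i / p + 1) (c := t / sSeq p q m)]
      rw [show t % (sSeq p q m : ℤ) + i / p + 1 + t / sSeq p q m * sSeq p q m =
        t + i / p + 1 by linarith]
    simp only [h, true_and, hiff]
    rfl
  · simp only [h, false_and, and_false, if_false]
    have := wsum_mul (n := nz p q) nz_le_finite 0 0
    simpa using this

theorem ext_trivialCoeff (m : ZMod p) (ℓ : ℤ) : ext (trivialCoeff p q) m ℓ =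
    if 0 < sSeq p q m ∧ (sSeq p q m : ℤ) ∣ ℓ then 1 else 0 := ext_indicator m ℓ

theorem sum_fiber (w : CoeffIndex p q → FU) (m : ZMod p) (x : ℤ) :
    ∑ ℓ : Fin (sSeq p q m), ext (trivialCoeff p q) m ((ℓ : ℕ) + x) * w ⟨m, ℓ⟩ = ext w m (-x) := by
  classical
  rw [← sum_rows, Fintype.sum_sigma, Finset.sum_eq_single m]
  · refine Finset.sum_congr rfl fun ℓ _ => ?_
    have : 0 < sSeq p q m := lt_of_le_of_lt (Nat.zero_le _) ℓ.2
    simp only [ext_trivialCoeff, this, true_and, ite_mul, one_mul, zero_mul]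
  · intro m' _ hne
    exact Finset.sum_eq_zero fun ℓ _ => if_neg fun h => hne h.1.symm
  · simp

/-- For trivial `u` the equations `right` and `left` are the two kernel equations. The equation
`right'` is then automatic, because it is a linear combination of right kernel equations with
coefficients from `w`. -/
theorem isAlgSol_trivial_left {v : ZMod q → FU} {w : CoeffIndex p q → FU}
    (hv : ∀ a : CoeffIndex p q, ∑ j, countMatrix a j * v j = 0)
    (hw : ∀ j : ZMod q, ∑ a, w a * countMatrix a j = 0) :
    IsAlgSol (trivialCoeff p q) v w where
  right m t := by
    classical
    refine Eq.trans ?_ (right_equation hv m t)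
    congr 1
    funext i
    simp only [ext_trivialCoeff, mul_ite, mul_one, mul_zero, ite_and]
  right' m t := by
    classical
    have key : (fun i : ℤ => if (i : ZMod p) = m then v i * ext w m (t - i / p - 1) else 0) =
        fun i : ℤ => ∑ a : CoeffIndex p q, (if m = a.1 then w a else 0) *
          if (i : ZMod p) = m ∧ 0 < sSeq p q m ∧ (sSeq p q m : ℤ) ∣ ((a.2 : ℕ) - t) + i / p + 1
            then v i else 0 := by
      funext i
      split_ifs with h
      · rw [show t - i / p - 1 = -(i / p + 1 - t) by ring, ← sum_rows, Finset.mul_sum]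
        refine Finset.sum_congr rfl fun a _ => ?_
        by_cases h1 : m = a.1
        · subst h1
          simp only [a.sSeq_pos, true_and, h, if_true,
            show ((a.2 : ℕ) - t : ℤ) + i / p + 1 = (a.2 : ℕ) + (i / p + 1 - t) by ring]
          split_ifs
          · ring
          · simp
        · simp [h1]
      · simp [h]
    rw [key, wsum_finset_sum nz_le_finite]
    refine Finset.sum_eq_zero fun a _ => ?_
    rw [wsum_mul nz_le_finite, right_equation hv, mul_zero]
  left j := by
    classical
    refine Eq.trans ?_ ((sum_mul_countMatrix w j).symm.trans (hw j))
    congr 1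
    funext i
    simp only [← sum_fiber, add_assoc]

theorem ext_neg (w : CoeffIndex p q → FU) (m : ZMod p) (ℓ : ℤ) :
    ext (fun a : CoeffIndex p q => ext w a.1 (-(a.2 : ℕ))) m ℓ = ext w m (-ℓ) := by
  rcases Nat.eq_zero_or_pos (sSeq p q m) with h | h
  · rw [ext_eq_zero _ h, ext_eq_zero _ h]
  · rw [ext, dif_pos h, indexMod_val]
    refine ext_congr w m ⟨ℓ / sSeq p q m, ?_⟩
    have := Int.emod_add_mul_ediv ℓ (sSeq p q m : ℤ)
    linarith

/-- The substitution `ℓ ↦ -ℓ` turns `right'` for `w` into `right` for the new `u` and conversely. In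
`left` only the composite of `u` and `w` matters, and it is unchanged. -/
theorem isAlgSol_trivial_right {v : ZMod q → FU} {w : CoeffIndex p q → FU}
    (h : IsAlgSol (trivialCoeff p q) v w) :
    IsAlgSol (fun a : CoeffIndex p q => ext w a.1 (-(a.2 : ℕ))) v (trivialCoeff p q) where
  right m t := by
    refine Eq.trans ?_ (h.right' m (-t))
    congr 1
    funext i
    rw [ext_neg, show -(t + i / p + 1) = -t - i / p - 1 by ring]
  right' m t := by
    refine Eq.trans ?_ (h.right m (-t))
    congr 1
    funext i
    rw [ext_trivialCoeff, ext_trivialCoeff, show t - i / p - 1 = -(-t + i / p + 1) by ring]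
    simp only [dvd_neg]
  left j := by
    classical
    refine Eq.trans ?_ (h.left j)
    congr 1
    funext i
    split_ifs with hj
    · simp only [ext_neg, add_assoc]
      rw [sum_fiber]
      rcases Nat.eq_zero_or_pos (sSeq p q (i : ZMod p)) with hs | hs
      · rw [ext_eq_zero _ hs]
        refine Finset.sum_eq_zero fun ℓ _ => ?_
        rw [ext_eq_zero _ hs, zero_mul]
      · rw [Finset.sum_eq_single ⟨0, hs⟩]
        · simp [trivialCoeff]
        · intro ℓ _ hℓ
          rw [trivialCoeff, if_neg fun h0 => hℓ (Fin.ext h0), mul_zero]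
        · simp
    · rfl

end LocalComp
end

/-! ### From the chains to the algebraic equations -/

open Topology
noncomputable section
namespace LocalComp

set_option linter.unusedSectionVars false

/-! ### The monodromies -/

theorem zpow_eq_of_add {ι R : Type*} [Fintype ι] [DecidableEq ι] [CommRing R]
    (D : ℤ → Matrix ι ι R) (h0 : D 0 = 1) (hadd : ∀ m n, D (m + n) = D m * D n) (c : ℤ) :
    D 1 ^ c = D c := by
  have hnat : ∀ n : ℕ, D 1 ^ n = D n := fun n => by
    induction n with
    | zero => rw [pow_zero, Nat.cast_zero, h0]
    | succ n ih => rw [pow_succ, ih, ← hadd]; push_cast; rfl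
  obtain ⟨n, rfl | rfl⟩ := Int.eq_nat_or_neg c
  · rw [zpow_natCast, hnat]
  · rw [Matrix.zpow_neg_natCast, hnat]
    refine Matrix.inv_eq_right_inv ?_
    rw [← hadd, add_neg_cancel, h0]

variable {p q k : ℕ}

theorem XIndex.ext {a b : XIndex p q k} (h : a.1 = b.1) (h' : (a.2 : ℕ) = b.2) : a = b := by
  obtain ⟨m, t⟩ := a
  obtain ⟨m', t'⟩ := b
  simp only at h
  subst h
  exact congrArg _ (Fin.ext h')

theorem XIndex.cSeq_pos (x : XIndex p q k) : 0 < cSeq p q k x.1 :=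
  lt_of_le_of_lt (Nat.zero_le _) x.2.2

/-- `(i, ℓ) ↦ (i, ℓ + c)`, where `ℓ` is interpreted modulo `c_i`. -/
def xRot (c : ℤ) (x : XIndex p q k) : XIndex p q k :=
  ⟨x.1, ⟨(((x.2 : ℕ) + c) % (cSeq p q k x.1 : ℤ)).toNat, by
    have := x.cSeq_pos
    have h1 := Int.emod_nonneg ((x.2 : ℕ) + c) (b := (cSeq p q k x.1 : ℤ)) (by omega)
    have h2 := Int.emod_lt_of_pos ((x.2 : ℕ) + c) (b := (cSeq p q k x.1 : ℤ)) (by omega)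
    omega⟩⟩

theorem xRot_val (c : ℤ) (x : XIndex p q k) :
    ((xRot c x).2 : ℤ) = ((x.2 : ℕ) + c) % (cSeq p q k x.1 : ℤ) :=
  Int.toNat_of_nonneg (Int.emod_nonneg _ (by have := x.cSeq_pos; omega))

theorem xRot_zero (x : XIndex p q k) : xRot 0 x = x := by
  refine XIndex.ext rfl ?_
  zify
  rw [xRot_val, add_zero]
  exact Int.emod_eq_of_lt (by positivity) (by exact_mod_cast x.2.2)

theorem xRot_add (m n : ℤ) (x : XIndex p q k) : xRot (m + n) x = xRot m (xRot n x) := by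
  refine XIndex.ext rfl ?_
  zify
  rw [xRot_val, xRot_val, xRot_val]
  change _ = _ % (cSeq p q k x.1 : ℤ)
  rw [Int.emod_add_emod]
  congr 1
  ring

theorem finRotate_val {n : ℕ} (i : Fin n) : (finRotate n i : ℕ) = (i + 1) % n := by
  cases n with
  | zero => exact i.elim0
  | succ n => rw [finRotate_apply, Fin.val_add]; cases n <;> simp

theorem xRot_one (x : XIndex p q k) : xRot 1 x = xNext x := by
  refine XIndex.ext rfl ?_
  zify
  rw [xRot_val]
  change _ = ((finRotate _ x.2 : ℕ) : ℤ)
  rw [finRotate_val]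
  push_cast
  rfl

/-- The coefficient index below a basis index. -/
def xDown (x : XIndex p q k) : CoeffIndex p q := ⟨x.1 - k, x.2⟩

theorem xShift_eq_iff (a : CoeffIndex p q) (x : XIndex p q k) : xShift k a = x ↔ a = xDown x := by
  constructor
  · rintro rfl
    exact CoeffIndex.ext (by simp [xDown, xShift]) rfl
  · rintro rfl
    exact XIndex.ext (by simp [xDown, xShift]) rfl

theorem apply_xDown_xRot {R : Type*} [Zero R] (w : CoeffIndex p q → R) (c : ℤ) (x : XIndex p q k) :
    w (xDown (xRot c x)) = LocalComp.ext w (x.1 - k) ((x.2 : ℕ) + c) := by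
  have h : 0 < sSeq p q (x.1 - k) := x.cSeq_pos
  rw [LocalComp.ext, dif_pos h]
  rfl

variable [NeZero p] [NeZero q]

theorem phi0_zpow (c : ℤ) (x y : XIndex p q k) :
    (phi0 p q k ^ c) x y = if x = xRot c y then 1 else 0 := by
  have h := zpow_eq_of_add (fun c => Matrix.of fun x y : XIndex p q k =>
    if x = xRot c y then (1 : FUinv) else 0) ?_ ?_ c
  · have h1 : phi0 p q k = Matrix.of fun x y : XIndex p q k => if x = xRot 1 y then 1 else 0 := by
      simp only [xRot_one, phi0]
    rw [h1, h]
    rfl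
  · ext x y
    simp [xRot_zero, Matrix.one_apply]
  · intro m n
    ext x z
    simp [Matrix.mul_apply, xRot_add]

theorem xRot_eq_iff (c : ℤ) (x y : XIndex p q k) : x = xRot c y ↔ y = xRot (-c) x := by
  constructor
  · rintro rfl; rw [← xRot_add, neg_add_cancel, xRot_zero]
  · rintro rfl; rw [← xRot_add, add_neg_cancel, xRot_zero]

theorem qinv (hpq : p.Coprime q) : (q : ZMod p) * (q : ZMod p)⁻¹ = 1 :=
  ZMod.coe_mul_inv_eq_one q hpq.symm

/-- The exponents of the powers of the second monodromy. -/
def gexp (p q k : ℕ) (i : ℤ) : ℤ := nz p q (i - k) - nz p q i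

/-- By `nz_add` the difference is `⌊(i - q)/p⌋ - ⌊(i - q - k)/p⌋`. It is `1` exactly when
subtracting `k` causes a borrow, which is the condition for `U_a = U` at `a = -i q⁻¹`. -/
theorem gexp_sub (hk : k < p) (i : ℤ) :
    gexp p q k (i - q) = gexp p q k i + if (i - q) % p < k then 1 else 0 := by
  have hp : (0 : ℤ) < p := by exact_mod_cast NeZero.pos p
  have h1 := nz_add (p := p) (q := q) (i - q)
  have h2 := nz_add (p := p) (q := q) (i - q - k)
  rw [sub_add_cancel] at h1
  rw [show i - q - k + q = i - (k : ℤ) by ring] at h2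
  have h3 := Int.mul_ediv_add_emod (i - q) p
  have h4 := Int.emod_nonneg (i - q) hp.ne'
  have h5 := Int.emod_lt_of_pos (i - q) hp
  have hk' : (k : ℤ) < p := by exact_mod_cast hk
  have h6 : (i - q - k : ℤ) / p = (i - q) / p - if (i - q) % p < k then 1 else 0 := by
    split_ifs with h
    · rw [Int.ediv_eq_iff_of_pos hp]; constructor <;> nlinarith
    · rw [Int.ediv_eq_iff_of_pos hp]; constructor <;> nlinarith
  unfold gexp
  rw [h6] at h2
  linarith

theorem gexp_eq_zero (hk : k < p) {i : ℤ} (h0 : 0 ≤ i) (h1 : i < q) : gexp p q k i = 0 := by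
  have hk' : (k : ℤ) < p := by exact_mod_cast hk
  have e1 : nz p q i = 0 := (nz_eq_zero_iff i).2 ⟨by linarith, h1⟩
  have e2 : nz p q (i - k) = 0 := (nz_eq_zero_iff _).2 ⟨by linarith, by linarith⟩
  simp [gexp, e1, e2]

theorem Uvar_ne_zero : Uvar ≠ 0 := by
  intro h
  have : ((PowerSeries.X : FU) : FUinv) = ((0 : FU) : FUinv) := by rw [PowerSeries.coe_zero]; exact h
  exact PowerSeries.X_ne_zero (HahnSeries.ofPowerSeries_injective this)

/-- The entries of the monodromy are differences of exponents, so powers of the monodromy telescope.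
This explains the choice of the `U_a`. -/
theorem uSeq_eq (hpq : p.Coprime q) (hk : k < p) (i : ℤ) :
    uSeq p q k (-(i : ZMod p) * (q : ZMod p)⁻¹) =
      Uvar ^ (gexp p q k (i - q) - gexp p q k i) := by
  have hp : (0 : ℤ) < p := by exact_mod_cast NeZero.pos p
  have hq := qinv hpq
  have hiff : (∃ j : ℕ, j < k ∧ -(i : ZMod p) * (q : ZMod p)⁻¹ = -(j : ZMod p) * (q : ZMod p)⁻¹ - 1) ↔
      (i - q) % p < k := by
    constructor
    · rintro ⟨j, hj, h⟩
      have h1 : ((i - q : ℤ) : ZMod p) = ((j : ℤ) : ZMod p) := by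
        push_cast
        linear_combination (-(q : ZMod p)) * h + ((j : ZMod p) - i) * hq
      rw [ZMod.intCast_eq_intCast_iff'] at h1
      rw [h1, Int.emod_eq_of_lt (by positivity) (by exact_mod_cast hj.trans hk)]
      exact_mod_cast hj
    · intro h
      have h0 := Int.emod_nonneg (i - q) hp.ne'
      refine ⟨((i - q) % p).toNat, by omega, ?_⟩
      have h1 : ((((i - q) % p).toNat : ℕ) : ZMod p) = (i : ZMod p) - q := by
        have : ((((i - q) % p).toNat : ℕ) : ℤ) = (i - q) % p := Int.toNat_of_nonneg h0
        have := congrArg (Int.cast : ℤ → ZMod p) this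
        rw [ZMod.intCast_mod] at this
        push_cast at this
        exact this
      rw [h1]
      linear_combination -hq
  rw [gexp_sub hk, add_sub_cancel_left]
  unfold uSeq
  simp only [hiff]
  split_ifs <;> simp

theorem isUnit_phiInf : IsUnit (phiInf p q k).det := by
  have hu : ∀ b, uSeq p q k b ≠ 0 := fun b => by
    unfold uSeq; split_ifs; exacts [Uvar_ne_zero, one_ne_zero]
  refine Matrix.isUnit_det_of_right_inverse
    (B := Matrix.of fun b a => if a = b + 1 then (uSeq p q k b)⁻¹ else 0) ?_
  ext a c
  rw [Matrix.mul_apply, Finset.sum_eq_single (a - 1)]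
  · by_cases h : a = c
    · subst h; simp [phiInf, hu]
    · simp [phiInf, h, Ne.symm h]
  · intro b _ hb
    have : a ≠ b + 1 := fun h => hb (by rw [h]; ring)
    simp [phiInf, this]
  · simp

theorem phiInf_zpow (hpq : p.Coprime q) (hk : k < p) (c : ℤ) (a : ZMod p) (i : ℤ) :
    (phiInf p q k ^ c) a (-(i : ZMod p) * (q : ZMod p)⁻¹) =
      if a = -((i - c * q : ℤ) : ZMod p) * (q : ZMod p)⁻¹ then
        Uvar ^ (gexp p q k (i - c * q) - gexp p q k i) else 0 := by
  have hq := qinv hpq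
  have hstep : ∀ (c : ℤ) (i : ℤ), (phiInf p q k ^ (c + 1)) a (-(i : ZMod p) * (q : ZMod p)⁻¹) =
      (phiInf p q k ^ c) a (-((i - q : ℤ) : ZMod p) * (q : ZMod p)⁻¹) *
        Uvar ^ (gexp p q k (i - q) - gexp p q k i) := fun c i => by
    have hb : -((i - q : ℤ) : ZMod p) * (q : ZMod p)⁻¹ = -(i : ZMod p) * (q : ZMod p)⁻¹ + 1 := by
      push_cast
      linear_combination hq
    rw [Matrix.zpow_add_one isUnit_phiInf, Matrix.mul_apply,
      Finset.sum_eq_single (-((i - q : ℤ) : ZMod p) * (q : ZMod p)⁻¹)]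
    · rw [phiInf, Matrix.of_apply, if_pos hb, uSeq_eq hpq hk]
    · intro b _ hne
      rw [phiInf, Matrix.of_apply, if_neg fun h => hne (h.trans hb.symm), mul_zero]
    · simp
  induction c generalizing i with
  | zero => simp [Matrix.one_apply]
  | succ c ih =>
    rw [hstep, ih, ite_mul, zero_mul, ← zpow_add₀ Uvar_ne_zero,
      show i - q - c * q = i - ((c : ℤ) + 1) * q by ring]
    congr 2
    ring
  | pred c ih =>
    have h1 := hstep (-(c : ℤ) - 1) (i + q)
    rw [sub_add_cancel, ih, add_sub_cancel_right] at h1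
    have h2 : Uvar ^ (gexp p q k i - gexp p q k (i + q)) ≠ 0 := zpow_ne_zero _ Uvar_ne_zero
    rw [← mul_left_inj' h2, ← h1, ite_mul, zero_mul, ← zpow_add₀ Uvar_ne_zero,
      show i + q - -(c : ℤ) * q = i - (-(c : ℤ) - 1) * q by ring]
    congr 2
    ring

end LocalComp
end

open Topology
noncomputable section
namespace LocalComp

set_option linter.unusedSectionVars false

/-! ### The values of the chains at the corners -/

variable {p q k : ℕ} [NeZero p] [NeZero q] {ε : ℝ}

theorem toTorus_half_div_eq_iff {n : ℕ} [NeZero n] (i j : ℤ) :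
    (∃ m : ℤ, ((i : ℝ) + 1 / 2) / n = ((j : ℝ) + 1 / 2) / n + m) ↔ (i : ZMod n) = j := by
  have hn : (n : ℝ) ≠ 0 := NeZero.ne _
  rw [ZMod.intCast_eq_intCast_iff_dvd_sub]
  constructor
  · rintro ⟨m, h⟩
    refine ⟨-m, ?_⟩
    field_simp at h
    have h' : (i : ℝ) = j + n * m := by linarith
    have h'' : i = j + n * m := by exact_mod_cast h'
    rw [h'']; ring
  · rintro ⟨m, h⟩
    refine ⟨-m, ?_⟩
    have h' : (j : ℝ) - i = n * m := by exact_mod_cast h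
    field_simp
    push_cast
    linarith

theorem toTorus_cornerA_eq_iff (i j : ℤ) :
    toTorus (cornerA p i) = toTorus (cornerA p j) ↔ (i : ZMod p) = j := by
  rw [← toTorus_half_div_eq_iff, toTorus_eq_iff]
  constructor
  · rintro ⟨m, h⟩
    exact ⟨m.1, congrArg Prod.fst h⟩
  · rintro ⟨m, h⟩
    exact ⟨(m, 0), Prod.ext h (by simp [cornerA])⟩

theorem toTorus_cornerB_eq_iff (i j : ℤ) :
    toTorus (cornerB q i) = toTorus (cornerB q j) ↔ (i : ZMod q) = j := by
  rw [← toTorus_half_div_eq_iff, toTorus_eq_iff]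
  constructor
  · rintro ⟨m, h⟩
    refine ⟨-m.2, ?_⟩
    have := congrArg Prod.snd h
    simp only [cornerB, Prod.snd_add] at this
    push_cast
    linarith
  · rintro ⟨m, h⟩
    refine ⟨(0, -m), Prod.ext (by simp [cornerB]) ?_⟩
    simp only [cornerB, Prod.snd_add]
    rw [h]
    push_cast
    ring

theorem theta_eq (m : ZMod p) : theta p m = toTorus (cornerA p m.val) := by
  simp [theta, cornerA]

theorem xi_eq (m : ZMod q) : xi q m = toTorus (cornerB q m.val) := by
  simp [xi, cornerB]

theorem toTorus_cornerA_eq_theta_iff (i : ℤ) (m : ZMod p) :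
    toTorus (cornerA p i) = theta p m ↔ (i : ZMod p) = m := by
  rw [theta_eq, toTorus_cornerA_eq_iff]
  simp

theorem toTorus_cornerB_eq_xi_iff (i : ℤ) (m : ZMod q) :
    toTorus (cornerB q i) = xi q m ↔ (i : ZMod q) = m := by
  rw [xi_eq, toTorus_cornerB_eq_iff]
  simp

theorem coeffAt_eq {ι κ : Type} {α : LCurve ι} {β : LCurve κ} (ψ : CF α β) {P : ℝ × ℝ} {m m' : ℤ}
    (h : α.across P = m) (h' : β.across P = m') :
    coeffAt ψ P = ψ ⟨toTorus P, ⟨P, ⟨m, h⟩, rfl⟩, ⟨P, ⟨m', h'⟩, rfl⟩⟩ :=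
  dif_pos _

/-- The two sums in the definition of `ψ_{0r}` correspond to the presence or absence of this borrow.
-/
theorem sub_div_eq (hk : k < p) (i : ℤ) :
    (i - k) / p = i / p - if ((i - k : ℤ) : ZMod p).val < p - k then 0 else 1 := by
  have hp : (0 : ℤ) < p := by exact_mod_cast NeZero.pos p
  have h1 : (((i - k : ℤ) : ZMod p).val : ℤ) = (i - k) % p := ZMod.val_intCast _
  have h3 := Int.mul_ediv_add_emod (i - k) p
  have h4 := Int.emod_nonneg (i - k) hp.ne'
  have h5 := Int.emod_lt_of_pos (i - k) hp
  have hk' : (k : ℤ) < p := by exact_mod_cast hk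
  split_ifs with h
  · have h6 : (i - k) % p < p - k := by omega
    have : i / p = (i - k) / p := by
      rw [Int.ediv_eq_iff_of_pos hp]; constructor <;> nlinarith
    omega
  · have h6 : p - k ≤ (i - k) % p := by omega
    have : i / p = (i - k) / p + 1 := by
      rw [Int.ediv_eq_iff_of_pos hp]; constructor <;> nlinarith
    omega

theorem psi0r_apply (hk : k < p) (u : CoeffIndex p q → FU) (i : ℤ) (x : XIndex p q k) :
    coeffAt (psi0r k ε u) (cornerA p i) () x =
      if x.1 = i then (u (xDown (xRot ((i - k) / p - i / p) x)) : FUinv) else 0 := by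
  classical
  rw [coeffAt_eq _ (across_cornerA_zero k ε i) (across_cornerA_R i)]
  unfold psi0r
  rw [Matrix.sum_apply]
  have key : ∀ a : CoeffIndex p q, (if toTorus (cornerA p i) = theta p (a.1 + k) then
      Matrix.single () (if a.1.val < p - k then xShift k a else xNext (xShift k a))
        (u a : FUinv) else 0) () x =
      if a = xDown (xRot ((i - k) / p - i / p) x) then
        (if x.1 = i then (u a : FUinv) else 0) else 0 := fun a => by
    have hθ := toTorus_cornerA_eq_theta_iff i (a.1 + (k : ZMod p))
    by_cases h : (i : ZMod p) = a.1 + k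
    · have ha : a.1 = ((i - k : ℤ) : ZMod p) := by push_cast; rw [h]; ring
      rw [if_pos (hθ.2 h)]
      have hs : (if a.1.val < p - k then xShift k a else xNext (xShift k a)) =
          xRot (i / p - (i - k) / p) (xShift k a) := by
        rw [sub_div_eq hk, ha]
        split_ifs
        · rw [sub_zero, sub_self, xRot_zero]
        · rw [sub_sub_cancel, xRot_one]
      rw [hs, Matrix.single_apply]
      have hiff : xRot (i / p - (i - k) / p) (xShift k a) = x ↔
          a = xDown (xRot ((i - k) / p - i / p) x) := by
        rw [eq_comm, xRot_eq_iff, neg_sub, xShift_eq_iff]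
      simp only [hiff, true_and]
      split_ifs with h1 h2
      · rfl
      · refine (h2 ?_).elim
        have : a.1 = x.1 - k := congrArg Sigma.fst h1
        rw [h, this]; ring
      · rfl
    · rw [if_neg (mt hθ.1 h)]
      split_ifs with h1 h2
      · refine (h ?_).elim
        have : a.1 = x.1 - k := congrArg Sigma.fst h1
        rw [this, ← h2]; ring
      · rfl
      · rfl
  rw [Finset.sum_congr rfl fun a _ => key a]
  simp

/-- For `c = ⌊i/p⌋ + 1`, the power along a full side, the quotient `⌊i/p⌋` cancels and `⌊(i - k)/p⌋
+ 1` remains, as in the case `k = 0` with `i - k` in place of `i`. -/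
theorem psi0r_mul_phi0 (hk : k < p) (u : CoeffIndex p q → FU) (i c : ℤ) (x : XIndex p q k) :
    (coeffAt (psi0r k ε u) (cornerA p i) * phi0 p q k ^ c) () x =
      if x.1 = i then
        ((ext u ((i - k : ℤ) : ZMod p) ((x.2 : ℕ) + c + ((i - k) / p - i / p)) : FU) : FUinv) else 0 := by
  rw [Matrix.mul_apply]
  simp only [phi0_zpow, mul_ite, mul_one, mul_zero, Finset.sum_ite_eq', Finset.mem_univ, if_true,
    psi0r_apply hk]
  change (if x.1 = i then _ else _) = _
  split_ifs with h
  · have h' : x.1 - (k : ZMod p) = ((i - k : ℤ) : ZMod p) := by rw [h]; push_cast; rfl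
    rw [← xRot_add, apply_xDown_xRot u, h']
    rw [show ((x.2 : ℕ) : ℤ) + ((i - k) / p - i / p + c) =
      (x.2 : ℕ) + c + ((i - k) / p - i / p) by ring]
  · rfl

theorem psiInf0_apply (w : CoeffIndex p q → FU) (x : XIndex p q k) (b : ZMod p) :
    coeffAt (psiInf0 k ε w) (0, 0) x b =
      if b = -x.1 * (q : ZMod p)⁻¹ then (w (xDown x) : FUinv) else 0 := by
  classical
  rw [coeffAt_eq _ (across_origin_inf k ε) (across_origin_zero k ε)]
  unfold psiInf0
  rw [Matrix.sum_apply, Finset.sum_eq_single (xDown x)]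
  · rw [if_pos (show toTorus (0, 0) = zeta from rfl), Matrix.single_apply, (xShift_eq_iff _ _).2 rfl]
    simp only [true_and, xDown, sub_add_cancel]
    congr 1
    exact propext eq_comm
  · intro a _ hne
    rw [if_pos (show toTorus (0, 0) = zeta from rfl), Matrix.single_apply, if_neg]
    rintro ⟨h, -⟩
    exact hne ((xShift_eq_iff _ _).1 h)
  · simp

theorem phi0_mul_psiInf0 (w : CoeffIndex p q → FU) (c : ℤ) (x : XIndex p q k) (b : ZMod p) :
    (phi0 p q k ^ c * coeffAt (psiInf0 k ε w) (0, 0)) x b =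
      if b = -x.1 * (q : ZMod p)⁻¹ then ((ext w (x.1 - k) ((x.2 : ℕ) - c) : FU) : FUinv) else 0 := by
  rw [Matrix.mul_apply, Finset.sum_eq_single (xRot (-c) x)]
  · rw [phi0_zpow, if_pos ((xRot_eq_iff c x _).2 rfl), one_mul, psiInf0_apply,
      apply_xDown_xRot w, ← sub_eq_add_neg]
    rfl
  · intro y _ hy
    rw [phi0_zpow, if_neg (mt (xRot_eq_iff c x y).1 hy), zero_mul]
  · simp

theorem psirInf_apply (v : ZMod q → FU) (i : ℤ) (b : ZMod p) :
    coeffAt (psirInf (p := p) k ε v) (cornerB q i) b () =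
      if b = -((i % q : ℤ) : ZMod p) * (q : ZMod p)⁻¹ then
        (v ((i - k : ℤ) : ZMod q) : FUinv) else 0 := by
  classical
  rw [coeffAt_eq _ (across_cornerB_R i) (across_cornerB_inf k ε i)]
  unfold psirInf
  rw [Matrix.sum_apply, Finset.sum_eq_single ((i - k : ℤ) : ZMod q)]
  · have h : (((i - k : ℤ) : ZMod q)) + k = i := by push_cast; ring
    rw [h, if_pos ((toTorus_cornerB_eq_xi_iff _ _).2 rfl), Matrix.single_apply]
    have h2 : (((i : ZMod q).val : ℕ) : ZMod p) = ((i % q : ℤ) : ZMod p) := by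
      rw [← ZMod.val_intCast]; push_cast; rfl
    rw [h2]
    simp only [and_true]
    congr 1
    exact propext eq_comm
  · intro j _ hne
    rw [if_neg, Matrix.zero_apply]
    rw [toTorus_cornerB_eq_xi_iff]
    intro h
    refine hne ?_
    push_cast
    rw [h]; ring
  · simp

/-- The chain has its basis vector at the representative of `i` in `[0, q)`, where `gexp` vanishes.
The power `-⌊i/q⌋` of the monodromy carries it to `i` and accumulates `U ^ gexp i`. -/
theorem phiInf_mul_psirInf (hpq : p.Coprime q) (hk : k < p) (v : ZMod q → FU) (i d : ℤ)
    (b : ZMod p) :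
    (phiInf p q k ^ (d - i / q) * coeffAt (psirInf (p := p) k ε v) (cornerB q i)) b () =
      if b = -((i - d * q : ℤ) : ZMod p) * (q : ZMod p)⁻¹ then
        Uvar ^ gexp p q k (i - d * q) * (v ((i - k : ℤ) : ZMod q) : FUinv) else 0 := by
  have hq : (0 : ℤ) < q := by exact_mod_cast NeZero.pos q
  rw [Matrix.mul_apply]
  simp only [psirInf_apply, mul_ite, mul_zero, Finset.sum_ite_eq', Finset.mem_univ, if_true,
    phiInf_zpow hpq hk, ite_mul, zero_mul]
  have h1 : i % q - (d - i / q) * q = i - d * q := by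
    have := Int.mul_ediv_add_emod i q
    linear_combination this
  rw [h1, gexp_eq_zero hk (Int.emod_nonneg _ hq.ne') (Int.emod_lt_of_pos _ hq), sub_zero]

theorem phiInf_zpow_row (hpq : p.Coprime q) (hk : k < p) (c : ℤ) (i : ℤ) (b : ZMod p) :
    (phiInf p q k ^ c) (-(i : ZMod p) * (q : ZMod p)⁻¹) b =
      if b = -((i + c * q : ℤ) : ZMod p) * (q : ZMod p)⁻¹ then
        Uvar ^ (gexp p q k i - gexp p q k (i + c * q)) else 0 := by
  have hq := qinv hpq
  by_cases h : b = -((i + c * q : ℤ) : ZMod p) * (q : ZMod p)⁻¹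
  · rw [if_pos h, h, phiInf_zpow hpq hk, if_pos] <;> rw [add_sub_cancel_right]
  · rw [if_neg h]
    have hb : b = -(((-b * q).val : ℤ) : ZMod p) * (q : ZMod p)⁻¹ := by
      simp only [Int.cast_natCast, ZMod.natCast_zmod_val]
      linear_combination -b * hq
    rw [hb, phiInf_zpow hpq hk, if_neg]
    intro h1
    refine h ?_
    push_cast at h1 ⊢
    simp only [ZMod.natCast_zmod_val] at h1
    linear_combination -h1 - b * hq

/-- The composition of the coefficients at two corners. -/
def hsum (u w : CoeffIndex p q → FU) (i : ℤ) : FU :=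
  ∑ ℓ : Fin (sSeq p q (i : ZMod p)), ext u (i : ZMod p) ((ℓ : ℕ) + i / p + 1) * w ⟨i, ℓ⟩

theorem psi0r_mul_psiInf0 (hk : k < p) (u w : CoeffIndex p q → FU) (i : ℤ) (b : ZMod p) :
    (coeffAt (psi0r k ε u) (cornerA p i) * phi0 p q k ^ (i / p + 1) *
      coeffAt (psiInf0 k ε w) (0, 0)) () b =
      if b = -(i : ZMod p) * (q : ZMod p)⁻¹ then (hsum u w (i - k) : FUinv) else 0 := by
  rw [Matrix.mul_apply, Fintype.sum_sigma, Finset.sum_eq_single (i : ZMod p)]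
  · simp only [psi0r_mul_phi0 hk, psiInf0_apply, if_true, mul_ite, mul_zero]
    split_ifs with h
    · have key : ∀ m : ZMod p, m = ((i - k : ℤ) : ZMod p) → ∑ ℓ : Fin (sSeq p q m),
          (((ext u ((i - k : ℤ) : ZMod p) ((ℓ : ℕ) + (i / p + 1) + ((i - k) / p - i / p)) : FU) : FUinv) *
            (w ⟨m, ℓ⟩ : FUinv)) = (hsum u w (i - k) : FUinv) := by
        rintro m rfl
        rw [hsum, map_sum]
        refine Finset.sum_congr rfl fun ℓ _ => ?_
        rw [map_mul, show ((ℓ : ℕ) : ℤ) + (i / p + 1) + ((i - k) / p - i / p) =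
          (ℓ : ℕ) + (i - k) / p + 1 by ring]
      exact key _ (by push_cast; rfl)
    · simp
  · intro m _ hm
    refine Finset.sum_eq_zero fun ℓ _ => ?_
    rw [psi0r_mul_phi0 hk, if_neg hm, zero_mul]
  · simp

/-- The mechanism by which the case of general `k` is reduced to `k = 0`: the weight `U ^ nz i` of a
triangle becomes `U ^ nz (i - k)`. -/
theorem Uvar_pow_mul_gexp (i : ℤ) :
    Uvar ^ nz p q i * Uvar ^ gexp p q k i = ((PowerSeries.X ^ nz p q (i - k) : FU) : FUinv) := by
  rw [← zpow_natCast, ← zpow_add₀ Uvar_ne_zero, gexp, add_sub_cancel, zpow_natCast, Uvar]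
  exact (map_pow (HahnSeries.ofPowerSeries ℤ F2) _ _).symm

end LocalComp
end

open Topology
noncomputable section
namespace LocalComp

set_option linter.unusedSectionVars false

/-! ### The chains are cycles, and the triangle counting maps vanish -/

variable {p q k : ℕ} [NeZero p] [NeZero q] {ε : ℝ} {u : CoeffIndex p q → FU} {v : ZMod q → FU}
  {w : CoeffIndex p q → FU}

/-- Lines of different slopes meet at most once, so all three differentials are empty sums. -/
theorem areCycles : AreCycles u v w k ε := by
  have hp : (p : ℝ) ≠ 0 := NeZero.ne _
  have hq : (q : ℝ) ≠ 0 := NeZero.ne _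
  refine ⟨fun y i j => ?_, fun y i j => ?_, fun y i j => ?_⟩
  · have := Polygon.isEmpty_bigon (γ₀ := (beta0 p q k ε).toCurve) (γ₁ := (betaR p q).toCurve)
      fun l₀ l₁ P Q h1 h2 h3 h4 => by
        change -P.2 = _ at h1
        change q * P.2 - p * P.1 + 1 / 2 = _ at h2
        change -Q.2 = _ at h3
        change q * Q.2 - p * Q.1 + 1 / 2 = _ at h4
        have e2 : P.2 = Q.2 := by linarith
        exact Prod.ext (mul_left_cancel₀ hp (by rw [e2] at h2; linarith)) e2
    exact uAdicHasSum_of_isEmpty _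
  · have := Polygon.isEmpty_bigon (γ₀ := (betaR p q).toCurve) (γ₁ := (betaInf p q k ε).toCurve)
      fun l₀ l₁ P Q h1 h2 h3 h4 => by
        change q * P.2 - p * P.1 + 1 / 2 = _ at h1
        change -P.1 = _ at h2
        change q * Q.2 - p * Q.1 + 1 / 2 = _ at h3
        change -Q.1 = _ at h4
        have e1 : P.1 = Q.1 := by linarith
        exact Prod.ext e1 (mul_left_cancel₀ hq (by rw [e1] at h1; linarith))
    exact uAdicHasSum_of_isEmpty _
  · have := Polygon.isEmpty_bigon (γ₀ := (betaInf p q k ε).toCurve)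
      (γ₁ := (beta0 p q k ε).toCurve) fun l₀ l₁ P Q h1 h2 h3 h4 => by
        change -P.1 = _ at h1
        change -P.2 = _ at h2
        change -Q.1 = _ at h3
        change -Q.2 = _ at h4
        exact Prod.ext (by linarith) (by linarith)
    exact uAdicHasSum_of_isEmpty _

theorem UAdicHasSum.comp_equiv {I J : Type*} {f : J → FUinv} {s : FUinv} (h : UAdicHasSum f s)
    (e : I ≃ J) : UAdicHasSum (fun i => f (e i)) s :=
  ⟨fun N => Set.Finite.preimage (f := e) e.injective.injOn (h.1 N), fun n => by
    rw [h.2 n, ← finsum_comp_equiv e]⟩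

theorem uAdicHasSum_shift {g : ℤ → FU} (h : wsum (nz p q) g = 0) (k : ℕ) :
    UAdicHasSum (fun i : ℤ =>
      ((PowerSeries.X ^ nz p q (i - k) * g (i - k) : FU) : FUinv)) 0 := by
  have := uAdicHasSum_wsum (nz_le_finite (p := p) (q := q)) g
  rw [h, PowerSeries.coe_zero] at this
  exact this.comp_equiv (Equiv.subRight (k : ℤ))

theorem wsum_ite_const {I : Type*} {n : I → ℕ} {g : I → FU} (P : Prop) [Decidable P]
    (h : P → wsum n g = 0) : wsum n (fun i => if P then g i else 0) = 0 := by
  by_cases hP : P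
  · simp only [if_pos hP, h hP]
  · ext N
    simp [wsum, hP]

theorem Matrix.mul_unit_apply {ι κ : Type*} (A : Matrix ι Unit FUinv) (B : Matrix Unit κ FUinv)
    (i : ι) (j : κ) : (A * B) i j = A i () * B () j := by
  simp [Matrix.mul_apply]

theorem neg_mul_inv_inj (hpq : p.Coprime q) {a b : ZMod p} :
    -a * (q : ZMod p)⁻¹ = -b * (q : ZMod p)⁻¹ ↔ a = b := by
  have hq := qinv hpq
  constructor
  · intro h
    linear_combination (-(q : ZMod p)) * h + (b - a) * hq
  · rintro rfl; rfl

theorem phi0_psiInf0_phiInf_psirInf (hpq : p.Coprime q) (hk : k < p) (c i : ℤ) (x : XIndex p q k) :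
    (phi0 p q k ^ c * coeffAt (psiInf0 k ε w) (0, 0) *
      (phiInf p q k ^ (-(i / q)) * coeffAt (psirInf (p := p) k ε v) (cornerB q i))) x () =
    if x.1 = i then Uvar ^ gexp p q k i * ((v ((i - k : ℤ) : ZMod q) *
      ext w ((i - k : ℤ) : ZMod p) ((x.2 : ℕ) - c) : FU) : FUinv) else 0 := by
  have h0 : -(i / (q : ℤ)) = 0 - i / q := by ring
  rw [Matrix.mul_apply, Finset.sum_eq_single (-(i : ZMod p) * (q : ZMod p)⁻¹), h0,
    phi0_mul_psiInf0, phiInf_mul_psirInf hpq hk, zero_mul, sub_zero, if_pos rfl]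
  · simp only [neg_mul_inv_inj hpq, @eq_comm _ (i : ZMod p)]
    split_ifs with h
    · have h' : x.1 - (k : ZMod p) = ((i - k : ℤ) : ZMod p) := by rw [h]; push_cast; rfl
      rw [h', map_mul]
      ring
    · rw [zero_mul]
  · intro b _ hb
    rw [h0, phiInf_mul_psirInf hpq hk, zero_mul, sub_zero, if_neg hb, mul_zero]
  · simp

theorem psi0r_psiInf0_phiInf (hpq : p.Coprime q) (hk : k < p) (i c : ℤ) (b : ZMod p) :
    (coeffAt (psi0r k ε u) (cornerA p i) * phi0 p q k ^ (i / p + 1) *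
      coeffAt (psiInf0 k ε w) (0, 0) * phiInf p q k ^ c) () b =
    if b = -((i + c * q : ℤ) : ZMod p) * (q : ZMod p)⁻¹ then
      Uvar ^ (gexp p q k i - gexp p q k (i + c * q)) * (hsum u w (i - k) : FUinv) else 0 := by
  rw [Matrix.mul_apply, Finset.sum_eq_single (-(i : ZMod p) * (q : ZMod p)⁻¹),
    psi0r_mul_psiInf0 hk, if_pos rfl, phiInf_zpow_row hpq hk, mul_ite, mul_zero,
    mul_comm (hsum u w (i - k) : FUinv)]
  · intro b _ hb
    rw [psi0r_mul_psiInf0 hk, if_neg hb, zero_mul]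
  · simp

theorem Uvar_smul {ι κ : Type*} (n : ℕ) (A : Matrix ι κ FUinv) (i : ι) (j : κ) :
    (Uvar ^ n • A) i j = Uvar ^ n * A i j := rfl

theorem Uvar_pow_mul (i : ℤ) (g : FU) : Uvar ^ nz p q i * (Uvar ^ gexp p q k i * (g : FUinv)) =
    ((PowerSeries.X ^ nz p q (i - k) * g : FU) : FUinv) := by
  rw [← mul_assoc, Uvar_pow_mul_gexp, map_mul]

theorem uAdicHasSum_zero {I : Type*} : UAdicHasSum (fun _ : I => 0) 0 :=
  ⟨fun N => by simp, fun n => by simp⟩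

theorem betaR_mono_zpow (c : ℤ) : (betaR p q).mono ^ c = 1 := Matrix.one_zpow c

theorem mu2_zero_r_inf (hpq : p.Coprime q) (hk : k < p) (hε : 0 < ε)
    (hε' : 4 * ((p : ℝ) + q) * ε < 1) (h : IsAlgSol u v w) :
    IsMu2 (ε, ε) (beta0 p q k ε) (betaR p q) (betaInf p q k ε) (psi0r k ε u) (psirInf k ε v) 0 := by
  classical
  refine (systemZero p q hpq k ε).isMu2 fun y b x => ?_
  change UAdicHasSum _ 0
  simp only [fun i => (systemZero_corners hpq k ε i).1, fun i => (systemZero_corners hpq k ε i).2.1,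
    fun i => (systemZero_corners hpq k ε i).2.2, systemZero_inTriangle, ncard_inRegion hε hε',
    crossings_zero k hε hε', crossings_inf k hε hε', betaR_mono_zpow, Matrix.mul_one]
  by_cases hy : toTorus (0, 0) = (y : T2)
  swap
  · simp only [if_neg hy]
    exact uAdicHasSum_zero
  simp only [if_pos hy, Uvar_smul]
  have hw := wsum_ite_const (b = -x.1 * (q : ZMod p)⁻¹) fun _ => h.right (x.1 - k) (x.2 : ℕ)
  convert uAdicHasSum_shift hw k using 2 with i
  have e : (beta0 p q k ε).mono = phi0 p q k := rfl
  have e' : (betaInf p q k ε).mono = phiInf p q k := rfl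
  rw [e, e', Matrix.mul_assoc (_ * _), Matrix.mul_unit_apply, psi0r_mul_phi0 hk,
    show -(i / (q : ℤ)) = 0 - i / q by ring, phiInf_mul_psirInf hpq hk, zero_mul, sub_zero]
  by_cases hx : x.1 = i
  · have h' : ((i - k : ℤ) : ZMod p) = x.1 - k := by rw [hx]; push_cast; rfl
    rw [if_pos hx, ← hx, h', if_pos rfl,
      show ((x.2 : ℕ) : ℤ) + (i / p + 1) + ((i - k) / p - i / p) = (x.2 : ℕ) + (i - k) / p + 1 by ring]
    split_ifs with hb
    · rw [← Uvar_pow_mul, map_mul]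
      ring
    · simp
  · have h' : ((i - k : ℤ) : ZMod p) ≠ x.1 - k := fun h => hx (by
      push_cast at h; linear_combination -h)
    rw [if_neg hx, if_neg h']
    simp

theorem mu2_r_inf_zero (hpq : p.Coprime q) (hk : k < p) (hε : 0 < ε)
    (hε' : 4 * ((p : ℝ) + q) * ε < 1) (h : IsAlgSol u v w) :
    IsMu2 (ε, ε) (betaR p q) (betaInf p q k ε) (beta0 p q k ε) (psirInf k ε v)
      (psiInf0 k ε w) 0 := by
  classical
  refine (systemR p q hpq k ε).isMu2 fun y x b => ?_
  change UAdicHasSum _ 0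
  simp only [fun i => (systemR_corners hpq k ε i).1, fun i => (systemR_corners hpq k ε i).2.1,
    fun i => (systemR_corners hpq k ε i).2.2, systemR_inTriangle, ncard_inRegion hε hε',
    crossings_zero k hε hε', crossings_inf k hε hε', betaR_mono_zpow, Matrix.mul_one, Uvar_smul]
  -- The shift of `t` by `0` or `1` compensates for the borrow in `⌊(i - k)/p⌋`, which depends only
  -- on the residue class.
  have hw := wsum_ite_const (theta p x.1 = y) fun _ => h.right' (x.1 - k)
    ((x.2 : ℕ) - if (x.1 - (k : ZMod p)).val < p - k then 0 else 1)
  convert uAdicHasSum_shift hw k using 2 with i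
  have hA : toTorus (cornerA p i) = theta p i := (toTorus_cornerA_eq_theta_iff _ _).2 rfl
  rw [hA]
  have e : (beta0 p q k ε).mono = phi0 p q k := rfl
  have e' : (betaInf p q k ε).mono = phiInf p q k := rfl
  rw [e, e', Matrix.mul_assoc (_ * _), phi0_psiInf0_phiInf_psirInf hpq hk]
  by_cases hx : x.1 = i
  · have h' : ((i - k : ℤ) : ZMod p) = x.1 - k := by rw [hx]; push_cast; rfl
    have hd := sub_div_eq hk i
    rw [if_pos hx, ← hx, h', if_pos rfl]
    split_ifs with hy hb
    · rw [h', if_pos hb, sub_zero] at hd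
      rw [Uvar_pow_mul, hd, sub_zero, sub_sub]
    · rw [h', if_neg hb] at hd
      rw [Uvar_pow_mul, hd, show ((x.2 : ℕ) : ℤ) - 1 - (i / p - 1) - 1 = (x.2 : ℕ) - (i / p + 1) by ring]
    · simp
  · have h' : ((i - k : ℤ) : ZMod p) ≠ x.1 - k := fun h => hx (by
      push_cast at h; linear_combination -h)
    rw [if_neg hx, if_neg h']
    simp

theorem mu2_inf_zero_r (hpq : p.Coprime q) (hk : k < p) (hε : 0 < ε)
    (hε' : 4 * ((p : ℝ) + q) * ε < 1) (h : IsAlgSol u v w) :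
    IsMu2 (ε, ε) (betaInf p q k ε) (beta0 p q k ε) (betaR p q) (psiInf0 k ε w) (psi0r k ε u) 0 := by
  classical
  refine (systemInf p q hpq k ε).isMu2 fun y a b => ?_
  change UAdicHasSum _ 0
  simp only [fun i => (systemInf_corners hpq k ε i).1, fun i => (systemInf_corners hpq k ε i).2.1,
    fun i => (systemInf_corners hpq k ε i).2.2, systemInf_inTriangle, ncard_inRegion hε hε',
    crossings_zero k hε hε', crossings_inf k hε hε', betaR_mono_zpow, Matrix.one_mul, Uvar_smul]
  by_cases hy : ∃ i₀ : ℤ, toTorus (cornerB q i₀) = (y : T2)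
  swap
  · push Not at hy
    simp only [if_neg (hy _)]
    exact uAdicHasSum_zero
  obtain ⟨i₀, hy⟩ := hy
  have hw := wsum_ite_const (b = -((i₀ % q : ℤ) : ZMod p) * (q : ZMod p)⁻¹)
    fun _ => h.left ((i₀ - k : ℤ) : ZMod q)
  convert uAdicHasSum_shift hw k using 2 with i
  have hB : toTorus (cornerB q i) = y ↔ (i : ZMod q) = i₀ := by rw [← hy, toTorus_cornerB_eq_iff]
  have e : (beta0 p q k ε).mono = phi0 p q k := rfl
  have e' : (betaInf p q k ε).mono = phiInf p q k := rfl
  -- The last monodromy brings the basis vector back to the representative in `[0, q)`, so the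
  -- matrix entry depends only on the corner modulo deck transformations.
  have hm : i + -(i / q) * q = i % q := by
    have := Int.mul_ediv_add_emod i q
    linear_combination -this
  have hq : (0 : ℤ) < q := by exact_mod_cast NeZero.pos q
  rw [e, e', psi0r_psiInf0_phiInf hpq hk, hm,
    gexp_eq_zero hk (Int.emod_nonneg _ hq.ne') (Int.emod_lt_of_pos _ hq), sub_zero]
  by_cases hx : (i : ZMod q) = i₀
  · have h' : ((i - k : ℤ) : ZMod q) = ((i₀ - k : ℤ) : ZMod q) := by push_cast; rw [hx]
    rw [if_pos (hB.2 hx), if_pos h', (ZMod.intCast_eq_intCast_iff' _ _ _).1 hx]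
    split_ifs with hb
    · rw [Uvar_pow_mul]; rfl
    · simp
  · have h' : ((i - k : ℤ) : ZMod q) ≠ ((i₀ - k : ℤ) : ZMod q) := fun h => hx (by
      push_cast at h; linear_combination h)
    rw [if_neg (mt hB.1 hx), if_neg h']
    simp

theorem trianglesVanish (hpq : p.Coprime q) (hk : k < p) (hε : 0 < ε)
    (hε' : 4 * ((p : ℝ) + q) * ε < 1) (h : IsAlgSol u v w) : TrianglesVanish u v w k ε :=
  ⟨mu2_inf_zero_r hpq hk hε hε' h, mu2_zero_r_inf hpq hk hε hε' h,
    mu2_r_inf_zero hpq hk hε hε' h⟩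

end LocalComp
end

/-! ### Quadrilaterals modulo `U` -/

open Topology
noncomputable section
namespace LocalComp

set_option linter.unusedSectionVars false

/-! ### Counting modulo two -/

/-- The integers between `a` and `b`, regardless of the order of `a` and `b`. -/
def between (a b : ℤ) : Finset ℤ := Finset.Ioc (min a b) (max a b)

theorem mem_between {a b h : ℤ} : h ∈ between a b ↔ min a b < h ∧ h ≤ max a b := Finset.mem_Ioc

/-- Whatever the order of `a` and `b`, the two intervals differ exactly by the integer `b`; modulo
two their common part cancels. -/
theorem sum_between (φ : ℤ → F2) (a b : ℤ) :
    ∑ h ∈ between a b, φ h + ∑ h ∈ between a (b - 1), φ h = φ b := by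
  rcases le_or_gt b a with hab | hab
  · have e1 : between a b = Finset.Ioc b a := by rw [between, min_eq_right hab, max_eq_left hab]
    have e2 : between a (b - 1) = insert b (Finset.Ioc b a) := by
      ext h
      rw [mem_between, Finset.mem_insert, Finset.mem_Ioc]
      omega
    rw [e1, e2, Finset.sum_insert (by simp), add_left_comm, CharTwo.add_self_eq_zero, add_zero]
  · have e2 : between a (b - 1) = Finset.Ioc a (b - 1) := by
      rw [between, min_eq_left (by omega), max_eq_right (by omega)]
    have e1 : between a b = insert b (Finset.Ioc a (b - 1)) := by
      ext h
      rw [mem_between, Finset.mem_insert, Finset.mem_Ioc]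
      omega
    rw [e1, e2, Finset.sum_insert (by simp), add_assoc, CharTwo.add_self_eq_zero, add_zero]

theorem sum_between_sub (φ : ℤ → F2) (a b : ℤ) (s : ℕ) :
    ∑ h ∈ between a b, φ h + ∑ h ∈ between a (b - s), φ h = ∑ j ∈ Finset.range s, φ (b - j) := by
  induction s with
  | zero => simp [CharTwo.add_self_eq_zero]
  | succ s ih =>
    rw [Finset.sum_range_succ, ← ih, ← sum_between φ a (b - s)]
    push_cast
    rw [← sub_sub, add_assoc, CharTwo.add_cancel_left]

theorem between_comm (a b : ℤ) : between a b = between b a := by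
  rw [between, between, min_comm, max_comm]

theorem sum_between_add_one (φ : ℤ → F2) (a b : ℤ) :
    ∑ h ∈ between a b, φ (h + 1) = ∑ h ∈ between (a + 1) (b + 1), φ h := by
  refine Finset.sum_bij' (fun h _ => h + 1) (fun h _ => h - 1) ?_ ?_ ?_ ?_ ?_ <;>
    simp only [mem_between, add_sub_cancel_right, sub_add_cancel, implies_true]
  · intro h hh; omega
  · intro h hh; omega

theorem sum_between_one (a b : ℤ) : (∑ _h ∈ between a b, 1 : F2) = (a : F2) + b := by
  rw [Finset.sum_const, between, Int.card_Ioc, nsmul_one]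
  have h := min_le_max (a := a) (b := b)
  have h1 : (((max a b - min a b).toNat : ℤ) : F2) = ((max a b - min a b : ℤ) : F2) := by
    rw [Int.toNat_of_nonneg (by omega)]
  rw [Int.cast_natCast] at h1
  rw [h1, Int.cast_sub, CharTwo.sub_eq_add]
  rcases le_total a b with hab | hab
  · rw [max_eq_right hab, min_eq_left hab, add_comm]
  · rw [max_eq_left hab, min_eq_right hab]

theorem sum_range_dvd {s : ℕ} (hs : 0 < s) (b : ℤ) :
    ∑ j ∈ Finset.range s, (if (s : ℤ) ∣ b - j then 1 else 0 : F2) = 1 := by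
  have hs' : (0 : ℤ) < s := by exact_mod_cast hs
  have h0 := Int.emod_nonneg b hs'.ne'
  have h1 := Int.emod_lt_of_pos b hs'
  rw [Finset.sum_eq_single (b % s).toNat]
  · rw [if_pos]
    rw [Int.toNat_of_nonneg h0]
    exact Int.dvd_self_sub_emod
  · intro j hj hne
    rw [Finset.mem_range] at hj
    refine if_neg fun hd => hne ?_
    have : b % s = j % s := Int.emod_eq_emod_iff_emod_sub_eq_zero.2 (Int.emod_eq_zero_of_dvd hd)
    rw [Int.emod_eq_of_lt (a := (j : ℤ)) (by positivity) (by exact_mod_cast hj)] at this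
    omega
  · intro hn
    exact (hn (by rw [Finset.mem_range]; omega)).elim

theorem sum_Ico_zmod {n : ℕ} [NeZero n] (a : ℤ) (m : ZMod n) :
    (∑ i ∈ Finset.Ico a (a + n), if (i : ZMod n) = m then 1 else 0 : F2) = 1 := by
  have hn : (0 : ℤ) < n := by exact_mod_cast NeZero.pos n
  have h0 := Int.emod_nonneg (m.val - a) hn.ne'
  have h1 := Int.emod_lt_of_pos (m.val - a) hn
  have hm : ((a + (m.val - a) % n : ℤ) : ZMod n) = m := by
    rw [Int.cast_add, ZMod.intCast_mod]
    simp
  rw [Finset.sum_eq_single (a + (m.val - a) % n), if_pos hm]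
  · intro j hj hne
    rw [Finset.mem_Ico] at hj
    refine if_neg fun h => hne ?_
    refine eq_of_cast_eq_of_lt (h.trans hm.symm) ?_ ?_ <;> omega
  · intro hn'
    exact (hn' (by rw [Finset.mem_Ico]; omega)).elim

variable {p q : ℕ} [NeZero p] [NeZero q]

theorem exists_neg_iff {i : ℤ} (h1 : -p ≤ i) (h2 : i < q) :
    (∃ t : ℕ, 1 ≤ t ∧ t ≤ min p q ∧ (i : ZMod q) = -(t : ZMod q)) ↔ i < 0 ∨ q - p ≤ i := by
  have hq : (0 : ℤ) < q := by exact_mod_cast NeZero.pos q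
  constructor
  · rintro ⟨t, ht1, ht2, ht⟩
    rw [le_min_iff] at ht2
    by_contra hn
    push Not at hn
    have : i = -(t : ℤ) := eq_of_cast_eq_of_lt (n := q) (by rw [ht]; push_cast; rfl) (by omega)
      (by omega)
    omega
  · intro h
    have e0 := Int.emod_nonneg i hq.ne'
    have e1 := Int.emod_lt_of_pos i hq
    refine ⟨(q - i % q).toNat, by omega, ?_, ?_⟩
    · rw [le_min_iff]
      refine ⟨?_, by omega⟩
      rcases h with h | h
      · rcases le_or_gt (-(q : ℤ)) i with h' | h'
        · have : i % q = i + q := by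
            rw [← Int.add_emod_right, Int.emod_eq_of_lt (by omega) (by omega)]
          omega
        · omega
      · rcases le_or_gt 0 i with h' | h'
        · rw [Int.emod_eq_of_lt h' h2]; omega
        · omega
    · have : (((q - i % q).toNat : ℤ) : ZMod q) = ((q - i % q : ℤ) : ZMod q) := by
        rw [Int.toNat_of_nonneg (by omega)]
      rw [Int.cast_natCast] at this
      rw [this, Int.cast_sub, ZMod.intCast_mod]
      simp

theorem div_eq_neg_one_iff {i : ℤ} (h1 : -p ≤ i) : i / p = -1 ↔ i < 0 := by
  have e1 := (neg_le_iff_div (p := p) i).1 h1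
  have e2 := nonneg_iff_div (p := p) i
  constructor
  · intro h; by_contra hn; have := e2.1 (by omega); omega
  · intro h; have := mt e2.2 (by omega); omega

theorem div_eq_sub_one_iff {i : ℤ} (h2 : i < q) :
    i / p = sSeq p q (i : ZMod p) - 1 ↔ q - p ≤ i := by
  have e1 := (lt_iff_div_lt (p := p) i).1 h2
  have e2 := lt_iff_div_lt (p := p) (q := q) (i + p * 1)
  rw [add_mul_div, cast_add_mul] at e2
  constructor
  · intro h; by_contra hn; have := e2.1 (by omega); omega
  · intro h; have := mt e2.2 (by omega); omega

section Weights

variable {v : ZMod q → F2}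

/-- The divisibility forces `⌊i/p⌋` to be `-1` or `s - 1`, that is, `i < 0` or `q - p ≤ i`, and
there `v` is `1`. For `s = 0` both conditions hold and the right side is `1 + 1 = 0`. -/
theorem weight_eq (hv : open Classical in ∀ j, v j =
      if ∃ t : ℕ, 1 ≤ t ∧ t ≤ min p q ∧ j = -(t : ZMod q) then 1 else 0)
    {i : ℤ} (h1 : -p ≤ i) (h2 : i < q) :
    (v i * if 0 < sSeq p q (i : ZMod p) ∧ (sSeq p q (i : ZMod p) : ℤ) ∣ i / p + 1 then 1 else 0) =
      (if i < 0 then 1 else 0) + if q - p ≤ i then 1 else 0 := by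
  classical
  rw [hv]
  simp only [exists_neg_iff h1 h2]
  have e1 := div_eq_neg_one_iff h1
  have e2 := div_eq_sub_one_iff (p := p) h2
  rcases Nat.eq_zero_or_pos (sSeq p q (i : ZMod p)) with hs | hs
  · have e3 := (lt_iff_div_lt (p := p) i).1 h2
    rw [hs] at e2 e3
    have e4 : i / p = -1 := by
      have := (neg_le_iff_div (p := p) i).1 h1
      omega
    rw [if_pos (e1.1 e4), if_pos (e2.1 (by omega)), hs]
    simp [CharTwo.add_self_eq_zero]
  · have e3 := dvd_iff_of_mem (t := 0) le_rfl (by exact_mod_cast hs) h1 h2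
    rw [zero_add, sub_zero, e1, e2] at e3
    simp only [e3, hs, true_and]
    have e4 : ¬(i < 0 ∧ q - p ≤ i) := by
      rw [← e1, ← e2]; omega
    by_cases ha : i < 0
    · have hb : ¬(q : ℤ) - p ≤ i := fun hb => e4 ⟨ha, hb⟩
      rw [if_pos ha, if_neg hb, if_pos (Or.inl ha), mul_one, add_zero]
    · simp only [ha, false_or, if_false, zero_add]
      split_ifs <;> simp

theorem sum_Ico_ite (N : ℤ → F2) {a b c d : ℤ} (h : a ≤ c) (h' : d ≤ b) :
    ∑ i ∈ Finset.Ico a b, (if c ≤ i ∧ i < d then N i else 0) = ∑ i ∈ Finset.Ico c d, N i := by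
  rw [← Finset.sum_filter]
  refine Finset.sum_congr ?_ fun _ _ => rfl
  ext i
  simp only [Finset.mem_filter, Finset.mem_Ico]
  omega

/-- The blocks `[-p, 0)` and `[q - p, q)` where the weight lives are translates by `q`. -/
theorem sum_weight (hv : open Classical in ∀ j, v j =
      if ∃ t : ℕ, 1 ≤ t ∧ t ≤ min p q ∧ j = -(t : ZMod q) then 1 else 0) (N : ℤ → F2) :
    ∑ i ∈ Finset.Ico (-(p : ℤ)) q, (v i *
        if 0 < sSeq p q (i : ZMod p) ∧ (sSeq p q (i : ZMod p) : ℤ) ∣ i / p + 1 then 1 else 0) * N i =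
      ∑ i ∈ Finset.Ico (-(p : ℤ)) 0, (N i + N (i + q)) := by
  have e : ∑ i ∈ Finset.Ico (-(p : ℤ)) 0, N (i + q) = ∑ i ∈ Finset.Ico (q - p : ℤ) q, N i := by
    rw [Finset.sum_Ico_add', zero_add, neg_add_eq_sub]
  rw [Finset.sum_add_distrib, e, ← sum_Ico_ite N (le_refl (-(p : ℤ))) (show (0 : ℤ) ≤ q by positivity),
    ← sum_Ico_ite N (show -(p : ℤ) ≤ q - p by omega) (le_refl (q : ℤ)), ← Finset.sum_add_distrib]
  refine Finset.sum_congr rfl fun i hi => ?_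
  rw [Finset.mem_Ico] at hi
  rw [weight_eq hv hi.1 hi.2, add_mul, ite_mul, ite_mul]
  simp only [hi, true_and, and_true, one_mul, zero_mul]

/-- Modulo two the blocks `[-p, 0)` and `[q - p, q)` have the same sum as `[-p, q - p)` and `[0,
q)`, which are translates by `p`. -/
theorem sum_weight' (hv : open Classical in ∀ j, v j =
      if ∃ t : ℕ, 1 ≤ t ∧ t ≤ min p q ∧ j = -(t : ZMod q) then 1 else 0) (N : ℤ → F2) :
    ∑ i ∈ Finset.Ico (-(p : ℤ)) q, (v i *
        if 0 < sSeq p q (i : ZMod p) ∧ (sSeq p q (i : ZMod p) : ℤ) ∣ i / p + 1 then 1 else 0) * N i =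
      ∑ i ∈ Finset.Ico (-(p : ℤ)) (q - p), (N i + N (i + p)) := by
  have e : ∑ i ∈ Finset.Ico (-(p : ℤ)) (q - p), N (i + p) = ∑ i ∈ Finset.Ico (0 : ℤ) q, N i := by
    rw [Finset.sum_Ico_add', neg_add_cancel, sub_add_cancel]
  rw [Finset.sum_add_distrib, e,
    ← sum_Ico_ite N (le_refl (-(p : ℤ))) (show (q : ℤ) - p ≤ q by omega),
    ← sum_Ico_ite N (show -(p : ℤ) ≤ 0 by omega) (le_refl (q : ℤ)), ← Finset.sum_add_distrib]
  refine Finset.sum_congr rfl fun i hi => ?_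
  rw [Finset.mem_Ico] at hi
  rw [weight_eq hv hi.1 hi.2, add_mul, ite_mul, ite_mul]
  simp only [hi, true_and, and_true, one_mul, zero_mul]
  have hNN : N i + N i = 0 := CharTwo.add_self_eq_zero _
  by_cases ha : i < 0 <;> by_cases hb : i < q - p
  · rw [if_pos ha, if_neg (by omega), if_pos hb, if_neg (by omega)]
  · rw [if_pos ha, if_pos (by omega), if_neg hb, if_neg (by omega), hNN, add_zero]
  · rw [if_neg ha, if_neg (by omega), if_pos hb, if_pos (by omega), hNN, add_zero]
  · rw [if_neg ha, if_pos (by omega), if_neg hb, if_pos (by omega)]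

/-- The contribution of one residue class. -/
theorem sum_weight_class (hv : open Classical in ∀ j, v j =
      if ∃ t : ℕ, 1 ≤ t ∧ t ≤ min p q ∧ j = -(t : ZMod q) then 1 else 0) (N : ℤ → F2) {i₀ δ : ℤ}
    (h0 : i₀ / p = -1) (hδ : |δ| < sSeq p q (i₀ : ZMod p)) :
    ∑ i ∈ Finset.Ico (-(p : ℤ)) q, (if (i : ZMod p) = i₀ then
        (if (sSeq p q (i₀ : ZMod p) : ℤ) ∣ δ + i / p + 1 then v i * N i else 0) else 0) =
      if δ = 0 then N i₀ + N (i₀ + p * sSeq p q (i₀ : ZMod p)) else 0 := by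
  classical
  set s := sSeq p q (i₀ : ZMod p) with hs
  have hspos : 0 < s := by have := abs_nonneg δ; omega
  set i₁ := i₀ + p * s with hi₁
  have hc1 : (i₁ : ZMod p) = i₀ := cast_add_mul _ _
  have hd1 : i₁ / p = s - 1 := by rw [hi₁, add_mul_div, h0]; ring
  have h00 : -p ≤ i₀ := by rw [neg_le_iff_div, h0]
  have h01 : i₀ < 0 := (div_eq_neg_one_iff h00).1 h0
  have h11 : i₁ < q := by rw [lt_iff_div_lt (p := p), hc1, hd1]; omega
  have h12 : q - p ≤ i₁ := by rw [← div_eq_sub_one_iff h11, hc1, hd1]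
  have hps : (0 : ℤ) ≤ p * s := by positivity
  -- In each residue class with `s > 0` there are just two indices in the range at which `v` is
  -- nonzero, one in each block.
  have key : ∀ i ∈ Finset.Ico (-(p : ℤ)) q, i ≠ i₀ → i ≠ i₁ → (i : ZMod p) = i₀ → v i = 0 := by
    intro i hi hne hne1 hc
    rw [Finset.mem_Ico] at hi
    rw [hv]
    simp only [exists_neg_iff hi.1 hi.2]
    refine if_neg ?_
    rw [← div_eq_neg_one_iff hi.1, ← div_eq_sub_one_iff (p := p) hi.2, hc]
    rintro (h | h)
    · exact hne (eq_of_cast_eq_of_div_eq hc (h.trans h0.symm))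
    · exact hne1 (eq_of_cast_eq_of_div_eq (hc.trans hc1.symm) (h.trans hd1.symm))
  have v0 : v i₀ = 1 := by
    rw [hv]; simp only [exists_neg_iff h00 (by omega : i₀ < q)]; exact if_pos (Or.inl h01)
  have v1 : v i₁ = 1 := by
    rw [hv]; simp only [exists_neg_iff (show -(p : ℤ) ≤ i₁ by omega) h11]; exact if_pos (Or.inr h12)
  have hne : i₀ ≠ i₁ := fun h => by rw [← h] at hd1; omega
  rw [Finset.sum_eq_add i₀ i₁ hne]
  · rw [if_pos rfl, if_pos hc1, v0, v1, h0, hd1, one_mul, one_mul]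
    have d0 : (s : ℤ) ∣ δ + -1 + 1 ↔ δ = 0 := by
      rw [neg_add_cancel_right]
      exact ⟨fun h => Int.eq_zero_of_abs_lt_dvd h hδ, fun h => by rw [h]; exact dvd_zero _⟩
    have d1 : (s : ℤ) ∣ δ + (s - 1) + 1 ↔ δ = 0 := by
      rw [← d0, show δ + ((s : ℤ) - 1) + 1 = δ + -1 + 1 + s by ring, dvd_add_self_right]
    simp only [d0, d1]
    split_ifs <;> simp
  · intro i hi hni
    split_ifs with h1 h2
    · rw [key i hi hni.1 hni.2 h1, zero_mul]
    · rfl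
    · rfl
  · intro hn
    exact (hn (Finset.mem_Ico.2 ⟨h00, by omega⟩)).elim
  · intro hn
    exact (hn (Finset.mem_Ico.2 ⟨by omega, h11⟩)).elim

end Weights

end LocalComp
end

open Topology
noncomputable section
namespace LocalComp

set_option linter.unusedSectionVars false

/-! ### The quadrilateral counting maps modulo `U` -/

theorem mem_between_floor_iff {x y : ℝ} (hxy : x < y) (hy : ∀ h : ℤ, y ≠ h) (h : ℤ) :
    h ∈ between ⌊x⌋ ⌊y⌋ ↔ x < h ∧ (h : ℝ) < y := by
  have := Int.floor_mono hxy.le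
  rw [mem_between, min_eq_left this, max_eq_right this, Int.floor_lt, Int.le_floor]
  exact and_congr_right fun _ => ⟨fun h' => lt_of_le_of_ne h' (hy h).symm, le_of_lt⟩

namespace TriangleSystem

variable {ι₀ ι₁ ι₂ : Type} [Fintype ι₀] [DecidableEq ι₀] [Fintype ι₁] [DecidableEq ι₁]
  [Fintype ι₂] [DecidableEq ι₂] {α₀ : LCurve ι₀} {α₁ : LCurve ι₁} {α₂ : LCurve ι₂}
  (S : TriangleSystem α₀.toCurve α₁.toCurve α₂.toCurve) {ε : ℝ} {f : ℝ → ℝ} {tp : ℝ}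

theorem along_ptY (x : ℤ × ℤ) : α₀.along (S.ptY tp x) = tp + x.2 := by
  rw [(S.frame x.1).along₀, ptY, Homeomorph.apply_symm_apply, (S.frame x.1).σ_σ_mul]

/-- The small region around `Θ⁺` is disjoint from the other two curves, so no corner of a triangle
lies over `Θ⁺`. -/
theorem along_sub_ne (D : TranslateData α₀.toCurve α₁.toCurve α₂.toCurve ε f tp) {P : ℝ × ℝ}
    {l m : ℤ} (h : α₀.across P = l) (h' : α₁.across P = m ∨ α₂.across P = m) (n : ℤ) :
    α₀.along P - tp ≠ n := by
  intro hn
  have e : α₀.along P = tp + n := by linarith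
  have hδ : 0 < D.δ := (abs_nonneg (f 0)).trans_lt ((D.bdd 0).trans D.lt_δ)
  have := D.avoid P ⟨l, by rw [h, sub_self, abs_zero]; exact hδ⟩
    (by rw [e]; exact D.zero_mem _ (D.zero n)) m
  tauto

/-- The lifts of `Θ⁺` on a side are the integers between two non-integral numbers. For `σ = -1` the
end points are exchanged, which `between` ignores. -/
theorem quadIndex_iff (D : TranslateData α₀.toCurve α₁.toCurve α₂.toCurve ε f tp) (i h : ℤ) :
    ((S.frame i).tO < (S.frame i).σ * (tp + h) ∧ (S.frame i).σ * (tp + h) < (S.frame i).tA) ↔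
      h ∈ between ⌊α₀.along (S.frame i).ptO - tp⌋ ⌊α₀.along (S.frame i).ptA - tp⌋ := by
  have hO : α₀.along (S.frame i).ptO = (S.frame i).σ * (S.frame i).tO := by
    rw [(S.frame i).along₀, Frame.ptO, Homeomorph.apply_symm_apply]
  have hA : α₀.along (S.frame i).ptA = (S.frame i).σ * (S.frame i).tA := by
    rw [(S.frame i).along₀, Frame.ptA, Homeomorph.apply_symm_apply]
  have nO := along_sub_ne D (P := (S.frame i).ptO) (l := S.l₀ i) (m := S.l₂ i)
    (by rw [(S.frame i).across₀_eq_iff, Frame.ptO, Homeomorph.apply_symm_apply])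
    (Or.inr (by rw [(S.frame i).across₂_eq_iff, Frame.ptO, Homeomorph.apply_symm_apply]; simp))
  have nA := along_sub_ne D (P := (S.frame i).ptA) (l := S.l₀ i) (m := S.l₁ i)
    (by rw [(S.frame i).across₀_eq_iff, Frame.ptA, Homeomorph.apply_symm_apply])
    (Or.inl (by rw [(S.frame i).across₁_eq_iff, Frame.ptA, Homeomorph.apply_symm_apply]; simp))
  have hlt := (S.frame i).tO_lt
  rw [hO] at nO
  rw [hA] at nA
  rw [hO, hA]
  rcases (S.frame i).σ_eq with hσ | hσ <;> rw [hσ] at nO nA ⊢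
  · rw [mem_between_floor_iff (by linarith) nA]
    constructor <;> rintro ⟨h1, h2⟩ <;> constructor <;> linarith
  · rw [between_comm, mem_between_floor_iff (by linarith) nO]
    constructor <;> rintro ⟨h1, h2⟩ <;> constructor <;> linarith

/-- A criterion for the quadrilateral counting map to be the identity modulo `U`. -/
theorem exists_isMu3_modUEq
    (D : TranslateData α₀.toCurve α₁.toCurve α₂.toCurve ε f tp) {z : ℝ × ℝ} {ψ₁ : CF α₀ α₁}
    {ψ₂ : CF α₁ α₂} {ψ₃ : CF α₂ α₀} (hε : ε ≤ 1)
    (hz : ∀ l : ℤ, ε ≤ |α₀.across z - l|)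
    (hO₀ : ∀ i s, |s| < ε → α₀.mono = 1 ∨
      ⌊α₀.along ((S.frame i).Ξ.symm ((S.frame i).tO + (S.frame i).κ₂ * s, s)) - α₀.arc⌋ =
        ⌊α₀.along (S.frame i).ptO - α₀.arc⌋)
    (hO₂ : ∀ i s, |s| < ε → α₂.mono = 1 ∨
      ⌊α₂.along ((S.frame i).Ξ.symm ((S.frame i).tO + (S.frame i).κ₂ * s, s)) - α₂.arc⌋ =
        ⌊α₂.along (S.frame i).ptO - α₂.arc⌋)
    {n : ℤ → ℕ} (hn : ∀ N, {i | n i ≤ N}.Finite) {s : Finset ℤ} (hs : ∀ i, n i = 0 ↔ i ∈ s)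
    (g : ι₀ → ι₀ → ℤ → ℤ → FU)
    (hterm : ∀ (i h : ℤ) a b,
        (Uvar ^ Set.ncard {m : ℤ × ℤ |
            (S.frame i).InTriangle ((S.frame i).Ξ (z + latticeVec m))} •
          (α₀.mono ^ α₀.crossings (S.frame i).ptO (S.ptY tp (i, h)) *
            coeffAt ψ₃ (S.frame i).ptO *
            α₂.mono ^ α₂.crossings (S.frame i).ptB (S.frame i).ptO *
            coeffAt ψ₂ (S.frame i).ptB *
            α₁.mono ^ α₁.crossings (S.frame i).ptA (S.frame i).ptB *
            coeffAt ψ₁ (S.frame i).ptA *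
            α₀.mono ^ α₀.crossings (S.ptY tp (i, h)) (S.frame i).ptA)) a b =
          ((PowerSeries.X ^ n i * g a b i h : FU) : FUinv))
    (hcc : ∀ a b, ∑ i ∈ s,
      ∑ h ∈ between ⌊α₀.along (S.frame i).ptO - tp⌋ ⌊α₀.along (S.frame i).ptA - tp⌋,
        PowerSeries.constantCoeff (g a b i h) = if a = b then 1 else 0) :
    ∃ M, IsMu3 z α₀ α₁ α₂ (α₀.translate f) ψ₁ ψ₂ (nearestPointMap f ψ₃) M ∧
      ModUEq M (idTheta α₀ f tp) := by
  classical
  let H : ℤ → Finset ℤ := fun i =>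
    between ⌊α₀.along (S.frame i).ptO - tp⌋ ⌊α₀.along (S.frame i).ptA - tp⌋
  let e : (Σ i : ℤ, H i) ≃ S.QuadIndex tp :=
    { toFun := fun x => ⟨(x.1, x.2), (S.quadIndex_iff D x.1 x.2).2 x.2.2⟩
      invFun := fun x => ⟨x.1.1, x.1.2, (S.quadIndex_iff D _ _).1 x.2⟩
      left_inv := fun x => rfl
      right_inv := fun x => rfl }
  let N : (Σ i : ℤ, H i) → ℕ := fun x => n x.1
  have hN : ∀ k, {x | N x ≤ k}.Finite := fun k =>
    (((hn k).toFinset.sigma fun i => (H i).attach).finite_toSet).subset fun x hx => by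
      simpa [N] using hx
  let G : ι₀ → ι₀ → (Σ i : ℤ, H i) → FU := fun a b x => g a b x.1 x.2
  have hconst : ∀ a b, PowerSeries.constantCoeff (wsum N (G a b)) = if a = b then 1 else 0 := by
    intro a b
    rw [constantCoeff_wsum (s.sigma fun i => (H i).attach) (fun x => by simp [N, hs]),
      Finset.sum_sigma, ← hcc a b]
    refine Finset.sum_congr rfl fun i _ => ?_
    exact Finset.sum_attach (H i) fun h => PowerSeries.constantCoeff (g a b i h)
  refine ⟨_, S.isMu3 D hε hz hO₀ hO₂ (Matrix.of fun a b => ((wsum N (G a b) : FU) : FUinv))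
    fun a b => ?_, fun y a b => ?_⟩
  · change UAdicHasSum _ ((wsum N (G a b) : FU) : FUinv)
    convert (uAdicHasSum_wsum hN (G a b)).comp_equiv e.symm using 2 with x
    exact hterm x.1.1 x.1.2 a b
  · unfold idTheta
    by_cases hy : IsTheta α₀.toCurve tp y
    · have hy' : ∃ P : ℝ × ℝ, toTorus P = y ∧ (∃ m : ℤ, α₀.across P = m) ∧
        ∃ m : ℤ, α₀.along P = tp + m := hy
      simp only [if_pos hy, if_pos hy']
      have h1 : PowerSeries.X ∣ wsum N (G a b) - if a = b then 1 else 0 := by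
        rw [PowerSeries.X_dvd_iff, map_sub, hconst]
        split_ifs <;> simp
      obtain ⟨g', hg'⟩ := h1
      refine ⟨g', ?_⟩
      rw [← hg', map_sub, Matrix.of_apply]
      by_cases hab : a = b
      · subst hab
        rw [if_pos rfl, map_one]
        exact congrArg _ (if_pos rfl)
      · rw [if_neg hab, map_zero]
        exact congrArg _ (if_neg hab)
    · have hy' : ¬∃ P : ℝ × ℝ, toTorus P = y ∧ (∃ m : ℤ, α₀.across P = m) ∧
        ∃ m : ℤ, α₀.along P = tp + m := hy
      simp only [if_neg hy, if_neg hy']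
      exact ⟨0, by simp⟩

end TriangleSystem

end LocalComp
end

open Topology
noncomputable section
namespace LocalComp

set_option linter.unusedSectionVars false

/-! ### The quadrilateral counting maps of the diagram -/

variable {p q k : ℕ} [NeZero p] [NeZero q] {ε : ℝ} {u : CoeffIndex p q → FU} {v : ZMod q → FU}
  {w : CoeffIndex p q → FU}

theorem constantCoeff_ext {u : CoeffIndex p q → FU}
    (hu : ∀ a, PowerSeries.constantCoeff (u a) = if (a.2 : ℕ) = 0 then 1 else 0)
    (m : ZMod p) (ℓ : ℤ) : PowerSeries.constantCoeff (ext u m ℓ) =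
      if 0 < sSeq p q m ∧ (sSeq p q m : ℤ) ∣ ℓ then 1 else 0 := by
  rw [map_ext]
  simp only [hu]
  exact ext_indicator m ℓ

theorem constantCoeff_hsum
    (hu : ∀ a, PowerSeries.constantCoeff (u a) = if (a.2 : ℕ) = 0 then 1 else 0)
    (hw : ∀ a, PowerSeries.constantCoeff (w a) = if (a.2 : ℕ) = 0 then 1 else 0) (i : ℤ) :
    PowerSeries.constantCoeff (hsum u w i) = if 0 < sSeq p q (i : ZMod p) ∧
      (sSeq p q (i : ZMod p) : ℤ) ∣ i / p + 1 then 1 else 0 := by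
  rw [hsum, map_sum]
  simp only [map_mul, constantCoeff_ext hu, hw]
  rcases Nat.eq_zero_or_pos (sSeq p q (i : ZMod p)) with hs | hs
  · rw [if_neg (by omega)]
    exact Finset.sum_eq_zero fun ℓ _ => absurd ℓ.2 (by omega)
  · rw [Finset.sum_eq_single ⟨0, hs⟩]
    · simp
    · intro ℓ _ hne
      rw [if_neg (c := (ℓ : ℕ) = 0), mul_zero]
      exact fun h => hne (Fin.ext h)
    · simp

theorem nz_shift_finite (k N : ℕ) : {i : ℤ | nz p q (i - k) ≤ N}.Finite :=
  Set.Finite.preimage (f := fun i : ℤ => i - (k : ℤ)) (sub_left_injective.injOn) (nz_le_finite N)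

theorem nz_shift_eq_zero_iff (k : ℕ) (i : ℤ) :
    nz p q (i - k) = 0 ↔ i ∈ Finset.Ico (-(p : ℤ) + k) (q + k) := by
  rw [nz_eq_zero_iff, Finset.mem_Ico]
  omega

theorem floor_half_div_add {n : ℕ} [NeZero n] (i c : ℤ) (t : ℝ) :
    ⌊-(((i + n * c : ℤ) + 1 / 2 : ℝ) / n) - t⌋ = ⌊-(((i : ℝ) + 1 / 2) / n) - t⌋ - c := by
  have hn : (n : ℝ) ≠ 0 := NeZero.ne _
  rw [← Int.floor_sub_intCast]
  congr 1
  push_cast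
  field_simp
  ring

theorem crossings_add {ι : Type} (α : LCurve ι) (P Q R : ℝ × ℝ) :
    α.crossings Q R = α.crossings P R - α.crossings P Q := by
  unfold LCurve.crossings; ring

/-- Modulo `U`, the class of `x.1 - k` contributes two indices, `i₀` and `i₀ + p s`, and only if `ℓ
= ℓ'`. The corresponding ranges of lifts of `Θ⁺` differ by `s` consecutive ones, and exactly one of
these satisfies the divisibility condition at the corner `ζ`. -/
theorem mu3_zero (hpq : p.Coprime q) (hk : k < p) (hε : 0 < ε) (hε' : 4 * ((p : ℝ) + q) * ε < 1)
    (hr : ReducesCorrectly u v w) (f : ℝ → ℝ) (t : ℝ)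
    (ht : IsStandardTranslate (beta0 p q k ε).toCurve (betaR p q).toCurve
      (betaInf p q k ε).toCurve ε (-ε) f t) :
    ∃ M, IsMu3 (ε, ε) (beta0 p q k ε) (betaR p q) (betaInf p q k ε) ((beta0 p q k ε).translate f)
        (psi0r k ε u) (psirInf k ε v) (nearestPointMap f (psiInf0 k ε w)) M ∧
      ModUEq M (idTheta (beta0 p q k ε) f t) := by
  classical
  obtain ⟨D⟩ := ht.nonempty_translateData
  obtain ⟨hu, hw, hv⟩ := hr
  have hp1 : (1 : ℝ) ≤ p := by exact_mod_cast NeZero.pos p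
  have hq1 : (1 : ℝ) ≤ q := by exact_mod_cast NeZero.pos q
  -- The number of arcs between the origin and the lift of `Θ⁺` with index `h` is `C - h`.
  set C : ℤ := ⌊(beta0 p q k ε).along (0, 0) - (beta0 p q k ε).arc⌋ -
    ⌊t - (beta0 p q k ε).arc⌋ with hC
  have hc : ∀ i h : ℤ, (beta0 p q k ε).crossings (0, 0) ((systemZero p q hpq k ε).ptY t (i, h)) =
      C - h := fun i h => by
    rw [LCurve.crossings, TriangleSystem.along_ptY, hC, add_sub_right_comm,
      Int.floor_add_intCast]
    ring
  refine (systemZero p q hpq k ε).exists_isMu3_modUEq D (by nlinarith) (basepoint_axis hε hε')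
    (fun i s _ => Or.inr (by rw [systemZero_pushOff]))
    (fun i s hs => Or.inr (systemZero_pushOff₂ k i hε hε' hpq hs))
    (nz_shift_finite (p := p) (q := q) k) (nz_shift_eq_zero_iff k)
    (fun x x' i h => if x.1 = i ∧ x'.1 = i then v ((i - k : ℤ) : ZMod q) *
      ext w ((i - k : ℤ) : ZMod p) ((x.2 : ℕ) - (C - h)) *
        ext u ((i - k : ℤ) : ZMod p) ((x'.2 : ℕ) - (C - h) + (i - k) / p + 1) else 0)
    (fun i h x x' => ?_) fun x x' => ?_
  · simp only [(systemZero_corners hpq k ε i).1, (systemZero_corners hpq k ε i).2.1,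
      (systemZero_corners hpq k ε i).2.2, systemZero_inTriangle, ncard_inRegion hε hε',
      crossings_inf k hε hε', betaR_mono_zpow, Matrix.mul_one, Uvar_smul]
    rw [crossings_add _ (0, 0) (TriangleSystem.ptY _ _ _), crossings_zero k hε hε', hc]
    have e : (beta0 p q k ε).mono = phi0 p q k := rfl
    have e' : (betaInf p q k ε).mono = phiInf p q k := rfl
    rw [e, e', Matrix.mul_assoc _ (coeffAt (psi0r k ε u) _), Matrix.mul_unit_apply,
      Matrix.mul_assoc (_ * _), phi0_psiInf0_phiInf_psirInf hpq hk, psi0r_mul_phi0 hk]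
    by_cases h1 : x.1 = i
    · by_cases h2 : x'.1 = i
      · rw [if_pos h1, if_pos h2, if_pos ⟨h1, h2⟩, ← Uvar_pow_mul, map_mul _ (_ * _),
          show ((x'.2 : ℕ) : ℤ) + (i / p + 1 - (C - h)) + ((i - k) / p - i / p) =
            (x'.2 : ℕ) - (C - h) + (i - k) / p + 1 by ring]
        ring
      · rw [if_neg h2, if_neg (not_and_of_not_right _ h2)]; simp
    · rw [if_neg h1, if_neg (not_and_of_not_left _ h1)]; simp
  · simp only [(systemZero_corners hpq k ε _).1, (systemZero_corners hpq k ε _).2.1]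
    rw [← Finset.sum_Ico_add']
    by_cases hx : x'.1 = x.1
    swap
    · rw [if_neg fun h => hx (by rw [h])]
      refine Finset.sum_eq_zero fun i _ => Finset.sum_eq_zero fun h _ => ?_
      rw [if_neg fun h => hx (h.2.trans h.1.symm), map_zero]
    obtain ⟨i₀, hi₀, hi₀'⟩ := exists_int_of_zmod (x.1 - (k : ZMod p)) (-1)
    have hs : (x.2 : ℕ) < sSeq p q (i₀ : ZMod p) := lt_of_lt_of_eq x.2.2 (by rw [hi₀, cSeq])
    have hs' : (x'.2 : ℕ) < sSeq p q (i₀ : ZMod p) := lt_of_lt_of_eq x'.2.2 (by rw [hi₀, cSeq, hx])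
    set s := sSeq p q (i₀ : ZMod p) with hsdef
    -- The variable `i` has been shifted by `k` in the sum, so that it runs over `[-p, q)` for every
    -- `k`; the corner is that of `i + k`.
    let b : ℤ → ℤ := fun i => ⌊(beta0 p q k ε).along (cornerA p (i + k)) - t⌋
    let a : ℤ := ⌊(beta0 p q k ε).along (0, 0) - t⌋
    let φ : ℤ → F2 := fun h => if (s : ℤ) ∣ (x.2 : ℕ) - C + h then 1 else 0
    have hb : ∀ i c : ℤ, b (i + p * c) = b i - c := fun i c => by
      change ⌊-(((i + p * c + k : ℤ) + 1 / 2 : ℝ) / p) - t⌋ = _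
      rw [show i + p * c + k = i + k + p * c by ring]
      exact floor_half_div_add _ _ _
    have key := sum_weight_class (p := p) (q := q) hv
      (fun i => ∑ h ∈ between a (b i), φ h) (δ := (x'.2 : ℕ) - (x.2 : ℕ)) hi₀'
      (by rw [abs_lt]; constructor <;> omega)
    refine Eq.trans ?_ (key.trans ?_)
    · refine Finset.sum_congr rfl fun i _ => ?_
      have hiff : x.1 = ((i + k : ℤ) : ZMod p) ↔ (i : ZMod p) = i₀ := by
        rw [hi₀]; push_cast
        constructor <;> intro h
        · rw [h]; ring
        · rw [h]; ring
      have hspos : 0 < s := by omega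
      simp only [hx, and_self, hiff, add_sub_cancel_right]
      by_cases hi : (i : ZMod p) = i₀
      · rw [if_pos hi]
        have hh : ∀ h : ℤ, PowerSeries.constantCoeff (if (i : ZMod p) = i₀ then
            v (i : ZMod q) * ext w (i : ZMod p) ((x.2 : ℕ) - (C - h)) *
              ext u (i : ZMod p) ((x'.2 : ℕ) - (C - h) + i / p + 1) else 0) =
            if (s : ℤ) ∣ (x'.2 : ℕ) - (x.2 : ℕ) + i / p + 1 then
              PowerSeries.constantCoeff (v i) * φ h else 0 := fun h => by
          rw [if_pos hi, map_mul, map_mul, constantCoeff_ext hu, constantCoeff_ext hw, hi, ← hsdef]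
          simp only [hspos, true_and, φ]
          rw [show ((x.2 : ℕ) : ℤ) - (C - h) = (x.2 : ℕ) - C + h by ring,
            show ((x'.2 : ℕ) : ℤ) - (C - h) + i / p + 1 =
              ((x.2 : ℕ) - C + h) + ((x'.2 : ℕ) - (x.2 : ℕ) + i / p + 1) by ring]
          by_cases hd : (s : ℤ) ∣ (x.2 : ℕ) - C + h
          · simp only [hd, if_true, mul_one, dvd_add_right hd, mul_ite, mul_zero]
          · simp [hd]
        rw [Finset.sum_congr rfl fun h _ => hh h]
        split_ifs
        · rw [Finset.mul_sum]
        · exact Finset.sum_const_zero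
      · rw [if_neg hi]
        refine Finset.sum_eq_zero fun h _ => ?_
        rw [if_neg hi, map_zero]
    · have hδ : ((x'.2 : ℕ) : ℤ) - (x.2 : ℕ) = 0 ↔ x = x' := by
        constructor
        · intro h
          exact XIndex.ext hx.symm (by omega)
        · rintro rfl; simp
      simp only [hδ]
      split_ifs with hxx
      · rw [← hsdef, hb, sum_between_sub]
        have := sum_range_dvd (s := s) (by omega) ((x.2 : ℕ) - C + b i₀)
        simpa only [φ, add_sub_assoc] using this
      · rfl

end LocalComp
end

/-! ### The quadrilateral counts based at `β_r` and `β_∞` -/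

open Topology
noncomputable section
namespace LocalComp

set_option linter.unusedSectionVars false

variable {p q k : ℕ} [NeZero p] [NeZero q] {ε : ℝ} {u : CoeffIndex p q → FU} {v : ZMod q → FU}
  {w : CoeffIndex p q → FU}

theorem psi0r_psiInf0_phiInf_psirInf (hpq : p.Coprime q) (hk : k < p) (i : ℤ) :
    (coeffAt (psi0r k ε u) (cornerA p i) * phi0 p q k ^ (i / p + 1) *
      coeffAt (psiInf0 k ε w) (0, 0) *
        (phiInf p q k ^ (-(i / q)) * coeffAt (psirInf (p := p) k ε v) (cornerB q i))) () () =
    Uvar ^ gexp p q k i * ((v ((i - k : ℤ) : ZMod q) * hsum u w (i - k) : FU) : FUinv) := by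
  have h0 : -(i / (q : ℤ)) = 0 - i / q := by ring
  rw [Matrix.mul_apply, Finset.sum_eq_single (-(i : ZMod p) * (q : ZMod p)⁻¹), h0,
    psi0r_mul_psiInf0 hk, phiInf_mul_psirInf hpq hk, zero_mul, sub_zero, if_pos rfl, if_pos rfl,
    map_mul]
  · ring
  · intro b _ hb
    rw [psi0r_mul_psiInf0 hk, if_neg hb, zero_mul]
  · simp

/-- The local system is trivial, so the lifts of `Θ⁺` on each side are only counted modulo two, as
the sum of the floors of the two ends. One end is paired by `i ↦ i + p`, giving `q` copies of
`gcdA`, the other by `i ↦ i + q`, giving `p` copies of `gcdB`. The total is the Bézout identity. -/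
theorem mu3_r (hpq : p.Coprime q) (hk : k < p) (hε : 0 < ε) (hε' : 4 * ((p : ℝ) + q) * ε < 1)
    (hr : ReducesCorrectly u v w) (c : ℝ) (f : ℝ → ℝ) (t : ℝ)
    (ht : IsStandardTranslate (betaR p q).toCurve (betaInf p q k ε).toCurve
      (beta0 p q k ε).toCurve ε c f t) :
    ∃ M, IsMu3 (ε, ε) (betaR p q) (betaInf p q k ε) (beta0 p q k ε) ((betaR p q).translate f)
        (psirInf k ε v) (psiInf0 k ε w) (nearestPointMap f (psi0r k ε u)) M ∧
      ModUEq M (idTheta (betaR p q) f t) := by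
  classical
  obtain ⟨D⟩ := ht.nonempty_translateData
  obtain ⟨hu, hw, hv⟩ := hr
  have hp1 : (1 : ℝ) ≤ p := by exact_mod_cast NeZero.pos p
  have hq1 : (1 : ℝ) ≤ q := by exact_mod_cast NeZero.pos q
  refine (systemR p q hpq k ε).exists_isMu3_modUEq D (by nlinarith) (basepoint_line hε hε')
    (fun i s _ => Or.inl rfl)
    (fun i s hs => Or.inr (systemR_pushOff₂ k i hε hε' hpq hs))
    (nz_shift_finite (p := p) (q := q) k) (nz_shift_eq_zero_iff k)
    (fun _ _ i _ => v ((i - k : ℤ) : ZMod q) * hsum u w (i - k))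
    (fun i h x x' => ?_) fun x x' => ?_
  · simp only [(systemR_corners hpq k ε i).1, (systemR_corners hpq k ε i).2.1,
      (systemR_corners hpq k ε i).2.2, systemR_inTriangle, ncard_inRegion hε hε',
      crossings_inf k hε hε', crossings_zero k hε hε', betaR_mono_zpow, Matrix.mul_one,
      Matrix.one_mul, Uvar_smul]
    have e : (beta0 p q k ε).mono = phi0 p q k := rfl
    have e' : (betaInf p q k ε).mono = phiInf p q k := rfl
    rw [e, e', Matrix.mul_assoc (_ * _), psi0r_psiInf0_phiInf_psirInf hpq hk, Uvar_pow_mul]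
  · simp only [(systemR_corners hpq k ε _).1, (systemR_corners hpq k ε _).2.1]
    rw [← Finset.sum_Ico_add']
    simp only [if_true, add_sub_cancel_right, map_mul, constantCoeff_hsum hu hw]
    let a : ℤ → ℤ := fun i => ⌊(betaR p q).along (cornerA p (i + k)) - t⌋
    let b : ℤ → ℤ := fun i => ⌊(betaR p q).along (cornerB q (i + k)) - t⌋
    have ha : ∀ i : ℤ, a (i + p) = a i + Nat.gcdA q p := fun i => by
      have hp : (p : ℝ) ≠ 0 := NeZero.ne _
      simp only [a]
      rw [← Int.floor_add_intCast]
      congr 1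
      simp only [betaR, cornerA]
      push_cast
      field_simp
      ring
    have hb : ∀ i : ℤ, b (i + q) = b i - Nat.gcdB q p := fun i => by
      have hq : (q : ℝ) ≠ 0 := NeZero.ne _
      simp only [b]
      rw [← Int.floor_sub_intCast]
      congr 1
      simp only [betaR, cornerB]
      push_cast
      field_simp
      ring
    have e1 : ∀ i ∈ Finset.Ico (-(p : ℤ)) q, ∑ _h ∈ between (a i) (b i),
        (PowerSeries.constantCoeff (v i) * if 0 < sSeq p q (i : ZMod p) ∧
          (sSeq p q (i : ZMod p) : ℤ) ∣ i / p + 1 then 1 else 0) =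
        (PowerSeries.constantCoeff (v i) * if 0 < sSeq p q (i : ZMod p) ∧
          (sSeq p q (i : ZMod p) : ℤ) ∣ i / p + 1 then 1 else 0) * (a i : F2) +
        (PowerSeries.constantCoeff (v i) * if 0 < sSeq p q (i : ZMod p) ∧
          (sSeq p q (i : ZMod p) : ℤ) ∣ i / p + 1 then 1 else 0) * (b i : F2) := fun i _ => by
      rw [← mul_add, ← sum_between_one, Finset.mul_sum]
      simp only [mul_one]
    refine (Finset.sum_congr rfl e1).trans ?_
    rw [Finset.sum_add_distrib, sum_weight' (p := p) hv fun i => (a i : F2),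
      sum_weight (p := p) hv fun i => (b i : F2)]
    have e2 : ∀ i : ℤ, (a i : F2) + (a (i + p) : F2) = (Nat.gcdA q p : F2) := fun i => by
      rw [ha, Int.cast_add, CharTwo.add_cancel_left]
    have e3 : ∀ i : ℤ, (b i : F2) + (b (i + q) : F2) = (Nat.gcdB q p : F2) := fun i => by
      rw [hb, Int.cast_sub, CharTwo.sub_eq_add, CharTwo.add_cancel_left]
    simp only [e2, e3, Finset.sum_const, Int.card_Ico, nsmul_eq_mul]
    have h : (Nat.gcdA q p : ℤ) * q + (Nat.gcdB q p : ℤ) * p = 1 := by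
      exact_mod_cast gcd_combination p q hpq
    have h' := congrArg (Int.cast : ℤ → F2) h
    push_cast at h'
    rw [show ((q : ℤ) - p - -p).toNat = q by omega, show ((0 : ℤ) - -p).toNat = p by omega, ← h']
    ring

/-- The monodromies before and after `Θ⁺` make the count diagonal. Passing from `i` to `i + q`
shifts both the end of the range and the condition on the basis index, so each pair leaves a single
lift, just outside the fixed end. The remaining `p` conditions single out one index modulo `p`. -/
theorem mu3_inf (hpq : p.Coprime q) (hk : k < p) (hε : 0 < ε) (hε' : 4 * ((p : ℝ) + q) * ε < 1)
    (hr : ReducesCorrectly u v w) (f : ℝ → ℝ) (t : ℝ)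
    (ht : IsStandardTranslate (betaInf p q k ε).toCurve (beta0 p q k ε).toCurve
      (betaR p q).toCurve ε ε f t) :
    ∃ M, IsMu3 (ε, ε) (betaInf p q k ε) (beta0 p q k ε) (betaR p q) ((betaInf p q k ε).translate f)
        (psiInf0 k ε w) (psi0r k ε u) (nearestPointMap f (psirInf k ε v)) M ∧
      ModUEq M (idTheta (betaInf p q k ε) f t) := by
  classical
  obtain ⟨D⟩ := ht.nonempty_translateData
  obtain ⟨hu, hw, hv⟩ := hr
  have hp1 : (1 : ℝ) ≤ p := by exact_mod_cast NeZero.pos p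
  have hq1 : (1 : ℝ) ≤ q := by exact_mod_cast NeZero.pos q
  have hqq := qinv hpq
  set e : ℤ := ⌊t - (betaInf p q k ε).arc⌋ with he
  have hc : ∀ i h : ℤ, (betaInf p q k ε).crossings (cornerB q i)
      ((systemInf p q hpq k ε).ptY t (i, h)) = (-1 - e - h) - i / q := fun i h => by
    rw [LCurve.crossings, TriangleSystem.along_ptY, floor_along_cornerB k hε hε',
      add_sub_right_comm, Int.floor_add_intCast]
    ring
  refine (systemInf p q hpq k ε).exists_isMu3_modUEq D (by nlinarith) (basepoint_axis hε hε')
    (fun i s hs => Or.inr (systemInf_pushOff k i hε hε' hpq hs))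
    (fun i s _ => Or.inl rfl)
    (nz_shift_finite (p := p) (q := q) k) (nz_shift_eq_zero_iff k)
    (fun b b' i h => if b = -((i - (-1 - e - h) * q : ℤ) : ZMod p) * (q : ZMod p)⁻¹ ∧ b = b' then
      v ((i - k : ℤ) : ZMod q) * hsum u w (i - k) else 0)
    (fun i h b b' => ?_) fun b b' => ?_
  · simp only [(systemInf_corners hpq k ε i).1, (systemInf_corners hpq k ε i).2.1,
      (systemInf_corners hpq k ε i).2.2, systemInf_inTriangle, ncard_inRegion hε hε',
      crossings_zero k hε hε', betaR_mono_zpow, Matrix.mul_one, Uvar_smul]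
    rw [crossings_add _ (cornerB q i) (TriangleSystem.ptY _ _ _), crossings_inf k hε hε', hc]
    have e0 : (beta0 p q k ε).mono = phi0 p q k := rfl
    have e' : (betaInf p q k ε).mono = phiInf p q k := rfl
    set d : ℤ := -1 - e - h with hd
    rw [e0, e', show -(i / (q : ℤ)) - (d - i / q) = -d by ring]
    have hm : phiInf p q k ^ (d - i / q) * coeffAt (psirInf (p := p) k ε v) (cornerB q i) *
        coeffAt (psi0r k ε u) (cornerA p i) * phi0 p q k ^ (i / p + 1) *
        coeffAt (psiInf0 k ε w) (0, 0) * phiInf p q k ^ (-d) =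
        (phiInf p q k ^ (d - i / q) * coeffAt (psirInf (p := p) k ε v) (cornerB q i)) *
        (coeffAt (psi0r k ε u) (cornerA p i) * phi0 p q k ^ (i / p + 1) *
        coeffAt (psiInf0 k ε w) (0, 0) * phiInf p q k ^ (-d)) := by
      simp only [Matrix.mul_assoc]
    rw [hm, Matrix.mul_unit_apply, phiInf_mul_psirInf hpq hk, psi0r_psiInf0_phiInf hpq hk,
      show i + -d * q = i - d * q by ring]
    by_cases h1 : b = -((i - d * q : ℤ) : ZMod p) * (q : ZMod p)⁻¹
    · by_cases h2 : b = b'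
      · subst h2
        rw [if_pos h1, if_pos h1, if_pos ⟨h1, rfl⟩, ← Uvar_pow_mul, map_mul,
          zpow_sub₀ Uvar_ne_zero]
        have h3 : Uvar ^ gexp p q k (i - d * q) ≠ 0 := zpow_ne_zero _ Uvar_ne_zero
        field_simp
      · rw [if_neg (c := b' = _) (fun h => h2 (h1.trans h.symm)),
          if_neg (not_and_of_not_right _ h2)]
        simp
    · rw [if_neg h1, if_neg (not_and_of_not_left _ h1)]; simp
  · simp only [(systemInf_corners hpq k ε _).1, (systemInf_corners hpq k ε _).2.1]
    rw [← Finset.sum_Ico_add']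
    by_cases hb : b = b'
    swap
    · rw [if_neg hb]
      refine Finset.sum_eq_zero fun i _ => Finset.sum_eq_zero fun h _ => ?_
      rw [if_neg (not_and_of_not_right _ hb), map_zero]
    subst hb
    rw [if_pos rfl]
    let a : ℤ → ℤ := fun i => ⌊(betaInf p q k ε).along (cornerB q (i + k)) - t⌋
    let κ : ℤ := ⌊(betaInf p q k ε).along (0, 0) - t⌋
    let φ : ℤ → ℤ → F2 := fun i h =>
      if b = -((i + k - (-1 - e - h) * q : ℤ) : ZMod p) * (q : ZMod p)⁻¹ then 1 else 0
    have ha : ∀ i : ℤ, a (i + q) = a i - 1 := fun i => by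
      change ⌊-(((i + q + k : ℤ) + 1 / 2 : ℝ) / q) - t⌋ = _
      rw [show i + q + (k : ℤ) = i + k + q * 1 by ring]
      exact floor_half_div_add _ _ _
    have hφ : ∀ i h : ℤ, φ (i + q) h = φ i (h + 1) := fun i h => by
      simp only [φ]
      rw [show i + (q : ℤ) + k - (-1 - e - h) * q = i + k - (-1 - e - (h + 1)) * q by ring]
    have e1 : ∀ i ∈ Finset.Ico (-(p : ℤ)) q, ∑ h ∈ between (a i) κ, PowerSeries.constantCoeff
        (if b = -((i + k - (-1 - e - h) * q : ℤ) : ZMod p) * (q : ZMod p)⁻¹ ∧ b = b then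
          v ((i + k - k : ℤ) : ZMod q) * hsum u w (i + k - k) else 0) =
        (PowerSeries.constantCoeff (v i) * if 0 < sSeq p q (i : ZMod p) ∧
          (sSeq p q (i : ZMod p) : ℤ) ∣ i / p + 1 then 1 else 0) *
            ∑ h ∈ between (a i) κ, φ i h := fun i _ => by
      rw [Finset.mul_sum]
      refine Finset.sum_congr rfl fun h _ => ?_
      simp only [φ, and_true, add_sub_cancel_right]
      rw [← constantCoeff_hsum hu hw, ← map_mul, mul_ite, mul_one, mul_zero]
      split_ifs
      · rfl
      · exact map_zero _
    refine (Finset.sum_congr rfl e1).trans ?_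
    rw [sum_weight (p := p) hv fun i => ∑ h ∈ between (a i) κ, φ i h]
    -- Substituting `h + 1` moves both ends of the second range up by one: it becomes the range from
    -- `a i` to `κ + 1`, which differs from the first by `κ + 1`.
    have e2 : ∀ i : ℤ, ∑ h ∈ between (a i) κ, φ i h + ∑ h ∈ between (a (i + q)) κ, φ (i + q) h =
        φ i (κ + 1) := fun i => by
      simp only [hφ]
      rw [ha, sum_between_add_one (φ i), sub_add_cancel, add_comm, ← sum_between (φ i) (a i),
        add_sub_cancel_right]
    rw [Finset.sum_congr rfl fun i _ => e2 i]
    have e3 := sum_Ico_zmod (n := p) (-(p : ℤ))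
      (-b * q - (k - (-1 - e - (κ + 1)) * q : ℤ) : ZMod p)
    rw [neg_add_cancel] at e3
    refine Eq.trans (Finset.sum_congr rfl fun i _ => ?_) e3
    simp only [φ]
    congr 1
    refine propext ⟨fun h => ?_, fun h => ?_⟩
    · push_cast at h ⊢
      linear_combination (q : ZMod p) * h - (i + k - (-1 - e - (κ + 1)) * q) * hqq
    · push_cast at h ⊢
      linear_combination (q : ZMod p)⁻¹ * h - b * hqq

theorem quadrilateralsIdentity (hpq : p.Coprime q) (hk : k < p) (hε : 0 < ε)
    (hε' : 4 * ((p : ℝ) + q) * ε < 1) (hr : ReducesCorrectly u v w) :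
    QuadrilateralsIdentity u v w k ε :=
  ⟨mu3_zero hpq hk hε hε' hr, mu3_r hpq hk hε hε' hr, mu3_inf hpq hk hε hε' hr⟩

theorem isSolution (hpq : p.Coprime q) (h : IsAlgSol u v w) (hr : ReducesCorrectly u v w) :
    IsSolution u v w :=
  ⟨hr, fun _ hk _ hε hε' => ⟨areCycles, trianglesVanish hpq hk hε hε' h,
    quadrilateralsIdentity hpq hk hε hε' hr⟩⟩

end LocalComp
end

/-! ### The solutions with trivial `u` and with trivial `w` -/

theorem theorem3p3 (p q : ℕ) [NeZero p] [NeZero q] (hpq : p.Coprime q) :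
    (∃ (u : LocalComp.CoeffIndex p q → LocalComp.FU) (v : ZMod q → LocalComp.FU)
      (w : LocalComp.CoeffIndex p q → LocalComp.FU), LocalComp.IsSolution u v w) ∧
    (∃ (v : ZMod q → LocalComp.FU) (w : LocalComp.CoeffIndex p q → LocalComp.FU),
      LocalComp.IsSolution (LocalComp.trivialCoeff p q) v w) ∧
    (∃ (u : LocalComp.CoeffIndex p q → LocalComp.FU) (v : ZMod q → LocalComp.FU),
      LocalComp.IsSolution u v (LocalComp.trivialCoeff p q)) := by
  obtain ⟨v, hv, hv'⟩ := LocalComp.exists_right_kernel hpq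
  obtain ⟨w, hw, hw'⟩ := LocalComp.exists_left_kernel hpq
  have hsol := LocalComp.isAlgSol_trivial_left hv hw
  have htriv : ∀ a : LocalComp.CoeffIndex p q, PowerSeries.constantCoeff
      (LocalComp.trivialCoeff p q a) = if (a.2 : ℕ) = 0 then 1 else 0 := fun a => by
    unfold LocalComp.trivialCoeff
    split_ifs <;> simp
  have h₁ := LocalComp.isSolution hpq hsol ⟨htriv, hw', hv'⟩
  -- The solution with trivial `u` also serves for the first claim. The reflected solution reduces
  -- correctly because, for `0 ≤ ℓ < s`, the number `-ℓ` is divisible by `s` only if `ℓ = 0`.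
  refine ⟨⟨_, v, w, h₁⟩, ⟨v, w, h₁⟩, _, v, LocalComp.isSolution hpq
    (LocalComp.isAlgSol_trivial_right hsol) ⟨fun a => ?_, htriv, hv'⟩⟩
  rw [LocalComp.constantCoeff_ext hw']
  have ha := a.2.2
  have hiff : (LocalComp.sSeq p q a.1 : ℤ) ∣ -((a.2 : ℕ) : ℤ) ↔ (a.2 : ℕ) = 0 := by
    rw [dvd_neg, Int.natCast_dvd_natCast]
    exact ⟨fun h => Nat.eq_zero_of_dvd_of_lt h ha, fun h => by rw [h]; exact dvd_zero _⟩
  simp only [hiff, a.sSeq_pos, true_and]
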